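/- **Setting.** Let $n\ge 1$, $x_1<\dots<x_n$ real, and $p(t,y):=-y^2/(2t)$ for $t>0$. Let $\mathscr H(t,\vec x):=\{\vec h\in\mathbb R^n: h_c\ge p(t,x_c)\ \forall c\}$. For $\vec h\in\mathscr H(t,\vec x)$ there is exactly one continuous, piecewise $C^1$ function $f=f_{t,\vec x,\vec h}:\mathbb R\to\mathbb R$ with: $f(x_c)=h_c$ for all $c$; $f\ge p(t,\cdot)$; $f(y)=p(t,y)$ for all large $|y|$; $f'$ is constant on each connected component of $\{f>p(t,\cdot)\}\setminus\{x_1,\dots,x_n\}$; $f$ is $C^1$ off $\{x_1,\dots,x_n\}$. Put $$I_{\rm KPZ}(t,\vec x,\vec h):=\int_{\mathbb R}\Big(\tfrac12 (f_{t,\vec x,\vec h}')^2-\tfrac12(\partial_y p(t,y))^2\Big)dy,\qquad \mathscr H_{\rm conc}(t,\vec x):=\{\vec h\in\mathscr H(t,\vec x): f_{t,\vec x,\vec h}\text{ concave}\}.$$ $\nabla I_{\rm KPZ}(t,\vec x,\vec h)$ is the gradient in $\vec h$, taken within $\mathscr H(t,\vec x)$ (one-sided at its boundary). For a finite measure $\lambda$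 on $\mathbb R$ let $Q[\lambda](a):=\inf\{y:\lambda((-\infty,y])\ge a\}$. For finitely many points $x_c$ and masses $m_c\ge0$ with $m:=\sum_c m_c$, let $$L_{\rm SHE}\big(\xi\xrightarrow{T}(x_c,m_c)_c\big):=\sup_\mu\int_0^T\Big(\sum_{y}\tfrac1{24}\,\mu(s)(\{y\})^3-\int_0^m\tfrac12\big(\partial_sQ[\mu(s)](a)\big)^2da\Big)ds,$$ where $\mu$ runs over the weakly continuous paths on $[0,T]$ of measures of mass $m$ on $\mathbb R$ with $\mu(0)=\sum_c m_c\delta_{x_c}$ and $\mu(T)=m\delta_\xi$, and the functional is $-\infty$ unless $s\mapsto Q[\mu(s)](a)$ is absolutely continuous for a.e. $a\in(0,m)$ with $\partial_sQ[\mu]\in L^2([0,T]\times[0,m])$. *Optimal clusters.* For $\vec m\in(0,\infty)^n$ and $T>0$ the inertia clusters $z_1,\dots,z_n:[0,T]\to\mathbb R$ are the point masses $m_c$ that start at $s=0$ from $x_c$ with velocities $\tfrac12(\sum_{c'>c}m_{c'}-\sum_{c'<c}m_{c'})$, travel at constant velocity until they meet, and, when they meet, merge (for good) with conservation of momentum.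 The optimal clusters (ending at $0$) are $\zeta_c(s):=z_c(s)-\frac{z_c(T)}{T}\,s$. *Limit shape and shocks.* The limit shape $g=g(t,y)$, $t\in(0,T]$, with terminal data $f_{T,\vec x,\vec h}$ is the entropy solution of $\partial_tg=\tfrac12(\partial_yg)^2$ solved backward in time from $g(T,\cdot)=f_{T,\vec x,\vec h}$. That is, $g$ is locally Lipschitz on $(0,T]\times\mathbb R$, satisfies the equation a.e., and for each $\tau\in(0,T)$ there are constants $K,C$ such that $|g(t,y)-g(t,y')|\le K(1+|y|+|y'|)|y-y'|$ for $t\in[\tau,T]$ and $g(t,y+r)+g(t,y-r)-2g(t,y)\le \frac{C}{T-t}r^2$ for $t\in[\tau,T)$ (Oleinik's entropy condition in the backward time $T-t$). Its shocks at time $t$ are the points $y$ where $g(t,\cdot)$ is not differentiable (jumps of $\partial_yg$). A shock trajectory from $x_c$ is a continuous $\gamma:[0,T)\to\mathbb R$ with $\gamma(0)=x_c$ such that $\gamma(s)$ is a shock at time $T-s$ for every $s\in[0,T)$. **Theorem 2.4.** (a) Fix $t>0$ and regard $I_{\rm KPZ}(\vec h):=I_{\rm KPZ}(t,\vec x,\vec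 h)$ as a function on $\mathscr H_{\rm conc}:=\mathscr H_{\rm conc}(t,\vec x)$ and $L_{\rm SHE}(\vec m):=L_{\rm SHE}(0\xrightarrow{t}(x_c,m_c)_{c=1}^n)$ as a function on $[0,\infty)^n$. Then $L_{\rm SHE}$ is finite, both functions are continuous and strictly convex (on convex domains), and they are Legendre transforms of each other: $L_{\rm SHE}(\vec m)=\sup_{\vec h\in\mathscr H_{\rm conc}}(\vec m\cdot\vec h-I_{\rm KPZ}(\vec h))$ for $\vec m\in[0,\infty)^n$ and $I_{\rm KPZ}(\vec h)=\sup_{\vec m\in[0,\infty)^n}(\vec m\cdot\vec h-L_{\rm SHE}(\vec m))$ for $\vec h\in\mathscr H_{\rm conc}$. Further, $\nabla I_{\rm KPZ}$ exists on $\mathscr H_{\rm conc}$ and is a homeomorphism $\mathscr H_{\rm conc}\to[0,\infty)^n$. Now let $T>0$, $\vec h\in\mathscr H_{\rm conc}(T,\vec x)^\circ$ and $\vec m\in(0,\infty)^n$ with $\nabla I_{\rm KPZ}(T,\vec x,\vec h)=\vec m$. Then a limit shape with terminal data $f_{T,\vec x,\vec h}$ and inertia clusters for $\vec m$ exist, and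 the following hold for any such limit shape $g$ and the corresponding optimal clusters $\zeta_1,\dots,\zeta_n$. (b) The trajectories of the shocks of $g$ and of the optimal clusters coincide: for every $t\in(0,T]$ the set of shocks of $g$ at time $t$ is $\{\zeta_c(T-t):c=1,\dots,n\}$, and for every $c$ the path $\zeta_c$ on $[0,T)$ is the one and only shock trajectory from $x_c$. (c) Let $t'\in(0,T]$, let $\xi_1<\dots<\xi_{n'}$ be the distinct values of $\zeta_1(T-t'),\dots,\zeta_n(T-t')$, and put $A(a):=\{c:\zeta_c(T-t')=\xi_a\}$, $m'_a:=\sum_{c\in A(a)}m_c$, $h'_a:=g(t',\xi_a)$. Then $\vec h'\in\mathscr H_{\rm conc}(t',\vec\xi)$, $$\nabla I_{\rm KPZ}(t',\vec\xi,\vec h')=\vec m',$$ $$L_{\rm SHE}\big(0\xrightarrow{T}(x_c,m_c)_{c=1}^n\big)=L_{\rm SHE}\big(0\xrightarrow{t'}(\xi_a,m'_a)_{a=1}^{n'}\big)+\sum_{a=1}^{n'}L_{\rm SHE}\big(\xi_a\xrightarrow{T-t'}(x_c,m_c)_{c\in A(a)}\big).$$ -/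

import Mathlib

noncomputable section

/-- The parabola `p(t, y) = -y² / (2t)`. -/
def parab (t y : ℝ) : ℝ := -y ^ 2 / (2 * t)

/-- The properties that characterize the function `f = f_{t,x,h}`.  Continuity together with the
other clauses makes `f` piecewise `C¹`: away from the points `x c` it is `C¹`, and on each connected
component of `{f > p(t)} \ {x c}` its derivative is constant. -/
structure IsShapeAt {n : ℕ} (t : ℝ) (x : Fin n → ℝ) (h : EuclideanSpace ℝ (Fin n))
    (f : ℝ → ℝ) : Prop where
  continuous : Continuous f
  contDiffOn : ContDiffOn ℝ 1 f (Set.range x)ᶜ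
  value : ∀ c, f (x c) = h c
  ge_parab : ∀ y, parab t y ≤ f y
  eq_parab : ∃ R : ℝ, ∀ y, R ≤ |y| → f y = parab t y
  deriv_const : ∀ a b : ℝ, a ≤ b →
    (∀ y ∈ Set.Icc a b, parab t y < f y ∧ y ∉ Set.range x) → deriv f a = deriv f b

/-- The function `f_{t,x,h}`. -/
def shapeFn {n : ℕ} (t : ℝ) (x : Fin n → ℝ) (h : EuclideanSpace ℝ (Fin n)) : ℝ → ℝ :=
  Classical.epsilon (IsShapeAt t x h)

/-- The `n`-point upper-tail rate function `I_KPZ(t, x, h)`. -/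
def rateKPZ {n : ℕ} (t : ℝ) (x : Fin n → ℝ) (h : EuclideanSpace ℝ (Fin n)) : ℝ :=
  ∫ y : ℝ, ((1 / 2) * (deriv (shapeFn t x h) y) ^ 2 - (1 / 2) * (deriv (parab t) y) ^ 2)

/-- The space of all upper-tail deviations: `h c ≥ p(t, x c)` for all `c`. -/
def hvSpace {n : ℕ} (t : ℝ) (x : Fin n → ℝ) : Set (EuclideanSpace ℝ (Fin n)) :=
  {h | ∀ c, parab t (x c) ≤ h c}

/-- The deviations whose shape `f_{t,x,h}` is concave. -/
def hvConc {n : ℕ} (t : ℝ) (x : Fin n → ℝ) : Set (EuclideanSpace ℝ (Fin n)) :=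
  {h | h ∈ hvSpace t x ∧ ConcaveOn ℝ Set.univ (shapeFn t x h)}

/-- `[0,∞)^n`. -/
def orthant (n : ℕ) : Set (EuclideanSpace ℝ (Fin n)) := {m | ∀ c, 0 ≤ m c}

/-- The quantile function (inverse CDF) of a finite measure on `ℝ`. -/
def quantileFn (lam : MeasureTheory.FiniteMeasure ℝ) (a : ℝ) : ℝ :=
  sInf {y : ℝ | a ≤ (lam : MeasureTheory.Measure ℝ).real (Set.Iic y)}

/-- `∂ₛ` of the quantile function exists and is in `L²([0,T] × [0,m])`: for almost every quantile
coordinate `a` the path `s ↦ quantileFn (μ s) a` is absolutely continuous, and its derivative is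
square integrable. -/
def HasFiniteEnergy (T m : ℝ) (μ : ℝ → MeasureTheory.FiniteMeasure ℝ) : Prop :=
  (∀ᵐ a ∂(MeasureTheory.volume.restrict (Set.Ioo (0 : ℝ) m)),
    AbsolutelyContinuousOnInterval (fun s => quantileFn (μ s) a) 0 T) ∧
  MeasureTheory.MemLp (fun p : ℝ × ℝ => deriv (fun s => quantileFn (μ s) p.2) p.1) 2
    (MeasureTheory.volume.restrict (Set.Ioo (0 : ℝ) T ×ˢ Set.Ioo (0 : ℝ) m))

open Classical in
/-- The functional `𝓜_{[0,T]}(μ)` for a path `μ` of measures of total mass `m`: the time integral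
of `∑_y μ(s){y}³ / 24 - ∫₀ᵐ (∂ₛ quantile)² / 2 da`, or `-∞` when `∂ₛ quantile` is not in `L²`. -/
def momFn (T m : ℝ) (μ : ℝ → MeasureTheory.FiniteMeasure ℝ) : EReal :=
  if HasFiniteEnergy T m μ then
    ((∫ s in (0 : ℝ)..T,
      ((∑' y : ℝ, (1 / 24) * ((μ s : MeasureTheory.Measure ℝ).real {y}) ^ 3) -
        ∫ a in (0 : ℝ)..m, (1 / 2) * (deriv (fun r => quantileFn (μ r) a) s) ^ 2) : ℝ) : EReal)
  else ⊥

/-- `L_SHE(ξ →^T (x, m))`: the supremum of `𝓜_{[0,T]}(μ)` over all weakly continuous paths `μ` of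
measures on `[0,T]`, of total mass `∑ m c`, that start at `∑ m c • δ_{x c}` and end at
`(∑ m c) • δ_ξ`. -/
def LSHE {ι : Type*} [Fintype ι] (ξ T : ℝ) (x m : ι → ℝ) : EReal :=
  sSup {E : EReal | ∃ μ : ℝ → MeasureTheory.FiniteMeasure ℝ,
    ContinuousOn μ (Set.Icc 0 T) ∧
    (∀ s ∈ Set.Icc 0 T, (((μ s).mass : NNReal) : ℝ) = ∑ c, m c) ∧
    (μ 0 : MeasureTheory.Measure ℝ) =
      ∑ c, ENNReal.ofReal (m c) • MeasureTheory.Measure.dirac (x c) ∧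
    (μ T : MeasureTheory.Measure ℝ) =
      ENNReal.ofReal (∑ c, m c) • MeasureTheory.Measure.dirac ξ ∧
    E = momFn T (∑ c, m c) μ}

/-- Initial velocity of the `c`-th inertia cluster: half of (mass to the right - mass to the left). -/
def pull {n : ℕ} (m : Fin n → ℝ) (c : Fin n) : ℝ :=
  (1 / 2) * ((∑ c' ∈ Finset.Ioi c, m c') - ∑ c' ∈ Finset.Iio c, m c')

/-- The trajectories `z c` of the inertia clusters on `[0,T]`.  They start from `x c`; clusters that
have met stay together; and at every time the (right) velocity of a cluster is its total momentum
`∑ m c' * pull c'` divided by its total mass `∑ m c'`, the sums being over the point masses that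
have merged into it.  So velocities are constant between merging times, and momentum is conserved
when clusters merge. -/
structure IsInertiaClusters {n : ℕ} (T : ℝ) (x m : Fin n → ℝ) (z : Fin n → ℝ → ℝ) : Prop where
  continuousOn : ∀ c, ContinuousOn (z c) (Set.Icc 0 T)
  start : ∀ c, z c 0 = x c
  merged : ∀ c c' s s', 0 ≤ s → s ≤ s' → s' ≤ T → z c s = z c' s → z c s' = z c' s'
  velocity : ∀ c, ∀ s ∈ Set.Ico 0 T, HasDerivWithinAt (z c)
    ((∑ c' with z c' s = z c s, m c' * pull m c') / ∑ c' with z c' s = z c s, m c')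
    (Set.Ici s) s

/-- The optimal clusters: to each inertia cluster, add the constant drift that brings it to `ξ` at
time `T`.  Clusters in the same branch (merged before time `T`) have the same value of `z c T`, hence
get the same drift. -/
def optimalCluster {n : ℕ} (ξ T : ℝ) (z : Fin n → ℝ → ℝ) (c : Fin n) (s : ℝ) : ℝ :=
  z c s + (ξ - z c T) / T * s

/-- `g = g(t,y)`, `t ∈ (0,T]`, is the entropy solution of the equation
`∂ₜ g = (∂_y g)² / 2`, solved backward in time from the terminal condition `g(T) = f`:
a locally Lipschitz function, with spatial derivative of at most linear growth, that satisfies the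
equation almost everywhere together with the Oleinik one-sided entropy condition in the backward
time `s = T - t`, namely that `∂_y g(t, ·) - C y / (T - t)` is nonincreasing. -/
structure IsBackwardEntropySolution (T : ℝ) (f : ℝ → ℝ) (g : ℝ → ℝ → ℝ) : Prop where
  terminal : g T = f
  locallyLipschitz :
    LocallyLipschitzOn (Set.Ioc 0 T ×ˢ Set.univ) (fun p : ℝ × ℝ => g p.1 p.2)
  growth : ∀ τ ∈ Set.Ioo 0 T, ∃ K : ℝ, ∀ t ∈ Set.Icc τ T, ∀ y y' : ℝ,
    |g t y - g t y'| ≤ K * (1 + |y| + |y'|) * |y - y'|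
  equation : ∀ᵐ p : ℝ × ℝ ∂(MeasureTheory.volume.restrict (Set.Ioo 0 T ×ˢ Set.univ)),
    deriv (fun t => g t p.2) p.1 = (1 / 2) * (deriv (g p.1) p.2) ^ 2
  entropy : ∀ τ ∈ Set.Ioo 0 T, ∃ C : ℝ, ∀ t ∈ Set.Ico τ T, ∀ y r : ℝ,
    g t (y + r) + g t (y - r) - 2 * g t y ≤ C / (T - t) * r ^ 2

/-- The positions of the shocks of `g` at time `t`, i.e. the discontinuities of `∂_y g(t, ·)`. -/
def shockSet (g : ℝ → ℝ → ℝ) (t : ℝ) : Set ℝ := {y | ¬ DifferentiableAt ℝ (g t) y}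

/-- `γ` is the trajectory, in the backward time `s = T - t`, of a shock of `g` that starts from
`y₀` at the terminal time. -/
structure IsShockTrajectory (T : ℝ) (g : ℝ → ℝ → ℝ) (y₀ : ℝ) (γ : ℝ → ℝ) : Prop where
  continuousOn : ContinuousOn γ (Set.Ico 0 T)
  start : γ 0 = y₀
  mem_shockSet : ∀ s ∈ Set.Ico 0 T, γ s ∈ shockSet g (T - s)

end

/-!
The theorem compares two convex functions and two evolutions, and the proof makes all four explicit.

*The rate function.* On a gap between two marked points the shape consists of the tangents of the
parabola through the two prescribed points with a piece of the parabola between them, or is the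
chord if the tangents leave no room (`GapShape.eq_gapFn`). So `rateKPZ` is a sum of explicit costs
of gaps and tails (`rateKPZ_eq`). Its gradient is the vector of the kinks of the shape at the marked
points (`hasGradientWithinAt_rateKPZ`), and it lies strictly above its first-order expansions
(`rateKPZ_strict`).

*The moment functional.* Completing the square against a field `ψ` of slope at most `-1` in the
quantile coordinate bounds it from above, since the atoms move with one velocity and a field of
slope `-1` is away from a constant (`momFn_le_of_field`). The field that runs downwards through the
velocity intervals `[v_c - m_c / 2, v_c + m_c / 2]` bounds `LSHE` by `certificate`
(`LSHE_le_certificate`). A flow of clusters whose velocities are block averages of `v`, and whose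
velocity intervals are adjacent within each block, attains this bound (`certificate_le_LSHE`); the
optimal clusters are such a flow.

*The bridge.* The velocity intervals of the optimal clusters define a function of the velocity `b`,
with derivative `-ζ_c` for `b` in the interval of the cluster at `ζ_c`, and `t b` outside the
intervals. Its concave conjugate, `profile`, is a concave shape with corners at the clusters
(`isShapeAt_profile`), and its kinks are the cluster masses because the intervals tile the slopes at
a corner (`profile_kink`). That the profile is above the parabola and touches it where the velocity
intervals leave a gap is conservation of momentum: a set of leftmost clusters can only lose momentum
to the others, and loses none if it never meets them (`momentum_nonneg`, `momentum_eq_zero`).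
Hence every nonnegative `m` is the gradient of `rateKPZ` at some `h` with concave shape, with
`LSHE m = m · h - rateKPZ h` (`exists_dual`). Together with strict convexity this gives the Legendre
duality, and concave shapes are those with nonnegative kinks (`mem_hvConc_iff`); the gradient is a
homeomorphism because it is proper (`isClosedMap_kinkMap`).

*The limit shape.* The profiles of the clusters at all times are the infimum of one family of planes
which solve the equation (`limitShape_le_plane`): as the clusters move, the dual function changes by
their lag of momentum, which has a sign and vanishes at the minimizing velocities (`excess_le`,
`limitShape_eq`). So the profiles form an entropy solution with the shape as terminal data. The
entropy solution is unique (`IsBackwardEntropySolution.unique`), and the shocks of a profile are its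
corners, the clusters. Finally, the values of `LSHE` in the splitting are certificates with the
same velocities, and add up (`LSHE_split`).
-/

noncomputable section
open Set Filter Topology

/-! ### The obstacle `p` and the tangents to it -/

/-- Distance from `x` to the two points at which a line through `(x, h)` touches the parabola. The
radicand is nonnegative exactly if `(x, h)` is not below the parabola. -/
def rad (t x h : ℝ) : ℝ := √(x ^ 2 + 2 * t * h)

lemma rad_nonneg (t x h : ℝ) : 0 ≤ rad t x h := Real.sqrt_nonneg _

lemma parab_le_iff {t : ℝ} (ht : 0 < t) {y v : ℝ} : parab t y ≤ v ↔ 0 ≤ 2 * t * v + y ^ 2 := by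
  unfold parab
  rw [div_le_iff₀ (by positivity)]
  constructor <;> intro h <;> linarith

lemma eq_parab_iff {t : ℝ} (ht : 0 < t) {y v : ℝ} : v = parab t y ↔ 2 * t * v + y ^ 2 = 0 := by
  unfold parab
  rw [eq_div_iff (by positivity)]
  constructor <;> intro h <;> linarith

lemma rad_sq {t : ℝ} (ht : 0 < t) {x h : ℝ} (hh : parab t x ≤ h) :
    rad t x h ^ 2 = 2 * t * h + x ^ 2 := by
  unfold rad
  rw [Real.sq_sqrt] <;> linarith [(parab_le_iff ht).1 hh]

lemma rad_eq {t x h r : ℝ} (hr : 0 ≤ r) (h1 : 2 * t * h + x ^ 2 = r ^ 2) : rad t x h = r := by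
  unfold rad
  rw [show x ^ 2 + 2 * t * h = r ^ 2 by linarith, Real.sqrt_sq hr]

lemma hasDerivAt_parab (t y : ℝ) : HasDerivAt (parab t) (-y / t) y := by
  have h := ((hasDerivAt_pow 2 y).neg).div_const (2 * t)
  refine h.congr_deriv ?_
  rcases eq_or_ne t 0 with rfl | ht
  · simp
  · field_simp
    simp

/-! ### Functions that are affine off the contact set -/

/-- The conditions of `IsShapeAt` that concern a gap `[a, b]` without marked points in `(a, b)`. -/
structure GapShape (t a b : ℝ) (f : ℝ → ℝ) : Prop where
  cont : ContinuousOn f (Icc a b)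
  diff : ∀ y ∈ Ioo a b, DifferentiableAt ℝ f y
  ge : ∀ y ∈ Icc a b, parab t y ≤ f y
  const : ∀ c d, a < c → c ≤ d → d < b → (∀ y ∈ Icc c d, parab t y < f y) → deriv f c = deriv f d

namespace GapShape
variable {t a b : ℝ} {f : ℝ → ℝ}

lemma reflect (hf : GapShape t a b f) : GapShape t (-b) (-a) (fun y => f (-y)) where
  cont := hf.cont.comp continuousOn_neg fun y hy => ⟨by linarith [hy.2], by linarith [hy.1]⟩
  diff y hy := (hf.diff (-y) ⟨by linarith [hy.2], by linarith [hy.1]⟩).comp y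
    differentiableAt_id.neg
  ge y hy := by
    have := hf.ge (-y) ⟨by linarith [hy.2], by linarith [hy.1]⟩
    simpa [parab] using this
  const c d hc hcd hd h := by
    have := hf.const (-d) (-c) (by linarith) (by linarith) (by linarith) fun y hy => by
      have := h (-y) ⟨by linarith [hy.2], by linarith [hy.1]⟩
      simpa [parab] using this
    rw [deriv_comp_neg, deriv_comp_neg, this]

lemma affine (hf : GapShape t a b f) {c d : ℝ} (hac : a ≤ c) (hcd : c < d) (hdb : d ≤ b)
    (h : ∀ y ∈ Ioo c d, parab t y < f y) :
    ∃ β, ∀ y ∈ Icc c d, f y = f c + β * (y - c) := by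
  refine ⟨deriv f ((c + d) / 2), fun y hy => ?_⟩
  rcases eq_or_lt_of_le hy.1 with rfl | hcy
  · simp
  have hsub : Icc c y ⊆ Icc a b := Icc_subset_Icc hac (hy.2.trans hdb)
  obtain ⟨z, hz, hzd⟩ := exists_deriv_eq_slope f hcy (hf.cont.mono hsub) fun w hw =>
    (hf.diff w ⟨hac.trans_lt hw.1, hw.2.trans_le (hy.2.trans hdb)⟩).differentiableWithinAt
  have hzd2 : z < d := hz.2.trans_le hy.2
  have key : deriv f z = deriv f ((c + d) / 2) := by
    rcases le_total z ((c + d) / 2) with hle | hle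
    · exact hf.const _ _ (hac.trans_lt hz.1) hle (by linarith) fun w hw =>
        h w ⟨hz.1.trans_le hw.1, by linarith [hw.2]⟩
    · exact (hf.const _ _ (by linarith) hle (by linarith) fun w hw =>
        h w ⟨by linarith [hw.1], by linarith [hw.2, hz.2, hy.2]⟩).symm
  rw [← key, hzd, div_mul_cancel₀ _ (by linarith)]
  ring

/-- At a contact point the function is tangent to the parabola. -/
lemma deriv_contact (hf : GapShape t a b f) {q : ℝ} (hq : q ∈ Ioo a b)
    (hc : f q = parab t q) : HasDerivAt f (-q / t) q := by
  have hd := (hf.diff q hq).hasDerivAt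
  have hmin : IsLocalMin (fun y => f y - parab t y) q := by
    filter_upwards [Icc_mem_nhds hq.1 hq.2] with y hy
    linarith [hf.ge y hy]
  have := hmin.hasDerivAt_eq_zero (hd.sub (hasDerivAt_parab t q))
  rwa [sub_eq_zero.1 this] at hd

/-- If the first contact point to the right of `c` is `q`, then the function is on `[c, q]` the
tangent of the parabola at `q`, whose distance to the parabola is `(q - y) ^ 2 / (2 * t)`. -/
lemma tangent_of_gt (ht : 0 < t) (hf : GapShape t a b f) {c q : ℝ} (hac : a ≤ c) (hcq : c < q)
    (hqb : q < b) (hc : f q = parab t q) (h : ∀ y ∈ Ioo c q, parab t y < f y) :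
    ∀ y ∈ Icc c q, 2 * t * f y + y ^ 2 = (q - y) ^ 2 := by
  obtain ⟨β, hβ⟩ := hf.affine hac hcq hqb.le h
  have h1 : HasDerivWithinAt f (-q / t) (Icc c q) q :=
    (hf.deriv_contact ⟨by linarith, hqb⟩ hc).hasDerivWithinAt
  have h2 : HasDerivWithinAt f β (Icc c q) q := by
    have : HasDerivWithinAt (fun y => f c + β * (y - c)) β (Icc c q) q := by
      have := (((hasDerivAt_id q).sub_const c).const_mul β).const_add (f c)
      simpa using this.hasDerivWithinAt
    exact this.congr hβ (hβ q ⟨hcq.le, le_rfl⟩)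
  have hu : UniqueDiffWithinAt ℝ (Icc c q) q := uniqueDiffOn_Icc hcq q ⟨hcq.le, le_rfl⟩
  have hβ' : β = -q / t := hu.eq_deriv _ h2 h1
  have hq := (eq_parab_iff ht).1 hc
  have hq2 := hβ q ⟨hcq.le, le_rfl⟩
  have hβt : t * β = -q := by rw [hβ']; field_simp
  intro y hy
  have hy2 := hβ y hy
  have : f y = f q + β * (y - q) := by rw [hy2, hq2]; ring
  rw [this]
  linear_combination hq + 2 * (y - q) * hβt

/-- To the left of a contact point the function follows the tangent through its left end point,
then the parabola. -/
lemma tangent_right (ht : 0 < t) (hf : GapShape t a b f) {q : ℝ} (hq : q ∈ Ioo a b)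
    (hc : f q = parab t q) :
    rad t a (f a) ≤ q - a ∧
      ∀ y ∈ Icc a q, 2 * t * f y + y ^ 2 = (max 0 (rad t a (f a) - (y - a))) ^ 2 := by
  -- the set of contact points in a closed subinterval is closed
  have hcl : ∀ c d, a ≤ c → d ≤ b → IsClosed (Icc c d ∩ {y | f y = parab t y}) := by
    intro c d hac hdb
    have h1 : ContinuousOn (fun y => f y - parab t y) (Icc c d) :=
      (hf.cont.mono (Icc_subset_Icc hac hdb)).sub (fun y _ =>
        (hasDerivAt_parab t y).continuousAt.continuousWithinAt)
    have := h1.preimage_isClosed_of_isClosed isClosed_Icc (isClosed_singleton (x := (0 : ℝ)))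
    convert this using 1
    ext y
    simp [sub_eq_zero]
  -- a contact point with none to its left in `(c, y]`
  have hfirst : ∀ c, a ≤ c → c ≤ q → ∃ z ∈ Icc c q, f z = parab t z ∧
      ∀ y ∈ Ico c z, parab t y < f y := by
    intro c hac hcq
    set S := Icc c q ∩ {y | f y = parab t y}
    have hS : IsClosed S := hcl c q hac hq.2.le
    have hne : S.Nonempty := ⟨q, ⟨hcq, le_rfl⟩, hc⟩
    have hbd : BddBelow S := ⟨c, fun y hy => hy.1.1⟩
    have hmem := hS.csInf_mem hne hbd
    refine ⟨sInf S, hmem.1, hmem.2, fun y hy => ?_⟩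
    refine lt_of_le_of_ne (hf.ge y ⟨hac.trans hy.1, by linarith [hy.2, hmem.1.2, hq.2]⟩) ?_
    intro heq
    have : sInf S ≤ y := csInf_le hbd ⟨⟨hy.1, by linarith [hy.2, hmem.1.2]⟩, heq.symm⟩
    linarith [hy.2]
  obtain ⟨z, hz, hzc, hzlt⟩ := hfirst a le_rfl hq.1.le
  have hleft : ∀ y ∈ Icc a z, 2 * t * f y + y ^ 2 = (z - y) ^ 2 := by
    rcases eq_or_lt_of_le hz.1 with rfl | haz
    · intro y hy
      obtain rfl : y = a := le_antisymm hy.2 hy.1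
      rw [(eq_parab_iff ht).1 hzc]; ring
    · exact hf.tangent_of_gt ht le_rfl haz (hz.2.trans_lt hq.2) hzc
        fun y hy => hzlt y ⟨hy.1.le, hy.2⟩
  have hrad : rad t a (f a) = z - a :=
    rad_eq (by linarith [hz.1]) (hleft a ⟨le_rfl, hz.1⟩)
  refine ⟨by rw [hrad]; linarith [hz.2], fun y hy => ?_⟩
  rw [hrad]
  rcases le_total y z with hyz | hzy
  · rw [hleft y ⟨hy.1, hyz⟩, max_eq_right (by linarith)]; ring
  · rw [max_eq_left (by linarith)]
    have : f y = parab t y := by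
      by_contra hne
      have hgt : parab t y < f y :=
        lt_of_le_of_ne (hf.ge y ⟨hy.1, by linarith [hy.2, hq.2]⟩) (Ne.symm hne)
      -- the last contact point before `y`
      set S := Icc z y ∩ {w | f w = parab t w}
      have hS : IsClosed S := hcl z y hz.1 (by linarith [hy.2, hq.2])
      have hbd : BddAbove S := ⟨y, fun w hw => hw.1.2⟩
      have hmem := hS.csSup_mem ⟨z, ⟨le_rfl, hzy⟩, hzc⟩ hbd
      obtain ⟨w, hw, hwc, hwlt⟩ := hfirst y hy.1 hy.2
      have hαy : sSup S < y := lt_of_le_of_ne hmem.1.2 fun h => hne (h ▸ hmem.2)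
      have hyw : y < w := lt_of_le_of_ne hw.1 fun h => hne (h ▸ hwc)
      have := hf.tangent_of_gt ht (hz.1.trans hmem.1.1) (hαy.trans hyw) (hw.2.trans_lt hq.2) hwc
        (fun v hv => by
          rcases le_or_gt y v with hyv | hvy
          · exact hwlt v ⟨hyv, hv.2⟩
          · refine lt_of_le_of_ne (hf.ge v ⟨by linarith [hv.1, hmem.1.1, hz.1],
              by linarith [hy.2, hq.2]⟩) fun h => ?_
            have : v ≤ sSup S := le_csSup hbd ⟨⟨by linarith [hv.1, hmem.1.1], hvy.le⟩, h.symm⟩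
            linarith [hv.1]) (sSup S) ⟨le_rfl, by linarith⟩
      rw [(eq_parab_iff ht).1 hmem.2] at this
      nlinarith
    rw [(eq_parab_iff ht).1 this]; simp

end GapShape

/-! ### The explicit shape on a gap -/

/-- The shape on the gap `[x₁, x₂]`: the two tangents and the parabola between them if the tangents
leave room for it, the chord otherwise. -/
def gapFn (t x₁ h₁ x₂ h₂ y : ℝ) : ℝ :=
  if rad t x₁ h₁ + rad t x₂ h₂ ≤ x₂ - x₁ then
    parab t y + ((max 0 (rad t x₁ h₁ - (y - x₁))) ^ 2 + (max 0 (rad t x₂ h₂ - (x₂ - y))) ^ 2) /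
      (2 * t)
  else h₁ + (h₂ - h₁) / (x₂ - x₁) * (y - x₁)

/-- The distance of the chord to the parabola, in terms of the tangent lengths at the ends. -/
lemma chord_sq {t x₁ h₁ x₂ h₂ : ℝ} (ht : 0 < t) (hx : x₁ < x₂) (H₁ : parab t x₁ ≤ h₁)
    (H₂ : parab t x₂ ≤ h₂) (y : ℝ) :
    (x₂ - x₁) * (2 * t * (h₁ + (h₂ - h₁) / (x₂ - x₁) * (y - x₁)) + y ^ 2) =
      (x₂ - y) * rad t x₁ h₁ ^ 2 + (y - x₁) * rad t x₂ h₂ ^ 2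
        - (x₂ - y) * (y - x₁) * (x₂ - x₁) := by
  have h0 : x₂ - x₁ ≠ 0 := by linarith
  rw [rad_sq ht H₁, rad_sq ht H₂]
  field_simp
  ring

/-- The shape conditions determine the shape on a gap: a contact point inside the gap forces the
tangents on both sides, and without one the shape is the chord. -/
lemma GapShape.eq_gapFn {t x₁ x₂ : ℝ} {f : ℝ → ℝ} (ht : 0 < t) (hx : x₁ < x₂)
    (hf : GapShape t x₁ x₂ f) {y : ℝ} (hy : y ∈ Icc x₁ x₂) :
    f y = gapFn t x₁ (f x₁) x₂ (f x₂) y := by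
  have H₁ := hf.ge x₁ ⟨le_rfl, hx.le⟩
  have H₂ := hf.ge x₂ ⟨hx.le, le_rfl⟩
  have hr₁ := rad_nonneg t x₁ (f x₁)
  have hr₂ := rad_nonneg t x₂ (f x₂)
  have hform : ∀ v, 2 * t * f y + y ^ 2 = v → f y = parab t y + v / (2 * t) := by
    rintro v rfl
    unfold parab
    field_simp
    ring
  by_cases hex : ∃ q ∈ Ioo x₁ x₂, f q = parab t q
  · obtain ⟨q, hq, hqc⟩ := hex
    obtain ⟨hle, hR⟩ := hf.tangent_right ht hq hqc
    have hqc' : f (- -q) = parab t (-q) := by simpa [parab] using hqc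
    obtain ⟨hle', hL⟩ := hf.reflect.tangent_right ht (q := -q)
      ⟨by linarith [hq.2], by linarith [hq.1]⟩ hqc'
    simp only [neg_neg] at hle' hL
    have hradneg : rad t (-x₂) (f x₂) = rad t x₂ (f x₂) := by simp [rad]
    rw [hradneg] at hle' hL
    rw [gapFn, if_pos (by linarith)]
    apply hform
    rcases le_total y q with hyq | hqy
    · rw [hR y ⟨hy.1, hyq⟩, max_eq_left (a := 0) (b := rad t x₂ (f x₂) - (x₂ - y)) (by linarith)]
      ring
    · have := hL (-y) ⟨by linarith [hy.2], by linarith⟩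
      rw [neg_neg, neg_sq] at this
      rw [this, max_eq_left (a := 0) (b := rad t x₁ (f x₁) - (y - x₁)) (by linarith),
        show rad t x₂ (f x₂) - (-y - -x₂) = rad t x₂ (f x₂) - (x₂ - y) by ring]
      ring
  · push Not at hex
    obtain ⟨β, hβ⟩ := hf.affine le_rfl hx le_rfl fun y hy =>
      lt_of_le_of_ne (hf.ge y ⟨hy.1.le, hy.2.le⟩) (hex y hy).symm
    have h2 := hβ x₂ ⟨hx.le, le_rfl⟩
    have hβ' : β = (f x₂ - f x₁) / (x₂ - x₁) := by
      rw [h2]; field_simp [(by linarith : x₂ - x₁ ≠ 0)]; ring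
    have hch : ∀ y ∈ Icc x₁ x₂, f y = f x₁ + (f x₂ - f x₁) / (x₂ - x₁) * (y - x₁) := by
      rw [← hβ']; exact hβ
    have hsq : ∀ y ∈ Icc x₁ x₂, (x₂ - x₁) * (2 * t * f y + y ^ 2) =
        (x₂ - y) * rad t x₁ (f x₁) ^ 2 + (y - x₁) * rad t x₂ (f x₂) ^ 2
        - (x₂ - y) * (y - x₁) * (x₂ - x₁) := fun y hy => by
      rw [hch y hy]; exact chord_sq ht hx H₁ H₂ y
    rw [gapFn]
    split_ifs with hle
    · set r₁ := rad t x₁ (f x₁)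
      set r₂ := rad t x₂ (f x₂)
      -- the chord stays above the parabola, which forces the two tangents to be one line
      have hd : x₂ - x₁ ≤ r₁ + r₂ := by
        by_contra hlt
        push Not at hlt
        -- the chord is below the parabola at the middle of the interval between the two tangents
        have hmem : (x₁ + (x₂ - x₁ + r₁ - r₂) / 2) ∈ Icc x₁ x₂ := ⟨by linarith, by linarith⟩
        have h3 := hsq _ hmem
        have h4 := (parab_le_iff ht).1 (hf.ge _ hmem)
        have h5 : 0 ≤ (x₂ - x₁) * (2 * t * f (x₁ + (x₂ - x₁ + r₁ - r₂) / 2) +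
          (x₁ + (x₂ - x₁ + r₁ - r₂) / 2) ^ 2) := mul_nonneg (by linarith) h4
        rw [h3] at h5
        obtain ⟨e, he⟩ : ∃ e, x₂ = x₁ + r₁ + r₂ + e := ⟨x₂ - x₁ - r₁ - r₂, by ring⟩
        have he0 : 0 < e := by linarith
        rw [he] at h5
        have : 0 < r₁ + e / 2 ∧ 0 < r₂ + e / 2 := ⟨by linarith, by linarith⟩
        nlinarith [mul_pos he0 he0, mul_pos this.1 this.2, mul_pos he0 (mul_pos this.1 this.2),
          mul_nonneg hr₁ hr₂, mul_pos he0 this.1, mul_pos he0 this.2, pow_pos he0 3,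
          mul_nonneg hr₁ he0.le, mul_nonneg hr₂ he0.le,
          mul_nonneg (mul_nonneg hr₁ hr₂) he0.le]
      have hd' : x₂ = x₁ + r₁ + r₂ := by linarith
      apply hform
      have h3 := hsq y hy
      have h4 : (x₂ - x₁) * (2 * t * f y + y ^ 2) = (x₂ - x₁) * (r₁ - (y - x₁)) ^ 2 := by
        rw [h3, hd']; ring
      rw [mul_left_cancel₀ (by linarith) h4,
        show r₂ - (x₂ - y) = -(r₁ - (y - x₁)) by rw [hd']; ring]
      rcases le_total 0 (r₁ - (y - x₁)) with h | h
      · rw [max_eq_right h, max_eq_left (by linarith)]; ring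
      · rw [max_eq_left h, max_eq_right (by linarith)]; ring
    · exact hch y hy
end

noncomputable section
open Set Filter Topology

/-! ### Existence and uniqueness of the shape -/

lemma hasDerivAt_posPart_sq (s : ℝ) : HasDerivAt (fun s : ℝ => (max 0 s) ^ 2) (2 * max 0 s) s := by
  have h1 : s ≤ 0 → HasDerivWithinAt (fun s : ℝ => (max 0 s) ^ 2) (2 * max 0 s) (Iic 0) s := by
    intro hs
    rw [max_eq_left hs, mul_zero]
    exact (hasDerivWithinAt_const s _ (0 : ℝ)).congr
      (fun y hy => by simp only [mem_Iic] at hy; simp [max_eq_left hy]) (by simp [max_eq_left hs])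
  have h2 : 0 ≤ s → HasDerivWithinAt (fun s : ℝ => (max 0 s) ^ 2) (2 * max 0 s) (Ici 0) s := by
    intro hs
    rw [max_eq_right hs]
    have := (hasDerivAt_pow 2 s).hasDerivWithinAt (s := Ici 0)
    simp only [Nat.cast_ofNat, Nat.add_one_sub_one, pow_one] at this
    exact this.congr (fun y hy => by simp only [mem_Ici] at hy; simp [max_eq_right hy])
      (by simp [max_eq_right hs])
  rcases lt_trichotomy s 0 with hs | hs | hs
  · exact (h1 hs.le).hasDerivAt (Iic_mem_nhds hs)
  · have := (h1 hs.le).union (h2 hs.ge)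
    rwa [Iic_union_Ici, hasDerivWithinAt_univ] at this
  · exact (h2 hs.le).hasDerivAt (Ici_mem_nhds hs)

lemma contDiff_posPart_sq : ContDiff ℝ 1 (fun s : ℝ => (max 0 s) ^ 2) := by
  rw [contDiff_one_iff_deriv]
  refine ⟨fun s => (hasDerivAt_posPart_sq s).differentiableAt, ?_⟩
  rw [funext fun s => (hasDerivAt_posPart_sq s).deriv]
  fun_prop

lemma contDiff_parab (t : ℝ) : ContDiff ℝ 1 (parab t) := by
  unfold parab
  fun_prop

/-- Local form of the shape conditions at a point off the marked points. -/
def LocGood (t : ℝ) (f : ℝ → ℝ) (y : ℝ) : Prop :=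
  ContDiffAt ℝ 1 f y ∧ (parab t y < f y → ∃ a b : ℝ, f =ᶠ[𝓝 y] fun z => a + b * z)

lemma LocGood.congr {t : ℝ} {f g : ℝ → ℝ} {y : ℝ} (hf : LocGood t f y) (h : g =ᶠ[𝓝 y] f) :
    LocGood t g y := by
  refine ⟨hf.1.congr_of_eventuallyEq h, fun hy => ?_⟩
  rw [h.eq_of_nhds] at hy
  obtain ⟨a, b, hab⟩ := hf.2 hy
  exact ⟨a, b, h.trans hab⟩

/-- The shape to the right of the last marked point. -/
def tailR (t x h y : ℝ) : ℝ := parab t y + (max 0 (rad t x h - (y - x))) ^ 2 / (2 * t)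

/-- The shape to the left of the first marked point. -/
def tailL (t x h y : ℝ) : ℝ := parab t y + (max 0 (rad t x h - (x - y))) ^ 2 / (2 * t)

/-- The tangent of the parabola at `c`. -/
lemma sq_gap_affine {t : ℝ} (c y : ℝ) :
    parab t y + (c - y) ^ 2 / (2 * t) = c ^ 2 / (2 * t) + -(2 * c) / (2 * t) * y := by
  unfold parab
  rw [← add_div]
  ring

lemma contDiff_tailR (t x h : ℝ) : ContDiff ℝ 1 (tailR t x h) := by
  unfold tailR
  exact (contDiff_parab t).add ((contDiff_posPart_sq.comp (by fun_prop)).div_const _)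

lemma contDiff_tailL (t x h : ℝ) : ContDiff ℝ 1 (tailL t x h) := by
  unfold tailL
  exact (contDiff_parab t).add ((contDiff_posPart_sq.comp (by fun_prop)).div_const _)

lemma tailR_locGood (t x h y : ℝ) : LocGood t (tailR t x h) y := by
  refine ⟨(contDiff_tailR t x h).contDiffAt, fun hy => ?_⟩
  have hlt : y < rad t x h + x := by
    by_contra hge
    rw [tailR, max_eq_left (by linarith)] at hy
    simp at hy
  refine ⟨(rad t x h + x) ^ 2 / (2 * t), -(2 * (rad t x h + x)) / (2 * t), ?_⟩
  filter_upwards [Iio_mem_nhds hlt] with z hz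
  simp only [mem_Iio] at hz
  rw [tailR, max_eq_right (by linarith), ← sq_gap_affine]
  ring

lemma tailL_locGood (t x h y : ℝ) : LocGood t (tailL t x h) y := by
  refine ⟨(contDiff_tailL t x h).contDiffAt, fun hy => ?_⟩
  have hlt : x - rad t x h < y := by
    by_contra hge
    rw [tailL, max_eq_left (by linarith)] at hy
    simp at hy
  refine ⟨(x - rad t x h) ^ 2 / (2 * t), -(2 * (x - rad t x h)) / (2 * t), ?_⟩
  filter_upwards [Ioi_mem_nhds hlt] with z hz
  simp only [mem_Ioi] at hz
  rw [tailL, max_eq_right (by linarith), ← sq_gap_affine]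
  ring

lemma gapFn_locGood (t x₁ h₁ x₂ h₂ y : ℝ) : LocGood t (gapFn t x₁ h₁ x₂ h₂) y := by
  unfold gapFn
  split_ifs with hle
  · have hadd : ∀ z, parab t z + ((max 0 (rad t x₁ h₁ - (z - x₁))) ^ 2 +
        (max 0 (rad t x₂ h₂ - (x₂ - z))) ^ 2) / (2 * t) =
        tailR t x₁ h₁ z + (tailL t x₂ h₂ z - parab t z) := fun z => by
      unfold tailR tailL; ring
    simp only [hadd]
    refine ⟨((contDiff_tailR t x₁ h₁).add
      ((contDiff_tailL t x₂ h₂).sub (contDiff_parab t))).contDiffAt, fun hy => ?_⟩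
    rcases lt_trichotomy y (x₁ + rad t x₁ h₁) with hlt | heq | hgt
    · have h2 : ∀ z < x₁ + rad t x₁ h₁, tailL t x₂ h₂ z - parab t z = 0 := fun z hz => by
        rw [tailL, max_eq_left (by linarith)]; simp
      have hev : (fun z => tailR t x₁ h₁ z + (tailL t x₂ h₂ z - parab t z)) =ᶠ[𝓝 y]
          tailR t x₁ h₁ := by
        filter_upwards [Iio_mem_nhds hlt] with z hz
        rw [h2 z hz, add_zero]
      exact ((tailR_locGood t x₁ h₁ y).congr hev).2 hy
    · simp only [tailR, tailL] at hy
      rw [max_eq_left (by linarith), max_eq_left (by linarith)] at hy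
      simp at hy
    · have h2 : ∀ z > x₁ + rad t x₁ h₁, tailR t x₁ h₁ z = parab t z := fun z hz => by
        rw [tailR, max_eq_left (by linarith [hz.lt])]; simp
      have hev : (fun z => tailR t x₁ h₁ z + (tailL t x₂ h₂ z - parab t z)) =ᶠ[𝓝 y]
          tailL t x₂ h₂ := by
        filter_upwards [Ioi_mem_nhds hgt] with z hz
        rw [h2 z hz]; ring
      exact ((tailL_locGood t x₂ h₂ y).congr hev).2 hy
  · refine ⟨by fun_prop, fun _ => ⟨h₁ - (h₂ - h₁) / (x₂ - x₁) * x₁, (h₂ - h₁) / (x₂ - x₁),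
      Eventually.of_forall fun z => by ring⟩⟩

lemma tailR_self {t x h : ℝ} (ht : 0 < t) (hh : parab t x ≤ h) : tailR t x h x = h := by
  rw [tailR, sub_self, sub_zero, max_eq_right (rad_nonneg _ _ _), rad_sq ht hh, parab]
  field_simp; ring

lemma tailL_self {t x h : ℝ} (ht : 0 < t) (hh : parab t x ≤ h) : tailL t x h x = h := by
  rw [tailL, sub_self, sub_zero, max_eq_right (rad_nonneg _ _ _), rad_sq ht hh, parab]
  field_simp; ring

lemma parab_le_tailR {t : ℝ} (ht : 0 < t) (x h y : ℝ) : parab t y ≤ tailR t x h y := by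
  unfold tailR
  have : 0 ≤ (max 0 (rad t x h - (y - x))) ^ 2 / (2 * t) := by positivity
  linarith

lemma parab_le_tailL {t : ℝ} (ht : 0 < t) (x h y : ℝ) : parab t y ≤ tailL t x h y := by
  unfold tailL
  have : 0 ≤ (max 0 (rad t x h - (x - y))) ^ 2 / (2 * t) := by positivity
  linarith

section gap
variable {t x₁ h₁ x₂ h₂ : ℝ}

lemma gapFn_left (ht : 0 < t) (H₁ : parab t x₁ ≤ h₁) :
    gapFn t x₁ h₁ x₂ h₂ x₁ = h₁ := by
  unfold gapFn
  split_ifs with h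
  · have h3 := tailR_self ht H₁
    rw [max_eq_left (a := 0) (b := rad t x₂ h₂ - (x₂ - x₁))
      (by linarith [rad_nonneg t x₁ h₁])]
    rw [tailR] at h3
    simpa using h3
  · ring

lemma gapFn_right (ht : 0 < t) (hx : x₁ < x₂) (H₂ : parab t x₂ ≤ h₂) :
    gapFn t x₁ h₁ x₂ h₂ x₂ = h₂ := by
  unfold gapFn
  split_ifs with h
  · have h3 := tailL_self ht H₂
    rw [max_eq_left (a := 0) (b := rad t x₁ h₁ - (x₂ - x₁))
      (by linarith [rad_nonneg t x₂ h₂])]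
    rw [tailL] at h3
    simpa using h3
  · field_simp [(by linarith : x₂ - x₁ ≠ 0)]; ring

lemma parab_le_gapFn (ht : 0 < t) (hx : x₁ < x₂) (H₁ : parab t x₁ ≤ h₁) (H₂ : parab t x₂ ≤ h₂)
    {y : ℝ} (hy : y ∈ Icc x₁ x₂) : parab t y ≤ gapFn t x₁ h₁ x₂ h₂ y := by
  unfold gapFn
  split_ifs with h
  · have : 0 ≤ ((max 0 (rad t x₁ h₁ - (y - x₁))) ^ 2 + (max 0 (rad t x₂ h₂ - (x₂ - y))) ^ 2) /
      (2 * t) := by positivity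
    linarith
  · rw [parab_le_iff ht]
    refine nonneg_of_mul_nonneg_right ?_ (sub_pos.2 hx)
    rw [chord_sq ht hx H₁ H₂]
    have hr₁ := rad_nonneg t x₁ h₁
    have hr₂ := rad_nonneg t x₂ h₂
    set r₁ := rad t x₁ h₁
    set r₂ := rad t x₂ h₂
    push Not at h
    obtain ⟨a, ha⟩ : ∃ a, y = x₁ + a := ⟨y - x₁, by ring⟩
    obtain ⟨b, hb⟩ : ∃ b, x₂ = y + b := ⟨x₂ - y, by ring⟩
    have ha0 : 0 ≤ a := by linarith [hy.1]
    have hb0 : 0 ≤ b := by linarith [hy.2]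
    have hab : 0 < a + b := by linarith
    have e : x₂ - y = b ∧ y - x₁ = a ∧ x₂ - x₁ = a + b := ⟨by linarith, by linarith, by linarith⟩
    rw [e.1, e.2.1, e.2.2]
    rw [e.2.2] at h
    -- `(a+b)(b r₁² + a r₂² - ab(a+b)) = (b r₁ - a r₂)² + ab((r₁+r₂)² - (a+b)²)`
    refine nonneg_of_mul_nonneg_right (a := a + b) ?_ hab
    have h3 : 0 ≤ a * b * ((r₁ + r₂) ^ 2 - (a + b) ^ 2) :=
      mul_nonneg (mul_nonneg ha0 hb0) (by nlinarith)
    nlinarith [sq_nonneg (b * r₁ - a * r₂)]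

end gap

lemma continuous_tailR (t x h : ℝ) : Continuous (tailR t x h) := (contDiff_tailR t x h).continuous
lemma continuous_tailL (t x h : ℝ) : Continuous (tailL t x h) := (contDiff_tailL t x h).continuous
lemma continuous_gapFn (t x₁ h₁ x₂ h₂ : ℝ) : Continuous (gapFn t x₁ h₁ x₂ h₂) :=
  continuous_iff_continuousAt.2 fun y => (gapFn_locGood t x₁ h₁ x₂ h₂ y).1.continuousAt

/-- The shape through the points `(X i, H i)`, `i ≤ k`, built by adding the points from left to
right. -/
def shapeRec (t : ℝ) (X H : ℕ → ℝ) : ℕ → ℝ → ℝ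
  | 0, y => if y ≤ X 0 then tailL t (X 0) (H 0) y else tailR t (X 0) (H 0) y
  | k + 1, y => if y ≤ X k then shapeRec t X H k y else
      if y ≤ X (k + 1) then gapFn t (X k) (H k) (X (k + 1)) (H (k + 1)) y
      else tailR t (X (k + 1)) (H (k + 1)) y

lemma LocGood.ite {t a : ℝ} {f g : ℝ → ℝ} {y : ℝ} (hy : y ≠ a) (hf : y < a → LocGood t f y)
    (hg : a < y → LocGood t g y) : LocGood t (fun z => if z ≤ a then f z else g z) y := by
  rcases lt_or_gt_of_ne hy with h | h
  · refine (hf h).congr ?_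
    filter_upwards [Iio_mem_nhds h] with z hz
    rw [if_pos (le_of_lt hz)]
  · refine (hg h).congr ?_
    filter_upwards [Ioi_mem_nhds h] with z hz
    rw [if_neg (not_le.2 hz)]

/-- The glued function satisfies the shape conditions, in a form that passes through the induction.
-/
lemma shapeRec_spec {t : ℝ} (ht : 0 < t) (X H : ℕ → ℝ) (k : ℕ)
    (hX : ∀ i < k, X i < X (i + 1)) (hH : ∀ i ≤ k, parab t (X i) ≤ H i) :
    Continuous (shapeRec t X H k) ∧
    (∀ y, (∀ i ≤ k, y ≠ X i) → LocGood t (shapeRec t X H k) y) ∧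
    (∀ i ≤ k, shapeRec t X H k (X i) = H i) ∧
    (∀ y, parab t y ≤ shapeRec t X H k y) ∧
    (∀ y, X k ≤ y → shapeRec t X H k y = tailR t (X k) (H k) y) ∧
    (∀ y, y ≤ X 0 → shapeRec t X H k y = tailL t (X 0) (H 0) y) ∧ (∀ i ≤ k, X i ≤ X k) ∧
    (∀ i ≤ k, X 0 ≤ X i) := by
  induction k with
  | zero =>
    have hR := tailR_self ht (hH 0 le_rfl)
    have hL := tailL_self ht (hH 0 le_rfl)
    refine ⟨?_, fun y hy => ?_, fun i hi => ?_, fun y => ?_, fun y hy => ?_, fun y hy => ?_,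
      fun i hi => ?_, fun i hi => ?_⟩
    · exact Continuous.if_le (continuous_tailL _ _ _) (continuous_tailR _ _ _) continuous_id
        continuous_const fun y hy => by rw [hy, hL, hR]
    · exact LocGood.ite (hy 0 le_rfl) (fun _ => tailL_locGood _ _ _ _)
        fun _ => tailR_locGood _ _ _ _
    · obtain rfl : i = 0 := by omega
      simp [shapeRec, hL]
    · unfold shapeRec
      split_ifs
      · exact parab_le_tailL ht _ _ _
      · exact parab_le_tailR ht _ _ _
    · rcases eq_or_lt_of_le hy with rfl | h
      · simp [shapeRec, hL, hR]
      · simp [shapeRec, not_le.2 h]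
    · simp [shapeRec, hy]
    · obtain rfl : i = 0 := by omega
      rfl
    · obtain rfl : i = 0 := by omega
      rfl
  | succ k ih =>
    obtain ⟨hc, hloc, hval, hge, hright, hleft, hmax, hmin⟩ :=
      ih (fun i hi => hX i (by omega)) (fun i hi => hH i (by omega))
    have hk := hX k (by omega)
    have hHk := hH k (by omega)
    have hHk1 := hH (k + 1) le_rfl
    have hmax1 : ∀ i ≤ k + 1, X i ≤ X (k + 1) := fun i hi => by
      rcases Nat.lt_or_ge i (k + 1) with h | h
      · exact (hmax i (by omega)).trans hk.le
      · rw [show i = k + 1 by omega]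
    have hmin1 : ∀ i ≤ k + 1, X 0 ≤ X i := fun i hi => by
      rcases Nat.lt_or_ge i (k + 1) with h | h
      · exact hmin i (by omega)
      · rw [show i = k + 1 by omega]; exact (hmin k le_rfl).trans hk.le
    refine ⟨?_, fun y hy => ?_, fun i hi => ?_, fun y => ?_, fun y hy => ?_, fun y hy => ?_,
      hmax1, hmin1⟩
    · refine Continuous.if_le hc (Continuous.if_le (continuous_gapFn _ _ _ _ _)
        (continuous_tailR _ _ _) continuous_id continuous_const fun y hy => ?_) continuous_id
        continuous_const fun y hy => ?_
      · rw [hy, gapFn_right ht hk hHk1, tailR_self ht hHk1]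
      · rw [hy, if_pos hk.le, hval k le_rfl, gapFn_left ht hHk]
    · refine LocGood.ite (hy k (by omega)) (fun _ => hloc y fun i hi => hy i (by omega)) fun _ =>
        LocGood.ite (hy (k + 1) le_rfl) (fun _ => gapFn_locGood _ _ _ _ _ _)
          fun _ => tailR_locGood _ _ _ _
    · rcases Nat.lt_or_ge i (k + 1) with h | h
      · rw [shapeRec, if_pos (hmax i (by omega)), hval i (by omega)]
      · rw [show i = k + 1 by omega, shapeRec, if_neg (not_le.2 hk), if_pos le_rfl,
          gapFn_right ht hk hHk1]
    · rw [shapeRec]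
      split_ifs with h1 h2
      · exact hge y
      · exact parab_le_gapFn ht hk hHk hHk1 ⟨(not_le.1 h1).le, h2⟩
      · exact parab_le_tailR ht _ _ _
    · rw [shapeRec, if_neg (by linarith)]
      split_ifs with h2
      · rw [le_antisymm h2 hy, gapFn_right ht hk hHk1, tailR_self ht hHk1]
      · rfl
    · rw [shapeRec, if_pos (hy.trans (hmin k le_rfl)), hleft y hy]

/-- A locally affine function has constant slope on an interval. -/
lemma deriv_const_of_locGood {t : ℝ} {f : ℝ → ℝ} {a b : ℝ} (hab : a ≤ b)
    (h : ∀ y ∈ Icc a b, parab t y < f y ∧ LocGood t f y) : deriv f a = deriv f b := by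
  have hd : ∀ y ∈ Icc a b, HasDerivAt (deriv f) 0 y := fun y hy => by
    obtain ⟨α, β, he⟩ := (h y hy).2.2 (h y hy).1
    have h2 : deriv f =ᶠ[𝓝 y] fun _ => β := by
      filter_upwards [he.eventuallyEq_nhds] with z hz
      rw [hz.deriv_eq]
      have : HasDerivAt (fun z => α + β * z) β z := by
        simpa using ((hasDerivAt_id z).const_mul β).const_add α
      exact this.deriv
    exact (hasDerivAt_const y β).congr_of_eventuallyEq h2
  have := constant_of_has_deriv_right_zero (f := deriv f)
    (fun y hy => (hd y hy).continuousAt.continuousWithinAt)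
    (fun y hy => (hd y ⟨hy.1, hy.2.le⟩).hasDerivWithinAt) b ⟨hab, le_rfl⟩
  exact this.symm

section shape
variable {k : ℕ} {t : ℝ} {x : Fin (k + 1) → ℝ} {h : EuclideanSpace ℝ (Fin (k + 1))}

theorem exists_isShapeAt (ht : 0 < t) (hx : StrictMono x) (hh : h ∈ hvSpace t x) :
    ∃ f, IsShapeAt t x h f := by
  set e : ℕ → Fin (k + 1) := fun i => Fin.ofNat (k + 1) i
  have he : ∀ i ≤ k, (e i).val = i := fun i hi => by
    simp only [e, Fin.ofNat]; exact Nat.mod_eq_of_lt (by omega)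
  have hec : ∀ c : Fin (k + 1), e c.val = c := fun c => Fin.ext (he _ (by omega))
  obtain ⟨hc, hloc, hval, hge, hright, hleft, hmax, hmin⟩ :=
    shapeRec_spec ht (fun i => x (e i)) (fun i => h (e i)) k
      (fun i hi => hx (by rw [Fin.lt_def, he i (by omega), he (i + 1) (by omega)]; omega))
      (fun i _ => hh (e i))
  set f := shapeRec t (fun i => x (e i)) (fun i => h (e i)) k
  have hoff : ∀ y, y ∉ range x → LocGood t f y := fun y hy =>
    hloc y fun i _ hi => hy ⟨e i, hi.symm⟩
  refine ⟨f, hc, fun y hy => (hoff y hy).1.contDiffWithinAt, fun c => ?_, hge, ?_, ?_⟩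
  · have := hval c.val (by omega)
    simpa only [hec] using this
  · refine ⟨|x (e 0)| + |x (e k)| + rad t (x (e 0)) (h (e 0)) + rad t (x (e k)) (h (e k)),
      fun y hy => ?_⟩
    have h0 := rad_nonneg t (x (e 0)) (h (e 0))
    have h1 := rad_nonneg t (x (e k)) (h (e k))
    have a0 := neg_abs_le (x (e 0))
    have a1 := le_abs_self (x (e k))
    have a2 := abs_nonneg (x (e 0))
    have a3 := abs_nonneg (x (e k))
    rcases le_total 0 y with hy0 | hy0
    · rw [abs_of_nonneg hy0] at hy
      rw [hright y (by linarith), tailR, max_eq_left (by linarith)]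
      simp
    · rw [abs_of_nonpos hy0] at hy
      rw [hleft y (by linarith), tailL, max_eq_left (by linarith)]
      simp
  · exact fun a b hab hy => deriv_const_of_locGood hab fun y hyy => ⟨(hy y hyy).1, hoff y (hy y hyy).2⟩

lemma IsShapeAt.gapShape {n : ℕ} {x : Fin n → ℝ} {h : EuclideanSpace ℝ (Fin n)} {f : ℝ → ℝ}
    (hf : IsShapeAt t x h f) {a b : ℝ} (hab : ∀ c, x c ∉ Ioo a b) : GapShape t a b f where
  cont := hf.continuous.continuousOn
  diff y hy := by
    have hopen : IsOpen (range x)ᶜ := (finite_range x).isClosed.isOpen_compl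
    have hmem : y ∈ (range x)ᶜ := by rintro ⟨c, rfl⟩; exact hab c hy
    exact (hf.contDiffOn.contDiffAt (hopen.mem_nhds hmem)).differentiableAt (by simp)
  ge y _ := hf.ge_parab y
  const c d hc hcd hd h := hf.deriv_const c d hcd fun y hy => ⟨h y hy, by
    rintro ⟨e, rfl⟩; exact hab e ⟨by linarith [hy.1], by linarith [hy.2]⟩⟩

lemma form_of_sq {v w y : ℝ} (ht : 0 < t) (h : 2 * t * v + y ^ 2 = w) :
    v = parab t y + w / (2 * t) := by
  rw [← h]; unfold parab; field_simp; ring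

lemma IsShapeAt.eq_tailR {n : ℕ} {x : Fin n → ℝ} {h : EuclideanSpace ℝ (Fin n)} {f : ℝ → ℝ}
    (hf : IsShapeAt t x h f) (ht : 0 < t) {c : Fin n} (hc : ∀ j, x j ≤ x c) {y : ℝ}
    (hy : x c ≤ y) : f y = tailR t (x c) (h c) y := by
  obtain ⟨R, hR⟩ := hf.eq_parab
  set q := max (y + 1) (max R 0)
  have hq1 : y + 1 ≤ q := le_max_left _ _
  have hq2 : R ≤ |q| := (le_max_left R 0).trans ((le_max_right _ _).trans (le_abs_self q))
  have hg := hf.gapShape (a := x c) (b := q + 1) fun j hj => by linarith [hc j, hj.1]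
  have := (hg.tangent_right ht ⟨by linarith, by linarith⟩ (hR q hq2)).2 y ⟨hy, by linarith⟩
  rw [hf.value] at this
  exact form_of_sq ht this

lemma IsShapeAt.eq_tailL {n : ℕ} {x : Fin n → ℝ} {h : EuclideanSpace ℝ (Fin n)} {f : ℝ → ℝ}
    (hf : IsShapeAt t x h f) (ht : 0 < t) {c : Fin n} (hc : ∀ j, x c ≤ x j) {y : ℝ}
    (hy : y ≤ x c) : f y = tailL t (x c) (h c) y := by
  obtain ⟨R, hR⟩ := hf.eq_parab
  set q := min (y - 1) (min (-R) 0)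
  have hq1 : q ≤ y - 1 := min_le_left _ _
  have hq0 : q ≤ -R ∧ q ≤ 0 :=
    ⟨(min_le_right _ _).trans (min_le_left _ _), (min_le_right _ _).trans (min_le_right _ _)⟩
  have hq2 : R ≤ |q| := by rw [abs_of_nonpos hq0.2]; linarith
  have hg := (hf.gapShape (a := q - 1) (b := x c) fun j hj => by linarith [hc j, hj.2]).reflect
  have hqc : f (- -q) = parab t (-q) := by rw [neg_neg, hR q hq2]; simp [parab]
  have := (hg.tangent_right ht (q := -q) ⟨by linarith, by linarith⟩ hqc).2 (-y)
    ⟨by linarith, by linarith⟩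
  simp only [neg_neg, hf.value, neg_sq] at this
  rw [show rad t (-x c) (h c) = rad t (x c) (h c) by simp [rad],
    show (-y - -x c) = x c - y by ring] at this
  exact form_of_sq ht this

lemma StrictMono.notMem_gap (hx : StrictMono x) (i : Fin k) (c : Fin (k + 1)) :
    x c ∉ Ioo (x i.castSucc) (x i.succ) := by
  intro hc
  have h1 := hx.lt_iff_lt.1 hc.1
  have h2 := hx.lt_iff_lt.1 hc.2
  rw [Fin.lt_def] at h1 h2
  simp at h1 h2
  omega

lemma IsShapeAt.eq_gap {f : ℝ → ℝ} (hf : IsShapeAt t x h f) (ht : 0 < t) (hx : StrictMono x)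
    (i : Fin k) {y : ℝ} (hy : y ∈ Icc (x i.castSucc) (x i.succ)) :
    f y = gapFn t (x i.castSucc) (h i.castSucc) (x i.succ) (h i.succ) y := by
  have := (hf.gapShape (hx.notMem_gap i)).eq_gapFn ht (hx i.castSucc_lt_succ) hy
  rwa [hf.value, hf.value] at this

lemma exists_gap (x : Fin (k + 1) → ℝ) (y : ℝ) :
    y ≤ x 0 ∨ x (Fin.last k) ≤ y ∨ ∃ i : Fin k, y ∈ Icc (x i.castSucc) (x i.succ) := by
  induction k with
  | zero => exact (le_total y (x 0)).imp_right Or.inl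
  | succ k ih =>
    rcases ih (fun i => x i.castSucc) with h1 | h1 | ⟨i, hi⟩
    · exact Or.inl h1
    · rcases le_total y (x (Fin.last (k + 1))) with h2 | h2
      · exact Or.inr (Or.inr ⟨Fin.last k, h1, by simpa using h2⟩)
      · exact Or.inr (Or.inl h2)
    · exact Or.inr (Or.inr ⟨i.castSucc, hi.1, by simpa using hi.2⟩)

lemma IsShapeAt.unique {f g : ℝ → ℝ} (hf : IsShapeAt t x h f) (hg : IsShapeAt t x h g)
    (ht : 0 < t) (hx : StrictMono x) : f = g := by
  funext y
  rcases exists_gap x y with h1 | h1 | ⟨i, hi⟩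
  · have : ∀ j, x 0 ≤ x j := fun j => hx.monotone (Fin.zero_le j)
    rw [hf.eq_tailL ht this h1, hg.eq_tailL ht this h1]
  · have : ∀ j, x j ≤ x (Fin.last k) := fun j => hx.monotone (Fin.le_last j)
    rw [hf.eq_tailR ht this h1, hg.eq_tailR ht this h1]
  · rw [hf.eq_gap ht hx i hi, hg.eq_gap ht hx i hi]

lemma isShapeAt_shapeFn (ht : 0 < t) (hx : StrictMono x) (hh : h ∈ hvSpace t x) :
    IsShapeAt t x h (shapeFn t x h) :=
  Classical.epsilon_spec (exists_isShapeAt ht hx hh)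

lemma IsShapeAt.shapeFn_eq {f : ℝ → ℝ} (hf : IsShapeAt t x h f) (ht : 0 < t)
    (hx : StrictMono x) : shapeFn t x h = f :=
  IsShapeAt.unique (Classical.epsilon_spec ⟨f, hf⟩) hf ht hx

lemma IsShapeAt.mem_hvSpace {n : ℕ} {x : Fin n → ℝ} {h : EuclideanSpace ℝ (Fin n)} {f : ℝ → ℝ}
    (hf : IsShapeAt t x h f) : h ∈ hvSpace t x := fun c => by
  rw [← hf.value c]; exact hf.ge_parab _

end shape
end

noncomputable section
open Set Filter Topology MeasureTheory

/-! ### Slopes and costs on a gap -/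

/-- Right slope at `x₁` of the shape on the gap `[x₁, x₂]`. -/
def slopeR (t x₁ h₁ x₂ h₂ : ℝ) : ℝ :=
  if rad t x₁ h₁ + rad t x₂ h₂ ≤ x₂ - x₁ then -(x₁ + rad t x₁ h₁) / t else (h₂ - h₁) / (x₂ - x₁)

/-- Left slope at `x₂` of the shape on the gap `[x₁, x₂]`. -/
def slopeL (t x₁ h₁ x₂ h₂ : ℝ) : ℝ :=
  if rad t x₁ h₁ + rad t x₂ h₂ ≤ x₂ - x₁ then -(x₂ - rad t x₂ h₂) / t else (h₂ - h₁) / (x₂ - x₁)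

/-- Cost of the tangent that leaves `(x, h)` to the right. -/
def capR (t x h : ℝ) : ℝ := (3 * x * rad t x h ^ 2 + 2 * rad t x h ^ 3) / (6 * t ^ 2)

/-- Cost of the tangent that leaves `(x, h)` to the left. -/
def capL (t x h : ℝ) : ℝ := (-3 * x * rad t x h ^ 2 + 2 * rad t x h ^ 3) / (6 * t ^ 2)

/-- Cost of the shape on the gap `[x₁, x₂]`. -/
def gapCost (t x₁ h₁ x₂ h₂ : ℝ) : ℝ :=
  if rad t x₁ h₁ + rad t x₂ h₂ ≤ x₂ - x₁ then capR t x₁ h₁ + capL t x₂ h₂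
  else (h₂ - h₁) ^ 2 / (2 * (x₂ - x₁)) - (x₂ ^ 3 - x₁ ^ 3) / (6 * t ^ 2)

lemma hasDerivAt_posPart_cube (s : ℝ) :
    HasDerivAt (fun s : ℝ => (max 0 s) ^ 3) (3 * (max 0 s) ^ 2) s := by
  have h1 : (fun s : ℝ => (max 0 s) ^ 3) = fun s => s * (max 0 s) ^ 2 := by
    funext s
    rcases le_total 0 s with h | h <;> simp [h]; ring
  rw [h1]
  refine ((hasDerivAt_id s).mul (hasDerivAt_posPart_sq s)).congr_deriv ?_
  rcases le_total 0 s with h | h <;> simp [h]; ring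

lemma hasDerivAt_tailR {t : ℝ} (ht : 0 < t) (x h y : ℝ) :
    HasDerivAt (tailR t x h) (-(y + max 0 (rad t x h - (y - x))) / t) y := by
  have h1 : HasDerivAt (fun y => rad t x h - (y - x)) (-1) y := by
    simpa using ((hasDerivAt_id y).sub_const x).const_sub (rad t x h)
  have h2 := ((hasDerivAt_posPart_sq (rad t x h - (y - x))).comp y h1).div_const (2 * t)
  refine ((hasDerivAt_parab t y).add h2).congr_deriv ?_
  field_simp; ring

lemma hasDerivAt_tailL {t : ℝ} (ht : 0 < t) (x h y : ℝ) :
    HasDerivAt (tailL t x h) (-(y - max 0 (rad t x h - (x - y))) / t) y := by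
  have h1 : HasDerivAt (fun y => rad t x h - (x - y)) 1 y := by
    simpa using ((hasDerivAt_id y).const_sub x).const_sub (rad t x h)
  have h2 := ((hasDerivAt_posPart_sq (rad t x h - (x - y))).comp y h1).div_const (2 * t)
  refine ((hasDerivAt_parab t y).add h2).congr_deriv ?_
  field_simp; ring

lemma hasDerivAt_gapFn_of_le {t x₁ h₁ x₂ h₂ : ℝ} (ht : 0 < t)
    (hle : rad t x₁ h₁ + rad t x₂ h₂ ≤ x₂ - x₁) (y : ℝ) :
    HasDerivAt (gapFn t x₁ h₁ x₂ h₂)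
      (-(y + max 0 (rad t x₁ h₁ - (y - x₁)) - max 0 (rad t x₂ h₂ - (x₂ - y))) / t) y := by
  have hadd : gapFn t x₁ h₁ x₂ h₂ = fun z =>
      tailR t x₁ h₁ z + (tailL t x₂ h₂ z - parab t z) := by
    funext z
    rw [gapFn, if_pos hle]
    unfold tailR tailL; ring
  rw [hadd]
  refine ((hasDerivAt_tailR ht x₁ h₁ y).add
    ((hasDerivAt_tailL ht x₂ h₂ y).sub (hasDerivAt_parab t y))).congr_deriv ?_
  field_simp; ring

lemma hasDerivAt_gapFn_of_gt {t x₁ h₁ x₂ h₂ : ℝ}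
    (hgt : ¬ rad t x₁ h₁ + rad t x₂ h₂ ≤ x₂ - x₁) (y : ℝ) :
    HasDerivAt (gapFn t x₁ h₁ x₂ h₂) ((h₂ - h₁) / (x₂ - x₁)) y := by
  have : gapFn t x₁ h₁ x₂ h₂ = fun y => h₁ + (h₂ - h₁) / (x₂ - x₁) * (y - x₁) := by
    funext y; rw [gapFn, if_neg hgt]
  rw [this]
  simpa using (((hasDerivAt_id y).sub_const x₁).const_mul ((h₂ - h₁) / (x₂ - x₁))).const_add h₁

lemma hasDerivAt_gapFn_left {t x₁ h₁ x₂ h₂ : ℝ} (ht : 0 < t) :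
    HasDerivAt (gapFn t x₁ h₁ x₂ h₂) (slopeR t x₁ h₁ x₂ h₂) x₁ := by
  unfold slopeR
  split_ifs with h
  · refine (hasDerivAt_gapFn_of_le ht h x₁).congr_deriv ?_
    have := rad_nonneg t x₁ h₁
    rw [max_eq_right (by linarith), max_eq_left (by linarith)]
    ring
  · exact hasDerivAt_gapFn_of_gt h x₁

lemma hasDerivAt_gapFn_right {t x₁ h₁ x₂ h₂ : ℝ} (ht : 0 < t) :
    HasDerivAt (gapFn t x₁ h₁ x₂ h₂) (slopeL t x₁ h₁ x₂ h₂) x₂ := by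
  unfold slopeL
  split_ifs with h
  · refine (hasDerivAt_gapFn_of_le ht h x₂).congr_deriv ?_
    have := rad_nonneg t x₂ h₂
    rw [max_eq_left (by linarith), max_eq_right (by linarith)]
    ring
  · exact hasDerivAt_gapFn_of_gt h x₂

/-- The density of the rate function. -/
def rateDensity (t : ℝ) (f : ℝ → ℝ) (y : ℝ) : ℝ :=
  (1 / 2) * (deriv f y) ^ 2 - (1 / 2) * (deriv (parab t) y) ^ 2

/-- On an interval where the shape agrees with an explicit function, the density of the rate
function is integrable with the same integral. -/
lemma rateDensity_piece {t a b : ℝ} {f φ : ℝ → ℝ} {e : ℝ → ℝ} (hab : a ≤ b)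
    (hf : ∀ y ∈ Icc a b, f y = φ y) (he : ∀ y, HasDerivAt φ (e y) y) (hc : Continuous e) :
    IntervalIntegrable (rateDensity t f) volume a b ∧
    ∫ y in a..b, rateDensity t f y = ∫ y in a..b, ((1 / 2) * e y ^ 2 - (1 / 2) * (-y / t) ^ 2) := by
  have hEq : EqOn (fun y => (1 / 2) * e y ^ 2 - (1 / 2) * (-y / t) ^ 2) (rateDensity t f)
      (Ioo a b) := by
    intro y hy
    have : f =ᶠ[𝓝 y] φ := by
      filter_upwards [Icc_mem_nhds hy.1 hy.2] with z hz using hf z hz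
    simp only [rateDensity]
    rw [this.deriv_eq, (he y).deriv, (hasDerivAt_parab t y).deriv]
  have hcont : Continuous (fun y => (1 / 2) * e y ^ 2 - (1 / 2) * (-y / t) ^ 2) := by fun_prop
  constructor
  · rw [intervalIntegrable_iff_integrableOn_Ioo_of_le hab]
    exact (((intervalIntegrable_iff_integrableOn_Ioo_of_le hab).1
      (hcont.intervalIntegrable a b))).congr_fun hEq measurableSet_Ioo
  · rw [intervalIntegral.integral_of_le hab, intervalIntegral.integral_of_le hab,
      integral_Ioc_eq_integral_Ioo, integral_Ioc_eq_integral_Ioo]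
    exact (setIntegral_congr_fun measurableSet_Ioo hEq).symm

lemma posPart_mul_self (s : ℝ) : max 0 s * s = (max 0 s) ^ 2 := by
  rcases le_total 0 s with h | h <;> simp [h]; ring

lemma integral_tailR {t x h : ℝ} (a b : ℝ) :
    ∫ y in a..b, ((1 / 2) * (-(y + max 0 (rad t x h - (y - x))) / t) ^ 2
      - (1 / 2) * (-y / t) ^ 2) =
    (-(x + rad t x h) * (max 0 (rad t x h - (b - x))) ^ 2
        + (max 0 (rad t x h - (b - x))) ^ 3 / 3) / (2 * t ^ 2)
      - (-(x + rad t x h) * (max 0 (rad t x h - (a - x))) ^ 2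
        + (max 0 (rad t x h - (a - x))) ^ 3 / 3) / (2 * t ^ 2) := by
  refine intervalIntegral.integral_eq_sub_of_hasDerivAt (f := fun y =>
    (-(x + rad t x h) * (max 0 (rad t x h - (y - x))) ^ 2
        + (max 0 (rad t x h - (y - x))) ^ 3 / 3) / (2 * t ^ 2)) (fun y _ => ?_)
    (Continuous.intervalIntegrable (by fun_prop) _ _)
  have h1 : HasDerivAt (fun y => rad t x h - (y - x)) (-1) y := by
    simpa using ((hasDerivAt_id y).sub_const x).const_sub (rad t x h)
  have h2 := (hasDerivAt_posPart_sq (rad t x h - (y - x))).comp y h1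
  have h3 := (hasDerivAt_posPart_cube (rad t x h - (y - x))).comp y h1
  refine (((h2.const_mul (-(x + rad t x h))).add (h3.div_const 3)).div_const
    (2 * t ^ 2)).congr_deriv ?_
  have := posPart_mul_self (rad t x h - (y - x))
  set A := max 0 (rad t x h - (y - x))
  rcases eq_or_ne t 0 with rfl | ht
  · simp
  field_simp
  linear_combination 2 * this

lemma integral_tailL {t x h : ℝ} (a b : ℝ) :
    ∫ y in a..b, ((1 / 2) * (-(y - max 0 (rad t x h - (x - y))) / t) ^ 2
      - (1 / 2) * (-y / t) ^ 2) =
    (-(x - rad t x h) * (max 0 (rad t x h - (x - b))) ^ 2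
        - (max 0 (rad t x h - (x - b))) ^ 3 / 3) / (2 * t ^ 2)
      - (-(x - rad t x h) * (max 0 (rad t x h - (x - a))) ^ 2
        - (max 0 (rad t x h - (x - a))) ^ 3 / 3) / (2 * t ^ 2) := by
  refine intervalIntegral.integral_eq_sub_of_hasDerivAt (f := fun y =>
    (-(x - rad t x h) * (max 0 (rad t x h - (x - y))) ^ 2
        - (max 0 (rad t x h - (x - y))) ^ 3 / 3) / (2 * t ^ 2)) (fun y _ => ?_)
    (Continuous.intervalIntegrable (by fun_prop) _ _)
  have h1 : HasDerivAt (fun y => rad t x h - (x - y)) 1 y := by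
    simpa using ((hasDerivAt_id y).const_sub x).const_sub (rad t x h)
  have h2 := (hasDerivAt_posPart_sq (rad t x h - (x - y))).comp y h1
  have h3 := (hasDerivAt_posPart_cube (rad t x h - (x - y))).comp y h1
  refine (((h2.const_mul (-(x - rad t x h))).sub (h3.div_const 3)).div_const
    (2 * t ^ 2)).congr_deriv ?_
  have := posPart_mul_self (rad t x h - (x - y))
  set A := max 0 (rad t x h - (x - y))
  rcases eq_or_ne t 0 with rfl | ht
  · simp
  field_simp
  linear_combination 2 * this

lemma rateDensity_tailR {t x h b : ℝ} {f : ℝ → ℝ} (ht : 0 < t) (hb : x + rad t x h ≤ b)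
    (hf : ∀ y, x ≤ y → f y = tailR t x h y) :
    IntervalIntegrable (rateDensity t f) volume x b ∧
      ∫ y in x..b, rateDensity t f y = capR t x h := by
  have hr := rad_nonneg t x h
  obtain ⟨h1, h2⟩ := rateDensity_piece (t := t) (a := x) (b := b) (by linarith)
    (fun y hy => hf y hy.1) (fun y => hasDerivAt_tailR ht x h y) (by fun_prop)
  refine ⟨h1, ?_⟩
  rw [h2, integral_tailR, max_eq_left (a := 0) (b := rad t x h - (b - x)) (by linarith),
    max_eq_right (by linarith), capR]
  field_simp; ring

lemma rateDensity_tailL {t x h a : ℝ} {f : ℝ → ℝ} (ht : 0 < t) (ha : a ≤ x - rad t x h)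
    (hf : ∀ y, y ≤ x → f y = tailL t x h y) :
    IntervalIntegrable (rateDensity t f) volume a x ∧
      ∫ y in a..x, rateDensity t f y = capL t x h := by
  have hr := rad_nonneg t x h
  obtain ⟨h1, h2⟩ := rateDensity_piece (t := t) (a := a) (b := x) (by linarith)
    (fun y hy => hf y hy.2) (fun y => hasDerivAt_tailL ht x h y) (by fun_prop)
  refine ⟨h1, ?_⟩
  rw [h2, integral_tailL, max_eq_left (a := 0) (b := rad t x h - (x - a)) (by linarith),
    max_eq_right (by linarith), capL]
  field_simp; ring

lemma rateDensity_gap {t x₁ h₁ x₂ h₂ : ℝ} {f : ℝ → ℝ} (ht : 0 < t) (hx : x₁ < x₂)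
    (hf : ∀ y ∈ Icc x₁ x₂, f y = gapFn t x₁ h₁ x₂ h₂ y) :
    IntervalIntegrable (rateDensity t f) volume x₁ x₂ ∧
      ∫ y in x₁..x₂, rateDensity t f y = gapCost t x₁ h₁ x₂ h₂ := by
  have hr₁ := rad_nonneg t x₁ h₁
  have hr₂ := rad_nonneg t x₂ h₂
  unfold gapCost
  split_ifs with hle
  · obtain ⟨h1, h2⟩ := rateDensity_piece (t := t) hx.le hf
      (fun y => hasDerivAt_gapFn_of_le ht hle y) (by fun_prop)
    refine ⟨h1, ?_⟩
    -- the two positive parts have disjoint supports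
    have hAB : ∀ y, max 0 (rad t x₁ h₁ - (y - x₁)) * max 0 (rad t x₂ h₂ - (x₂ - y)) = 0 := by
      intro y
      rcases le_total (rad t x₁ h₁) (y - x₁) with h | h
      · rw [max_eq_left (by linarith), zero_mul]
      · rw [max_eq_left (a := 0) (b := rad t x₂ h₂ - (x₂ - y)) (by linarith), mul_zero]
    have hsum : ∀ y, (1 / 2) * (-(y + max 0 (rad t x₁ h₁ - (y - x₁))
        - max 0 (rad t x₂ h₂ - (x₂ - y))) / t) ^ 2 - (1 / 2) * (-y / t) ^ 2 =
        ((1 / 2) * (-(y + max 0 (rad t x₁ h₁ - (y - x₁))) / t) ^ 2 - (1 / 2) * (-y / t) ^ 2) +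
        ((1 / 2) * (-(y - max 0 (rad t x₂ h₂ - (x₂ - y))) / t) ^ 2
          - (1 / 2) * (-y / t) ^ 2) := by
      intro y
      have := hAB y
      set A := max 0 (rad t x₁ h₁ - (y - x₁))
      set B := max 0 (rad t x₂ h₂ - (x₂ - y))
      field_simp
      linear_combination -2 * this
    rw [h2]
    simp only [hsum]
    rw [intervalIntegral.integral_add (Continuous.intervalIntegrable (by fun_prop) _ _)
      (Continuous.intervalIntegrable (by fun_prop) _ _), integral_tailR, integral_tailL,
      max_eq_left (a := 0) (b := rad t x₁ h₁ - (x₂ - x₁)) (by linarith),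
      max_eq_left (a := 0) (b := rad t x₂ h₂ - (x₂ - x₁)) (by linarith),
      max_eq_right (by linarith), max_eq_right (by linarith), capR, capL]
    field_simp; ring
  · obtain ⟨h1, h2⟩ := rateDensity_piece (t := t) hx.le hf
      (fun y => hasDerivAt_gapFn_of_gt hle y) continuous_const
    refine ⟨h1, ?_⟩
    have hd : x₂ - x₁ ≠ 0 := by linarith
    rw [h2, intervalIntegral.integral_eq_sub_of_hasDerivAt (f := fun y =>
      (1 / 2) * ((h₂ - h₁) / (x₂ - x₁)) ^ 2 * y - y ^ 3 / (6 * t ^ 2)) (fun y _ => ?_)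
      (Continuous.intervalIntegrable (by fun_prop) _ _)]
    · field_simp; ring
    · refine (((hasDerivAt_id y).const_mul _).sub
        ((hasDerivAt_pow 3 y).div_const (6 * t ^ 2))).congr_deriv ?_
      simp only [Nat.cast_ofNat, Nat.add_one_sub_one]
      field_simp; ring

/-! ### Differentiability of the costs -/

/-- The cube of the tangent length is differentiable also at the parabola, where the tangent length
itself is a square root. -/
lemma hasDerivWithinAt_rad_cube {t x h : ℝ} (ht : 0 < t) (hh : parab t x ≤ h) :
    HasDerivWithinAt (fun h => rad t x h ^ 3) (3 * t * rad t x h) (Ici (parab t x)) h := by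
  have h1 : HasDerivAt (fun h => x ^ 2 + 2 * t * h) (2 * t) h := by
    simpa using ((hasDerivAt_id h).const_mul (2 * t)).const_add (x ^ 2)
  have h2 := (Real.hasDerivAt_rpow_const (x := x ^ 2 + 2 * t * h) (p := 3 / 2)
    (Or.inr (by norm_num))).comp h h1
  have key : ∀ h, parab t x ≤ h → rad t x h ^ 3 = (x ^ 2 + 2 * t * h) ^ (3 / 2 : ℝ) := by
    intro h hh
    have h0 : 0 ≤ x ^ 2 + 2 * t * h := by linarith [(parab_le_iff ht).1 hh]
    rw [rad, Real.sqrt_eq_rpow, ← Real.rpow_natCast, ← Real.rpow_mul h0]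
    norm_num
  refine (h2.hasDerivWithinAt.congr (fun y hy => key y hy) (key h hh)).congr_deriv ?_
  rw [rad, Real.sqrt_eq_rpow]
  norm_num
  ring

lemma hasDerivWithinAt_rad_sq {t x h : ℝ} (ht : 0 < t) (hh : parab t x ≤ h) :
    HasDerivWithinAt (fun h => rad t x h ^ 2) (2 * t) (Ici (parab t x)) h := by
  have h1 : HasDerivAt (fun h => 2 * t * h + x ^ 2) (2 * t) h := by
    simpa using ((hasDerivAt_id h).const_mul (2 * t)).add_const (x ^ 2)
  exact h1.hasDerivWithinAt.congr (fun y hy => rad_sq ht hy) (rad_sq ht hh)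

lemma hasDerivWithinAt_capR {t x h : ℝ} (ht : 0 < t) (hh : parab t x ≤ h) :
    HasDerivWithinAt (capR t x) ((x + rad t x h) / t) (Ici (parab t x)) h := by
  refine ((((hasDerivWithinAt_rad_sq ht hh).const_mul (3 * x)).add
    ((hasDerivWithinAt_rad_cube ht hh).const_mul 2)).div_const (6 * t ^ 2)).congr_deriv ?_
  field_simp; ring

lemma hasDerivWithinAt_capL {t x h : ℝ} (ht : 0 < t) (hh : parab t x ≤ h) :
    HasDerivWithinAt (capL t x) (-(x - rad t x h) / t) (Ici (parab t x)) h := by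
  refine ((((hasDerivWithinAt_rad_sq ht hh).const_mul (-3 * x)).add
    ((hasDerivWithinAt_rad_cube ht hh).const_mul 2)).div_const (6 * t ^ 2)).congr_deriv ?_
  field_simp; ring

lemma continuous_rad (t x : ℝ) : Continuous (rad t x) := by
  unfold rad; fun_prop

section gap
variable {t x₁ h₁ x₂ h₂ : ℝ}

/-- When the two tangents form one line, that line is the chord. -/
lemma chord_slope_of_eq (ht : 0 < t) (hx : x₁ < x₂) (H₁ : parab t x₁ ≤ h₁) (H₂ : parab t x₂ ≤ h₂)
    (h : rad t x₁ h₁ + rad t x₂ h₂ = x₂ - x₁) :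
    (h₂ - h₁) / (x₂ - x₁) = -(x₁ + rad t x₁ h₁) / t ∧
    (h₂ - h₁) / (x₂ - x₁) = -(x₂ - rad t x₂ h₂) / t := by
  have e1 := rad_sq ht H₁
  have e2 := rad_sq ht H₂
  have h0 : x₂ - x₁ ≠ 0 := by linarith
  have hr : rad t x₂ h₂ = x₂ - x₁ - rad t x₁ h₁ := by linarith
  rw [hr] at e2 ⊢
  set r := rad t x₁ h₁
  constructor
  · rw [div_eq_div_iff h0 ht.ne']
    linear_combination (1 / 2) * e1 - (1 / 2) * e2
  · rw [div_eq_div_iff h0 ht.ne']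
    linear_combination (1 / 2) * e1 - (1 / 2) * e2

lemma gapCost_of_le (h : rad t x₁ h₁ + rad t x₂ h₂ ≤ x₂ - x₁) :
    gapCost t x₁ h₁ x₂ h₂ = capR t x₁ h₁ + capL t x₂ h₂ := by rw [gapCost, if_pos h]

lemma gapCost_of_ge (ht : 0 < t) (hx : x₁ < x₂) (H₁ : parab t x₁ ≤ h₁) (H₂ : parab t x₂ ≤ h₂)
    (h : x₂ - x₁ ≤ rad t x₁ h₁ + rad t x₂ h₂) : gapCost t x₁ h₁ x₂ h₂ =
      (h₂ - h₁) ^ 2 / (2 * (x₂ - x₁)) - (x₂ ^ 3 - x₁ ^ 3) / (6 * t ^ 2) := by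
  rcases eq_or_lt_of_le h with heq | hlt
  · rw [gapCost_of_le heq.ge]
    have hs := (chord_slope_of_eq ht hx H₁ H₂ heq.symm).1
    have h0 : x₂ - x₁ ≠ 0 := by linarith
    have : (h₂ - h₁) ^ 2 / (2 * (x₂ - x₁)) = ((h₂ - h₁) / (x₂ - x₁)) ^ 2 * (x₂ - x₁) / 2 := by
      field_simp
    rw [this, hs, capR, capL, show rad t x₂ h₂ = x₂ - x₁ - rad t x₁ h₁ by linarith]
    field_simp; ring
  · rw [gapCost, if_neg (not_le.2 hlt)]

/-- The cost of a gap is differentiable in the two heights up to the boundary. -/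
lemma hasFDerivWithinAt_gapCost (ht : 0 < t) (hx : x₁ < x₂) (H₁ : parab t x₁ ≤ h₁)
    (H₂ : parab t x₂ ≤ h₂) :
    HasFDerivWithinAt (fun p : ℝ × ℝ => gapCost t x₁ p.1 x₂ p.2)
      (-slopeR t x₁ h₁ x₂ h₂ • ContinuousLinearMap.fst ℝ ℝ ℝ
        + slopeL t x₁ h₁ x₂ h₂ • ContinuousLinearMap.snd ℝ ℝ ℝ)
      (Ici (parab t x₁) ×ˢ Ici (parab t x₂)) (h₁, h₂) := by
  set S : Set (ℝ × ℝ) := Ici (parab t x₁) ×ˢ Ici (parab t x₂) with hSdef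
  have hS : IsClosed S := isClosed_Ici.prod isClosed_Ici
  have hcont : Continuous fun p : ℝ × ℝ => rad t x₁ p.1 + rad t x₂ p.2 :=
    ((continuous_rad t x₁).comp continuous_fst).add ((continuous_rad t x₂).comp continuous_snd)
  set S₁ := S ∩ {p | rad t x₁ p.1 + rad t x₂ p.2 ≤ x₂ - x₁}
  set S₂ := S ∩ {p | x₂ - x₁ ≤ rad t x₁ p.1 + rad t x₂ p.2}
  have hS₁ : IsClosed S₁ := hS.inter (isClosed_le hcont continuous_const)
  have hS₂ : IsClosed S₂ := hS.inter (isClosed_le continuous_const hcont)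
  have hU : S = S₁ ∪ S₂ := by
    rw [← inter_union_distrib_left]
    ext p
    exact ⟨fun h => ⟨h, (le_total (rad t x₁ p.1 + rad t x₂ p.2) (x₂ - x₁) :)⟩, fun h => h.1⟩
  have hmem : (h₁, h₂) ∈ S := ⟨H₁, H₂⟩
  rw [hU]
  refine HasFDerivWithinAt.union ?_ ?_
  · by_cases hp : (h₁, h₂) ∈ S₁
    · have hle : rad t x₁ h₁ + rad t x₂ h₂ ≤ x₂ - x₁ := hp.2
      rw [slopeR, slopeL, if_pos hle, if_pos hle]
      have a1 : HasFDerivWithinAt (fun p : ℝ × ℝ => capR t x₁ p.1)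
          (((x₁ + rad t x₁ h₁) / t) • ContinuousLinearMap.fst ℝ ℝ ℝ) S₁ (h₁, h₂) :=
        (hasDerivWithinAt_capR ht H₁).comp_hasFDerivWithinAt (f := Prod.fst) (h₁, h₂)
          hasFDerivWithinAt_fst fun p hp => hp.1.1
      have a2 : HasFDerivWithinAt (fun p : ℝ × ℝ => capL t x₂ p.2)
          ((-(x₂ - rad t x₂ h₂) / t) • ContinuousLinearMap.snd ℝ ℝ ℝ) S₁ (h₁, h₂) :=
        (hasDerivWithinAt_capL ht H₂).comp_hasFDerivWithinAt (f := Prod.snd) (h₁, h₂)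
          hasFDerivWithinAt_snd fun p hp => hp.1.2
      have a3 := (a1.add a2).congr (f₁ := fun p : ℝ × ℝ => gapCost t x₁ p.1 x₂ p.2)
        (fun p hp => gapCost_of_le hp.2) (gapCost_of_le hle)
      rwa [show -(-(x₁ + rad t x₁ h₁) / t) = (x₁ + rad t x₁ h₁) / t by ring]
    · exact HasFDerivWithinAt.of_notMem_closure (by rwa [hS₁.closure_eq])
  · by_cases hp : (h₁, h₂) ∈ S₂
    · have hge : x₂ - x₁ ≤ rad t x₁ h₁ + rad t x₂ h₂ := hp.2
      have hR : slopeR t x₁ h₁ x₂ h₂ = (h₂ - h₁) / (x₂ - x₁) := by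
        unfold slopeR
        split_ifs with h
        · exact (chord_slope_of_eq ht hx H₁ H₂ (le_antisymm h hge)).1.symm
        · rfl
      have hL : slopeL t x₁ h₁ x₂ h₂ = (h₂ - h₁) / (x₂ - x₁) := by
        unfold slopeL
        split_ifs with h
        · exact (chord_slope_of_eq ht hx H₁ H₂ (le_antisymm h hge)).2.symm
        · rfl
      rw [hR, hL]
      have a1 : HasFDerivAt (fun p : ℝ × ℝ => p.2 - p.1)
          (ContinuousLinearMap.snd ℝ ℝ ℝ - ContinuousLinearMap.fst ℝ ℝ ℝ) (h₁, h₂) :=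
        hasFDerivAt_snd.sub hasFDerivAt_fst
      have a2 : HasDerivAt (fun z : ℝ => z ^ 2 / (2 * (x₂ - x₁))
          - (x₂ ^ 3 - x₁ ^ 3) / (6 * t ^ 2)) ((h₂ - h₁) / (x₂ - x₁)) (h₂ - h₁) := by
        refine (((hasDerivAt_pow 2 (h₂ - h₁)).div_const (2 * (x₂ - x₁))).sub_const
          _).congr_deriv ?_
        have h0 : x₂ - x₁ ≠ 0 := by linarith
        simp only [Nat.cast_ofNat, Nat.add_one_sub_one]
        field_simp
      have a3 := (a2.comp_hasFDerivAt (h₁, h₂) a1).hasFDerivWithinAt (s := S₂)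
      have a4 := a3.congr (f₁ := fun p : ℝ × ℝ => gapCost t x₁ p.1 x₂ p.2)
        (fun p hp => gapCost_of_ge ht hx hp.1.1 hp.1.2 hp.2) (gapCost_of_ge ht hx H₁ H₂ hge)
      refine a4.congr_fderiv ?_
      ext <;> simp
    · exact HasFDerivWithinAt.of_notMem_closure (by rwa [hS₂.closure_eq])

end gap
end

noncomputable section
open Set Filter Topology MeasureTheory

/-! ### Strict convexity of the cost of a gap -/

section convex
variable {t : ℝ}

lemma height_eq (ht : 0 < t) {x h : ℝ} (hh : parab t x ≤ h) :
    h = (rad t x h ^ 2 - x ^ 2) / (2 * t) := by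
  rw [rad_sq ht hh]; field_simp; ring

lemma eq_of_rad_eq (ht : 0 < t) {x h h' : ℝ} (hh : parab t x ≤ h) (hh' : parab t x ≤ h')
    (e : rad t x h = rad t x h') : h = h' := by
  rw [height_eq ht hh, height_eq ht hh', e]

/-- The excess of the cost of a tangent over its first-order expansion, in the tangent lengths. -/
lemma capR_excess (ht : 0 < t) {x h h' : ℝ} (hh : parab t x ≤ h) (hh' : parab t x ≤ h') :
    capR t x h' - capR t x h - (x + rad t x h) / t * (h' - h) =
      (rad t x h' - rad t x h) ^ 2 * (2 * rad t x h' + rad t x h) / (6 * t ^ 2) := by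
  have e1 := height_eq ht hh
  have e2 := height_eq ht hh'
  have : h' - h = (rad t x h' ^ 2 - rad t x h ^ 2) / (2 * t) := by
    rw [sub_eq_iff_eq_add, e1, e2]; field_simp; rw [← e1, ← e2]; ring
  rw [this, capR, capR]
  field_simp; ring

/-- The excess of the cost of a tangent over its first-order expansion, in the tangent lengths. -/
lemma capL_excess (ht : 0 < t) {x h h' : ℝ} (hh : parab t x ≤ h) (hh' : parab t x ≤ h') :
    capL t x h' - capL t x h - -(x - rad t x h) / t * (h' - h) =
      (rad t x h' - rad t x h) ^ 2 * (2 * rad t x h' + rad t x h) / (6 * t ^ 2) := by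
  have e1 := height_eq ht hh
  have e2 := height_eq ht hh'
  have : h' - h = (rad t x h' ^ 2 - rad t x h ^ 2) / (2 * t) := by
    rw [sub_eq_iff_eq_add, e1, e2]; field_simp; rw [← e1, ← e2]; ring
  rw [this, capL, capL]
  field_simp; ring

lemma excess_nonneg {r ρ : ℝ} (hr : 0 ≤ r) (hρ : 0 ≤ ρ) : 0 ≤ (ρ - r) ^ 2 * (2 * ρ + r) := by
  positivity

lemma eq_of_excess_eq_zero {r ρ : ℝ} (hr : 0 ≤ r) (hρ : 0 ≤ ρ)
    (h : (ρ - r) ^ 2 * (2 * ρ + r) = 0) : ρ = r := by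
  rcases mul_eq_zero.1 h with h | h
  · exact sub_eq_zero.1 (pow_eq_zero_iff two_ne_zero |>.1 h)
  · linarith

/-- From a tangent position with lengths `r₁, r₂` to a chord position with lengths `ρ₁, ρ₂`, the
excess of the cost is nonnegative. -/
lemma excess_tangent_chord {r₁ r₂ ρ₁ ρ₂ d : ℝ} (h₁ : 0 ≤ r₁) (h₂ : 0 ≤ r₂) (hr : r₁ + r₂ ≤ d)
    (hρ : d < ρ₁ + ρ₂) (hd : 0 < d) :
    0 ≤ 3 * (ρ₂ ^ 2 - ρ₁ ^ 2) ^ 2 + 6 * d ^ 2 * (ρ₁ ^ 2 + ρ₂ ^ 2) - d ^ 4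
      - 12 * d * (r₁ * ρ₁ ^ 2 + r₂ * ρ₂ ^ 2) + 4 * d * (r₁ ^ 3 + r₂ ^ 3) := by
  -- move from `(r₁, r₂)` to a pair `(s, d - s)`, where the expression is a perfect square
  have hsq : ∀ s, 3 * (ρ₂ ^ 2 - ρ₁ ^ 2) ^ 2 + 6 * d ^ 2 * (ρ₁ ^ 2 + ρ₂ ^ 2) - d ^ 4
      - 12 * d * (s * ρ₁ ^ 2 + (d - s) * ρ₂ ^ 2) + 4 * d * (s ^ 3 + (d - s) ^ 3) =
      3 * (ρ₂ ^ 2 - ρ₁ ^ 2 + d * (2 * s - d)) ^ 2 := fun s => by ring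
  have hinc : ∀ r s ρ : ℝ, 0 ≤ r → r ≤ s → s ≤ ρ →
      0 ≤ (s - r) * (3 * ρ ^ 2 - (s ^ 2 + s * r + r ^ 2)) := by
    intro r s ρ hr hrs hsρ
    refine mul_nonneg (by linarith) ?_
    nlinarith
  obtain ⟨s, hs1, hs2⟩ : ∃ s, 0 ≤ (s - r₁) * (3 * ρ₁ ^ 2 - (s ^ 2 + s * r₁ + r₁ ^ 2)) ∧
      0 ≤ ((d - s) - r₂) * (3 * ρ₂ ^ 2 - ((d - s) ^ 2 + (d - s) * r₂ + r₂ ^ 2)) := by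
    rcases le_total (d - r₁) ρ₂ with h | h
    · exact ⟨r₁, by simp, hinc _ _ _ h₂ (by linarith) h⟩
    · rcases le_total (d - r₂) ρ₁ with h' | h'
      · exact ⟨d - r₂, hinc _ _ _ h₁ (by linarith) h', by simp⟩
      · refine ⟨d - ρ₂, hinc _ _ _ h₁ (by linarith) (by linarith), ?_⟩
        exact hinc _ _ _ h₂ (by linarith) (by linarith)
  have h3 := hsq s
  nlinarith [sq_nonneg (ρ₂ ^ 2 - ρ₁ ^ 2 + d * (2 * s - d)), mul_nonneg hd.le hs1,
    mul_nonneg hd.le hs2]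

/-- The excess of the cost is positive if the left height is unchanged. -/
lemma excess_tangent_chord_pos {r₁ r₂ ρ₂ d : ℝ} (h₂ : 0 ≤ r₂) (hr : r₁ + r₂ ≤ d)
    (hρ : d < r₁ + ρ₂) (hd : 0 < d) :
    0 < 3 * (ρ₂ ^ 2 - r₁ ^ 2) ^ 2 + 6 * d ^ 2 * (r₁ ^ 2 + ρ₂ ^ 2) - d ^ 4
      - 12 * d * (r₁ * r₁ ^ 2 + r₂ * ρ₂ ^ 2) + 4 * d * (r₁ ^ 3 + r₂ ^ 3) := by
  have hsq : 3 * (ρ₂ ^ 2 - r₁ ^ 2) ^ 2 + 6 * d ^ 2 * (r₁ ^ 2 + ρ₂ ^ 2) - d ^ 4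
      - 12 * d * (r₁ * r₁ ^ 2 + r₂ * ρ₂ ^ 2) + 4 * d * (r₁ ^ 3 + r₂ ^ 3) =
      3 * (ρ₂ ^ 2 - (d - r₁) ^ 2) ^ 2 + 4 * d * ((d - r₁ - r₂) *
        (3 * ρ₂ ^ 2 - ((d - r₁) ^ 2 + (d - r₁) * r₂ + r₂ ^ 2))) := by ring
  rw [hsq]
  have h3 : 0 < ρ₂ ^ 2 - (d - r₁) ^ 2 := by nlinarith
  have h4 : 0 ≤ (d - r₁ - r₂) * (3 * ρ₂ ^ 2 - ((d - r₁) ^ 2 + (d - r₁) * r₂ + r₂ ^ 2)) :=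
    mul_nonneg (by linarith) (by nlinarith)
  positivity

/-- From a chord position to a tangent position the excess of the cost is nonnegative. -/
lemma excess_chord_tangent {s₁ s₂ ρ₁ ρ₂ : ℝ} (k₁ : 0 ≤ ρ₁) (k₂ : 0 ≤ ρ₂)
    (hρ : ρ₁ + ρ₂ ≤ s₁ + s₂) (hd : 0 < s₁ + s₂) :
    0 ≤ (ρ₁ - s₁) ^ 2 * (2 * ρ₁ + s₁) + (ρ₂ - s₂) ^ 2 * (2 * ρ₂ + s₂) ∧
    ((ρ₁ - s₁) ^ 2 * (2 * ρ₁ + s₁) + (ρ₂ - s₂) ^ 2 * (2 * ρ₂ + s₂) = 0 → ρ₁ = s₁ ∧ ρ₂ = s₂) := by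
  obtain ⟨p, rfl⟩ : ∃ p, s₁ = ρ₁ + p := ⟨s₁ - ρ₁, by ring⟩
  obtain ⟨q, rfl⟩ : ∃ q, s₂ = ρ₂ + q := ⟨s₂ - ρ₂, by ring⟩
  have e : (ρ₁ - (ρ₁ + p)) ^ 2 * (2 * ρ₁ + (ρ₁ + p)) + (ρ₂ - (ρ₂ + q)) ^ 2 * (2 * ρ₂ + (ρ₂ + q)) =
      3 * ρ₁ * p ^ 2 + 3 * ρ₂ * q ^ 2 + (p + q) * (p ^ 2 - p * q + q ^ 2) := by ring
  rw [e]
  have hpq : 0 ≤ p + q := by linarith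
  have a1 : 0 ≤ 3 * ρ₁ * p ^ 2 := by positivity
  have a2 : 0 ≤ 3 * ρ₂ * q ^ 2 := by positivity
  have hq0 : 0 ≤ p ^ 2 - p * q + q ^ 2 := by nlinarith [sq_nonneg (p - q), sq_nonneg (p + q)]
  have a3 := mul_nonneg hpq hq0
  refine ⟨by linarith, fun h => ?_⟩
  have b1 : 3 * ρ₁ * p ^ 2 = 0 := by linarith
  have b2 : 3 * ρ₂ * q ^ 2 = 0 := by linarith
  have b3 : (p + q) * (p ^ 2 - p * q + q ^ 2) = 0 := by linarith
  rcases mul_eq_zero.1 b3 with h0 | h0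
  · by_cases hp : p = 0
    · exact ⟨by linarith, by linarith⟩
    · exfalso
      have hq : q ≠ 0 := by rintro rfl; exact hp (by linarith)
      have c1 : ρ₁ = 0 := by simpa [hp] using b1
      have c2 : ρ₂ = 0 := by simpa [hq] using b2
      linarith
  · have hp : p = 0 := by nlinarith [sq_nonneg (p - q), sq_nonneg (p + q)]
    have hq : q = 0 := by nlinarith [sq_nonneg (p - q), sq_nonneg (p + q)]
    exact ⟨by linarith, by linarith⟩

/-- First-order convexity of the cost of a gap, with the equality case: the excess is positive if
only the right height changes. -/
lemma gapCost_convex (ht : 0 < t) {x₁ x₂ h₁ h₂ k₁ k₂ : ℝ} (hx : x₁ < x₂) (H₁ : parab t x₁ ≤ h₁)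
    (H₂ : parab t x₂ ≤ h₂) (K₁ : parab t x₁ ≤ k₁) (K₂ : parab t x₂ ≤ k₂) :
    0 ≤ gapCost t x₁ k₁ x₂ k₂ - gapCost t x₁ h₁ x₂ h₂ + slopeR t x₁ h₁ x₂ h₂ * (k₁ - h₁)
      - slopeL t x₁ h₁ x₂ h₂ * (k₂ - h₂) ∧
    (gapCost t x₁ k₁ x₂ k₂ - gapCost t x₁ h₁ x₂ h₂ + slopeR t x₁ h₁ x₂ h₂ * (k₁ - h₁)
      - slopeL t x₁ h₁ x₂ h₂ * (k₂ - h₂) = 0 → k₁ = h₁ → k₂ = h₂) := by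
  have r₁ := rad_nonneg t x₁ h₁
  have r₂ := rad_nonneg t x₂ h₂
  have ρ₁ := rad_nonneg t x₁ k₁
  have ρ₂ := rad_nonneg t x₂ k₂
  have t2 : 0 < 6 * t ^ 2 := by positivity
  have hd : 0 < x₂ - x₁ := sub_pos.2 hx
  by_cases hle : rad t x₁ h₁ + rad t x₂ h₂ ≤ x₂ - x₁ <;>
  by_cases kle : rad t x₁ k₁ + rad t x₂ k₂ ≤ x₂ - x₁
  · rw [gapCost, gapCost, slopeR, slopeL, if_pos hle, if_pos hle, if_pos hle, if_pos kle]
    -- from tangent position to tangent position, the two sides decouple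
    have e1 := capR_excess ht H₁ K₁
    have e2 := capL_excess ht H₂ K₂
    have e : capR t x₁ k₁ + capL t x₂ k₂ - (capR t x₁ h₁ + capL t x₂ h₂) +
        -(x₁ + rad t x₁ h₁) / t * (k₁ - h₁) - -(x₂ - rad t x₂ h₂) / t * (k₂ - h₂) =
        (rad t x₁ k₁ - rad t x₁ h₁) ^ 2 * (2 * rad t x₁ k₁ + rad t x₁ h₁) / (6 * t ^ 2) +
        (rad t x₂ k₂ - rad t x₂ h₂) ^ 2 * (2 * rad t x₂ k₂ + rad t x₂ h₂) / (6 * t ^ 2) := by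
      rw [← e1, ← e2]; ring
    rw [e]
    have p1 := div_nonneg (excess_nonneg r₁ ρ₁) t2.le
    have p2 := div_nonneg (excess_nonneg r₂ ρ₂) t2.le
    refine ⟨add_nonneg p1 p2, fun h _ => ?_⟩
    have : (rad t x₂ k₂ - rad t x₂ h₂) ^ 2 * (2 * rad t x₂ k₂ + rad t x₂ h₂) / (6 * t ^ 2) = 0 := by
      linarith
    rw [div_eq_zero_iff] at this
    exact eq_of_rad_eq ht K₂ H₂ (eq_of_excess_eq_zero r₂ ρ₂ (this.resolve_right t2.ne'))
  · -- tangent position to chord position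
    rw [slopeR, slopeL, if_pos hle, if_pos hle, gapCost_of_le hle,
      gapCost_of_ge ht hx K₁ K₂ (not_le.1 kle).le]
    push Not at kle
    have e : (k₂ - k₁) ^ 2 / (2 * (x₂ - x₁)) - (x₂ ^ 3 - x₁ ^ 3) / (6 * t ^ 2) -
        (capR t x₁ h₁ + capL t x₂ h₂) + -(x₁ + rad t x₁ h₁) / t * (k₁ - h₁) -
        -(x₂ - rad t x₂ h₂) / t * (k₂ - h₂) =
        (3 * (rad t x₂ k₂ ^ 2 - rad t x₁ k₁ ^ 2) ^ 2
          + 6 * (x₂ - x₁) ^ 2 * (rad t x₁ k₁ ^ 2 + rad t x₂ k₂ ^ 2) - (x₂ - x₁) ^ 4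
          - 12 * (x₂ - x₁) * (rad t x₁ h₁ * rad t x₁ k₁ ^ 2 + rad t x₂ h₂ * rad t x₂ k₂ ^ 2)
          + 4 * (x₂ - x₁) * (rad t x₁ h₁ ^ 3 + rad t x₂ h₂ ^ 3)) /
            (24 * t ^ 2 * (x₂ - x₁)) := by
      have a1 := height_eq ht H₁
      have a2 := height_eq ht H₂
      have b1 := height_eq ht K₁
      have b2 := height_eq ht K₂
      rw [capR, capL]
      generalize rad t x₁ h₁ = u₁ at *
      generalize rad t x₂ h₂ = u₂ at *
      generalize rad t x₁ k₁ = v₁ at *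
      generalize rad t x₂ k₂ = v₂ at *
      subst a1 a2 b1 b2
      have h0 := hd.ne'
      field_simp
      ring
    rw [e]
    refine ⟨div_nonneg (excess_tangent_chord r₁ r₂ hle kle hd) (by positivity),
      fun h hk => ?_⟩
    exfalso
    subst hk
    rw [div_eq_zero_iff] at h
    have := excess_tangent_chord_pos r₂ hle kle hd
    rcases h with h | h
    · linarith
    · have : 0 < 24 * t ^ 2 * (x₂ - x₁) := by positivity
      linarith
  · -- chord position to tangent position
    rw [slopeR, slopeL, if_neg hle, if_neg hle, gapCost_of_le kle,
      gapCost_of_ge ht hx H₁ H₂ (not_le.1 hle).le]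
    push Not at hle
    -- the slope of the chord is that of the tangent at `x₁ + s₁`, so `s₁` and `x₂ - x₁ - s₁` play
    -- the part of tangent lengths
    obtain ⟨s₁, hs₁⟩ : ∃ s, (h₂ - h₁) / (x₂ - x₁) = -(x₁ + s) / t :=
      ⟨-t * ((h₂ - h₁) / (x₂ - x₁)) - x₁, by field_simp; ring⟩
    have hh : h₂ - h₁ = -(x₁ + s₁) / t * (x₂ - x₁) := by rw [← hs₁]; field_simp
    have e : capR t x₁ k₁ + capL t x₂ k₂ -
        ((h₂ - h₁) ^ 2 / (2 * (x₂ - x₁)) - (x₂ ^ 3 - x₁ ^ 3) / (6 * t ^ 2)) +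
        (h₂ - h₁) / (x₂ - x₁) * (k₁ - h₁) - (h₂ - h₁) / (x₂ - x₁) * (k₂ - h₂) =
        ((rad t x₁ k₁ - s₁) ^ 2 * (2 * rad t x₁ k₁ + s₁) +
          (rad t x₂ k₂ - (x₂ - x₁ - s₁)) ^ 2 * (2 * rad t x₂ k₂ + (x₂ - x₁ - s₁)))
            / (6 * t ^ 2) := by
      have b1 := height_eq ht K₁
      have b2 := height_eq ht K₂
      have : (h₂ - h₁) ^ 2 / (2 * (x₂ - x₁)) = ((h₂ - h₁) / (x₂ - x₁)) ^ 2 * (x₂ - x₁) / 2 := by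
        field_simp
      rw [this, hs₁, capR, capL, show h₂ = h₁ + -(x₁ + s₁) / t * (x₂ - x₁) by linarith]
      generalize rad t x₁ k₁ = v₁ at *
      generalize rad t x₂ k₂ = v₂ at *
      subst b1 b2
      field_simp
      ring
    rw [e]
    obtain ⟨p, q⟩ := excess_chord_tangent (s₁ := s₁) (s₂ := x₂ - x₁ - s₁) ρ₁ ρ₂ (by linarith)
      (by linarith)
    refine ⟨div_nonneg p t2.le, fun h hk => ?_⟩
    exfalso
    subst hk
    obtain ⟨q1, q2⟩ := q ((div_eq_zero_iff.1 h).resolve_right t2.ne')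
    have a1 := rad_sq ht H₁
    have a2 := rad_sq ht H₂
    have a3 : t * (h₂ - k₁) = -(x₁ + s₁) * (x₂ - x₁) := by rw [hh]; field_simp
    have a4 : rad t x₂ h₂ ^ 2 = rad t x₂ k₂ ^ 2 := by
      rw [q2, a2]; rw [q1] at a1
      linear_combination 2 * a3 - a1
    have a5 := (sq_eq_sq₀ r₂ ρ₂).1 a4
    linarith
  · rw [slopeR, slopeL, if_neg hle, if_neg hle, gapCost_of_ge ht hx K₁ K₂ (not_le.1 kle).le,
      gapCost_of_ge ht hx H₁ H₂ (not_le.1 hle).le]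
    have e : (k₂ - k₁) ^ 2 / (2 * (x₂ - x₁)) - (x₂ ^ 3 - x₁ ^ 3) / (6 * t ^ 2) -
        ((h₂ - h₁) ^ 2 / (2 * (x₂ - x₁)) - (x₂ ^ 3 - x₁ ^ 3) / (6 * t ^ 2)) +
        (h₂ - h₁) / (x₂ - x₁) * (k₁ - h₁) - (h₂ - h₁) / (x₂ - x₁) * (k₂ - h₂) =
        ((k₂ - h₂) - (k₁ - h₁)) ^ 2 / (2 * (x₂ - x₁)) := by
      have h0 := hd.ne'
      field_simp; ring
    rw [e]
    refine ⟨by positivity, fun h hk => ?_⟩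
    rw [div_eq_zero_iff] at h
    have := h.resolve_right (by positivity)
    have := pow_eq_zero_iff two_ne_zero |>.1 this
    linarith

end convex

/-! ### The rate function and its gradient -/

section rate
variable {k : ℕ} {t : ℝ} {x : Fin (k + 1) → ℝ} {h : EuclideanSpace ℝ (Fin (k + 1))}

/-- Right slopes of the shape at the marked points. -/
def slopesR (t : ℝ) (x : Fin (k + 1) → ℝ) (h : EuclideanSpace ℝ (Fin (k + 1))) :
    Fin (k + 1) → ℝ :=
  Fin.snoc (α := fun _ => ℝ)
    (fun i : Fin k => slopeR t (x i.castSucc) (h i.castSucc) (x i.succ) (h i.succ))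
    (-(x (Fin.last k) + rad t (x (Fin.last k)) (h (Fin.last k))) / t)

/-- Left slopes of the shape at the marked points. -/
def slopesL (t : ℝ) (x : Fin (k + 1) → ℝ) (h : EuclideanSpace ℝ (Fin (k + 1))) :
    Fin (k + 1) → ℝ :=
  Fin.cons (α := fun _ => ℝ) (-(x 0 - rad t (x 0) (h 0)) / t)
    (fun i : Fin k => slopeL t (x i.castSucc) (h i.castSucc) (x i.succ) (h i.succ))

/-- Sizes of the kinks of the shape at the marked points; this is the gradient of the rate
function. -/
def kinks (t : ℝ) (x : Fin (k + 1) → ℝ) (h : EuclideanSpace ℝ (Fin (k + 1))) :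
    EuclideanSpace ℝ (Fin (k + 1)) :=
  WithLp.toLp 2 fun c => slopesL t x h c - slopesR t x h c

lemma kinks_apply (c : Fin (k + 1)) :
    kinks t x h c = slopesL t x h c - slopesR t x h c := rfl

lemma sum_kinks_mul (v : Fin (k + 1) → ℝ) : ∑ c, kinks t x h c * v c =
    slopesL t x h 0 * v 0 + ∑ i : Fin k,
      (slopeL t (x i.castSucc) (h i.castSucc) (x i.succ) (h i.succ) * v i.succ -
       slopeR t (x i.castSucc) (h i.castSucc) (x i.succ) (h i.succ) * v i.castSucc)
      - slopesR t x h (Fin.last k) * v (Fin.last k) := by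
  simp only [kinks_apply, sub_mul, Finset.sum_sub_distrib]
  rw [Fin.sum_univ_succ (f := fun c => slopesL t x h c * v c),
    Fin.sum_univ_castSucc (f := fun c => slopesR t x h c * v c)]
  simp only [slopesL, slopesR, Fin.cons_succ, Fin.snoc_castSucc]
  ring

lemma IsShapeAt.hasDerivWithinAt_right {f : ℝ → ℝ} (hf : IsShapeAt t x h f) (ht : 0 < t)
    (hx : StrictMono x) (c : Fin (k + 1)) :
    HasDerivWithinAt f (slopesR t x h c) (Ici (x c)) (x c) := by
  refine Fin.lastCases ?_ (fun i => ?_) c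
  · have hl : ∀ j, x j ≤ x (Fin.last k) := fun j => hx.monotone (Fin.le_last j)
    have h1 := (hasDerivAt_tailR ht (x (Fin.last k)) (h (Fin.last k))
      (x (Fin.last k))).hasDerivWithinAt (s := Ici (x (Fin.last k)))
    have h2 := h1.congr (fun y hy => hf.eq_tailR ht hl hy) (hf.eq_tailR ht hl le_rfl)
    refine h2.congr_deriv ?_
    rw [sub_self, sub_zero, max_eq_right (rad_nonneg _ _ _)]
    simp [slopesR]
  · have hlt := hx i.castSucc_lt_succ
    have h1 := (hasDerivAt_gapFn_left ht (x₁ := x i.castSucc) (h₁ := h i.castSucc) (x₂ := x i.succ)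
      (h₂ := h i.succ)).hasDerivWithinAt (s := Icc (x i.castSucc) (x i.succ))
    have h2 := h1.congr (fun y hy => hf.eq_gap ht hx i hy) (hf.eq_gap ht hx i ⟨le_rfl, hlt.le⟩)
    have h3 := h2.mono_of_mem_nhdsWithin (Icc_mem_nhdsGE hlt)
    simpa [slopesR] using h3

lemma IsShapeAt.hasDerivWithinAt_left {f : ℝ → ℝ} (hf : IsShapeAt t x h f) (ht : 0 < t)
    (hx : StrictMono x) (c : Fin (k + 1)) :
    HasDerivWithinAt f (slopesL t x h c) (Iic (x c)) (x c) := by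
  refine Fin.cases ?_ (fun i => ?_) c
  · have hl : ∀ j, x 0 ≤ x j := fun j => hx.monotone (Fin.zero_le j)
    have h1 := (hasDerivAt_tailL ht (x 0) (h 0) (x 0)).hasDerivWithinAt (s := Iic (x 0))
    have h2 := h1.congr (fun y hy => hf.eq_tailL ht hl hy) (hf.eq_tailL ht hl le_rfl)
    refine h2.congr_deriv ?_
    rw [sub_self, sub_zero, max_eq_right (rad_nonneg _ _ _)]
    simp [slopesL]
  · have hlt := hx i.castSucc_lt_succ
    have h1 := (hasDerivAt_gapFn_right ht (x₁ := x i.castSucc) (h₁ := h i.castSucc)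
      (x₂ := x i.succ) (h₂ := h i.succ)).hasDerivWithinAt (s := Icc (x i.castSucc) (x i.succ))
    have h2 := h1.congr (fun y hy => hf.eq_gap ht hx i hy) (hf.eq_gap ht hx i ⟨hlt.le, le_rfl⟩)
    have h3 := h2.mono_of_mem_nhdsWithin (Icc_mem_nhdsLE hlt)
    simpa [slopesL] using h3

/-- The rate function is the sum of the costs of the tails and of the gaps. -/
theorem rateKPZ_eq (ht : 0 < t) (hx : StrictMono x) (hh : h ∈ hvSpace t x) :
    rateKPZ t x h = capL t (x 0) (h 0) +
      ∑ i : Fin k, gapCost t (x i.castSucc) (h i.castSucc) (x i.succ) (h i.succ) +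
      capR t (x (Fin.last k)) (h (Fin.last k)) := by
  have hf := isShapeAt_shapeFn ht hx hh
  set f := shapeFn t x h
  obtain ⟨R, hR⟩ := hf.eq_parab
  have hl0 : ∀ j, x 0 ≤ x j := fun j => hx.monotone (Fin.zero_le j)
  have hl1 : ∀ j, x j ≤ x (Fin.last k) := fun j => hx.monotone (Fin.le_last j)
  have r0 := rad_nonneg t (x 0) (h 0)
  have r1 := rad_nonneg t (x (Fin.last k)) (h (Fin.last k))
  set N : ℝ := |R| + |x 0| + |x (Fin.last k)| + rad t (x 0) (h 0) +
    rad t (x (Fin.last k)) (h (Fin.last k)) + 1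
  have b1 := abs_nonneg R
  have b2 := abs_nonneg (x 0)
  have b3 := abs_nonneg (x (Fin.last k))
  have b4 := neg_abs_le (x 0)
  have b5 := le_abs_self (x (Fin.last k))
  have b6 := le_abs_self R
  obtain ⟨iL, eL⟩ := rateDensity_tailL (t := t) (x := x 0) (h := h 0) (a := -N) (f := f) ht
    (by simp only [N]; linarith) fun y hy => hf.eq_tailL ht hl0 hy
  obtain ⟨iR, eR⟩ := rateDensity_tailR (t := t) (x := x (Fin.last k)) (h := h (Fin.last k)) (b := N)
    (f := f) ht (by simp only [N]; linarith) fun y hy => hf.eq_tailR ht hl1 hy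
  have hgap := fun i : Fin k => rateDensity_gap (t := t) (f := f) ht
    (hx i.castSucc_lt_succ) (fun y hy => hf.eq_gap ht hx i hy)
  have hsupp : Function.support (rateDensity t f) ⊆ Ioc (-N) N := by
    intro y hy
    by_contra hout
    refine hy ?_
    have hy' : R < |y| := by
      rw [mem_Ioc, not_and_or, not_lt, not_le] at hout
      rcases hout with hout | hout
      · rw [lt_abs]; right; simp only [N] at hout; linarith
      · rw [lt_abs]; left; simp only [N] at hout; linarith
    have : f =ᶠ[𝓝 y] parab t := by
      filter_upwards [(isOpen_lt continuous_const continuous_abs).mem_nhds hy'] with z hz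
      exact hR z (le_of_lt hz)
    rw [rateDensity, this.deriv_eq, sub_self]
  have hmid : IntervalIntegrable (rateDensity t f) volume (x 0) (x (Fin.last k)) ∧
      ∫ y in (x 0)..(x (Fin.last k)), rateDensity t f y =
        ∑ i : Fin k, gapCost t (x i.castSucc) (h i.castSucc) (x i.succ) (h i.succ) := by
    set e : ℕ → ℝ := fun i => x (Fin.ofNat (k + 1) i)
    have he0 : e 0 = x 0 := rfl
    have hek : e k = x (Fin.last k) := congrArg x (Fin.ext (Nat.mod_eq_of_lt (by simp)))
    have hc : ∀ i : Fin k, e i = x i.castSucc := fun i =>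
      congrArg x (Fin.ext (Nat.mod_eq_of_lt (by have := i.2; omega)))
    have hs : ∀ i : Fin k, e (i + 1) = x i.succ := fun i =>
      congrArg x (Fin.ext (Nat.mod_eq_of_lt (by have := i.2; omega)))
    have hint : ∀ i < k, IntervalIntegrable (rateDensity t f) volume (e i) (e (i + 1)) :=
      fun i hi => by
        have := (hgap ⟨i, hi⟩).1
        rwa [← hc ⟨i, hi⟩, ← hs ⟨i, hi⟩] at this
    rw [← he0, ← hek]
    refine ⟨IntervalIntegrable.trans_iterate hint, ?_⟩
    rw [← intervalIntegral.sum_integral_adjacent_intervals hint, Finset.sum_range]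
    exact Finset.sum_congr rfl fun i _ => by rw [hc, hs]; exact (hgap i).2
  have : rateKPZ t x h = ∫ y, rateDensity t f y := rfl
  rw [this, ← intervalIntegral.integral_eq_integral_of_support_subset hsupp,
    ← intervalIntegral.integral_add_adjacent_intervals (iL.trans hmid.1) iR,
    ← intervalIntegral.integral_add_adjacent_intervals iL hmid.1, eL, eR, hmid.2]

/-- The gradient of the rate function within `hvSpace` is the vector of kinks. -/
theorem hasGradientWithinAt_rateKPZ (ht : 0 < t) (hx : StrictMono x) (hh : h ∈ hvSpace t x) :
    HasGradientWithinAt (rateKPZ t x) (kinks t x h) (hvSpace t x) h := by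
  rw [hasGradientWithinAt_iff_hasFDerivWithinAt]
  have hproj : ∀ c : Fin (k + 1), HasFDerivWithinAt (fun h : EuclideanSpace ℝ (Fin (k + 1)) => h c)
      (EuclideanSpace.proj c : EuclideanSpace ℝ (Fin (k + 1)) →L[ℝ] ℝ) (hvSpace t x) h :=
    fun c => (EuclideanSpace.proj c : EuclideanSpace ℝ (Fin (k + 1)) →L[ℝ] ℝ).hasFDerivWithinAt
  have hL := (hasDerivWithinAt_capL ht (hh 0)).comp_hasFDerivWithinAt h (hproj 0)
    fun h hh => hh 0
  have hR := (hasDerivWithinAt_capR ht (hh (Fin.last k))).comp_hasFDerivWithinAt h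
    (hproj (Fin.last k)) fun h hh => hh (Fin.last k)
  have hG := fun i : Fin k => (hasFDerivWithinAt_gapCost ht (hx i.castSucc_lt_succ)
    (hh i.castSucc) (hh i.succ)).comp h ((hproj i.castSucc).prodMk (hproj i.succ))
    (t := Ici (parab t (x i.castSucc)) ×ˢ Ici (parab t (x i.succ)))
    fun h hh => ⟨hh i.castSucc, hh i.succ⟩
  have hS := HasFDerivWithinAt.fun_sum (u := Finset.univ) fun i _ => hG i
  have := ((hL.add hS).add hR).congr (f₁ := rateKPZ t x)
    (fun h hh => by rw [rateKPZ_eq ht hx hh]; simp) (by rw [rateKPZ_eq ht hx hh]; simp)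
  refine this.congr_fderiv ?_
  ext v
  rw [InnerProductSpace.toDual_apply_apply]
  have hin : inner ℝ (kinks t x h) v = ∑ c, kinks t x h c * v c := by
    simp [PiLp.inner_apply, mul_comm]
  rw [hin, sum_kinks_mul]
  simp [slopesL, slopesR]
  have : ∀ i : Fin k, -(slopeR t (x i.castSucc) (h i.castSucc) (x i.succ) (h i.succ) *
      v i.castSucc) + slopeL t (x i.castSucc) (h i.castSucc) (x i.succ) (h i.succ) * v i.succ =
      slopeL t (x i.castSucc) (h i.castSucc) (x i.succ) (h i.succ) * v i.succ -
      slopeR t (x i.castSucc) (h i.castSucc) (x i.succ) (h i.succ) * v i.castSucc :=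
    fun i => by ring
  simp only [this, Finset.sum_sub_distrib]
  ring

/-- Strict first-order convexity of the rate function on `hvSpace`. -/
theorem rateKPZ_strict (ht : 0 < t) (hx : StrictMono x) {g : EuclideanSpace ℝ (Fin (k + 1))}
    (hh : h ∈ hvSpace t x) (hg : g ∈ hvSpace t x) (hne : g ≠ h) :
    rateKPZ t x h + ∑ c, kinks t x h c * (g c - h c) < rateKPZ t x g := by
  set A : ℝ := capL t (x 0) (g 0) - capL t (x 0) (h 0) - slopesL t x h 0 * (g 0 - h 0)
  set B : Fin k → ℝ := fun i =>
    gapCost t (x i.castSucc) (g i.castSucc) (x i.succ) (g i.succ)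
    - gapCost t (x i.castSucc) (h i.castSucc) (x i.succ) (h i.succ)
    + slopeR t (x i.castSucc) (h i.castSucc) (x i.succ) (h i.succ) * (g i.castSucc - h i.castSucc)
    - slopeL t (x i.castSucc) (h i.castSucc) (x i.succ) (h i.succ) * (g i.succ - h i.succ)
    with hB
  set C : ℝ := capR t (x (Fin.last k)) (g (Fin.last k)) - capR t (x (Fin.last k)) (h (Fin.last k))
    + slopesR t x h (Fin.last k) * (g (Fin.last k) - h (Fin.last k))
  have t2 : 0 < 6 * t ^ 2 := by positivity
  have hsum : rateKPZ t x g - (rateKPZ t x h + ∑ c, kinks t x h c * (g c - h c)) =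
      A + ∑ i, B i + C := by
    rw [rateKPZ_eq ht hx hh, rateKPZ_eq ht hx hg, sum_kinks_mul]
    simp only [hB, Finset.sum_sub_distrib, Finset.sum_add_distrib, A, C]
    ring
  have hA : A = (rad t (x 0) (g 0) - rad t (x 0) (h 0)) ^ 2 *
      (2 * rad t (x 0) (g 0) + rad t (x 0) (h 0)) / (6 * t ^ 2) := by
    rw [← capL_excess ht (hh 0) (hg 0)]; simp [A, slopesL]
  have hC : C = (rad t (x (Fin.last k)) (g (Fin.last k)) - rad t (x (Fin.last k)) (h (Fin.last k)))
      ^ 2 * (2 * rad t (x (Fin.last k)) (g (Fin.last k)) +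
        rad t (x (Fin.last k)) (h (Fin.last k))) / (6 * t ^ 2) := by
    rw [← capR_excess ht (hh _) (hg _)]
    simp only [C, slopesR, Fin.snoc_last]
    ring
  have hA0 : 0 ≤ A := hA ▸ div_nonneg (excess_nonneg (rad_nonneg _ _ _) (rad_nonneg _ _ _)) t2.le
  have hC0 : 0 ≤ C := hC ▸ div_nonneg (excess_nonneg (rad_nonneg _ _ _) (rad_nonneg _ _ _)) t2.le
  have hBc := fun i : Fin k => gapCost_convex ht (hx i.castSucc_lt_succ) (hh i.castSucc)
    (hh i.succ) (hg i.castSucc) (hg i.succ)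
  have hB0 : 0 ≤ ∑ i, B i := Finset.sum_nonneg fun i _ => (hBc i).1
  by_contra hle
  push Not at hle
  have hA1 : A = 0 := by linarith
  have hB1 : ∑ i, B i = 0 := by linarith
  have hBi : ∀ i, B i = 0 := fun i =>
    (Finset.sum_eq_zero_iff_of_nonneg fun i _ => (hBc i).1).1 hB1 i (Finset.mem_univ i)
  have h0 : g 0 = h 0 := by
    rw [hA, div_eq_zero_iff] at hA1
    exact eq_of_rad_eq ht (hg 0) (hh 0) (eq_of_excess_eq_zero (rad_nonneg _ _ _)
      (rad_nonneg _ _ _) (hA1.resolve_right t2.ne'))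
  apply hne
  ext c
  induction c using Fin.induction with
  | zero => exact h0
  | succ i ih => exact (hBc i).2 (hBi i) ih

lemma rateKPZ_le (ht : 0 < t) (hx : StrictMono x) {g : EuclideanSpace ℝ (Fin (k + 1))}
    (hh : h ∈ hvSpace t x) (hg : g ∈ hvSpace t x) :
    rateKPZ t x h + ∑ c, kinks t x h c * (g c - h c) ≤ rateKPZ t x g := by
  rcases eq_or_ne g h with rfl | hne
  · simp
  · exact (rateKPZ_strict ht hx hh hg hne).le

/-- `∫ (t b² / 2 + x b) db` over the slopes between the one-sided slopes at `x`. -/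
def slopePrim (t x b : ℝ) : ℝ := t * b ^ 3 / 6 + x * b ^ 2 / 2

/-- The contribution of a gap to the Legendre transform of the rate function depends only on the
slopes at its ends. -/
lemma gap_dual (ht : 0 < t) {x₁ h₁ x₂ h₂ : ℝ} (hx : x₁ < x₂) (H₁ : parab t x₁ ≤ h₁)
    (H₂ : parab t x₂ ≤ h₂) :
    slopeL t x₁ h₁ x₂ h₂ * h₂ - slopeR t x₁ h₁ x₂ h₂ * h₁ - gapCost t x₁ h₁ x₂ h₂ =
      slopePrim t x₂ (slopeL t x₁ h₁ x₂ h₂) - slopePrim t x₁ (slopeR t x₁ h₁ x₂ h₂)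
        + (x₂ ^ 3 - x₁ ^ 3) / (6 * t ^ 2) := by
  by_cases hle : rad t x₁ h₁ + rad t x₂ h₂ ≤ x₂ - x₁
  · rw [slopeR, slopeL, if_pos hle, if_pos hle, gapCost_of_le hle, capR, capL, slopePrim, slopePrim]
    have a1 := height_eq ht H₁
    have a2 := height_eq ht H₂
    generalize rad t x₁ h₁ = v₁ at *
    generalize rad t x₂ h₂ = v₂ at *
    subst a1 a2
    field_simp
    ring
  · rw [slopeR, slopeL, if_neg hle, if_neg hle, gapCost, if_neg hle, slopePrim, slopePrim]
    have h0 : x₂ - x₁ ≠ 0 := by linarith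
    field_simp
    ring

/-- The Legendre transform of the rate function at its gradient, in terms of the slopes. -/
theorem kinks_dual (ht : 0 < t) (hx : StrictMono x) (hh : h ∈ hvSpace t x) :
    ∑ c, kinks t x h c * h c - rateKPZ t x h =
      ∑ c, (slopePrim t (x c) (slopesL t x h c) - slopePrim t (x c) (slopesR t x h c)) := by
  rw [Finset.sum_sub_distrib, rateKPZ_eq ht hx hh, sum_kinks_mul,
    Fin.sum_univ_succ (f := fun c => slopePrim t (x c) (slopesL t x h c)),
    Fin.sum_univ_castSucc (f := fun c => slopePrim t (x c) (slopesR t x h c))]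
  have htel : ∑ i : Fin k, (x i.succ ^ 3 - x i.castSucc ^ 3) = x (Fin.last k) ^ 3 - x 0 ^ 3 := by
    have h1 := Fin.sum_univ_succ (fun c => x c ^ 3)
    have h2 := Fin.sum_univ_castSucc (fun c => x c ^ 3)
    rw [Finset.sum_sub_distrib]
    linarith
  have hgap := Finset.sum_congr (s₁ := (Finset.univ : Finset (Fin k))) rfl fun i _ =>
    gap_dual ht (hx i.castSucc_lt_succ) (hh i.castSucc) (hh i.succ)
  simp only [Finset.sum_sub_distrib, Finset.sum_add_distrib, ← Finset.sum_div] at hgap htel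
  have e0 : slopesL t x h 0 * h 0 - capL t (x 0) (h 0) =
      slopePrim t (x 0) (slopesL t x h 0) + x 0 ^ 3 / (6 * t ^ 2) := by
    simp only [slopesL, Fin.cons_zero, capL, slopePrim]
    have a1 := height_eq ht (hh 0)
    generalize rad t (x 0) (h 0) = v at *
    rw [a1]; field_simp; ring
  have e1 : -slopesR t x h (Fin.last k) * h (Fin.last k) - capR t (x (Fin.last k)) (h (Fin.last k)) =
      -slopePrim t (x (Fin.last k)) (slopesR t x h (Fin.last k))
        - x (Fin.last k) ^ 3 / (6 * t ^ 2) := by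
    simp only [slopesR, Fin.snoc_last, capR, slopePrim]
    have a1 := height_eq ht (hh (Fin.last k))
    generalize rad t (x (Fin.last k)) (h (Fin.last k)) = v at *
    rw [a1]; field_simp; ring
  have hd : (x (Fin.last k) ^ 3 - x 0 ^ 3) / (6 * t ^ 2) =
      x (Fin.last k) ^ 3 / (6 * t ^ 2) - x 0 ^ 3 / (6 * t ^ 2) := sub_div _ _ _
  rw [htel, hd] at hgap
  have hsl : ∀ i : Fin k, slopesL t x h i.succ =
      slopeL t (x i.castSucc) (h i.castSucc) (x i.succ) (h i.succ) := fun i => by simp [slopesL]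
  have hsr : ∀ i : Fin k, slopesR t x h i.castSucc =
      slopeR t (x i.castSucc) (h i.castSucc) (x i.succ) (h i.succ) := fun i => by simp [slopesR]
  simp only [hsl, hsr, Finset.sum_sub_distrib]
  linarith

end rate
end

noncomputable section
open Set Filter Topology MeasureTheory

/-! ### Concave shapes -/

/-- Where `f` touches `φ` from below, its right derivative is the smaller one. -/
lemma deriv_right_le_of_le {f φ : ℝ → ℝ} {a b y : ℝ} (hf : HasDerivWithinAt f a (Ici y) y)
    (hφ : HasDerivWithinAt φ b (Ici y) y) (hle : ∀ z, y ≤ z → f z ≤ φ z) (heq : f y = φ y) :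
    a ≤ b := by
  have h := hφ.sub hf
  rw [hasDerivWithinAt_iff_tendsto_slope, Ici_sdiff_left] at h
  have : 0 ≤ b - a := by
    refine ge_of_tendsto h ?_
    filter_upwards [self_mem_nhdsWithin] with z hz
    have hz' : 0 < z - y := sub_pos.2 hz
    rw [slope_def_field]
    have := hle z (le_of_lt hz)
    simp only [Pi.sub_apply]
    exact div_nonneg (by linarith) hz'.le
  linarith

/-- Where `f` touches `φ` from below, its left derivative is the larger one. -/
lemma deriv_left_ge_of_le {f φ : ℝ → ℝ} {a b y : ℝ} (hf : HasDerivWithinAt f a (Iic y) y)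
    (hφ : HasDerivWithinAt φ b (Iic y) y) (hle : ∀ z, z ≤ y → f z ≤ φ z) (heq : f y = φ y) :
    b ≤ a := by
  have h := hφ.sub hf
  rw [hasDerivWithinAt_iff_tendsto_slope, Iic_sdiff_right] at h
  have : b - a ≤ 0 := by
    refine le_of_tendsto h ?_
    filter_upwards [self_mem_nhdsWithin] with z hz
    have hz' : z - y < 0 := sub_neg.2 hz
    rw [slope_def_field]
    have := hle z (le_of_lt hz)
    simp only [Pi.sub_apply]
    exact div_nonpos_of_nonneg_of_nonpos (by linarith) hz'.le
  linarith

lemma ConcaveOn.right_le_left {φ : ℝ → ℝ} {a b y : ℝ} (h : ConcaveOn ℝ univ φ)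
    (hL : HasDerivWithinAt φ a (Iic y) y) (hR : HasDerivWithinAt φ b (Ici y) y) : b ≤ a := by
  rw [hasDerivWithinAt_iff_tendsto_slope, Iic_sdiff_right] at hL
  rw [hasDerivWithinAt_iff_tendsto_slope, Ici_sdiff_left] at hR
  have key : ∀ z > y, slope φ y z ≤ a := fun z hz => by
    refine ge_of_tendsto hL ?_
    filter_upwards [self_mem_nhdsWithin] with w hw
    rw [slope_comm φ y w, slope_def_field, slope_def_field]
    exact h.slope_anti_adjacent (mem_univ w) (mem_univ z) hw hz
  exact le_of_tendsto hR (by filter_upwards [self_mem_nhdsWithin] with z hz using key z hz)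

/-- The shape is below any concave majorant of the parabola that dominates it at the ends of a
gap. -/
lemma GapShape.le_concave {t a b : ℝ} {f φ : ℝ → ℝ} (hf : GapShape t a b f)
    (hφ : ConcaveOn ℝ univ φ) (hp : ∀ y, parab t y ≤ φ y) (ha : f a ≤ φ a) (hb : f b ≤ φ b)
    {y : ℝ} (hy : y ∈ Icc a b) : f y ≤ φ y := by
  by_contra hlt
  push Not at hlt
  have hφc : Continuous φ := continuousOn_univ.1 (hφ.continuousOn isOpen_univ)
  have hcl : ∀ c d, a ≤ c → d ≤ b → IsClosed (Icc c d ∩ {z | f z ≤ φ z}) := by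
    intro c d hc hd
    have h1 : ContinuousOn (fun z => f z - φ z) (Icc c d) :=
      (hf.cont.mono (Icc_subset_Icc hc hd)).sub hφc.continuousOn
    have := h1.preimage_isClosed_of_isClosed isClosed_Icc (isClosed_Iic (a := (0 : ℝ)))
    convert this using 1
    ext z
    simp
  -- the maximal interval around `y` on which `f` exceeds `φ`, hence the parabola: `f` is affine
  -- there, and at most `φ` at its ends
  set S := Icc a y ∩ {z | f z ≤ φ z}
  set S' := Icc y b ∩ {z | f z ≤ φ z}
  have bS : BddAbove S := ⟨y, fun z hz => hz.1.2⟩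
  have bS' : BddBelow S' := ⟨y, fun z hz => hz.1.1⟩
  have m := (hcl a y le_rfl hy.2).csSup_mem ⟨a, ⟨le_rfl, hy.1⟩, ha⟩ bS
  have m' := (hcl y b hy.1 le_rfl).csInf_mem ⟨b, ⟨hy.2, le_rfl⟩, hb⟩ bS'
  set α := sSup S
  set β := sInf S'
  have hα : α < y := lt_of_le_of_ne m.1.2 fun h => by
    have := m.2; rw [h] at this; exact absurd this (not_le.2 hlt)
  have hβ : y < β := lt_of_le_of_ne m'.1.1 fun h => by
    have := m'.2; rw [← h] at this; exact absurd this (not_le.2 hlt)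
  obtain ⟨s, hs⟩ := hf.affine m.1.1 (hα.trans hβ) m'.1.2 fun z hz => by
    refine (hp z).trans_lt ?_
    by_contra hle
    push Not at hle
    rcases le_total z y with h | h
    · have : z ≤ α := le_csSup bS ⟨⟨by linarith [m.1.1, hz.1], h⟩, hle⟩
      linarith [hz.1]
    · have : β ≤ z := csInf_le bS' ⟨⟨h, by linarith [m'.1.2, hz.2]⟩, hle⟩
      linarith [hz.2]
  have e1 := hs y ⟨hα.le, hβ.le⟩
  have e2 := hs β ⟨(hα.trans hβ).le, le_rfl⟩
  have hd : 0 < β - α := by linarith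
  have w1 : 0 ≤ (β - y) / (β - α) := div_nonneg (by linarith) hd.le
  have w2 : 0 ≤ (y - α) / (β - α) := div_nonneg (by linarith) hd.le
  have w3 : (β - y) / (β - α) + (y - α) / (β - α) = 1 := by
    rw [← add_div, div_eq_one_iff_eq hd.ne']; ring
  have hc := hφ.2 (mem_univ α) (mem_univ β) w1 w2 w3
  have hyy : (β - y) / (β - α) * α + (y - α) / (β - α) * β = y := by field_simp; ring
  simp only [smul_eq_mul] at hc
  rw [hyy] at hc
  have hmA := m.2
  have hmB := m'.2
  simp only [mem_ofPred_eq] at hmA hmB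
  have p1 : (β - y) / (β - α) * f α ≤ (β - y) / (β - α) * φ α :=
    mul_le_mul_of_nonneg_left hmA (div_nonneg (by linarith) hd.le)
  have p2 : (y - α) / (β - α) * f β ≤ (y - α) / (β - α) * φ β :=
    mul_le_mul_of_nonneg_left hmB (div_nonneg (by linarith) hd.le)
  have p3 : (β - y) / (β - α) * f α + (y - α) / (β - α) * f β = f y := by
    rw [e1, e2]; field_simp; ring
  linarith

section conc
variable {k : ℕ} {t : ℝ} {x : Fin (k + 1) → ℝ} {h : EuclideanSpace ℝ (Fin (k + 1))}

/-- The shape is below every concave majorant of the parabola that is above the prescribed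
heights. -/
lemma IsShapeAt.le_concave {f φ : ℝ → ℝ} (hf : IsShapeAt t x h f) (hx : StrictMono x)
    (hφ : ConcaveOn ℝ univ φ) (hp : ∀ y, parab t y ≤ φ y) (hv : ∀ c, h c ≤ φ (x c)) (y : ℝ) :
    f y ≤ φ y := by
  obtain ⟨R, hR⟩ := hf.eq_parab
  have hv' : ∀ c, f (x c) ≤ φ (x c) := fun c => by rw [hf.value]; exact hv c
  rcases exists_gap x y with h1 | h1 | ⟨i, hi⟩
  · set q := min y (-|R|)
    have hq : q ≤ y ∧ q ≤ -|R| := ⟨min_le_left _ _, min_le_right _ _⟩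
    refine (hf.gapShape (a := q) (b := x 0) fun j hj => ?_).le_concave hφ hp ?_ (hv' 0) ⟨hq.1, h1⟩
    · exact absurd hj.2 (not_lt.2 (hx.monotone (Fin.zero_le j)))
    · rw [hR q (by rw [le_abs]; right; linarith [hq.2, le_abs_self R])]
      exact hp q
  · set q := max y |R|
    have hq : y ≤ q ∧ |R| ≤ q := ⟨le_max_left _ _, le_max_right _ _⟩
    refine (hf.gapShape (a := x (Fin.last k)) (b := q) fun j hj => ?_).le_concave hφ hp
      (hv' _) ?_ ⟨h1, hq.1⟩
    · exact absurd hj.1 (not_lt.2 (hx.monotone (Fin.le_last j)))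
    · rw [hR q (by rw [le_abs]; left; linarith [hq.2, le_abs_self R])]
      exact hp q
  · exact (hf.gapShape (hx.notMem_gap i)).le_concave hφ hp (hv' _) (hv' _) hi

lemma kinks_nonneg (ht : 0 < t) (hx : StrictMono x) (hh : h ∈ hvConc t x) (c : Fin (k + 1)) :
    0 ≤ kinks t x h c := by
  have hf := isShapeAt_shapeFn ht hx hh.1
  have := hh.2.right_le_left (hf.hasDerivWithinAt_left ht hx c) (hf.hasDerivWithinAt_right ht hx c)
  rw [kinks_apply]; linarith

/-- The kinks stay concave under convex combinations of the heights: the shape of the combination is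
below the combination of the shapes, which is concave, and touches it at the marked points. -/
lemma kinks_nonneg_of_convexComb (ht : 0 < t) (hx : StrictMono x)
    {g : EuclideanSpace ℝ (Fin (k + 1))} (hh : h ∈ hvConc t x) (hg : g ∈ hvConc t x) {a b : ℝ}
    (ha : 0 ≤ a) (hb : 0 ≤ b) (hab : a + b = 1) :
    a • h + b • g ∈ hvSpace t x ∧ ∀ c, 0 ≤ kinks t x (a • h + b • g) c := by
  have hmem : a • h + b • g ∈ hvSpace t x := fun c => by
    have h1 := mul_le_mul_of_nonneg_left (hh.1 c) ha
    have h2 := mul_le_mul_of_nonneg_left (hg.1 c) hb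
    have : parab t (x c) = a * parab t (x c) + b * parab t (x c) := by rw [← add_mul, hab, one_mul]
    simp only [PiLp.add_apply, PiLp.smul_apply, smul_eq_mul]
    linarith
  refine ⟨hmem, fun c => ?_⟩
  have hf := isShapeAt_shapeFn ht hx hh.1
  have hg' := isShapeAt_shapeFn ht hx hg.1
  have hm := isShapeAt_shapeFn ht hx hmem
  set φ : ℝ → ℝ := fun y => a * shapeFn t x h y + b * shapeFn t x g y
  have hφ : ConcaveOn ℝ univ φ := (hh.2.smul ha).add (hg.2.smul hb)
  have hp : ∀ y, parab t y ≤ φ y := fun y => by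
    have h1 := mul_le_mul_of_nonneg_left (hf.ge_parab y) ha
    have h2 := mul_le_mul_of_nonneg_left (hg'.ge_parab y) hb
    have : parab t y = a * parab t y + b * parab t y := by rw [← add_mul, hab, one_mul]
    simp only [φ]; linarith
  have hv : ∀ c, (a • h + b • g) c = φ (x c) := fun c => by
    simp only [φ, hf.value, hg'.value, PiLp.add_apply, PiLp.smul_apply, smul_eq_mul]
  have hle := hm.le_concave hx hφ hp fun c => (hv c).le
  have hφR : HasDerivWithinAt φ (a * slopesR t x h c + b * slopesR t x g c) (Ici (x c)) (x c) :=
    ((hf.hasDerivWithinAt_right ht hx c).const_mul a).add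
      ((hg'.hasDerivWithinAt_right ht hx c).const_mul b)
  have hφL : HasDerivWithinAt φ (a * slopesL t x h c + b * slopesL t x g c) (Iic (x c)) (x c) :=
    ((hf.hasDerivWithinAt_left ht hx c).const_mul a).add
      ((hg'.hasDerivWithinAt_left ht hx c).const_mul b)
  have heq : shapeFn t x (a • h + b • g) (x c) = φ (x c) := by rw [hm.value, hv]
  have i1 := deriv_right_le_of_le (hm.hasDerivWithinAt_right ht hx c) hφR (fun z _ => hle z) heq
  have i2 := deriv_left_ge_of_le (hm.hasDerivWithinAt_left ht hx c) hφL (fun z _ => hle z) heq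
  have i3 := hφ.right_le_left hφL hφR
  rw [kinks_apply]; linarith

/-- The slopes on a gap are continuous in the heights up to the parabola, across the transition
between tangents and chord. -/
lemma continuousOn_slope {t x₁ x₂ : ℝ} (ht : 0 < t) (hx : x₁ < x₂) :
    ContinuousOn (fun p : ℝ × ℝ => slopeR t x₁ p.1 x₂ p.2)
      (Ici (parab t x₁) ×ˢ Ici (parab t x₂)) ∧
    ContinuousOn (fun p : ℝ × ℝ => slopeL t x₁ p.1 x₂ p.2)
      (Ici (parab t x₁) ×ˢ Ici (parab t x₂)) := by
  set S : Set (ℝ × ℝ) := Ici (parab t x₁) ×ˢ Ici (parab t x₂) with hSdef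
  have hS : IsClosed S := isClosed_Ici.prod isClosed_Ici
  have hc1 : Continuous fun p : ℝ × ℝ => rad t x₁ p.1 := (continuous_rad t x₁).comp continuous_fst
  have hc2 : Continuous fun p : ℝ × ℝ => rad t x₂ p.2 := (continuous_rad t x₂).comp continuous_snd
  have hcont := hc1.add hc2
  set S₁ := S ∩ {p | rad t x₁ p.1 + rad t x₂ p.2 ≤ x₂ - x₁}
  set S₂ := S ∩ {p | x₂ - x₁ ≤ rad t x₁ p.1 + rad t x₂ p.2}
  have hS₁ : IsClosed S₁ := hS.inter (isClosed_le hcont continuous_const)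
  have hS₂ : IsClosed S₂ := hS.inter (isClosed_le continuous_const hcont)
  have hU : S = S₁ ∪ S₂ := by
    rw [← inter_union_distrib_left]
    ext p
    exact ⟨fun h => ⟨h, (le_total (rad t x₁ p.1 + rad t x₂ p.2) (x₂ - x₁) :)⟩, fun h => h.1⟩
  rw [hU]
  have chord : Continuous fun p : ℝ × ℝ => (p.2 - p.1) / (x₂ - x₁) := by fun_prop
  constructor
  · refine ContinuousOn.union_of_isClosed ?_ ?_ hS₁ hS₂
    · have : Continuous fun p : ℝ × ℝ => -(x₁ + rad t x₁ p.1) / t := by fun_prop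
      exact this.continuousOn.congr fun p hp => if_pos hp.2
    · refine chord.continuousOn.congr fun p hp => ?_
      unfold slopeR
      split_ifs with h
      · exact (chord_slope_of_eq ht hx hp.1.1 hp.1.2 (le_antisymm h hp.2)).1.symm
      · rfl
  · refine ContinuousOn.union_of_isClosed ?_ ?_ hS₁ hS₂
    · have : Continuous fun p : ℝ × ℝ => -(x₂ - rad t x₂ p.2) / t := by fun_prop
      exact this.continuousOn.congr fun p hp => if_pos hp.2
    · refine chord.continuousOn.congr fun p hp => ?_
      unfold slopeL
      split_ifs with h
      · exact (chord_slope_of_eq ht hx hp.1.1 hp.1.2 (le_antisymm h hp.2)).2.symm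
      · rfl

lemma continuousOn_kinks (ht : 0 < t) (hx : StrictMono x) :
    ContinuousOn (kinks t x) (hvSpace t x) := by
  have hproj : ∀ c : Fin (k + 1), Continuous fun h : EuclideanSpace ℝ (Fin (k + 1)) => h c :=
    fun c => by fun_prop
  have hpair : ∀ i : Fin k, ContinuousOn
      (fun h : EuclideanSpace ℝ (Fin (k + 1)) => (h i.castSucc, h i.succ)) (hvSpace t x) :=
    fun i => ((hproj _).prodMk (hproj _)).continuousOn
  have hR : ∀ c, ContinuousOn (fun h => slopesR t x h c) (hvSpace t x) := fun c => by
    refine Fin.lastCases ?_ (fun i => ?_) c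
    · simp only [slopesR, Fin.snoc_last]
      exact (((((continuous_rad t _).comp (hproj _)).const_add _).neg).div_const t).continuousOn
    · simp only [slopesR, Fin.snoc_castSucc]
      exact (continuousOn_slope ht (hx i.castSucc_lt_succ)).1.comp (hpair i)
        fun h hh => ⟨hh i.castSucc, hh i.succ⟩
  have hL : ∀ c, ContinuousOn (fun h => slopesL t x h c) (hvSpace t x) := fun c => by
    refine Fin.cases ?_ (fun i => ?_) c
    · simp only [slopesL, Fin.cons_zero]
      exact (((continuous_const.sub ((continuous_rad t _).comp (hproj _))).neg).div_const
        t).continuousOn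
    · simp only [slopesL, Fin.cons_succ]
      exact (continuousOn_slope ht (hx i.castSucc_lt_succ)).2.comp (hpair i)
        fun h hh => ⟨hh i.castSucc, hh i.succ⟩
  unfold kinks
  exact (PiLp.continuous_toLp 2 _).comp_continuousOn
    (continuousOn_pi.2 fun c => (hL c).sub (hR c))

lemma isClosed_hvSpace : IsClosed (hvSpace t x) := by
  have : hvSpace t x = ⋂ c, {h | parab t (x c) ≤ h c} := by ext; simp [hvSpace]
  rw [this]
  exact isClosed_iInter fun c => isClosed_le continuous_const (by fun_prop)

end conc
end

noncomputable section
open Set Filter Topology MeasureTheory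

/-! ### Quantile functions and atoms -/

/-- The quantile function is a generalized inverse of the distribution function. -/
lemma quantileFn_le_iff {μ : FiniteMeasure ℝ} {M a y : ℝ} (hM : (μ.mass : ℝ) = M) (h0 : 0 < a)
    (h1 : a < M) : quantileFn μ a ≤ y ↔ a ≤ (μ : Measure ℝ).real (Iic y) := by
  set ν : Measure ℝ := (μ : Measure ℝ)
  have hU : ν.real univ = M := by rw [← hM]; rfl
  set S := {y : ℝ | a ≤ ν.real (Iic y)} with hS
  have hne : S.Nonempty := by
    have h := (ENNReal.tendsto_toReal (measure_ne_top ν univ)).comp (tendsto_measure_Iic_atTop ν)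
    have h' : Tendsto (fun y => ν.real (Iic y)) atTop (𝓝 M) := by rw [← hU]; exact h
    obtain ⟨y, hy⟩ := (h'.eventually (lt_mem_nhds h1)).exists
    exact ⟨y, hy.le⟩
  have hbdd : BddBelow S := by
    have h := (ENNReal.tendsto_toReal (measure_ne_top ν univ)).comp (tendsto_measure_Ici_atBot ν)
    have h' : Tendsto (fun y => ν.real (Ici y)) atBot (𝓝 M) := by rw [← hU]; exact h
    obtain ⟨z, hz⟩ := (h'.eventually (lt_mem_nhds (show M - a < M by linarith))).exists
    refine ⟨z, fun y hy => ?_⟩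
    by_contra hlt
    push Not at hlt
    have hd : Disjoint (Iic y) (Ici z) :=
      Set.disjoint_left.2 fun w hw hw' => absurd (lt_of_le_of_lt hw hlt) (not_lt.2 hw')
    have := measureReal_union (μ := ν) hd measurableSet_Ici
    have hle : ν.real (Iic y ∪ Ici z) ≤ M := by
      rw [← hU]; exact measureReal_mono (subset_univ _)
    have hy' : a ≤ ν.real (Iic y) := hy
    linarith
  have hmono : ∀ y z, y ≤ z → ν.real (Iic y) ≤ ν.real (Iic z) := fun y z h =>
    measureReal_mono (Iic_subset_Iic.2 h)
  have hmem : a ≤ ν.real (Iic (quantileFn μ a)) := by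
    set q := quantileFn μ a
    have h := tendsto_measure_iInter_atTop (μ := ν) (s := fun n : ℕ => Iic (q + 1 / ((n : ℝ) + 1)))
      (fun _ => measurableSet_Iic.nullMeasurableSet)
      (fun i j hij => Iic_subset_Iic.2 (by
        have : (1 : ℝ) / ((j : ℝ) + 1) ≤ 1 / ((i : ℝ) + 1) :=
          one_div_le_one_div_of_le (by positivity) (by exact_mod_cast Nat.succ_le_succ hij)
        linarith)) ⟨0, measure_ne_top _ _⟩
    have hI : (⋂ n : ℕ, Iic (q + 1 / ((n : ℝ) + 1))) = Iic q := by
      ext w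
      simp only [mem_iInter, mem_Iic]
      constructor
      · intro hw
        have h2 : Tendsto (fun n : ℕ => q + 1 / ((n : ℝ) + 1)) atTop (𝓝 (q + 0)) :=
          tendsto_one_div_add_atTop_nhds_zero_nat.const_add q
        rw [add_zero] at h2
        exact ge_of_tendsto' h2 hw
      · intro hw n
        have : (0 : ℝ) < 1 / ((n : ℝ) + 1) := by positivity
        linarith
    rw [hI] at h
    have h' := (ENNReal.tendsto_toReal (measure_ne_top ν (Iic q))).comp h
    refine ge_of_tendsto' h' fun n => ?_
    have hlt : sInf S < q + 1 / ((n : ℝ) + 1) := by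
      have : (0 : ℝ) < 1 / ((n : ℝ) + 1) := by positivity
      change q < _; linarith
    obtain ⟨z, hz, hz'⟩ := exists_lt_of_csInf_lt hne hlt
    exact le_trans hz (hmono _ _ hz'.le)
  constructor
  · intro h; exact hmem.trans (hmono _ _ h)
  · intro h; exact csInf_le hbdd h

lemma quantileFn_mono {μ : FiniteMeasure ℝ} {M a b : ℝ} (hM : (μ.mass : ℝ) = M) (h0 : 0 < a)
    (hab : a ≤ b) (h1 : b < M) : quantileFn μ a ≤ quantileFn μ b :=
  (quantileFn_le_iff hM h0 (hab.trans_lt h1)).2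
    (hab.trans ((quantileFn_le_iff hM (h0.trans_le hab) h1).1 le_rfl))

/-- The quantile function is constant on the interval that an atom covers. -/
lemma quantileFn_atom {μ : FiniteMeasure ℝ} {M a y : ℝ} (hM : (μ.mass : ℝ) = M)
    (ha : a ∈ Ioo ((μ : Measure ℝ).real (Iio y)) ((μ : Measure ℝ).real (Iic y))) :
    quantileFn μ a = y := by
  have h0 : 0 < a := measureReal_nonneg.trans_lt ha.1
  have h1 : a < M := ha.2.trans_le (by
    rw [← hM]; exact measureReal_mono (μ := (μ : Measure ℝ)) (subset_univ _))
  refine le_antisymm ((quantileFn_le_iff hM h0 h1).2 ha.2.le) ?_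
  by_contra hlt
  push Not at hlt
  have := (quantileFn_le_iff hM h0 h1).1 (le_refl (quantileFn μ a))
  have h2 : (μ : Measure ℝ).real (Iic (quantileFn μ a)) ≤ (μ : Measure ℝ).real (Iio y) :=
    measureReal_mono (fun w (hw : w ≤ _) => lt_of_le_of_lt hw hlt)
  linarith [ha.1]

lemma measureReal_Iic_eq (μ : Measure ℝ) [IsFiniteMeasure μ] (y : ℝ) :
    μ.real (Iic y) = μ.real (Iio y) + μ.real {y} := by
  have hd : Disjoint (Iio y) {y} := by simp
  rw [← measureReal_union hd (measurableSet_singleton y), Iio_union_right]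

/-- The sum over all atoms of the cubes of their masses, as an integral. -/
lemma lintegral_atom_sq (μ : Measure ℝ) [IsFiniteMeasure μ] :
    ∫⁻ y, (μ {y}) ^ 2 ∂μ = ∑' y : ℝ, (μ {y}) ^ 3 := by
  have hc : {y : ℝ | 0 < μ {y}}.Countable :=
    Measure.countable_meas_pos_of_disjoint_iUnion (fun y => measurableSet_singleton y)
      (fun a b hab => by simpa [Function.onFun] using hab)
  set S := {y : ℝ | 0 < μ {y}}
  have h1 : ∫⁻ y, (μ {y}) ^ 2 ∂μ = ∫⁻ y in S, (μ {y}) ^ 2 ∂μ := by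
    rw [← lintegral_indicator hc.measurableSet]
    congr 1
    ext y
    by_cases hy : y ∈ S
    · rw [indicator_of_mem hy]
    · have h0 : μ {y} = 0 := by simpa [S] using hy
      rw [indicator_of_notMem hy, h0]; simp
  rw [h1, lintegral_countable _ hc]
  rw [← tsum_subtype_eq_of_support_subset (s := S)]
  · congr 1; ext y; ring
  · intro y hy
    rw [Function.mem_support] at hy
    have : μ {y} ≠ 0 := fun h => hy (by rw [h]; simp)
    exact pos_iff_ne_zero.2 this

lemma measurable_finiteMeasure_of_continuous {μ : ℝ → FiniteMeasure ℝ} (hμ : Continuous μ) :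
    Measurable fun s => (μ s : Measure ℝ) := by
  have key : ∀ F : Set ℝ, IsClosed F → Measurable fun s => (μ s : Measure ℝ) F := by
    intro F hF
    have hlim : ∀ s, Tendsto (fun n : ℕ => ∫⁻ y, (hF.apprSeq n y : ENNReal) ∂(μ s : Measure ℝ))
        atTop (𝓝 ((μ s : Measure ℝ) F)) := fun s =>
      HasOuterApproxClosed.tendsto_lintegral_apprSeq hF _
    refine measurable_of_tendsto_metrizable (f := fun n s =>
      ∫⁻ y, (hF.apprSeq n y : ENNReal) ∂(μ s : Measure ℝ)) (fun n => ?_) (tendsto_pi_nhds.2 hlim)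
    have h1 := (FiniteMeasure.continuous_testAgainstNN_eval (hF.apprSeq n)).comp hμ
    have h2 := (ENNReal.continuous_coe.comp h1).measurable
    convert h2 using 2 with s
    simp [FiniteMeasure.testAgainstNN_coe_eq]
  exact Measurable.measure_of_isPiSystem (μ := fun s => (μ s : Measure ℝ))
    (BorelSpace.measurable_eq.trans borel_eq_generateFrom_isClosed) isPiSystem_isClosed
    key (key univ isClosed_univ)

/-- The sum of the cubes of the atoms is measurable along a weakly continuous path: by
`lintegral_atom_sq` it is an integral against a kernel. -/
lemma measurable_tsum_atom {μ : ℝ → FiniteMeasure ℝ} {M : ℝ} (hμ : Continuous μ)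
    (hM : ∀ s, ((μ s).mass : ℝ) = M) :
    Measurable fun s => ∑' y : ℝ, ((μ s : Measure ℝ) {y}) ^ 3 := by
  let κ : ProbabilityTheory.Kernel ℝ ℝ := ⟨fun s => μ s, measurable_finiteMeasure_of_continuous hμ⟩
  have hκ : ∀ s, κ s = μ s := fun s => rfl
  have : ProbabilityTheory.IsFiniteKernel κ := by
    refine ⟨ENNReal.ofReal M, ENNReal.ofReal_lt_top, fun s => ?_⟩
    rw [hκ, ← hM s, ← FiniteMeasure.ennreal_mass]
    simp
  have h1 : Measurable fun p : ℝ × ℝ => κ p.1 {p.2} := by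
    have := ProbabilityTheory.Kernel.measurable_kernel_prodMk_left
      (κ := κ.comap (Prod.fst : ℝ × ℝ → ℝ) measurable_fst)
      (t := {q : (ℝ × ℝ) × ℝ | q.2 = q.1.2})
      (measurableSet_eq_fun measurable_snd measurable_fst.snd)
    exact this
  have h2 := Measurable.lintegral_kernel_prod_right' (κ := κ) (h1.pow_const 2)
  simp only [← lintegral_atom_sq]
  exact h2

lemma tsum_atom_toReal (μ : Measure ℝ) [IsFiniteMeasure μ] :
    (∑' y : ℝ, (μ {y}) ^ 3).toReal = ∑' y : ℝ, (μ.real {y}) ^ 3 := by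
  rw [ENNReal.tsum_toReal_eq fun y => ENNReal.pow_ne_top (measure_ne_top _ _)]
  simp [Measure.real]

lemma tsum_atom_le (μ : FiniteMeasure ℝ) {M : ℝ} (hM : (μ.mass : ℝ) = M) :
    ∑' y : ℝ, ((μ : Measure ℝ).real {y}) ^ 3 ≤ M ^ 3 := by
  set ν : Measure ℝ := (μ : Measure ℝ)
  have hU : ν.real univ = M := by rw [← hM]; rfl
  have hle : ∀ s, ν.real s ≤ M := fun s => by rw [← hU]; exact measureReal_mono (subset_univ _)
  have hM0 : 0 ≤ M := measureReal_nonneg.trans (hle ∅)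
  refine Real.tsum_le_of_sum_le (fun y => by positivity) fun u => ?_
  have h1 : ∑ y ∈ u, ν.real {y} ≤ M := by
    rw [sum_measureReal_singleton]; exact hle _
  calc ∑ y ∈ u, ν.real {y} ^ 3 ≤ ∑ y ∈ u, M ^ 2 * ν.real {y} :=
        Finset.sum_le_sum fun y _ => by
          have h0 : 0 ≤ ν.real {y} := measureReal_nonneg
          have := pow_le_pow_left₀ h0 (hle {y}) 2
          nlinarith
    _ ≤ M ^ 3 := by
        rw [← Finset.mul_sum]
        nlinarith [sq_nonneg M]

/-- Along a weakly continuous path of fixed mass, the atomic term is integrable in time. -/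
lemma intervalIntegrable_atoms {μ : ℝ → FiniteMeasure ℝ} {T M : ℝ} (hT : 0 ≤ T)
    (hμ : ContinuousOn μ (Icc 0 T)) (hM : ∀ s ∈ Icc 0 T, ((μ s).mass : ℝ) = M) :
    IntegrableOn (fun s => ∑' y : ℝ, (1 / 24) * ((μ s : Measure ℝ).real {y}) ^ 3) (Ioo 0 T) := by
  set μ' : ℝ → FiniteMeasure ℝ := IccExtend hT ((Icc 0 T).domRestrict μ)
  have hμ' : Continuous μ' := (continuousOn_iff_continuous_domRestrict.1 hμ).Icc_extend'
  have hM' : ∀ s, ((μ' s).mass : ℝ) = M := fun s => hM _ (projIcc 0 T hT s).2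
  have hmeas := (measurable_tsum_atom hμ' hM').ennreal_toReal
  simp only [tsum_atom_toReal] at hmeas
  have hint : IntegrableOn (fun s => ∑' y : ℝ, ((μ' s : Measure ℝ).real {y}) ^ 3) (Ioo 0 T) := by
    refine Measure.integrableOn_of_bounded (M := M ^ 3) (by simp) hmeas.aestronglyMeasurable ?_
    refine Eventually.of_forall fun s => ?_
    rw [Real.norm_of_nonneg (tsum_nonneg fun y => by positivity)]
    exact tsum_atom_le _ (hM' s)
  refine IntegrableOn.congr_fun (hint.const_mul (1 / 24)) (fun s hs => ?_) measurableSet_Ioo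
  simp only [μ', IccExtend_of_mem hT _ (Ioo_subset_Icc_self hs), domRestrict_apply]
  rw [tsum_mul_left]

/-! ### Velocities of the quantiles on atoms -/

/-- Two functions of which one dominates the other have equal derivatives where they meet. -/
lemma deriv_eq_of_le_of_eq {f g : ℝ → ℝ} {s : ℝ} (hf : DifferentiableAt ℝ f s)
    (hg : DifferentiableAt ℝ g s) (hle : ∀ᶠ r in 𝓝 s, f r ≤ g r) (heq : f s = g s) :
    deriv f s = deriv g s := by
  have hm : IsLocalMin (fun r => g r - f r) s := by
    filter_upwards [hle] with r hr
    rw [heq]; linarith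
  have := hm.deriv_eq_zero
  rw [deriv_fun_sub hg hf] at this
  linarith

lemma deriv_eq_of_sandwich {f g k : ℝ → ℝ} {s : ℝ} (hf : DifferentiableAt ℝ f s)
    (hg : DifferentiableAt ℝ g s) (h1 : ∀ᶠ r in 𝓝 s, f r ≤ k r) (h2 : ∀ᶠ r in 𝓝 s, k r ≤ g r)
    (e1 : f s = k s) (e2 : k s = g s) : deriv k s = deriv f s := by
  have he := deriv_eq_of_le_of_eq hf hg (h1.mp (h2.mono fun r a b => b.trans a)) (e1.trans e2)
  have hf' := hf.hasDerivAt
  have hg' := hg.hasDerivAt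
  rw [← he] at hg'
  refine HasDerivAt.deriv ?_
  rw [hasDerivAt_iff_isLittleO] at hf' hg' ⊢
  refine Asymptotics.IsBigO.trans_isLittleO ?_ (hf'.norm_left.add hg'.norm_left)
  refine Asymptotics.IsBigO.of_bound 1 ?_
  filter_upwards [h1, h2] with r a b
  simp only [smul_eq_mul, Real.norm_eq_abs, one_mul]
  rw [abs_of_nonneg (a := |_| + |_|) (by positivity), abs_le]
  have i1 := neg_abs_le (f r - f s - (r - s) * deriv f s)
  have i2 := abs_nonneg (f r - f s - (r - s) * deriv f s)
  have i3 := le_abs_self (g r - g s - (r - s) * deriv f s)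
  have i4 := abs_nonneg (g r - g s - (r - s) * deriv f s)
  constructor <;> linarith

/-- All the quantiles covered by one atom have the same velocity, provided that a dense set of
quantiles has velocities. -/
lemma deriv_quantileFn_atom {μ : ℝ → FiniteMeasure ℝ} {T M s : ℝ} {D : Set ℝ} (hD : Dense D)
    (hM : ∀ r ∈ Icc 0 T, ((μ r).mass : ℝ) = M) (hs : s ∈ Ioo 0 T)
    (hd : ∀ a ∈ D, a ∈ Ioo 0 M → DifferentiableAt ℝ (fun r => quantileFn (μ r) a) s) (y : ℝ) :
    ∃ c, ∀ a ∈ Ioo ((μ s : Measure ℝ).real (Iio y)) ((μ s : Measure ℝ).real (Iic y)),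
      deriv (fun r => quantileFn (μ r) a) s = c := by
  set α := (μ s : Measure ℝ).real (Iio y)
  set β := (μ s : Measure ℝ).real (Iic y)
  have hMs := hM s (Ioo_subset_Icc_self hs)
  have hα : 0 ≤ α := measureReal_nonneg
  have hβ : β ≤ M := by
    rw [← hMs]; exact measureReal_mono (μ := (μ s : Measure ℝ)) (subset_univ _)
  have hev : ∀ᶠ r in 𝓝 s, r ∈ Icc 0 T := Icc_mem_nhds hs.1 hs.2
  have key : ∀ a ∈ Ioo α β, ∀ b ∈ Ioo α β, a ≤ b → deriv (fun r => quantileFn (μ r) a) s =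
      deriv (fun r => quantileFn (μ r) b) s := by
    intro a ha b hb hab
    obtain ⟨a0, hDa, ha0⟩ := hD.exists_between ha.1
    obtain ⟨b0, hDb, hb0⟩ := hD.exists_between hb.2
    have ma : a0 ∈ Ioo α β := ⟨ha0.1, ha0.2.trans ha.2⟩
    have mb : b0 ∈ Ioo α β := ⟨hb.1.trans hb0.1, hb0.2⟩
    have sub : ∀ c ∈ Ioo α β, c ∈ Ioo 0 M := fun c hc => ⟨hα.trans_lt hc.1, hc.2.trans_le hβ⟩
    have hQ : ∀ c ∈ Ioo α β, quantileFn (μ s) c = y := fun c hc => quantileFn_atom hMs hc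
    have hmono : ∀ c ∈ Ioo α β, ∀ d ∈ Ioo α β, c ≤ d →
        ∀ᶠ r in 𝓝 s, quantileFn (μ r) c ≤ quantileFn (μ r) d := fun c hc d hd hcd => by
      filter_upwards [hev] with r hr
      exact quantileFn_mono (hM r hr) (sub c hc).1 hcd (sub d hd).2
    have d1 := hd a0 hDa (sub _ ma)
    have d2 := hd b0 hDb (sub _ mb)
    have e : ∀ c ∈ Ioo α β, a0 ≤ c → c ≤ b0 → deriv (fun r => quantileFn (μ r) c) s =
        deriv (fun r => quantileFn (μ r) a0) s := fun c hc h1 h2 =>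
      deriv_eq_of_sandwich d1 d2 (hmono _ ma _ hc h1) (hmono _ hc _ mb h2)
        ((hQ _ ma).trans (hQ _ hc).symm) ((hQ _ hc).trans (hQ _ mb).symm)
    rw [e a ha ha0.2.le (hab.trans hb0.1.le), e b hb (ha0.2.le.trans hab) hb0.1.le]
  by_cases hne : (Ioo α β).Nonempty
  · obtain ⟨b, hb⟩ := hne
    refine ⟨deriv (fun r => quantileFn (μ r) b) s, fun a ha => ?_⟩
    rcases le_total a b with h | h
    · exact key a ha b hb h
    · exact (key b hb a ha h).symm
  · exact ⟨0, fun a ha => absurd ⟨a, ha⟩ hne⟩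

/-- A function of slope at most `-1` is at least as far from a constant, in mean square, as the
uniform distribution from its centre. -/
lemma cube_le_integral_sq {α β c : ℝ} {ψ : ℝ → ℝ} (hαβ : α ≤ β)
    (hψ : ∀ a ∈ Ioo α β, ∀ b ∈ Ioo α β, a ≤ b → b - a ≤ ψ a - ψ b)
    (hi : IntegrableOn (fun a => (c - ψ a) ^ 2) (Ioo α β)) :
    (β - α) ^ 3 / 12 ≤ ∫ a in Ioo α β, (c - ψ a) ^ 2 := by
  rcases hαβ.eq_or_lt with rfl | hlt
  · simp
  set a0 := (α + β) / 2
  have ha0 : a0 ∈ Ioo α β := ⟨by simp only [a0]; linarith, by simp only [a0]; linarith⟩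
  set d := ψ a0 - c
  -- this is `X ^ 2 ≥ -2 * X * Y - Y ^ 2` for `X = ψ a - c` and `Y = a - a0`;
  -- the term linear in `Y` has integral zero
  have hlow : ∀ a ∈ Ioo α β, (a - a0) ^ 2 - 2 * (a - a0) * d ≤ (c - ψ a) ^ 2 := by
    intro a ha
    have key : (a - a0) * (ψ a - ψ a0) ≤ -(a - a0) ^ 2 := by
      rcases le_total a a0 with h | h
      · have := hψ a ha a0 ha0 h
        nlinarith
      · have := hψ a0 ha0 a ha h
        nlinarith
    have : (a - a0) * (ψ a - c) ≤ -(a - a0) ^ 2 + (a - a0) * d := by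
      simp only [d]; linarith [mul_sub (a - a0) (ψ a) (ψ a0), mul_sub (a - a0) (ψ a0) c,
        mul_sub (a - a0) (ψ a) c]
    nlinarith [sq_nonneg ((ψ a - c) + (a - a0))]
  have hint : ∫ a in Ioo α β, ((a - a0) ^ 2 - 2 * (a - a0) * d) = (β - α) ^ 3 / 12 := by
    rw [← integral_Ioc_eq_integral_Ioo, ← intervalIntegral.integral_of_le hαβ]
    rw [intervalIntegral.integral_eq_sub_of_hasDerivAt (f := fun a => (a - a0) ^ 3 / 3 - (a - a0) ^ 2 * d)]
    · simp only [a0]; ring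
    · intro a _
      have h1 : HasDerivAt (fun a : ℝ => a - a0) 1 a := (hasDerivAt_id a).sub_const a0
      have h2 := ((h1.fun_pow 3).div_const 3).fun_sub ((h1.fun_pow 2).mul_const d)
      refine h2.congr_deriv ?_
      push_cast
      ring
    · exact (Continuous.intervalIntegrable (by fun_prop) _ _)
  rw [← hint]
  refine setIntegral_mono_on ?_ hi measurableSet_Ioo hlow
  exact (Continuous.integrableOn_Icc (by fun_prop)).mono_set Ioo_subset_Icc_self

/-- The atoms are paid for by the square of the difference between the velocity `v` and a field `ψ`
of slope at most `-1`, because `v` is constant on the quantile coordinates of an atom. -/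
lemma tsum_atom_le_integral {μ : FiniteMeasure ℝ} {M : ℝ} {ψ v : ℝ → ℝ}
    (hM : (μ.mass : ℝ) = M)
    (hv : ∀ y, ∃ c, ∀ a ∈ Ioo ((μ : Measure ℝ).real (Iio y)) ((μ : Measure ℝ).real (Iic y)),
      v a = c)
    (hψ : ∀ a ∈ Ioo 0 M, ∀ b ∈ Ioo 0 M, a ≤ b → b - a ≤ ψ a - ψ b)
    (hi : IntegrableOn (fun a => (v a - ψ a) ^ 2) (Ioo 0 M)) :
    ∑' y : ℝ, (1 / 24) * ((μ : Measure ℝ).real {y}) ^ 3 ≤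
      (1 / 2) * ∫ a in Ioo 0 M, (v a - ψ a) ^ 2 := by
  set ν : Measure ℝ := (μ : Measure ℝ)
  have hU : ν.real univ = M := by rw [← hM]; rfl
  have hsub : ∀ y, Ioo (ν.real (Iio y)) (ν.real (Iic y)) ⊆ Ioo 0 M := fun y a ha =>
    ⟨measureReal_nonneg.trans_lt ha.1,
      ha.2.trans_le (by rw [← hU]; exact measureReal_mono (subset_univ _))⟩
  have hdisj : ∀ y z, y < z → Disjoint (Ioo (ν.real (Iio y)) (ν.real (Iic y)))
      (Ioo (ν.real (Iio z)) (ν.real (Iic z))) := fun y z hyz => by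
    refine Set.disjoint_left.2 fun a ha ha' => ?_
    have : ν.real (Iic y) ≤ ν.real (Iio z) :=
      measureReal_mono fun w hw => lt_of_le_of_lt hw hyz
    linarith [ha.2, ha'.1]
  refine Real.tsum_le_of_sum_le (fun y => by positivity) fun u => ?_
  have h1 : ∀ y ∈ u, (1 / 24) * (ν.real {y}) ^ 3 ≤
      (1 / 2) * ∫ a in Ioo (ν.real (Iio y)) (ν.real (Iic y)), (v a - ψ a) ^ 2 := by
    intro y _
    obtain ⟨c, hc⟩ := hv y
    have he : EqOn (fun a => (v a - ψ a) ^ 2) (fun a => (c - ψ a) ^ 2)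
      (Ioo (ν.real (Iio y)) (ν.real (Iic y))) := fun a ha => by simp only [hc a ha]
    rw [setIntegral_congr_fun measurableSet_Ioo he]
    have h2 := cube_le_integral_sq (c := c) (ψ := ψ)
      (measureReal_mono (μ := ν) (Iio_subset_Iic_self : Iio y ⊆ Iic y))
      (fun a ha b hb => hψ a (hsub y ha) b (hsub y hb))
      (((hi.mono_set (hsub y)).congr_fun he measurableSet_Ioo))
    have h3 := measureReal_Iic_eq ν y
    have h4 : ν.real {y} = ν.real (Iic y) - ν.real (Iio y) := by linarith
    rw [h4]; linarith
  refine (Finset.sum_le_sum h1).trans ?_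
  rw [← Finset.mul_sum, ← integral_biUnion_finset u (fun _ _ => measurableSet_Ioo)]
  · refine mul_le_mul_of_nonneg_left ?_ (by norm_num)
    refine setIntegral_mono_set hi (Eventually.of_forall fun a => sq_nonneg _) ?_
    exact (iUnion₂_subset fun y _ => hsub y).eventuallyLE
  · intro y _ z _ hyz
    rcases lt_or_gt_of_ne hyz with h | h
    · exact hdisj y z h
    · exact (hdisj z y h).symm
  · intro y _; exact hi.mono_set (hsub y)

/-- The upper bound of the moment functional: subtracting a field `ψ` of slope at most `-1`
completes the square, and the mixed term depends only on the end points of the path. -/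
lemma momFn_le_of_field {T M : ℝ} (hT : 0 ≤ T) {μ : ℝ → FiniteMeasure ℝ} {ψ q₀ q₁ : ℝ → ℝ} {E : ℝ}
    (hμ : ContinuousOn μ (Icc 0 T)) (hM : ∀ r ∈ Icc 0 T, ((μ r).mass : ℝ) = M)
    (h0 : ∀ a ∈ Ioo 0 M, quantileFn (μ 0) a = q₀ a)
    (h1 : ∀ a ∈ Ioo 0 M, quantileFn (μ T) a = q₁ a)
    (hψ : ∀ a ∈ Ioo 0 M, ∀ b ∈ Ioo 0 M, a ≤ b → b - a ≤ ψ a - ψ b)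
    (hψL : MemLp ψ 2 (volume.restrict (Ioo 0 M)))
    (hE : T * ((1 / 2) * ∫ a in Ioo 0 M, ψ a ^ 2) - ∫ a in Ioo 0 M, ψ a * (q₁ a - q₀ a) = E) :
    momFn T M μ ≤ (E : EReal) := by
  unfold momFn
  split_ifs with hen
  swap
  · exact bot_le
  rw [EReal.coe_le_coe_iff]
  have hM0 : 0 ≤ M := by rw [← hM 0 ⟨le_rfl, hT⟩]; exact NNReal.coe_nonneg _
  obtain ⟨hac, hL2⟩ := hen
  set ν₁ := volume.restrict (Ioo (0 : ℝ) T) with hν₁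
  set ν₂ := volume.restrict (Ioo (0 : ℝ) M) with hν₂
  set v : ℝ → ℝ → ℝ := fun s a => deriv (fun r => quantileFn (μ r) a) s with hv
  have hprod : (volume : Measure (ℝ × ℝ)).restrict (Ioo 0 T ×ˢ Ioo 0 M) = ν₁.prod ν₂ := by
    rw [hν₁, hν₂, Measure.prod_restrict, Measure.volume_eq_prod]
  rw [hprod] at hL2
  have hψ2 : MemLp (fun p : ℝ × ℝ => ψ p.2) 2 (ν₁.prod ν₂) := hψL.comp_snd ν₁
  have iv2 : Integrable (fun p : ℝ × ℝ => (v p.1 p.2) ^ 2) (ν₁.prod ν₂) := hL2.integrable_sq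
  have iψv : Integrable (fun p : ℝ × ℝ => ψ p.2 * v p.1 p.2) (ν₁.prod ν₂) :=
    hψ2.integrable_mul hL2
  have iψ : Integrable (fun a => ψ a ^ 2) ν₂ := hψL.integrable_sq
  have iat := intervalIntegrable_atoms hT hμ hM
  -- velocities of the quantiles on atoms, at almost every time
  have hae : ∀ᵐ s ∂ν₁, ∀ y, ∃ c, ∀ a ∈ Ioo ((μ s : Measure ℝ).real (Iio y))
      ((μ s : Measure ℝ).real (Iic y)), v s a = c := by
    -- Almost every quantile is absolutely continuous in time. A countable dense set of those has
    -- velocities at almost every time, and `deriv_quantileFn_atom` takes care of the others.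
    have hG := (ae_restrict_iff' measurableSet_Ioo).1 hac
    obtain ⟨D, hDsub, hDc, hDd⟩ := (Measure.dense_of_ae hG).exists_countable_dense_subset
    have h2 : ∀ᵐ s : ℝ, ∀ a ∈ D, a ∈ Ioo 0 M → s ∈ uIcc 0 T →
        DifferentiableAt ℝ (fun r => quantileFn (μ r) a) s := by
      rw [ae_ball_iff hDc]
      intro a ha
      by_cases haM : a ∈ Ioo 0 M
      · filter_upwards [(hDsub ha haM).ae_differentiableAt] with s hs _ hs' using hs hs'
      · exact Eventually.of_forall fun s h => absurd h haM
    filter_upwards [ae_restrict_of_ae h2, ae_restrict_mem measurableSet_Ioo] with s hs hsT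
    refine deriv_quantileFn_atom hDd hM hsT fun a ha haM => hs a ha haM ?_
    rw [uIcc_of_le hT]; exact Ioo_subset_Icc_self hsT
  have hkey : ∀ᵐ s ∂ν₁, (∑' y : ℝ, (1 / 24) * ((μ s : Measure ℝ).real {y}) ^ 3) -
      (∫ a in (0 : ℝ)..M, (1 / 2) * (v s a) ^ 2) ≤
      (1 / 2) * (∫ a, ψ a ^ 2 ∂ν₂) - ∫ a, ψ a * v s a ∂ν₂ := by
    filter_upwards [hae, ae_restrict_mem measurableSet_Ioo, iv2.prod_right_ae, iψv.prod_right_ae]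
      with s hs hsT i1 i2
    have e : (fun a => (v s a - ψ a) ^ 2) =
        fun a => ((v s a) ^ 2 + ψ a ^ 2) - 2 * (ψ a * v s a) := by
      ext a; ring
    have i3 : Integrable (fun a => (v s a - ψ a) ^ 2) ν₂ := by
      rw [e]; exact (i1.add iψ).sub (i2.const_mul 2)
    have h3 := tsum_atom_le_integral (hM s (Ioo_subset_Icc_self hsT)) hs hψ i3
    have h4 : ∫ a, (v s a - ψ a) ^ 2 ∂ν₂ =
        ((∫ a, (v s a) ^ 2 ∂ν₂) + ∫ a, ψ a ^ 2 ∂ν₂) - 2 * ∫ a, ψ a * v s a ∂ν₂ := by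
      rw [e, integral_sub (f := fun a => (v s a) ^ 2 + ψ a ^ 2) (i1.add iψ) (i2.const_mul 2),
        integral_add i1 iψ, integral_const_mul]
    have h5 : ∫ a in (0 : ℝ)..M, (1 / 2) * (v s a) ^ 2 = (1 / 2) * ∫ a, (v s a) ^ 2 ∂ν₂ := by
      rw [intervalIntegral.integral_of_le hM0, integral_Ioc_eq_integral_Ioo, integral_const_mul]
    rw [h5]
    rw [h4] at h3
    linarith
  have h5 : ∀ s, ∫ a in (0 : ℝ)..M, (1 / 2) * (v s a) ^ 2 = (1 / 2) * ∫ a, (v s a) ^ 2 ∂ν₂ := by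
    intro s
    rw [intervalIntegral.integral_of_le hM0, integral_Ioc_eq_integral_Ioo, integral_const_mul]
  have iL : Integrable (fun s => (∑' y : ℝ, (1 / 24) * ((μ s : Measure ℝ).real {y}) ^ 3) -
      (∫ a in (0 : ℝ)..M, (1 / 2) * (v s a) ^ 2)) ν₁ := by
    simp only [h5]
    exact iat.sub (iv2.integral_prod_left.const_mul _)
  have iR : Integrable (fun s => (1 / 2) * (∫ a, ψ a ^ 2 ∂ν₂) - ∫ a, ψ a * v s a ∂ν₂) ν₁ :=
    (integrable_const _).sub iψv.integral_prod_left
  rw [intervalIntegral.integral_of_le hT, integral_Ioc_eq_integral_Ioo]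
  refine (integral_mono_ae iL iR hkey).trans (le_of_eq ?_)
  rw [integral_sub (integrable_const _) iψv.integral_prod_left, integral_integral_swap iψv, ← hE]
  have h6 : ∫ a, ∫ s, ψ a * v s a ∂ν₁ ∂ν₂ = ∫ a in Ioo 0 M, ψ a * (q₁ a - q₀ a) := by
    refine integral_congr_ae ?_
    filter_upwards [hac, ae_restrict_mem measurableSet_Ioo] with a ha haM
    rw [integral_const_mul, hν₁, ← integral_Ioc_eq_integral_Ioo,
      ← intervalIntegral.integral_of_le hT]
    simp only [hv]
    rw [ha.integral_deriv_eq_sub, h0 a haM, h1 a haM]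
  rw [h6, integral_const]
  simp [hν₁, hν₂, Measure.real, hT]
end

noncomputable section
open Set Filter Topology MeasureTheory

/-! ### Blocks of the mass line -/

section blocks
variable {ι : Type*} [Fintype ι] [LinearOrder ι]

/-- The mass strictly to the left of the point mass `c`; the quantile coordinates of `c` are
`(lowMass m c, lowMass m c + m c]`. -/
def lowMass (m : ι → ℝ) (c : ι) : ℝ := ∑ c' with c' < c, m c'

lemma lowMass_add (m : ι → ℝ) (c : ι) : lowMass m c + m c = ∑ c' with c' ≤ c, m c' := by
  have : (Finset.univ.filter fun c' => c' ≤ c) = insert c (Finset.univ.filter fun c' => c' < c) := by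
    ext c'; simp [le_iff_eq_or_lt]
  rw [this, Finset.sum_insert (by simp), lowMass, add_comm]

variable {m : ι → ℝ}

lemma lowMass_nonneg (hm : ∀ c, 0 ≤ m c) (c : ι) : 0 ≤ lowMass m c := Finset.sum_nonneg fun c _ => hm c

lemma lowMass_add_le (hm : ∀ c, 0 ≤ m c) {c c' : ι} (h : c < c') : lowMass m c + m c ≤ lowMass m c' := by
  rw [lowMass_add]
  refine Finset.sum_le_sum_of_subset_of_nonneg (fun d hd => ?_) fun d _ _ => hm d
  simp only [Finset.mem_filter, Finset.mem_univ, true_and] at hd ⊢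
  exact hd.trans_lt h

lemma lowMass_add_le_sum (hm : ∀ c, 0 ≤ m c) (c : ι) : lowMass m c + m c ≤ ∑ c, m c := by
  rw [lowMass_add]
  exact Finset.sum_le_sum_of_subset_of_nonneg (Finset.filter_subset _ _) fun d _ _ => hm d

lemma block_disjoint (hm : ∀ c, 0 ≤ m c) : Pairwise (Function.onFun Disjoint fun c =>
    Ioc (lowMass m c) (lowMass m c + m c)) := by
  have key : ∀ c c' : ι, c < c' → Disjoint (Ioc (lowMass m c) (lowMass m c + m c))
      (Ioc (lowMass m c') (lowMass m c' + m c')) := fun c c' h =>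
    Set.disjoint_left.2 fun a ha ha' => by
      have := lowMass_add_le hm h
      linarith [ha.2, ha'.1]
  intro c c' hne
  rcases lt_or_gt_of_ne hne with h | h
  · exact key c c' h
  · exact (key c' c h).symm

/-- A point mass with one below it has a predecessor. -/
lemma exists_lowMass_pred {c c₀ : ι} (h : c₀ < c) :
    ∃ d, c₀ ≤ d ∧ d < c ∧ lowMass m d + m d = lowMass m c := by
  have hn : (Finset.univ.filter fun c' => c' < c).Nonempty := ⟨c₀, by simpa using h⟩
  have hd := Finset.max'_mem _ hn
  have hle := Finset.le_max' (Finset.univ.filter fun c' => c' < c)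
  set d := Finset.max' _ hn
  simp only [Finset.mem_filter, Finset.mem_univ, true_and] at hd hle
  refine ⟨d, hle _ h, hd, ?_⟩
  rw [lowMass_add, lowMass]
  congr 1
  ext c'
  simp only [Finset.mem_filter, Finset.mem_univ, true_and]
  exact ⟨fun h => h.trans_lt hd, fun h => hle c' h⟩

lemma exists_block {a : ℝ} (ha : a ∈ Ioc 0 (∑ c, m c)) :
    ∃ c, a ∈ Ioc (lowMass m c) (lowMass m c + m c) := by
  have hne : (Finset.univ.filter fun c => a ≤ lowMass m c + m c).Nonempty := by
    have hn : (Finset.univ : Finset ι).Nonempty := by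
      by_contra h
      rw [Finset.not_nonempty_iff_eq_empty] at h
      have := ha.1.trans_le ha.2
      rw [h] at this; simp at this
    refine ⟨Finset.univ.max' hn, ?_⟩
    simp only [Finset.mem_filter, Finset.mem_univ, true_and]
    rw [lowMass_add]
    refine ha.2.trans (le_of_eq ?_)
    congr 1
    ext c
    simp [Finset.le_max' _ c (Finset.mem_univ c)]
  have hc := Finset.min'_mem _ hne
  have hmin := Finset.min'_le (Finset.univ.filter fun c => a ≤ lowMass m c + m c)
  set c := Finset.min' _ hne
  simp only [Finset.mem_filter, Finset.mem_univ, true_and] at hc hmin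
  refine ⟨c, ?_, hc⟩
  by_contra hlt
  push Not at hlt
  obtain ⟨c₀, h⟩ : ∃ c₀, c₀ < c := by
    by_contra h
    push Not at h
    have h0 : lowMass m c = 0 := by
      rw [lowMass, Finset.filter_false_of_mem fun c' _ => not_lt.2 (h c')]; simp
    linarith [ha.1]
  obtain ⟨d, -, hd, he⟩ := exists_lowMass_pred (m := m) h
  exact absurd hd (not_lt.2 (hmin d (by linarith)))

lemma iUnion_blocks (hm : ∀ c, 0 ≤ m c) :
    ⋃ c, Ioc (lowMass m c) (lowMass m c + m c) = Ioc 0 (∑ c, m c) := by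
  ext a
  constructor
  · rw [mem_iUnion]
    rintro ⟨c, hc⟩
    exact ⟨(lowMass_nonneg hm c).trans_lt hc.1, hc.2.trans (lowMass_add_le_sum hm c)⟩
  · intro ha; exact mem_iUnion.2 (exists_block ha)

/-- An integral over the quantile coordinate is the sum of the integrals over the blocks. -/
lemma integral_blocks (hm : ∀ c, 0 ≤ m c) {H : ℝ → ℝ} {G : ι → ℝ → ℝ} (hG : ∀ c, Continuous (G c))
    (h : ∀ c, ∀ a ∈ Ioc (lowMass m c) (lowMass m c + m c), H a = G c a) :
    ∫ a in Ioo 0 (∑ c, m c), H a = ∑ c, ∫ a in lowMass m c..lowMass m c + m c, G c a := by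
  rw [← integral_Ioc_eq_integral_Ioo, ← iUnion_blocks hm,
    integral_iUnion_fintype (fun _ => measurableSet_Ioc) (block_disjoint hm)]
  · refine Finset.sum_congr rfl fun c _ => ?_
    rw [intervalIntegral.integral_of_le (by linarith [hm c])]
    exact setIntegral_congr_fun measurableSet_Ioc (h c)
  · intro c
    refine IntegrableOn.congr_fun ?_ (fun a ha => (h c a ha).symm) measurableSet_Ioc
    exact ((hG c).integrableOn_Icc).mono_set Ioc_subset_Icc_self

/-- The function equal to `G c` on the quantile coordinates of `c`. -/
def blockFn (m : ι → ℝ) (G : ι → ℝ → ℝ) (a : ℝ) : ℝ :=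
  ∑ c, indicator (Ioc (lowMass m c) (lowMass m c + m c)) (G c) a

lemma blockFn_eq (hm : ∀ c, 0 ≤ m c) (G : ι → ℝ → ℝ) {c : ι} {a : ℝ}
    (ha : a ∈ Ioc (lowMass m c) (lowMass m c + m c)) : blockFn m G a = G c a := by
  rw [blockFn, Finset.sum_eq_single c]
  · rw [indicator_of_mem ha]
  · intro d _ hd
    exact indicator_of_notMem (fun h => Set.disjoint_left.1 (block_disjoint hm hd) h ha) _
  · simp

lemma measurable_blockFn {G : ι → ℝ → ℝ} (hG : ∀ c, Continuous (G c)) :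
    Measurable (blockFn m G) :=
  Finset.measurable_fun_sum _ fun c _ => (hG c).measurable.indicator measurableSet_Ioc

lemma memLp_blockFn {G : ι → ℝ → ℝ} (hG : ∀ c, Continuous (G c)) :
    MemLp (blockFn m G) 2 (volume.restrict (Ioo 0 (∑ c, m c))) := by
  have hb : ∀ c, ∃ C, ∀ a ∈ Icc (lowMass m c) (lowMass m c + m c), ‖G c a‖ ≤ C := fun c =>
    isCompact_Icc.exists_bound_of_continuousOn (hG c).continuousOn
  choose C hC using hb
  refine MemLp.of_bound (measurable_blockFn hG).aestronglyMeasurable (∑ c, |C c|) ?_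
  refine Eventually.of_forall fun a => (norm_sum_le _ _).trans (Finset.sum_le_sum fun c _ => ?_)
  by_cases ha : a ∈ Ioc (lowMass m c) (lowMass m c + m c)
  · rw [indicator_of_mem ha]
    exact (hC c a (Ioc_subset_Icc_self ha)).trans (le_abs_self _)
  · rw [indicator_of_notMem ha]; simp

/-- The quantile function of `∑ m_c δ_{y_c}` has the value `y_c` on the quantile coordinates of `c`.
-/
lemma quantileFn_sum_dirac (hm : ∀ c, 0 ≤ m c) {y : ι → ℝ} (hy : Monotone y) {μ : FiniteMeasure ℝ}
    (hμ : (μ : Measure ℝ) = ∑ c, ENNReal.ofReal (m c) • Measure.dirac (y c)) {c : ι} {a : ℝ}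
    (ha : a ∈ Ioc (lowMass m c) (lowMass m c + m c)) : quantileFn μ a = y c := by
  have hF : ∀ z, (μ : Measure ℝ).real (Iic z) = ∑ c with y c ≤ z, m c := by
    intro z
    rw [Measure.real, hμ, Measure.coe_finsetSum, Finset.sum_apply, ENNReal.toReal_sum, Finset.sum_filter]
    · refine Finset.sum_congr rfl fun c _ => ?_
      rw [Measure.smul_apply, Measure.dirac_apply' _ measurableSet_Iic]
      by_cases h : y c ≤ z
      · simp [h, hm c]
      · simp [h]
    · intro c _
      rw [Measure.smul_apply, smul_eq_mul]
      exact ENNReal.mul_ne_top ENNReal.ofReal_ne_top (measure_ne_top _ _)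
  have : {z : ℝ | a ≤ (μ : Measure ℝ).real (Iic z)} = Ici (y c) := by
    ext z
    simp only [mem_ofPred_eq, mem_Ici, hF]
    constructor
    · intro h
      by_contra hlt
      push Not at hlt
      have : ∑ c with y c ≤ z, m c ≤ lowMass m c := by
        refine Finset.sum_le_sum_of_subset_of_nonneg (fun d hd => ?_) fun d _ _ => hm d
        simp only [Finset.mem_filter, Finset.mem_univ, true_and] at hd ⊢
        by_contra hle
        exact absurd (hy (not_lt.1 hle)) (not_le.2 (hd.trans_lt hlt))
      linarith [ha.1]
    · intro h
      have : lowMass m c + m c ≤ ∑ c with y c ≤ z, m c := by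
        rw [lowMass_add]
        refine Finset.sum_le_sum_of_subset_of_nonneg (fun d hd => ?_) fun d _ _ => hm d
        simp only [Finset.mem_filter, Finset.mem_univ, true_and] at hd ⊢
        exact (hy hd).trans h
      exact ha.2.trans this
  rw [quantileFn, this, csInf_Ici]

/-- The velocity intervals of the point masses between `c` and `d` fit between theirs. -/
lemma lowMass_sub_le {v : ι → ℝ}
    (hv : ∀ c c', c < c' → v c' + m c' / 2 ≤ v c - m c / 2) {c d : ι} (hcd : c ≤ d) :
    lowMass m d - lowMass m c ≤ (v c + m c / 2) - (v d + m d / 2) := by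
  induction d using WellFoundedLT.induction with
  | ind d ih =>
    rcases hcd.eq_or_lt with rfl | h
    · linarith
    · obtain ⟨e, h1, h2, h3⟩ := exists_lowMass_pred (m := m) h
      have := ih e h2 h1
      have := hv e d h2
      linarith

/-- The value of the moment functional that the velocity centres `v` certify. -/
def certificate (ξ T : ℝ) (x m v : ι → ℝ) : ℝ :=
  ∑ c, (T / 2 * (m c * v c ^ 2 + m c ^ 3 / 12) + (x c - ξ) * (m c * v c))

/-- The upper bound of `LSHE`: the field is affine of slope `-1` on the quantile coordinates of each
point mass, where it runs through the velocity interval downwards, and jumps down between them since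
the velocity intervals are disjoint and in decreasing order. -/
lemma LSHE_le_certificate (hm : ∀ c, 0 ≤ m c) {ξ T : ℝ} {x v : ι → ℝ} (hT : 0 ≤ T)
    (hx : Monotone x)
    (hv : ∀ c c', c < c' → v c' + m c' / 2 ≤ v c - m c / 2) :
    LSHE ξ T x m ≤ (certificate ξ T x m v : EReal) := by
  refine sSup_le ?_
  rintro _ ⟨μ, hμ, hM, h0, h1, rfl⟩
  set G : ι → ℝ → ℝ := fun c a => v c + m c / 2 - (a - lowMass m c)
  have hG : ∀ c, Continuous (G c) := fun c => by fun_prop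
  have hblk : ∀ a ∈ Ioo 0 (∑ c, m c), ∃ c, a ∈ Ioc (lowMass m c) (lowMass m c + m c) :=
    fun a ha => exists_block ⟨ha.1, ha.2.le⟩
  refine momFn_le_of_field (ψ := blockFn m G) (q₀ := blockFn m fun c _ => x c)
    (q₁ := blockFn m fun _ _ => ξ) hT hμ hM ?_ ?_ ?_ (memLp_blockFn hG) ?_
  · intro a ha
    obtain ⟨c, hc⟩ := hblk a ha
    rw [blockFn_eq hm _ hc, quantileFn_sum_dirac hm hx h0 hc]
  · intro a ha
    obtain ⟨c, hc⟩ := hblk a ha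
    rw [blockFn_eq hm _ hc]
    refine quantileFn_sum_dirac hm (y := fun _ => ξ) (fun _ _ _ => le_rfl) ?_ hc
    rw [h1, ENNReal.ofReal_sum_of_nonneg fun c _ => hm c, Finset.sum_smul]
  · intro a ha b hb hab
    obtain ⟨c, hc⟩ := hblk a ha
    obtain ⟨d, hd⟩ := hblk b hb
    rw [blockFn_eq hm _ hc, blockFn_eq hm _ hd]
    simp only [G]
    rcases lt_trichotomy c d with h | h | h
    · have := lowMass_sub_le hv h.le
      linarith
    · subst h; linarith
    · have := lowMass_add_le hm h
      linarith [hd.2, hc.1]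
  · have e1 : ∫ a in Ioo 0 (∑ c, m c), blockFn m G a ^ 2 =
        ∑ c, (m c * v c ^ 2 + m c ^ 3 / 12) := by
      rw [integral_blocks hm (G := fun c a => G c a ^ 2) (fun c => (hG c).pow 2)
        fun c a ha => by rw [blockFn_eq hm _ ha]]
      refine Finset.sum_congr rfl fun c _ => ?_
      rw [intervalIntegral.integral_eq_sub_of_hasDerivAt
        (f := fun a => -(v c + m c / 2 - (a - lowMass m c)) ^ 3 / 3)]
      · ring
      · intro a _
        have h1 : HasDerivAt (fun a : ℝ => v c + m c / 2 - (a - lowMass m c)) (-1) a :=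
          ((hasDerivAt_id a).sub_const _).const_sub _
        refine ((h1.fun_pow 3).fun_neg.div_const 3).congr_deriv ?_
        simp only [G]; push_cast; ring
      · exact ((hG c).pow 2).intervalIntegrable _ _
    have e2 : ∫ a in Ioo 0 (∑ c, m c), blockFn m G a *
        (blockFn m (fun _ _ => ξ) a - blockFn m (fun c _ => x c) a) =
        ∑ c, (ξ - x c) * (m c * v c) := by
      rw [integral_blocks hm (G := fun c a => G c a * (ξ - x c)) (fun c => (hG c).mul_const _)
        fun c a ha => by rw [blockFn_eq hm _ ha, blockFn_eq hm _ ha, blockFn_eq hm _ ha]]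
      refine Finset.sum_congr rfl fun c _ => ?_
      rw [intervalIntegral.integral_eq_sub_of_hasDerivAt
        (f := fun a => -(v c + m c / 2 - (a - lowMass m c)) ^ 2 / 2 * (ξ - x c))]
      · ring
      · intro a _
        have h1 : HasDerivAt (fun a : ℝ => v c + m c / 2 - (a - lowMass m c)) (-1) a :=
          ((hasDerivAt_id a).sub_const _).const_sub _
        refine (((h1.fun_pow 2).fun_neg.div_const 2).mul_const (ξ - x c)).congr_deriv ?_
        simp only [G]; push_cast; ring
      · exact ((hG c).mul_const _).intervalIntegrable _ _
    rw [e1, e2, certificate, Finset.mul_sum, Finset.mul_sum, ← Finset.sum_sub_distrib]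
    refine Finset.sum_congr rfl fun c _ => ?_
    ring

end blocks
end

noncomputable section
open Set Filter Topology MeasureTheory

/-! ### The path of the clusters attains the certificate -/

section attain
variable {ι : Type*} [LinearOrder ι]

/-- If the velocity intervals of the point masses in `S` are adjacent, with right end `K`, then the
first and second moments telescope. -/
lemma block_moments {m v : ι → ℝ} {K : ℝ} (S : Finset ι)
    (h : ∀ c ∈ S, v c = K - (∑ c' ∈ S with c' < c, m c') - m c / 2) :
    ∑ c ∈ S, m c * v c = K * (∑ c ∈ S, m c) - (∑ c ∈ S, m c) ^ 2 / 2 ∧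
    ∑ c ∈ S, (m c * v c ^ 2 + m c ^ 3 / 12) = (K ^ 3 - (K - ∑ c ∈ S, m c) ^ 3) / 3 := by
  induction S using Finset.induction_on_max with
  | empty => simp
  | insert a S ha ih =>
    have haS : a ∉ S := fun h => lt_irrefl _ (ha a h)
    have h1 : ∀ c ∈ S, v c = K - (∑ c' ∈ S with c' < c, m c') - m c / 2 := by
      intro c hc
      rw [h c (Finset.mem_insert_of_mem hc), Finset.filter_insert, if_neg (not_lt.2 (ha c hc).le)]
    have h2 : v a = K - (∑ c ∈ S, m c) - m a / 2 := by
      rw [h a (Finset.mem_insert_self a S), Finset.filter_insert, if_neg (lt_irrefl a),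
        Finset.filter_true_of_mem ha]
    obtain ⟨i1, i2⟩ := ih h1
    rw [Finset.sum_insert haS, Finset.sum_insert haS, Finset.sum_insert haS, i1, i2, h2]
    constructor <;> ring

variable [Fintype ι]

/-- Equality in the completed square, for clusters at positions `y` which move with the block
averages `w` of `v` and whose velocity intervals are adjacent within each block. -/
lemma cluster_energy {m v w y : ι → ℝ} (hm : ∀ c, 0 < m c)
    (hw : ∀ c, w c = (∑ c' with y c' = y c, m c' * v c') / ∑ c' with y c' = y c, m c')
    (hblk : ∀ z, ∃ K, ∀ c, y c = z →
      v c = K - (∑ c' with y c' = z ∧ c' < c, m c') - m c / 2) :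
    (∑ z ∈ Finset.univ.image y, (1 / 24) * (∑ c with y c = z, m c) ^ 3) -
        ∑ c, m c * ((1 / 2) * w c ^ 2) =
      (1 / 2) * (∑ c, (m c * v c ^ 2 + m c ^ 3 / 12)) - ∑ c, m c * v c * w c := by
  have hf : ∀ f : ι → ℝ, ∑ c, f c = ∑ z ∈ Finset.univ.image y, ∑ c with y c = z, f c := fun f =>
    (Finset.sum_fiberwise_of_maps_to (fun c _ => Finset.mem_image_of_mem y (Finset.mem_univ c))
      f).symm
  rw [hf fun c => m c * ((1 / 2) * w c ^ 2), hf fun c => m c * v c ^ 2 + m c ^ 3 / 12,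
    hf fun c => m c * v c * w c, Finset.mul_sum, ← Finset.sum_sub_distrib,
    ← Finset.sum_sub_distrib]
  refine Finset.sum_congr rfl fun z hz => ?_
  obtain ⟨c₀, -, hc₀⟩ := Finset.mem_image.1 hz
  set S := Finset.univ.filter fun c => y c = z
  obtain ⟨K, hK⟩ := hblk z
  have hS : ∀ c ∈ S, v c = K - (∑ c' ∈ S with c' < c, m c') - m c / 2 := fun c hc => by
    rw [Finset.filter_filter]; exact hK c (Finset.mem_filter.1 hc).2
  obtain ⟨h1, h2⟩ := block_moments S hS
  have hpos : 0 < ∑ c ∈ S, m c :=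
    Finset.sum_pos (fun c _ => hm c) ⟨c₀, Finset.mem_filter.2 ⟨Finset.mem_univ _, hc₀⟩⟩
  set M := ∑ c ∈ S, m c
  have hwS : ∀ c ∈ S, w c = K - M / 2 := fun c hc => by
    have hcz := (Finset.mem_filter.1 hc).2
    have hsum : ∑ c' with y c' = z, m c' = M := rfl
    rw [hw c, hcz, h1, hsum]
    field_simp
  have e1 : ∑ c ∈ S, m c * ((1 / 2) * w c ^ 2) = M * ((1 / 2) * (K - M / 2) ^ 2) := by
    rw [Finset.sum_mul]
    exact Finset.sum_congr rfl fun c hc => by rw [hwS c hc]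
  have e2 : ∑ c ∈ S, m c * v c * w c = (K * M - M ^ 2 / 2) * (K - M / 2) := by
    rw [← h1, Finset.sum_mul]
    exact Finset.sum_congr rfl fun c hc => by rw [hwS c hc]
  rw [e1, e2, h2]
  ring

lemma lipschitzOn_of_right_deriv {f f' : ℝ → ℝ} {τ C : ℝ} (hf : ContinuousOn f (Icc 0 τ))
    (hf' : ∀ s ∈ Ico 0 τ, HasDerivWithinAt f (f' s) (Ici s) s) (hC : ∀ s ∈ Ico 0 τ, |f' s| ≤ C)
    (hC0 : 0 ≤ C) : LipschitzOnWith (Real.toNNReal C) f (Icc 0 τ) := by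
  have key : ∀ a ∈ Icc 0 τ, ∀ b ∈ Icc 0 τ, a ≤ b → |f b - f a| ≤ C * (b - a) := by
    intro a ha b hb hab
    exact norm_image_sub_le_of_norm_deriv_right_le_segment
      (hf.mono (Icc_subset_Icc ha.1 hb.2)) (fun s hs => hf' s ⟨ha.1.trans hs.1, hs.2.trans_le hb.2⟩)
      (fun s hs => hC s ⟨ha.1.trans hs.1, hs.2.trans_le hb.2⟩) b ⟨hab, le_rfl⟩
  refine LipschitzOnWith.of_dist_le_mul fun a ha b hb => ?_
  rw [Real.dist_eq, Real.dist_eq, Real.coe_toNNReal _ hC0]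
  rcases le_total a b with h | h
  · rw [abs_sub_comm (f a), abs_sub_comm a, abs_of_nonneg (sub_nonneg.2 h)]
    exact key a ha b hb h
  · rw [abs_of_nonneg (sub_nonneg.2 h)]
    exact key b hb a ha h

variable {κ : Type*} [Fintype κ]

/-- The finite measure `∑ m_c δ_{y_c}`. -/
def atomic (m y : κ → ℝ) : FiniteMeasure ℝ :=
  ∑ c, (m c).toNNReal • (diracProba (y c)).toFiniteMeasure

lemma atomic_toMeasure (m y : κ → ℝ) :
    (atomic m y : Measure ℝ) = ∑ c, ENNReal.ofReal (m c) • Measure.dirac (y c) := by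
  rw [atomic, FiniteMeasure.toMeasure_sum]
  rfl

lemma mass_atomic {m : κ → ℝ} (hm : ∀ c, 0 ≤ m c) (y : κ → ℝ) :
    ((atomic m y).mass : ℝ) = ∑ c, m c := by
  have h : ((atomic m y).mass : ENNReal) = ENNReal.ofReal (∑ c, m c) := by
    rw [FiniteMeasure.ennreal_mass, atomic_toMeasure, Measure.coe_finsetSum, Finset.sum_apply,
      ENNReal.ofReal_sum_of_nonneg fun c _ => hm c]
    simp
  have := congrArg ENNReal.toReal h
  rwa [ENNReal.toReal_ofReal (Finset.sum_nonneg fun c _ => hm c), ENNReal.coe_toReal] at this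

lemma atomic_singleton {m : κ → ℝ} (hm : ∀ c, 0 ≤ m c) (y : κ → ℝ) (z : ℝ) :
    (atomic m y : Measure ℝ).real {z} = ∑ c with y c = z, m c := by
  rw [Measure.real, atomic_toMeasure, Measure.coe_finsetSum, Finset.sum_apply, ENNReal.toReal_sum,
    Finset.sum_filter]
  · refine Finset.sum_congr rfl fun c _ => ?_
    rw [Measure.smul_apply, Measure.dirac_apply' _ (measurableSet_singleton z)]
    by_cases h : y c = z
    · simp [h, hm c]
    · simp [h]
  · intro c _
    rw [Measure.smul_apply, smul_eq_mul]
    exact ENNReal.mul_ne_top ENNReal.ofReal_ne_top (measure_ne_top _ _)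

lemma tsum_atomic {m : κ → ℝ} (hm : ∀ c, 0 ≤ m c) (y : κ → ℝ) :
    ∑' z : ℝ, (1 / 24) * ((atomic m y : Measure ℝ).real {z}) ^ 3 =
      ∑ z ∈ Finset.univ.image y, (1 / 24) * (∑ c with y c = z, m c) ^ 3 := by
  simp only [atomic_singleton hm]
  refine tsum_eq_sum fun z hz => ?_
  rw [Finset.filter_false_of_mem fun c _ h => hz (Finset.mem_image.2 ⟨c, Finset.mem_univ c, h⟩)]
  simp

lemma continuousOn_atomic (m : κ → ℝ) {ζ : κ → ℝ → ℝ} {A : Set ℝ}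
    (h : ∀ c, ContinuousOn (ζ c) A) : ContinuousOn (fun s => atomic m fun c => ζ c s) A := by
  unfold atomic
  refine continuousOn_finsetSum _ fun c _ => ?_
  have := (ProbabilityMeasure.toFiniteMeasure_continuous.comp
    (continuous_diracProba (X := ℝ))).comp_continuousOn (h c)
  exact ContinuousOn.const_smul (M := NNReal) this _

/-- The lower bound of `LSHE`: a flow of clusters to `ξ` whose velocities are the block averages of
`v`, with adjacent velocity intervals in each block, attains the certificate. -/
lemma certificate_le_LSHE {ξ τ : ℝ} {x m v : ι → ℝ} {ζ : ι → ℝ → ℝ} (hτ : 0 ≤ τ)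
    (hm : ∀ c, 0 < m c) (h0 : ∀ c, ζ c 0 = x c) (h1 : ∀ c, ζ c τ = ξ)
    (hmono : ∀ s ∈ Icc 0 τ, Monotone fun c => ζ c s)
    (hcont : ∀ c, ContinuousOn (ζ c) (Icc 0 τ))
    (hder : ∀ c, ∀ s ∈ Ico 0 τ, HasDerivWithinAt (ζ c)
      ((∑ c' with ζ c' s = ζ c s, m c' * v c') / ∑ c' with ζ c' s = ζ c s, m c') (Ici s) s)
    (hblk : ∀ s ∈ Ico 0 τ, ∀ z, ∃ K, ∀ c, ζ c s = z →
      v c = K - (∑ c' with ζ c' s = z ∧ c' < c, m c') - m c / 2) :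
    (certificate ξ τ x m v : EReal) ≤ LSHE ξ τ x m := by
  have hm' : ∀ c, 0 ≤ m c := fun c => (hm c).le
  set M := ∑ c, m c with hMdef
  have hM0 : 0 ≤ M := Finset.sum_nonneg fun c _ => hm' c
  set μ : ℝ → FiniteMeasure ℝ := fun s => atomic m fun c => ζ c s with hμ
  refine le_sSup_of_le ⟨μ, continuousOn_atomic m hcont, fun s _ => mass_atomic hm' _, ?_, ?_, rfl⟩ ?_
  · simp only [hμ, atomic_toMeasure, h0]
  · simp only [hμ, atomic_toMeasure, h1]
    rw [ENNReal.ofReal_sum_of_nonneg fun c _ => hm' c, Finset.sum_smul]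
  set w : ι → ℝ → ℝ := fun c s =>
    (∑ c' with ζ c' s = ζ c s, m c' * v c') / ∑ c' with ζ c' s = ζ c s, m c' with hw
  set C := ∑ c, |v c| with hC
  have hC0 : 0 ≤ C := Finset.sum_nonneg fun c _ => abs_nonneg _
  have hwC : ∀ c s, |w c s| ≤ C := by
    intro c s
    have hpos : 0 < ∑ c' with ζ c' s = ζ c s, m c' :=
      Finset.sum_pos (fun c _ => hm c) ⟨c, by simp⟩
    rw [hw, abs_div, abs_of_pos hpos, div_le_iff₀ hpos, Finset.mul_sum]
    refine (Finset.abs_sum_le_sum_abs _ _).trans (Finset.sum_le_sum fun c' _ => ?_)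
    rw [abs_mul, abs_of_pos (hm c'), mul_comm]
    exact mul_le_mul_of_nonneg_right
      (Finset.single_le_sum (f := fun c => |v c|) (fun c _ => abs_nonneg _) (Finset.mem_univ c'))
      (hm' c')
  have hlip : ∀ c, LipschitzOnWith (Real.toNNReal C) (ζ c) (Icc 0 τ) := fun c =>
    lipschitzOn_of_right_deriv (hcont c) (hder c) (fun s _ => hwC c s) hC0
  have hac : ∀ c, AbsolutelyContinuousOnInterval (ζ c) 0 τ := fun c =>
    LipschitzOnWith.absolutelyContinuousOnInterval (by rw [uIcc_of_le hτ]; exact hlip c)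
  have hdw : ∀ c, ∀ s ∈ Ioo 0 τ, DifferentiableAt ℝ (ζ c) s → deriv (ζ c) s = w c s :=
    fun c s hs hd => (uniqueDiffOn_Ici s s self_mem_Ici).eq_deriv _
      hd.hasDerivAt.hasDerivWithinAt (hder c s ⟨hs.1.le, hs.2⟩)
  have hdC : ∀ c, ∀ s ∈ Ioo 0 τ, |deriv (ζ c) s| ≤ C := by
    intro c s hs
    -- where the path is not differentiable, `deriv` has its default value zero
    by_cases hd : DifferentiableAt ℝ (ζ c) s
    · rw [hdw c s hs hd]; exact hwC c s
    · rw [deriv_zero_of_not_differentiableAt hd, abs_zero]; exact hC0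
  have hq : ∀ c, ∀ a ∈ Ioc (lowMass m c) (lowMass m c + m c), ∀ s ∈ Icc 0 τ,
      quantileFn (μ s) a = ζ c s := fun c a ha s hs =>
    quantileFn_sum_dirac hm' (hmono s hs) (atomic_toMeasure _ _) ha
  have hdq : ∀ c, ∀ a ∈ Ioc (lowMass m c) (lowMass m c + m c), ∀ s ∈ Ioo 0 τ,
      deriv (fun r => quantileFn (μ r) a) s = deriv (ζ c) s := fun c a ha s hs => by
    refine Filter.EventuallyEq.deriv_eq ?_
    filter_upwards [Icc_mem_nhds hs.1 hs.2] with r hr using hq c a ha r hr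
  have hen : HasFiniteEnergy τ M μ := by
    refine ⟨?_, ?_⟩
    · filter_upwards [ae_restrict_mem measurableSet_Ioo] with a ha
      obtain ⟨c, hc⟩ := exists_block ⟨ha.1, ha.2.le⟩
      refine LipschitzOnWith.absolutelyContinuousOnInterval (K := Real.toNNReal C) ?_
      rw [uIcc_of_le hτ]
      intro s hs r hr
      simp only [hq c a hc s hs, hq c a hc r hr]
      exact hlip c hs hr
    · have hae : (fun p : ℝ × ℝ => blockFn m (fun c _ => deriv (ζ c) p.1) p.2) =ᵐ[volume.restrict
          (Ioo (0 : ℝ) τ ×ˢ Ioo (0 : ℝ) M)]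
          fun p => deriv (fun s => quantileFn (μ s) p.2) p.1 := by
        filter_upwards [ae_restrict_mem (measurableSet_Ioo.prod measurableSet_Ioo)] with p hp
        obtain ⟨c, hc⟩ := exists_block ⟨hp.2.1, hp.2.2.le⟩
        rw [blockFn_eq hm' _ hc, hdq c _ hc _ hp.1]
      refine MemLp.ae_eq hae ?_
      have hfin : IsFiniteMeasure ((volume : Measure (ℝ × ℝ)).restrict
          (Ioo (0 : ℝ) τ ×ˢ Ioo (0 : ℝ) M)) := by
        refine ⟨?_⟩
        rw [Measure.restrict_apply_univ, Measure.volume_eq_prod, Measure.prod_prod]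
        simp [ENNReal.mul_lt_top]
      refine MemLp.of_bound (Measurable.aestronglyMeasurable ?_) C ?_
      · unfold blockFn
        refine Finset.measurable_fun_sum _ fun c _ => ?_
        have : (fun p : ℝ × ℝ => indicator (Ioc (lowMass m c) (lowMass m c + m c))
            (fun _ => deriv (ζ c) p.1) p.2) = indicator (Prod.snd ⁻¹'
              (Ioc (lowMass m c) (lowMass m c + m c))) fun p => deriv (ζ c) p.1 := by
          ext p; rfl
        rw [this]
        exact ((measurable_deriv _).comp measurable_fst).indicator
          (measurable_snd measurableSet_Ioc)
      · filter_upwards [ae_restrict_mem (measurableSet_Ioo.prod measurableSet_Ioo)] with p hp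
        obtain ⟨c, hc⟩ := exists_block ⟨hp.2.1, hp.2.2.le⟩
        rw [blockFn_eq hm' _ hc]
        exact hdC c _ hp.1
  unfold momFn
  rw [if_pos hen, EReal.coe_le_coe_iff]
  refine le_of_eq ?_
  have hint : ∀ c, IntervalIntegrable (deriv (ζ c)) volume 0 τ := fun c =>
    (hac c).intervalIntegrable_deriv
  have hval : ∫ s in (0 : ℝ)..τ, ((1 / 2) * (∑ c, (m c * v c ^ 2 + m c ^ 3 / 12)) -
      ∑ c, m c * v c * deriv (ζ c) s) = certificate ξ τ x m v := by
    rw [intervalIntegral.integral_sub (by simp)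
      (by
        have := IntervalIntegrable.sum Finset.univ fun c _ => (hint c).const_mul (m c * v c)
        rwa [Finset.sum_fn] at this),
      intervalIntegral.integral_finsetSum fun c _ => (hint c).const_mul _]
    simp only [intervalIntegral.integral_const_mul, intervalIntegral.integral_const,
      (hac _).integral_deriv_eq_sub, h0, h1, certificate]
    rw [smul_eq_mul, Finset.mul_sum, Finset.mul_sum, ← Finset.sum_sub_distrib]
    exact Finset.sum_congr rfl fun c _ => by ring
  rw [← hval]
  rw [intervalIntegral.integral_of_le hτ, intervalIntegral.integral_of_le hτ,
    integral_Ioc_eq_integral_Ioo, integral_Ioc_eq_integral_Ioo]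
  refine integral_congr_ae ?_
  have hdiff : ∀ᵐ s : ℝ, ∀ c, s ∈ uIcc 0 τ → DifferentiableAt ℝ (ζ c) s :=
    ae_all_iff.2 fun c => (hac c).ae_differentiableAt
  filter_upwards [ae_restrict_of_ae hdiff, ae_restrict_mem measurableSet_Ioo] with s hs hsT
  have hd : ∀ c, deriv (ζ c) s = w c s := fun c => hdw c s hsT
    (hs c (by rw [uIcc_of_le hτ]; exact Ioo_subset_Icc_self hsT))
  have he := cluster_energy (y := fun c => ζ c s) (w := fun c => w c s) hm (fun c => rfl)
    (hblk s ⟨hsT.1.le, hsT.2⟩)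
  have hi : ∫ a in (0 : ℝ)..M, (1 / 2) * (deriv (fun r => quantileFn (μ r) a) s) ^ 2 =
      ∑ c, m c * ((1 / 2) * w c s ^ 2) := by
    rw [intervalIntegral.integral_of_le hM0, integral_Ioc_eq_integral_Ioo,
      integral_blocks hm' (G := fun c _ => (1 / 2) * w c s ^ 2) (fun c => continuous_const)
        fun c a ha => by rw [hdq c a ha s hsT, hd]]
    refine Finset.sum_congr rfl fun c _ => ?_
    rw [intervalIntegral.integral_const, add_sub_cancel_left, smul_eq_mul]
  rw [hi]
  simp only [hd]
  rw [← he, tsum_atomic hm']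

/-- `LSHE` depends on the point masses only through the measure that they form. -/
lemma LSHE_congr {κ' : Type*} [Fintype κ'] {ξ T : ℝ} {x m : κ → ℝ} {x' m' : κ' → ℝ}
    (hs : ∑ c, m c = ∑ c, m' c)
    (hμ : ∑ c, ENNReal.ofReal (m c) • Measure.dirac (x c) =
      ∑ c, ENNReal.ofReal (m' c) • Measure.dirac (x' c)) :
    LSHE ξ T x m = LSHE ξ T x' m' := by
  unfold LSHE
  rw [hs, hμ]

end attain
end

noncomputable section
open Set Filter Topology MeasureTheory

/-! ### Existence of the inertia clusters -/

section sticky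
variable {ι : Type*} [Fintype ι]

/-- The mean of `u` over the point masses at the same position as `c`. -/
def blockAvg (m u y : ι → ℝ) (c : ι) : ℝ :=
  (∑ c' with y c' = y c, m c' * u c') / ∑ c' with y c' = y c, m c'

lemma blockAvg_congr {m u y y' : ι → ℝ} {c : ι} (h : ∀ c', y c' = y c ↔ y' c' = y' c) :
    blockAvg m u y c = blockAvg m u y' c := by
  simp only [blockAvg, h]

lemma blockAvg_eq_of_eq {m u y : ι → ℝ} {c c' : ι} (h : y c = y c') :
    blockAvg m u y c = blockAvg m u y c' := by
  simp only [blockAvg, h]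

/-- Sticky particles with conserved momentum exist, by induction on the number of distinct
positions: free flight up to the first collision, which lowers that number. -/
lemma exists_sticky (m u : ι → ℝ) (T : ℝ) (N : ℕ) : ∀ (x : ι → ℝ) (t₀ : ℝ), t₀ ≤ T →
    (Finset.univ.image x).card ≤ N → ∃ z : ι → ℝ → ℝ,
      (∀ c, ContinuousOn (z c) (Icc t₀ T)) ∧ (∀ c, z c t₀ = x c) ∧
      (∀ c c' s s', t₀ ≤ s → s ≤ s' → s' ≤ T → z c s = z c' s → z c s' = z c' s') ∧
      ∀ c, ∀ s ∈ Ico t₀ T,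
        HasDerivWithinAt (z c) (blockAvg m u (fun c' => z c' s) c) (Ici s) s := by
  induction N with
  | zero =>
    intro x t₀ _ hN
    have : IsEmpty ι := by
      rw [Nat.le_zero, Finset.card_eq_zero, Finset.image_eq_empty] at hN
      exact Finset.univ_eq_empty_iff.1 hN
    exact ⟨fun _ _ => 0, isEmptyElim, isEmptyElim, isEmptyElim, isEmptyElim⟩
  | succ N ih =>
    intro x t₀ ht₀ hN
    set w : ι → ℝ := blockAvg m u x
    set ℓ : ι → ℝ → ℝ := fun c s => x c + (s - t₀) * w c with hℓ
    have hℓc : ∀ c, Continuous (ℓ c) := fun c => by fun_prop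
    have hℓd : ∀ c s, HasDerivAt (ℓ c) (w c) s := fun c s => by
      refine ((((hasDerivAt_id s).sub_const t₀).mul_const (w c)).const_add (x c)).congr_deriv ?_
      rw [one_mul]
    have hsame : ∀ c c' s, x c = x c' → ℓ c s = ℓ c' s := fun c c' s h => by
      simp only [hℓ, w, h, blockAvg_eq_of_eq h]
    -- the times at which the free flights of two distinct positions meet
    set K : Set ℝ := Icc t₀ T ∩ ⋃ p : ι × ι, {s | x p.1 ≠ x p.2 ∧ ℓ p.1 s = ℓ p.2 s} with hK
    have hnot : ∀ s ∈ Icc t₀ T, s ∉ K → ∀ c c', ℓ c s = ℓ c' s ↔ x c = x c' := by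
      intro s hs hsK c c'
      refine ⟨fun h => ?_, hsame c c' s⟩
      by_contra hne
      exact hsK ⟨hs, mem_iUnion.2 ⟨(c, c'), hne, h⟩⟩
    have hvel : ∀ s ∈ Icc t₀ T, s ∉ K → ∀ c, blockAvg m u (fun c' => ℓ c' s) c = w c :=
      fun s hs hsK c => blockAvg_congr fun c' => hnot s hs hsK c' c
    by_cases hKe : K.Nonempty
    · have hKc : IsCompact K := by
        refine isCompact_Icc.inter_right (isClosed_iUnion_of_finite fun p => ?_)
        by_cases hp : x p.1 ≠ x p.2
        · simp only [hp, ne_eq, not_false_eq_true, true_and]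
          exact isClosed_eq (hℓc _) (hℓc _)
        · simp [hp]
      obtain ⟨τ, hτK, hτ⟩ := hKc.exists_isLeast hKe
      obtain ⟨p, hp1, hp2⟩ := mem_iUnion.1 hτK.2
      have ht₀τ : t₀ ≤ τ := hτK.1.1
      have hbefore : ∀ s, s < τ → s ∉ K := fun s hs h => absurd (hτ h) (not_le.2 hs)
      have hcard : (Finset.univ.image fun c => ℓ c τ).card ≤ N := by
        have hlt : (Finset.univ.image fun c => ℓ c τ).card < (Finset.univ.image x).card := by
          -- the position at time `τ` is a non-injective function of the initial position
          have : Nonempty ι := ⟨p.1⟩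
          choose! r hr using fun y (hy : y ∈ Finset.univ.image x) => Finset.mem_image.1 hy
          have himg : (Finset.univ.image fun c => ℓ c τ) =
              (Finset.univ.image x).image fun y => ℓ (r y) τ := by
            ext y
            simp only [Finset.mem_image, Finset.mem_univ, true_and, exists_exists_eq_and]
            refine exists_congr fun c => ?_
            rw [hsame (r (x c)) c τ (hr _ (Finset.mem_image_of_mem x (Finset.mem_univ c))).2]
          rw [himg]
          refine lt_of_le_of_ne Finset.card_image_le fun he => hp1 ?_
          have hinj := Finset.card_image_iff.1 he
          have hx : ∀ c, x c ∈ (Finset.univ.image x : Finset ℝ) := fun c =>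
            Finset.mem_image_of_mem x (Finset.mem_univ c)
          refine hinj (hx p.1) (hx p.2) ?_
          change ℓ (r (x p.1)) τ = ℓ (r (x p.2)) τ
          rw [hsame (r (x p.1)) p.1 τ (hr _ (hx _)).2, hsame (r (x p.2)) p.2 τ (hr _ (hx _)).2]
          exact hp2
        omega
      obtain ⟨z', hc', hs', hm', hv'⟩ := ih (fun c => ℓ c τ) τ hτK.1.2 hcard
      set z : ι → ℝ → ℝ := fun c s => if s ≤ τ then ℓ c s else z' c s with hz
      have hz1 : ∀ c s, s ≤ τ → z c s = ℓ c s := fun c s h => if_pos h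
      have hz2 : ∀ c s, τ ≤ s → z c s = z' c s := fun c s h => by
        rcases h.eq_or_lt with rfl | h
        · rw [hz1 c _ le_rfl, hs' c]
        · exact if_neg (not_le.2 h)
      refine ⟨z, fun c => ?_, fun c => ?_, ?_, ?_⟩
      · have : Icc t₀ T = Icc t₀ τ ∪ Icc τ T := (Icc_union_Icc_eq_Icc ht₀τ hτK.1.2).symm
        rw [this]
        refine ContinuousOn.union_of_isClosed ?_ ?_ isClosed_Icc isClosed_Icc
        · exact (hℓc c).continuousOn.congr fun s hs => hz1 c s hs.2
        · exact (hc' c).congr fun s hs => hz2 c s hs.1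
      · rw [hz1 c t₀ ht₀τ]; simp [hℓ]
      · intro c c' s s' h1 h2 h3 h
        rcases le_or_gt τ s with hs | hs
        · rw [hz2 c s hs, hz2 c' s hs] at h
          rw [hz2 c s' (hs.trans h2), hz2 c' s' (hs.trans h2)]
          exact hm' c c' s s' hs h2 h3 h
        · rw [hz1 c s hs.le, hz1 c' s hs.le,
            hnot s ⟨h1, h2.trans h3⟩ (hbefore s hs)] at h
          rcases le_total s' τ with h4 | h4
          · rw [hz1 c s' h4, hz1 c' s' h4]; exact hsame c c' s' h
          · rw [hz2 c s' h4, hz2 c' s' h4]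
            exact hm' c c' τ s' le_rfl h4 h3 (by rw [hs', hs']; exact hsame c c' τ h)
      · intro c s hs
        rcases le_or_gt τ s with h | h
        · have : (fun c' => z c' s) = fun c' => z' c' s := funext fun c' => hz2 c' s h
          rw [this]
          exact (hv' c s ⟨h, hs.2⟩).congr (fun r hr => hz2 c r (h.trans hr)) (hz2 c s h)
        · have : (fun c' => z c' s) = fun c' => ℓ c' s := funext fun c' => hz1 c' s h.le
          rw [this, hvel s ⟨hs.1, hs.2.le⟩ (hbefore s h)]
          refine (hℓd c s).hasDerivWithinAt.congr_of_eventuallyEq ?_ (hz1 c s h.le)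
          filter_upwards [mem_nhdsWithin_of_mem_nhds (Iio_mem_nhds h)] with r hr
          exact hz1 c r (le_of_lt hr)
    · rw [not_nonempty_iff_eq_empty] at hKe
      have hno : ∀ s, s ∉ K := fun s h => by rw [hKe] at h; exact h
      refine ⟨ℓ, fun c => (hℓc c).continuousOn, fun c => by simp [hℓ], ?_, ?_⟩
      · intro c c' s s' h1 h2 h3 h
        exact hsame c c' s' ((hnot s ⟨h1, h2.trans h3⟩ (hno s) c c').1 h)
      · intro c s hs
        rw [hvel s ⟨hs.1, hs.2.le⟩ (hno s)]
        exact (hℓd c s).hasDerivWithinAt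

lemma exists_isInertiaClusters {n : ℕ} {T : ℝ} (hT : 0 ≤ T) (x m : Fin n → ℝ) :
    ∃ z, IsInertiaClusters T x m z := by
  obtain ⟨z, h1, h2, h3, h4⟩ := exists_sticky m (pull m) T _ x 0 hT le_rfl
  exact ⟨z, h1, h2, h3, h4⟩

end sticky

/-! ### Order and momentum of the clusters -/

section clusters
variable {n : ℕ} {T : ℝ} {x m : Fin n → ℝ} {z : Fin n → ℝ → ℝ}

/-- The initial velocity in terms of the mass to the left. -/
lemma pull_eq (m : Fin n → ℝ) (c : Fin n) : pull m c = ((∑ c, m c) - m c) / 2 - lowMass m c := by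
  have h1 : ∑ c' ∈ Finset.Iio c, m c' = lowMass m c := by
    rw [lowMass]; congr 1; ext; simp
  have h2 : (∑ c' ∈ Finset.Ioi c, m c') = (∑ c, m c) - (lowMass m c + m c) := by
    have hset : Finset.Ioi c = Finset.univ.filter fun c' => ¬ c' ≤ c := by ext; simp
    rw [hset, lowMass_add, eq_sub_iff_add_eq, add_comm, Finset.sum_filter_add_sum_filter_not]
  rw [pull, h1, h2]; ring

/-- The initial velocities decrease by half the sum of the two masses from one point mass to the
next, and by more otherwise: the velocity intervals `[pull - m / 2, pull + m / 2]` tile an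
interval. -/
lemma pull_gap (hm : ∀ c, 0 ≤ m c) {c c' : Fin n} (h : c < c') :
    pull m c' + m c' / 2 ≤ pull m c - m c / 2 := by
  have := lowMass_add_le hm h
  rw [pull_eq, pull_eq]; linarith

namespace IsInertiaClusters

lemma monotone (hz : IsInertiaClusters T x m z) (hx : Monotone x) {s : ℝ} (hs : s ∈ Icc 0 T) :
    Monotone fun c => z c s := by
  intro c c' hcc
  by_contra hlt
  simp only [not_le] at hlt
  have hc : ContinuousOn (fun r => z c' r - z c r) (Icc 0 s) :=
    ((hz.continuousOn c').sub (hz.continuousOn c)).mono (Icc_subset_Icc le_rfl hs.2)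
  have h0 : (0 : ℝ) ∈ Icc (z c' s - z c s) (z c' 0 - z c 0) :=
    ⟨by linarith, by rw [hz.start, hz.start]; linarith [hx hcc]⟩
  obtain ⟨r, hr, hr0⟩ := intermediate_value_Icc' hs.1 hc h0
  have := hz.merged c c' r s hr.1 hr.2 hs.2 (by simp only at hr0; linarith)
  linarith

lemma hasDeriv (hz : IsInertiaClusters T x m z) (c : Fin n) {s : ℝ} (hs : s ∈ Ico 0 T) :
    HasDerivWithinAt (z c) (blockAvg m (pull m) (fun c' => z c' s) c) (Ici s) s :=
  hz.velocity c s hs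

/-- The averages of a decreasing function `u` over blocks: a lower set of indices has at least as
much of `u` as of its block averages. -/
lemma _root_.sum_sub_blockAvg_nonneg {m u y : Fin n → ℝ} (hm : ∀ c, 0 < m c) (hu : Antitone u)
    {K : Finset (Fin n)} (hK : ∀ c ∈ K, ∀ c' ∉ K, c ≤ c') :
    0 ≤ ∑ c ∈ K, m c * (u c - blockAvg m u y c) := by
  rw [← Finset.sum_fiberwise_of_maps_to (g := y) (t := Finset.univ.image y)
    fun c _ => Finset.mem_image_of_mem y (Finset.mem_univ c)]
  refine Finset.sum_nonneg fun p _ => ?_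
  set S := Finset.univ.filter fun c => y c = p
  set S₁ := K.filter fun c => y c = p with hS₁
  set S₂ := Kᶜ.filter fun c => y c = p with hS₂
  rcases S₁.eq_empty_or_nonempty with h | hne
  · rw [h]; simp
  have hsplit : ∀ f : Fin n → ℝ, ∑ c ∈ S, f c = ∑ c ∈ S₁, f c + ∑ c ∈ S₂, f c := fun f => by
    rw [← Finset.sum_union]
    · congr 1
      ext c
      simp only [S, S₁, S₂, Finset.mem_union, Finset.mem_filter, Finset.mem_univ, true_and,
        Finset.mem_compl]
      tauto
    · exact Finset.disjoint_filter_filter disjoint_compl_right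
  have hpos : 0 < ∑ c ∈ S₁, m c := Finset.sum_pos (fun c _ => hm c) hne
  have hpos2 : 0 ≤ ∑ c ∈ S₂, m c := Finset.sum_nonneg fun c _ => (hm c).le
  have havg : ∀ c ∈ S₁, blockAvg m u y c =
      (∑ c ∈ S, m c * u c) / ∑ c ∈ S, m c := fun c hc => by
    simp only [blockAvg, (Finset.mem_filter.1 hc).2, S]
  set θ := u (S₁.max' hne)
  have hθ1 : θ * ∑ c ∈ S₁, m c ≤ ∑ c ∈ S₁, m c * u c := by
    rw [Finset.mul_sum]
    refine Finset.sum_le_sum fun c hc => ?_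
    have := hu (S₁.le_max' c hc)
    nlinarith [hm c]
  have hθ2 : ∑ c ∈ S₂, m c * u c ≤ θ * ∑ c ∈ S₂, m c := by
    rw [Finset.mul_sum]
    refine Finset.sum_le_sum fun c hc => ?_
    have := hu (hK _ (Finset.mem_filter.1 (S₁.max'_mem hne)).1 c
      (Finset.mem_compl.1 (Finset.mem_filter.1 hc).1))
    nlinarith [hm c]
  have e : ∑ c ∈ S₁, m c * (u c - blockAvg m u y c) = (∑ c ∈ S₁, m c * u c) -
      (∑ c ∈ S₁, m c) * ((∑ c ∈ S, m c * u c) / ∑ c ∈ S, m c) := by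
    rw [Finset.sum_mul, ← Finset.sum_sub_distrib]
    exact Finset.sum_congr rfl fun c hc => by rw [havg c hc]; ring
  rw [e, hsplit, hsplit, sub_nonneg, ← mul_div_assoc, div_le_iff₀ (by linarith)]
  have i1 := mul_le_mul_of_nonneg_right hθ1 hpos2
  have i2 := mul_le_mul_of_nonneg_left hθ2 hpos.le
  nlinarith

/-- If no block straddles the boundary of `K`, the block averages conserve the momentum of `K`. -/
lemma _root_.sum_sub_blockAvg_eq_zero {m u y : Fin n → ℝ} (hm : ∀ c, 0 < m c)
    {K : Finset (Fin n)} (hK : ∀ c ∈ K, ∀ c' ∉ K, y c ≠ y c') :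
    ∑ c ∈ K, m c * (u c - blockAvg m u y c) = 0 := by
  rw [← Finset.sum_fiberwise_of_maps_to (g := y) (t := Finset.univ.image y)
    fun c _ => Finset.mem_image_of_mem y (Finset.mem_univ c)]
  refine Finset.sum_eq_zero fun p _ => ?_
  set S₁ := K.filter fun c => y c = p with hS₁
  rcases S₁.eq_empty_or_nonempty with h | hne
  · rw [h]; simp
  have hpos : 0 < ∑ c ∈ S₁, m c := Finset.sum_pos (fun c _ => hm c) hne
  obtain ⟨d, hd⟩ := hne
  have hd' := Finset.mem_filter.1 hd
  have hS : (Finset.univ.filter fun c => y c = p) = S₁ := by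
    ext c
    simp only [hS₁, Finset.mem_filter, Finset.mem_univ, true_and]
    refine ⟨fun h => ⟨?_, h⟩, fun h => h.2⟩
    by_contra hc
    exact hK d hd'.1 c hc (hd'.2.trans h.symm)
  have havg : ∀ c ∈ S₁, blockAvg m u y c = (∑ c ∈ S₁, m c * u c) / ∑ c ∈ S₁, m c := fun c hc => by
    simp only [blockAvg, (Finset.mem_filter.1 hc).2, hS]
  have e : ∑ c ∈ S₁, m c * (u c - blockAvg m u y c) = (∑ c ∈ S₁, m c * u c) -
      (∑ c ∈ S₁, m c) * ((∑ c ∈ S₁, m c * u c) / ∑ c ∈ S₁, m c) := by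
    rw [Finset.sum_mul, ← Finset.sum_sub_distrib]
    exact Finset.sum_congr rfl fun c hc => by rw [havg c hc]; ring
  rw [e]; field_simp; ring

lemma pull_antitone (hm : ∀ c, 0 ≤ m c) : Antitone (pull m) := by
  intro c c' h
  rcases h.eq_or_lt with rfl | h
  · exact le_rfl
  · have := pull_gap hm h
    linarith [hm c, hm c']

/-- The mass-weighted lag of the clusters in `K` behind their free flight. -/
def _root_.momentLag (x m : Fin n → ℝ) (z : Fin n → ℝ → ℝ) (K : Finset (Fin n)) (s : ℝ) : ℝ :=
  ∑ c ∈ K, m c * (x c + s * pull m c - z c s)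

lemma continuousOn_momentLag (hz : IsInertiaClusters T x m z) (K : Finset (Fin n)) :
    ContinuousOn (momentLag x m z K) (Icc 0 T) := by
  unfold momentLag
  refine continuousOn_finsetSum _ fun c _ => ?_
  exact continuousOn_const.mul ((by fun_prop : Continuous fun s : ℝ => x c + s * pull m c)
    |>.continuousOn.sub (hz.continuousOn c))

lemma hasDeriv_momentLag (hz : IsInertiaClusters T x m z) (K : Finset (Fin n)) {s : ℝ}
    (hs : s ∈ Ico 0 T) : HasDerivWithinAt (momentLag x m z K)
      (∑ c ∈ K, m c * (pull m c - blockAvg m (pull m) (fun c' => z c' s) c)) (Ici s) s := by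
  unfold momentLag
  refine HasDerivWithinAt.fun_sum fun c _ => ?_
  have h1 : HasDerivWithinAt (fun s : ℝ => x c + s * pull m c) (pull m c) (Ici s) s := by
    simpa using (((hasDerivAt_id s).mul_const (pull m c)).const_add (x c)).hasDerivWithinAt
  exact (h1.sub (hz.hasDeriv c hs)).const_mul (m c)

/-- The lag of a set of leftmost clusters does not decrease: collisions with the slower clusters on
their right take momentum from them. -/
lemma momentLag_mono (hz : IsInertiaClusters T x m z) (hm : ∀ c, 0 < m c) {K : Finset (Fin n)}
    (hK : ∀ c ∈ K, ∀ c' ∉ K, c ≤ c') {s s' : ℝ} (h0 : 0 ≤ s) (h1 : s ≤ s') (h2 : s' ≤ T) :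
    momentLag x m z K s ≤ momentLag x m z K s' := by
  have hcont := (hz.continuousOn_momentLag K).mono (Icc_subset_Icc h0 h2)
  have := image_le_of_deriv_right_le_deriv_boundary (f := fun r => -momentLag x m z K r)
    (f' := fun s => -∑ c ∈ K, m c * (pull m c - blockAvg m (pull m) (fun c' => z c' s) c))
    (a := s) (b := s') (B := fun _ => -momentLag x m z K s) (B' := fun _ => 0) hcont.neg
    (fun r hr => (hz.hasDeriv_momentLag K ⟨h0.trans hr.1, hr.2.trans_le h2⟩).neg) le_rfl
    continuousOn_const (fun r _ => hasDerivWithinAt_const _ _ _)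
    (fun r _ => neg_nonpos.2 (sum_sub_blockAvg_nonneg hm (pull_antitone fun c => (hm c).le) hK))
    (right_mem_Icc.2 h1)
  linarith

lemma momentLag_zero (hz : IsInertiaClusters T x m z) (K : Finset (Fin n)) :
    momentLag x m z K 0 = 0 := by
  simp [momentLag, hz.start]

/-- Clusters that have not met the others do not lag behind as a whole. -/
lemma momentLag_eq_zero (hz : IsInertiaClusters T x m z) (hm : ∀ c, 0 < m c)
    {K : Finset (Fin n)} {s : ℝ} (hs : s ∈ Icc 0 T) (hK : ∀ c ∈ K, ∀ c' ∉ K, z c s ≠ z c' s) :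
    momentLag x m z K s = 0 := by
  rw [← hz.momentLag_zero K]
  refine constant_of_has_deriv_right_zero
    ((hz.continuousOn_momentLag K).mono (Icc_subset_Icc le_rfl hs.2)) (fun r hr => ?_) s
    (right_mem_Icc.2 hs.1)
  have := hz.hasDeriv_momentLag K ⟨hr.1, hr.2.trans_le hs.2⟩
  rwa [sum_sub_blockAvg_eq_zero hm fun c hc c' hc' h =>
    hK c hc c' hc' (hz.merged c c' r s hr.1 hr.2.le hs.2 h)] at this

end IsInertiaClusters
end clusters
end

noncomputable section
open Set Filter Topology MeasureTheory

/-! ### The optimal clusters -/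

section avg
variable {ι : Type*} [Fintype ι] {m u y : ι → ℝ}

lemma blockMass_pos (hm : ∀ c, 0 < m c) (c : ι) : 0 < ∑ c' with y c' = y c, m c' :=
  Finset.sum_pos (fun c _ => hm c) ⟨c, by simp⟩

lemma exists_blockAvg_le (hm : ∀ c, 0 < m c) (c : ι) :
    ∃ j, y j = y c ∧ blockAvg m u y c ≤ u j := by
  obtain ⟨j, hj, hmax⟩ := Finset.exists_max_image (Finset.univ.filter fun c' => y c' = y c) u
    ⟨c, by simp⟩
  refine ⟨j, (Finset.mem_filter.1 hj).2, ?_⟩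
  rw [blockAvg, div_le_iff₀ (blockMass_pos hm c), Finset.mul_sum]
  refine Finset.sum_le_sum fun i hi => ?_
  have := hmax i hi
  nlinarith [hm i]

lemma exists_le_blockAvg (hm : ∀ c, 0 < m c) (c : ι) :
    ∃ j, y j = y c ∧ u j ≤ blockAvg m u y c := by
  obtain ⟨j, hj, hmin⟩ := Finset.exists_min_image (Finset.univ.filter fun c' => y c' = y c) u
    ⟨c, by simp⟩
  refine ⟨j, (Finset.mem_filter.1 hj).2, ?_⟩
  rw [blockAvg, le_div_iff₀ (blockMass_pos hm c), Finset.mul_sum]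
  refine Finset.sum_le_sum fun i hi => ?_
  have := hmin i hi
  nlinarith [hm i]

end avg

section optimal
variable {n : ℕ} {T : ℝ} {x m : Fin n → ℝ} {z : Fin n → ℝ → ℝ}

/-- The centre of the velocity interval of the optimal cluster `c` ending at `0`: the initial
velocity of the inertia cluster, corrected by the drift that brings its end point to `0`. -/
def optVel (T : ℝ) (m : Fin n → ℝ) (z : Fin n → ℝ → ℝ) (c : Fin n) : ℝ := pull m c - z c T / T

namespace IsInertiaClusters

lemma optimalCluster_zero (hz : IsInertiaClusters T x m z) (c : Fin n) :
    optimalCluster 0 T z c 0 = x c := by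
  simp [optimalCluster, hz.start]

lemma _root_.optimalCluster_end (hT : 0 < T) (z : Fin n → ℝ → ℝ) (c : Fin n) :
    optimalCluster 0 T z c T = 0 := by
  rw [optimalCluster]; field_simp; ring

lemma continuousOn_optimal (hz : IsInertiaClusters T x m z) (c : Fin n) :
    ContinuousOn (optimalCluster 0 T z c) (Icc 0 T) :=
  (hz.continuousOn c).add (by fun_prop)

/-- The velocity intervals of the optimal clusters are disjoint, up to end points, and in decreasing
order. -/
lemma optVel_gap (hz : IsInertiaClusters T x m z) (hT : 0 < T) (hx : Monotone x)
    (hm : ∀ c, 0 ≤ m c) {c c' : Fin n} (h : c < c') :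
    optVel T m z c' + m c' / 2 ≤ optVel T m z c - m c / 2 := by
  have h1 := pull_gap hm h
  have h2 := div_le_div_of_nonneg_right (hz.monotone hx ⟨hT.le, le_rfl⟩ h.le) hT.le
  simp only at h2
  rw [optVel, optVel]; linarith

lemma blockAvg_optVel (hz : IsInertiaClusters T x m z) (hm : ∀ c, 0 < m c) {s : ℝ}
    (hs : s ∈ Ico 0 T) (c : Fin n) :
    blockAvg m (optVel T m z) (fun c' => z c' s) c =
      blockAvg m (pull m) (fun c' => z c' s) c - z c T / T := by
  have hpos := blockMass_pos (y := fun c' => z c' s) hm c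
  simp only [blockAvg]
  rw [eq_sub_iff_add_eq, div_add' _ _ _ hpos.ne']
  congr 1
  rw [Finset.mul_sum, ← Finset.sum_add_distrib]
  refine Finset.sum_congr rfl fun i hi => ?_
  have := hz.merged i c s T hs.1 hs.2.le le_rfl (Finset.mem_filter.1 hi).2
  rw [optVel, this]; ring

lemma hasDeriv_optimal (hz : IsInertiaClusters T x m z) (hm : ∀ c, 0 < m c) {s : ℝ}
    (hs : s ∈ Ico 0 T) (c : Fin n) : HasDerivWithinAt (optimalCluster 0 T z c)
      (blockAvg m (optVel T m z) (fun c' => z c' s) c) (Ici s) s := by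
  rw [hz.blockAvg_optVel hm hs]
  have h2 : HasDerivWithinAt (fun s : ℝ => (0 - z c T) / T * s) ((0 - z c T) / T) (Ici s) s := by
    simpa using ((hasDerivAt_id s).const_mul ((0 - z c T) / T)).hasDerivWithinAt
  exact ((hz.hasDeriv c hs).add h2).congr_deriv (by ring)

/-- Optimal clusters whose inertia clusters do not meet stay apart before `T`: their distance
decreases strictly, and vanishes at `T`. -/
lemma optimal_lt (hz : IsInertiaClusters T x m z) (hT : 0 < T) (hx : Monotone x)
    (hm : ∀ c, 0 < m c) {s : ℝ} (hs : s ∈ Ico 0 T) {c c' : Fin n} (hc : c < c')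
    (hne : z c T ≠ z c' T) : optimalCluster 0 T z c s < optimalCluster 0 T z c' s := by
  set D : ℝ → ℝ := fun r => optimalCluster 0 T z c' r - optimalCluster 0 T z c r
  have hd : ∀ r ∈ Ico 0 T, ∃ d < 0, HasDerivWithinAt D d (Ici r) r := by
    intro r hr
    refine ⟨_, ?_, (hz.hasDeriv_optimal hm hr c').sub (hz.hasDeriv_optimal hm hr c)⟩
    obtain ⟨j, hj, hj'⟩ := exists_blockAvg_le (u := optVel T m z) (y := fun c' => z c' r) hm c'
    obtain ⟨i, hi, hi'⟩ := exists_le_blockAvg (u := optVel T m z) (y := fun c' => z c' r) hm c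
    have hlt : z c r < z c' r := lt_of_le_of_ne (hz.monotone hx ⟨hr.1, hr.2.le⟩ hc.le)
      fun h => hne (hz.merged c c' r T hr.1 hr.2.le le_rfl h)
    have hij : i < j := by
      by_contra hle
      have := hz.monotone hx ⟨hr.1, hr.2.le⟩ (not_lt.1 hle)
      simp only at this hi hj
      linarith
    have := hz.optVel_gap hT hx (fun c => (hm c).le) hij
    linarith [hm i, hm j]
  have hD : ContinuousOn D (Icc 0 T) := (hz.continuousOn_optimal c').sub (hz.continuousOn_optimal c)
  have hanti : ∀ a ∈ Icc 0 T, ∀ b ∈ Icc 0 T, a ≤ b → D b ≤ D a := by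
    intro a ha b hb hab
    choose! d hd0 hd using hd
    exact image_le_of_deriv_right_le_deriv_boundary (f := D) (f' := d)
      (a := a) (b := b) (B := fun _ => D a) (B' := fun _ => 0)
      (hD.mono (Icc_subset_Icc ha.1 hb.2))
      (fun r hr => hd r ⟨ha.1.trans hr.1, hr.2.trans_le hb.2⟩) le_rfl
      continuousOn_const (fun r _ => hasDerivWithinAt_const _ _ _)
      (fun r hr => (hd0 r ⟨ha.1.trans hr.1, hr.2.trans_le hb.2⟩).le)
      (right_mem_Icc.2 hab)
  have hDT : D T = 0 := by simp only [D, optimalCluster_end hT, sub_zero]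
  have hTm : T ∈ Icc 0 T := ⟨hT.le, le_rfl⟩
  have hsm : s ∈ Icc 0 T := ⟨hs.1, hs.2.le⟩
  have h0 : 0 ≤ D s := by rw [← hDT]; exact hanti s hsm T hTm hs.2.le
  rcases h0.eq_or_lt with h | h
  · -- a zero of `D` before `T` would make `D` vanish up to `T`
    exfalso
    obtain ⟨d, hd0, hd⟩ := hd s hs
    have hz0 : HasDerivWithinAt D 0 (Ici s) s := by
      refine (hasDerivWithinAt_const s (Ici s) (0 : ℝ)).congr_of_eventuallyEq ?_ h.symm
      filter_upwards [self_mem_nhdsWithin, mem_nhdsWithin_of_mem_nhds (Iio_mem_nhds hs.2)]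
        with r hr hr'
      have hrm : r ∈ Icc 0 T := ⟨hs.1.trans hr, le_of_lt hr'⟩
      have h1 := hanti s hsm r hrm hr
      have h2 := hanti r hrm T hTm (le_of_lt hr')
      linarith
    have := (uniqueDiffOn_Ici s s self_mem_Ici).eq_deriv _ hd hz0
    linarith
  · simpa [D] using h

lemma optimal_eq_iff (hz : IsInertiaClusters T x m z) (hT : 0 < T) (hx : Monotone x)
    (hm : ∀ c, 0 < m c) {s : ℝ} (hs : s ∈ Ico 0 T) (c c' : Fin n) :
    optimalCluster 0 T z c s = optimalCluster 0 T z c' s ↔ z c s = z c' s := by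
  by_cases hne : z c T = z c' T
  · simp [optimalCluster, hne]
  · have h1 : z c s ≠ z c' s := fun h => hne (hz.merged c c' s T hs.1 hs.2.le le_rfl h)
    have h2 : optimalCluster 0 T z c s ≠ optimalCluster 0 T z c' s := by
      rcases lt_trichotomy c c' with h | h | h
      · exact (hz.optimal_lt hT hx hm hs h hne).ne
      · subst h; exact absurd rfl hne
      · exact (hz.optimal_lt hT hx hm hs h fun h => hne h.symm).ne'
    simp [h1, h2]

lemma optimal_mono (hz : IsInertiaClusters T x m z) (hT : 0 < T) (hx : Monotone x)
    (hm : ∀ c, 0 < m c) {s : ℝ} (hs : s ∈ Icc 0 T) :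
    Monotone fun c => optimalCluster 0 T z c s := by
  intro c c' h
  rcases hs.2.eq_or_lt with rfl | hsT
  · simp [optimalCluster_end hT]
  rcases h.eq_or_lt with rfl | h
  · exact le_rfl
  by_cases hne : z c T = z c' T
  · simp only [optimalCluster, hne]
    have := hz.monotone hx hs h.le
    simp only at this
    linarith
  · exact (hz.optimal_lt hT hx hm ⟨hs.1, hsT⟩ h hne).le

lemma hasDeriv_optimal' (hz : IsInertiaClusters T x m z) (hT : 0 < T) (hx : Monotone x)
    (hm : ∀ c, 0 < m c) {s : ℝ} (hs : s ∈ Ico 0 T) (c : Fin n) :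
    HasDerivWithinAt (optimalCluster 0 T z c)
      (blockAvg m (optVel T m z) (fun c' => optimalCluster 0 T z c' s) c) (Ici s) s := by
  rw [blockAvg_congr fun c' => hz.optimal_eq_iff hT hx hm hs c' c]
  exact hz.hasDeriv_optimal hm hs c

/-- The velocity intervals of clusters that are together at a time before `T` are adjacent. -/
lemma optVel_block (hz : IsInertiaClusters T x m z) (hT : 0 < T) (hx : Monotone x)
    (hm : ∀ c, 0 < m c) {s : ℝ} (hs : s ∈ Ico 0 T) (y : ℝ) : ∃ K, ∀ c,
    optimalCluster 0 T z c s = y → optVel T m z c =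
      K - (∑ c' with optimalCluster 0 T z c' s = y ∧ c' < c, m c') - m c / 2 := by
  by_cases hne : ∃ d, optimalCluster 0 T z d s = y
  swap
  · exact ⟨0, fun c hc => absurd ⟨c, hc⟩ hne⟩
  obtain ⟨d, hd⟩ := hne
  refine ⟨(∑ c, m c) / 2 - (∑ c' with optimalCluster 0 T z c' s < y, m c') - z d T / T,
    fun c hc => ?_⟩
  have hzT : z c T = z d T := hz.merged c d s T hs.1 hs.2.le le_rfl
    ((hz.optimal_eq_iff hT hx hm hs c d).1 (hc.trans hd.symm))
  have hmono := hz.optimal_mono hT hx hm ⟨hs.1, hs.2.le⟩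
  have hlow : lowMass m c = (∑ c' with optimalCluster 0 T z c' s = y ∧ c' < c, m c') +
      ∑ c' with optimalCluster 0 T z c' s < y, m c' := by
    rw [lowMass, ← Finset.sum_union]
    · congr 1
      ext c'
      simp only [Finset.mem_filter, Finset.mem_univ, true_and, Finset.mem_union]
      constructor
      · intro h
        have := hmono h.le
        simp only [hc] at this
        rcases this.eq_or_lt with h' | h'
        · exact Or.inl ⟨h', h⟩
        · exact Or.inr h'
      · rintro (h | h)
        · exact h.2
        · by_contra hle
          have := hmono (not_lt.1 hle)
          simp only [hc] at this
          linarith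
    · rw [Finset.disjoint_left]
      intro c' h h'
      have h1 := (Finset.mem_filter.1 h).2.1
      have h2 := (Finset.mem_filter.1 h').2
      linarith
  rw [optVel, pull_eq, hlow, hzT]
  ring

/-- In free flight from time `s` on with the velocities `optVel`, the centre of mass of `K` would
pass its end point `0` by the lag that `K` acquires between `s` and `T`. -/
lemma momentum_eq (hT : 0 < T) (K : Finset (Fin n)) (s : ℝ) :
    ∑ c ∈ K, m c * (optimalCluster 0 T z c s + (T - s) * optVel T m z c) =
      momentLag x m z K T - momentLag x m z K s := by
  rw [momentLag, momentLag, ← Finset.sum_sub_distrib]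
  refine Finset.sum_congr rfl fun c _ => ?_
  rw [optimalCluster, optVel]
  field_simp
  ring

lemma momentum_nonneg (hz : IsInertiaClusters T x m z) (hT : 0 < T) (hm : ∀ c, 0 < m c) {s : ℝ}
    (hs : s ∈ Icc 0 T) {K : Finset (Fin n)} (hK : ∀ c ∈ K, ∀ c' ∉ K, c < c') :
    0 ≤ ∑ c ∈ K, m c * (optimalCluster 0 T z c s + (T - s) * optVel T m z c) := by
  rw [momentum_eq (x := x) hT]
  have := hz.momentLag_mono hm (fun c hc c' hc' => (hK c hc c' hc').le) hs.1 hs.2 le_rfl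
  linarith

/-- A separating gap between the velocity intervals of `K` and the others means that the inertia
clusters of `K` and of the others never meet, and so never exchange momentum. -/
lemma momentum_eq_zero (hz : IsInertiaClusters T x m z) (hT : 0 < T) (hx : Monotone x)
    (hm : ∀ c, 0 < m c) {s : ℝ} (hs : s ∈ Icc 0 T) {K : Finset (Fin n)}
    (hK : ∀ c ∈ K, ∀ c' ∉ K, c < c')
    (hgap : ∀ c ∈ K, ∀ c' ∉ K, optVel T m z c' + m c' / 2 < optVel T m z c - m c / 2) :
    ∑ c ∈ K, m c * (optimalCluster 0 T z c s + (T - s) * optVel T m z c) = 0 := by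
  have hTm : T ∈ Icc 0 T := ⟨hT.le, le_rfl⟩
  have hne : ∀ c ∈ K, ∀ c' ∉ K, z c T ≠ z c' T := by
    intro c hc c' hc'
    have hK1 : K.Nonempty := ⟨c, hc⟩
    have hK2 : Kᶜ.Nonempty := ⟨c', Finset.mem_compl.2 hc'⟩
    set c₀ := K.max' hK1
    set c₁ := Kᶜ.min' hK2
    have m0 : c₀ ∈ K := K.max'_mem hK1
    have m1 : c₁ ∉ K := Finset.mem_compl.1 (Kᶜ.min'_mem hK2)
    -- `c₀` and `c₁` are neighbours, so the initial velocity intervals are adjacent there, and the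
    -- gap comes from distinct end points of the inertia clusters
    have hadj : lowMass m c₁ = lowMass m c₀ + m c₀ := by
      rw [lowMass_add, lowMass]
      congr 1
      ext d
      simp only [Finset.mem_filter, Finset.mem_univ, true_and]
      constructor
      · intro h
        by_contra hle
        have hd : d ∉ K := fun hd => hle (K.le_max' d hd)
        exact absurd h (not_lt.2 (Kᶜ.min'_le d (Finset.mem_compl.2 hd)))
      · intro h
        exact h.trans_lt (hK c₀ m0 c₁ m1)
    have h1 := hgap c₀ m0 c₁ m1
    rw [optVel, optVel, pull_eq, pull_eq, hadj] at h1
    have h2 : z c₀ T / T < z c₁ T / T := by linarith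
    have h3 : z c₀ T < z c₁ T := by rwa [div_lt_div_iff_of_pos_right hT] at h2
    have h4 : z c T ≤ z c₀ T := hz.monotone hx hTm (K.le_max' c hc)
    have h5 : z c₁ T ≤ z c' T :=
      hz.monotone hx hTm (Kᶜ.min'_le c' (Finset.mem_compl.2 hc'))
    exact (h4.trans_lt (h3.trans_le h5)).ne
  rw [momentum_eq (x := x) hT, hz.momentLag_eq_zero hm hTm hne,
    hz.momentLag_eq_zero hm hs fun c hc c' hc' h =>
      hne c hc c' hc' (hz.merged c c' s T hs.1 hs.2 le_rfl h), sub_zero]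

end IsInertiaClusters
end optimal
end

noncomputable section
open Set Filter Topology MeasureTheory

/-! ### The concave profile of a configuration of clusters -/

/-- Left end of the velocity interval of `c`. -/
def loEnd {n : ℕ} (m v : Fin n → ℝ) (c : Fin n) : ℝ := v c - m c / 2

/-- Right end of the velocity interval of `c`. -/
def hiEnd {n : ℕ} (m v : Fin n → ℝ) (c : Fin n) : ℝ := v c + m c / 2

/-- The positions `ζ`, masses `m` and velocity centres `v` of clusters at distance `t` from the time
at which they all meet at `0`.  The last two fields say that, for every set `K` of leftmost
clusters, the momentum of `K` lags behind, and that it does not if the velocity intervals of `K` are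
separated from the others. -/
structure ClusterProfile {n : ℕ} (t : ℝ) (ζ m v : Fin n → ℝ) : Prop where
  t_pos : 0 < t
  m_pos : ∀ c, 0 < m c
  gap : ∀ c c', c < c' → hiEnd m v c' ≤ loEnd m v c
  mono : Monotone ζ
  mom_nonneg : ∀ K : Finset (Fin n), (∀ c ∈ K, ∀ c' ∉ K, c < c') →
    0 ≤ ∑ c ∈ K, m c * (ζ c + t * v c)
  mom_zero : ∀ K : Finset (Fin n), (∀ c ∈ K, ∀ c' ∉ K, c < c') →
    (∀ c ∈ K, ∀ c' ∉ K, hiEnd m v c' < loEnd m v c) → ∑ c ∈ K, m c * (ζ c + t * v c) = 0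

/-- The contribution of `c` to the excess of the dual function over that of the parabola: the
integral of `ζ c + t β` over the part above `b` of the velocity interval. -/
def excessTerm {n : ℕ} (t : ℝ) (ζ m v : Fin n → ℝ) (b : ℝ) (c : Fin n) : ℝ :=
  ζ c * (hiEnd m v c - max (loEnd m v c) (min b (hiEnd m v c))) +
    t / 2 * (hiEnd m v c ^ 2 - max (loEnd m v c) (min b (hiEnd m v c)) ^ 2)

/-- The dual function: the profile is `y ↦ min_b (b y + profileDual b)`. -/
def profileDual {n : ℕ} (t : ℝ) (ζ m v : Fin n → ℝ) (b : ℝ) : ℝ :=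
  t * b ^ 2 / 2 + ∑ c, excessTerm t ζ m v b c

/-- `w` clipped to lie below the velocity intervals of `K` and above those of the complement. -/
def clipVel {n : ℕ} (m v : Fin n → ℝ) (K : Finset (Fin n)) (w : ℝ) : ℝ :=
  Kᶜ.fold max (K.fold min w (loEnd m v)) (hiEnd m v)

/-- The right derivative of the profile at `y`. -/
def profileSlope {n : ℕ} (t : ℝ) (ζ m v : Fin n → ℝ) (y : ℝ) : ℝ :=
  clipVel m v (Finset.univ.filter fun c => ζ c ≤ y) (-y / t)

/-- The left derivative of the profile at `y`. -/
def profileSlopeL {n : ℕ} (t : ℝ) (ζ m v : Fin n → ℝ) (y : ℝ) : ℝ :=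
  clipVel m v (Finset.univ.filter fun c => ζ c < y) (-y / t)

/-- The profile `y ↦ min_b (b y + profileDual b)`, written with its minimizer. -/
def profile {n : ℕ} (t : ℝ) (ζ m v : Fin n → ℝ) (y : ℝ) : ℝ :=
  profileSlope t ζ m v y * y + profileDual t ζ m v (profileSlope t ζ m v y)

lemma continuous_clipVel {n : ℕ} (m v : Fin n → ℝ) (K : Finset (Fin n)) :
    Continuous (clipVel m v K) := by
  have h1 : ∀ K : Finset (Fin n), Continuous fun w => K.fold min w (loEnd m v) := fun K => by
    induction K using Finset.induction_on with
    | empty => simp only [Finset.fold_empty]; fun_prop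
    | insert a K ha ih =>
      simp only [Finset.fold_insert ha]
      exact continuous_const.min ih
  have h2 : ∀ K : Finset (Fin n), Continuous fun w => K.fold max w (hiEnd m v) := fun K => by
    induction K using Finset.induction_on with
    | empty => simp only [Finset.fold_empty]; fun_prop
    | insert a K ha ih =>
      simp only [Finset.fold_insert ha]
      exact continuous_const.max ih
  exact (h2 Kᶜ).comp (h1 K)

namespace ClusterProfile
variable {n : ℕ} {t : ℝ} {ζ m v : Fin n → ℝ}

lemma lo_lt_hi (h : ClusterProfile t ζ m v) (c : Fin n) : loEnd m v c < hiEnd m v c := by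
  have := h.m_pos c
  rw [loEnd, hiEnd]; linarith

lemma lo_antitone (h : ClusterProfile t ζ m v) {c c' : Fin n} (hc : c ≤ c') :
    loEnd m v c' ≤ loEnd m v c := by
  rcases hc.eq_or_lt with rfl | hc
  · exact le_rfl
  · exact (h.lo_lt_hi c').le.trans (h.gap c c' hc)

lemma clip_le (h : ClusterProfile t ζ m v) {K : Finset (Fin n)}
    (hK : ∀ c ∈ K, ∀ c' ∉ K, c < c') (w : ℝ) {c : Fin n} (hc : c ∈ K) :
    clipVel m v K w ≤ loEnd m v c := by
  rw [clipVel, Finset.fold_max_le]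
  refine ⟨(Finset.fold_min_le _).2 (Or.inr ⟨c, hc, le_rfl⟩), fun c' hc' => ?_⟩
  exact h.gap c c' (hK c hc c' (Finset.mem_compl.1 hc'))

lemma le_clip {K : Finset (Fin n)} (w : ℝ) {c : Fin n} (hc : c ∉ K) :
    hiEnd m v c ≤ clipVel m v K w := by
  rw [clipVel, Finset.le_fold_max]
  exact Or.inr ⟨c, Finset.mem_compl.2 hc, le_rfl⟩

/-- If the clipping takes effect from below, it does so at the right end of a velocity interval of
the complement of `K`. -/
lemma lt_clip {K : Finset (Fin n)}
    {w : ℝ} (hw : w < clipVel m v K w) : ∃ c ∉ K, clipVel m v K w = hiEnd m v c := by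
  by_contra hne
  push Not at hne
  have h1 : ∀ c ∉ K, hiEnd m v c < clipVel m v K w := fun c hc =>
    lt_of_le_of_ne (le_clip w hc) (hne c hc).symm
  have h2 : clipVel m v K w ≤ K.fold min w (loEnd m v) := by
    have := (Finset.le_fold_max (s := Kᶜ) (b := K.fold min w (loEnd m v)) (f := hiEnd m v)
      (clipVel m v K w)).1 le_rfl
    rcases this with h | ⟨c, hc, h⟩
    · exact h
    · exact absurd h (not_le.2 (h1 c (Finset.mem_compl.1 hc)))
  have h3 : K.fold min w (loEnd m v) ≤ w := (Finset.fold_min_le _).2 (Or.inl le_rfl)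
  linarith

/-- If the clipping takes effect from above, it does so at the left end of a velocity interval of
`K`. -/
lemma clip_lt (h : ClusterProfile t ζ m v) {K : Finset (Fin n)}
    (hK : ∀ c ∈ K, ∀ c' ∉ K, c < c') {w : ℝ} (hw : clipVel m v K w < w) :
    ∃ c ∈ K, clipVel m v K w = loEnd m v c := by
  have h1 : K.fold min w (loEnd m v) ≤ clipVel m v K w := by
    rw [clipVel, Finset.le_fold_max]; exact Or.inl le_rfl
  rcases (Finset.fold_min_le _).1 h1 with h2 | ⟨c, hc, h2⟩
  · exact absurd h2 (not_le.2 hw)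
  · exact ⟨c, hc, le_antisymm (h.clip_le hK w hc) h2⟩

lemma lower_le (h : ClusterProfile t ζ m v) (y : ℝ) :
    ∀ c ∈ Finset.univ.filter (fun c => ζ c ≤ y), ∀ c' ∉ Finset.univ.filter (fun c => ζ c ≤ y),
      c < c' := by
  intro c hc c' hc'
  simp only [Finset.mem_filter, Finset.mem_univ, true_and] at hc hc'
  by_contra hle
  exact hc' ((h.mono (not_lt.1 hle)).trans hc)

lemma lower_lt (h : ClusterProfile t ζ m v) (y : ℝ) :
    ∀ c ∈ Finset.univ.filter (fun c => ζ c < y), ∀ c' ∉ Finset.univ.filter (fun c => ζ c < y),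
      c < c' := by
  intro c hc c' hc'
  simp only [Finset.mem_filter, Finset.mem_univ, true_and] at hc hc'
  by_contra hle
  exact hc' ((h.mono (not_lt.1 hle)).trans_lt hc)

/-- Outside the velocity intervals, `-t b` is to the left of the clusters with slower intervals. -/
lemma neg_mul_le (h : ClusterProfile t ζ m v) {b : ℝ}
    (hb : ∀ c, b ∉ Ico (loEnd m v c) (hiEnd m v c)) {c : Fin n} (hc : hiEnd m v c ≤ b) :
    -t * b ≤ ζ c := by
  set S := Finset.univ.filter fun c => hiEnd m v c ≤ b
  have hne : S.Nonempty := ⟨c, by simpa [S] using hc⟩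
  set d := S.min' hne
  have hd : hiEnd m v d ≤ b := (Finset.mem_filter.1 (S.min'_mem hne)).2
  have hdc : d ≤ c := S.min'_le c (by simpa [S] using hc)
  set K := Finset.univ.filter fun c => b < loEnd m v c
  have hK' : ∀ c, c ∉ K → hiEnd m v c ≤ b := fun c hc => by
    by_contra hlt
    exact hb c ⟨by simpa [K] using hc, not_le.1 hlt⟩
  have hK : ∀ c ∈ K, ∀ c' ∉ K, c < c' := fun c hc c' hc' => by
    by_contra hle
    have h1 := h.lo_antitone (not_lt.1 hle)
    have h2 := (Finset.mem_filter.1 hc).2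
    exact hc' (by simp only [K, Finset.mem_filter, Finset.mem_univ, true_and]; linarith)
  have h0 := h.mom_zero K hK fun c hc c' hc' => (hK' c' hc').trans_lt (Finset.mem_filter.1 hc).2
  have hdK : d ∉ K := fun hdK => by
    have := (Finset.mem_filter.1 hdK).2
    linarith [h.lo_lt_hi d]
  -- add to the faster clusters the leftmost slower one, `d`; what its momentum adds is nonnegative
  have h1 := h.mom_nonneg (insert d K) fun c hc c' hc' => by
    have hc'K : c' ∉ K := fun h => hc' (Finset.mem_insert_of_mem h)
    rcases Finset.mem_insert.1 hc with rfl | hc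
    · exact lt_of_le_of_ne (S.min'_le c' (by simpa [S] using hK' c' hc'K))
        fun e => hc' (by rw [← e]; exact Finset.mem_insert_self _ _)
    · exact hK c hc c' hc'K
  rw [Finset.sum_insert hdK, h0, add_zero] at h1
  have h2 : 0 ≤ ζ d + t * v d := nonneg_of_mul_nonneg_right h1 (h.m_pos d)
  have h3 : v d ≤ b := by
    rw [hiEnd] at hd; linarith [h.m_pos d]
  have h4 := mul_le_mul_of_nonneg_left h3 h.t_pos.le
  linarith [h.mono hdc]

/-- Outside the velocity intervals, `-t b` is to the right of the clusters with faster intervals. -/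
lemma le_neg_mul (h : ClusterProfile t ζ m v) {b : ℝ}
    (hb : ∀ c, b ∉ Ico (loEnd m v c) (hiEnd m v c)) {c : Fin n} (hc : b ≤ loEnd m v c) :
    ζ c ≤ -t * b := by
  set K := Finset.univ.filter fun c => b < loEnd m v c with hKdef
  have hcK : c ∈ K := by
    simp only [K, Finset.mem_filter, Finset.mem_univ, true_and]
    exact lt_of_le_of_ne hc fun e => hb c ⟨e.ge, by rw [e]; exact h.lo_lt_hi c⟩
  set d := K.max' ⟨c, hcK⟩
  have hd : d ∈ K := K.max'_mem _
  have hdc : c ≤ d := K.le_max' c hcK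
  have hK' : ∀ c, c ∉ K → hiEnd m v c ≤ b := fun c hc => by
    by_contra hlt
    exact hb c ⟨by simpa [K] using hc, not_le.1 hlt⟩
  have hK : ∀ c ∈ K, ∀ c' ∉ K, c < c' := fun c hc c' hc' => by
    by_contra hle
    have h1 := h.lo_antitone (not_lt.1 hle)
    have h2 := (Finset.mem_filter.1 hc).2
    exact hc' (by simp only [K, Finset.mem_filter, Finset.mem_univ, true_and]; linarith)
  have h0 := h.mom_zero K hK fun c hc c' hc' => (hK' c' hc').trans_lt (Finset.mem_filter.1 hc).2
  -- take away from the faster clusters the rightmost one, `d`; what its momentum adds is not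
  -- positive
  have h1 := h.mom_nonneg (K.erase d) fun c hc c' hc' => by
    have hc2 := Finset.mem_erase.1 hc
    by_cases e : c' = d
    · rw [e]; exact lt_of_le_of_ne (K.le_max' c hc2.2) hc2.1
    · exact hK c hc2.2 c' fun h => hc' (Finset.mem_erase.2 ⟨e, h⟩)
  rw [← Finset.add_sum_erase K _ hd] at h0
  have h2 : ζ d + t * v d ≤ 0 := by
    by_contra hlt
    have := mul_pos (h.m_pos d) (not_le.1 hlt)
    linarith
  have h3 : b ≤ v d := by
    have := (Finset.mem_filter.1 hd).2
    rw [loEnd] at this; linarith [h.m_pos d]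
  have h4 := mul_le_mul_of_nonneg_left h3 h.t_pos.le
  linarith [h.mono hdc]

/-- The right derivative of `b ↦ b y + profileDual b`. -/
def _root_.dualSlope {n : ℕ} (t : ℝ) (ζ m v : Fin n → ℝ) (y b : ℝ) : ℝ :=
  y + t * b - ∑ c, if b ∈ Ico (loEnd m v c) (hiEnd m v c) then ζ c + t * b else 0

lemma dualSlope_of_mem (h : ClusterProfile t ζ m v) {y b : ℝ} {c : Fin n}
    (hb : b ∈ Ico (loEnd m v c) (hiEnd m v c)) : dualSlope t ζ m v y b = y - ζ c := by
  rw [dualSlope, Finset.sum_eq_single c]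
  · rw [if_pos hb]; ring
  · intro d _ hd
    refine if_neg fun hb' => ?_
    rcases lt_or_gt_of_ne hd with hlt | hlt
    · have := h.gap _ _ hlt; linarith [hb.2, hb'.1]
    · have := h.gap _ _ hlt; linarith [hb.1, hb'.2]
  · simp

lemma dualSlope_of_notMem {y b : ℝ} (hb : ∀ c, b ∉ Ico (loEnd m v c) (hiEnd m v c)) :
    dualSlope t ζ m v y b = y + t * b := by
  rw [dualSlope, Finset.sum_eq_zero fun c _ => if_neg (hb c), sub_zero]

/-- To the right of the clipped velocity, `b ↦ b y + profileDual b` is nondecreasing. -/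
lemma dualSlope_nonneg (h : ClusterProfile t ζ m v) {y b : ℝ} {K : Finset (Fin n)}
    (hK : ∀ c ∈ K, ∀ c' ∉ K, c < c') (hy : ∀ c ∈ K, ζ c ≤ y)
    (hb : clipVel m v K (-y / t) ≤ b) : 0 ≤ dualSlope t ζ m v y b := by
  have ht := h.t_pos
  by_cases hblk : ∃ c, b ∈ Ico (loEnd m v c) (hiEnd m v c)
  · obtain ⟨c, hc⟩ := hblk
    rw [h.dualSlope_of_mem hc, sub_nonneg]
    refine hy c ?_
    by_contra hcK
    linarith [le_clip (m := m) (v := v) (-y / t) hcK, hc.2]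
  · push Not at hblk
    rw [dualSlope_of_notMem hblk]
    have key : -y / t ≤ b := by
      by_contra hlt
      push Not at hlt
      obtain ⟨c, hc, he⟩ := h.clip_lt hK (hb.trans_lt hlt)
      have h1 : hiEnd m v c ≤ b := by
        by_contra h2
        exact hblk c ⟨he ▸ hb, not_le.1 h2⟩
      have h2 := h.neg_mul_le hblk h1
      have h3 := hy c hc
      rw [lt_div_iff₀ ht] at hlt
      linarith
    rw [div_le_iff₀ ht] at key
    linarith

/-- To the left of the clipped velocity, `b ↦ b y + profileDual b` is nonincreasing. -/
lemma dualSlope_nonpos (h : ClusterProfile t ζ m v) {y b : ℝ} {K : Finset (Fin n)}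
    (hK : ∀ c ∈ K, ∀ c' ∉ K, c < c') (hy : ∀ c ∉ K, y ≤ ζ c)
    (hb : b < clipVel m v K (-y / t)) : dualSlope t ζ m v y b ≤ 0 := by
  have ht := h.t_pos
  by_cases hblk : ∃ c, b ∈ Ico (loEnd m v c) (hiEnd m v c)
  · obtain ⟨c, hc⟩ := hblk
    rw [h.dualSlope_of_mem hc, sub_nonpos]
    refine hy c fun hcK => ?_
    linarith [h.clip_le hK (-y / t) hcK, hc.1]
  · push Not at hblk
    rw [dualSlope_of_notMem hblk]
    have key : b ≤ -y / t := by
      by_contra hlt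
      push Not at hlt
      obtain ⟨c, hc, he⟩ := lt_clip (hlt.trans hb)
      have h1 : b ≤ loEnd m v c := by
        by_contra h2
        exact hblk c ⟨(not_le.1 h2).le, he ▸ hb⟩
      have h2 := h.le_neg_mul hblk h1
      have h3 := hy c hc
      rw [div_lt_iff₀ ht] at hlt
      linarith
    rw [le_div_iff₀ ht] at key
    linarith

lemma hasDerivWithinAt_excessTerm (h : ClusterProfile t ζ m v) (b : ℝ) (c : Fin n) :
    HasDerivWithinAt (fun b => excessTerm t ζ m v b c)
      (-(if b ∈ Ico (loEnd m v c) (hiEnd m v c) then ζ c + t * b else 0)) (Ici b) b := by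
  have hlh := h.lo_lt_hi c
  rcases lt_or_ge b (loEnd m v c) with h1 | h1
  · rw [if_neg fun hb => absurd hb.1 (not_le.2 h1), neg_zero]
    refine (hasDerivWithinAt_const b _ (excessTerm t ζ m v b c)).congr_of_eventuallyEq ?_ rfl
    filter_upwards [mem_nhdsWithin_of_mem_nhds (Iio_mem_nhds h1)] with r hr
    have hr' : r < loEnd m v c := hr
    simp only [excessTerm, max_eq_left ((min_le_left r (hiEnd m v c)).trans hr'.le),
      max_eq_left ((min_le_left b (hiEnd m v c)).trans h1.le)]
  rcases lt_or_ge b (hiEnd m v c) with h2 | h2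
  · rw [if_pos ⟨h1, h2⟩]
    have hd : HasDerivAt (fun b : ℝ => ζ c * (hiEnd m v c - b) + t / 2 * (hiEnd m v c ^ 2 - b ^ 2))
        (-(ζ c + t * b)) b := by
      have e1 := ((hasDerivAt_id b).const_sub (hiEnd m v c)).const_mul (ζ c)
      have e2 := (((hasDerivAt_id b).fun_pow 2).const_sub (hiEnd m v c ^ 2)).const_mul (t / 2)
      refine (e1.add e2).congr_deriv ?_
      simp only [id]; push_cast; ring
    have heq : ∀ r, b ≤ r → r < hiEnd m v c → excessTerm t ζ m v r c =
        ζ c * (hiEnd m v c - r) + t / 2 * (hiEnd m v c ^ 2 - r ^ 2) := fun r h3 h4 => by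
      rw [excessTerm, min_eq_left h4.le, max_eq_right (h1.trans h3)]
    refine hd.hasDerivWithinAt.congr_of_eventuallyEq ?_ (heq b le_rfl h2)
    filter_upwards [self_mem_nhdsWithin, mem_nhdsWithin_of_mem_nhds (Iio_mem_nhds h2)] with r h3 h4
    exact heq r h3 h4
  · rw [if_neg fun hb => absurd hb.2 (not_lt.2 h2), neg_zero]
    refine (hasDerivWithinAt_const b _ (excessTerm t ζ m v b c)).congr (fun r hr => ?_) rfl
    simp only [excessTerm, min_eq_right h2, min_eq_right (h2.trans hr)]

lemma hasDerivWithinAt_dual (h : ClusterProfile t ζ m v) (y b : ℝ) :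
    HasDerivWithinAt (fun b => b * y + profileDual t ζ m v b) (dualSlope t ζ m v y b)
      (Ici b) b := by
  have e1 : HasDerivWithinAt (fun b : ℝ => b * y) y (Ici b) b := by
    simpa using ((hasDerivAt_id b).mul_const y).hasDerivWithinAt
  have e2 : HasDerivWithinAt (fun b : ℝ => t * b ^ 2 / 2) (t * b) (Ici b) b := by
    refine ((((hasDerivAt_id b).fun_pow 2).const_mul t).div_const 2).hasDerivWithinAt.congr_deriv ?_
    simp only [id]; push_cast; ring
  have e3 := HasDerivWithinAt.fun_sum (u := Finset.univ)
    fun c (_ : c ∈ Finset.univ) => h.hasDerivWithinAt_excessTerm b c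
  refine (e1.add (e2.add e3)).congr_deriv ?_
  rw [dualSlope, Finset.sum_neg_distrib]; ring

lemma _root_.continuous_profileDual (t : ℝ) (ζ m v : Fin n → ℝ) :
    Continuous (profileDual t ζ m v) := by
  unfold profileDual excessTerm
  fun_prop

/-- The clipped velocity minimizes `b ↦ b y + profileDual b`. -/
lemma dual_min (h : ClusterProfile t ζ m v) {y : ℝ} {K : Finset (Fin n)}
    (hK : ∀ c ∈ K, ∀ c' ∉ K, c < c') (hy : ∀ c ∈ K, ζ c ≤ y) (hy' : ∀ c ∉ K, y ≤ ζ c) (b : ℝ) :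
    clipVel m v K (-y / t) * y + profileDual t ζ m v (clipVel m v K (-y / t)) ≤
      b * y + profileDual t ζ m v b := by
  set q := clipVel m v K (-y / t)
  set H : ℝ → ℝ := fun b => b * y + profileDual t ζ m v b with hH
  have hc : Continuous H := by
    have := continuous_profileDual t ζ m v
    fun_prop
  change H q ≤ H b
  rcases le_total q b with hb | hb
  · have := image_le_of_deriv_right_le_deriv_boundary (f := fun r => -H r)
      (f' := fun r => -dualSlope t ζ m v y r) (a := q) (b := b) (B := fun _ => -H q)
      (B' := fun _ => 0) hc.neg.continuousOn (fun r _ => (h.hasDerivWithinAt_dual y r).neg) le_rfl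
      continuousOn_const (fun r _ => hasDerivWithinAt_const _ _ _)
      (fun r hr => neg_nonpos.2 (h.dualSlope_nonneg hK hy hr.1)) (right_mem_Icc.2 hb)
    linarith
  · exact image_le_of_deriv_right_le_deriv_boundary (f := H)
      (f' := fun r => dualSlope t ζ m v y r) (a := b) (b := q) (B := fun _ => H b)
      (B' := fun _ => 0) hc.continuousOn (fun r _ => h.hasDerivWithinAt_dual y r) le_rfl
      continuousOn_const (fun r _ => hasDerivWithinAt_const _ _ _)
      (fun r hr => h.dualSlope_nonpos hK hy' hr.2) (right_mem_Icc.2 hb)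

lemma profile_le (h : ClusterProfile t ζ m v) (y b : ℝ) :
    profile t ζ m v y ≤ b * y + profileDual t ζ m v b :=
  h.dual_min (h.lower_le y) (fun c hc => (Finset.mem_filter.1 hc).2)
    (fun c hc => le_of_lt (by simpa using hc)) b

lemma profile_le_line (h : ClusterProfile t ζ m v) (y y' : ℝ) :
    profile t ζ m v y' ≤ profile t ζ m v y + profileSlope t ζ m v y * (y' - y) := by
  refine (h.profile_le y' (profileSlope t ζ m v y)).trans (le_of_eq ?_)
  rw [profile]; ring

end ClusterProfile
end

noncomputable section
open Set Filter Topology MeasureTheory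

/-! ### The profile is a concave shape -/

namespace ClusterProfile
variable {n : ℕ} {t : ℝ} {ζ m v : Fin n → ℝ}

/-- Between the velocity intervals, the excess of the dual function is a momentum. -/
lemma profileDual_of_between (h : ClusterProfile t ζ m v) {K : Finset (Fin n)} {b : ℝ}
    (h1 : ∀ c ∈ K, b ≤ loEnd m v c) (h2 : ∀ c ∉ K, hiEnd m v c ≤ b) :
    profileDual t ζ m v b = t * b ^ 2 / 2 + ∑ c ∈ K, m c * (ζ c + t * v c) := by
  rw [profileDual]
  congr 1
  rw [← Finset.sum_subset (Finset.subset_univ K)]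
  · refine Finset.sum_congr rfl fun c hc => ?_
    rw [excessTerm, max_eq_left ((min_le_left _ _).trans (h1 c hc)), loEnd, hiEnd]
    ring
  · intro c _ hc
    rw [excessTerm, min_eq_right (h2 c hc), max_eq_right (h.lo_lt_hi c).le]
    ring

/-- At a clipped velocity the excess of the dual function is the momentum of the clusters in `K`. -/
lemma profileDual_clip (h : ClusterProfile t ζ m v) {K : Finset (Fin n)}
    (hK : ∀ c ∈ K, ∀ c' ∉ K, c < c') (w : ℝ) :
    profileDual t ζ m v (clipVel m v K w) =
      t * clipVel m v K w ^ 2 / 2 + ∑ c ∈ K, m c * (ζ c + t * v c) :=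
  h.profileDual_of_between (fun _ hc => h.clip_le hK w hc) fun _ hc => le_clip w hc

/-- The height of the profile above the parabola is the sum of two nonnegative terms: one from the
deviation of its slope from the slope `-y / t` of the parabola, and the momentum of the clusters to
the left. -/
lemma profile_eq (h : ClusterProfile t ζ m v) (y : ℝ) :
    profile t ζ m v y = parab t y + t / 2 * (profileSlope t ζ m v y + y / t) ^ 2 +
      ∑ c with ζ c ≤ y, m c * (ζ c + t * v c) := by
  have ht := h.t_pos
  rw [profile]
  conv_lhs => rw [profileSlope, h.profileDual_clip (h.lower_le y)]
  rw [profileSlope, parab]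
  field_simp
  ring

lemma parab_le_profile (h : ClusterProfile t ζ m v) (y : ℝ) : parab t y ≤ profile t ζ m v y := by
  rw [h.profile_eq]
  have h1 := h.mom_nonneg _ (h.lower_le y)
  have h2 : 0 ≤ t / 2 * (profileSlope t ζ m v y + y / t) ^ 2 :=
    mul_nonneg (by linarith [h.t_pos]) (sq_nonneg _)
  linarith

lemma profile_eq_left (h : ClusterProfile t ζ m v) (y : ℝ) :
    profile t ζ m v y = profileSlopeL t ζ m v y * y +
      profileDual t ζ m v (profileSlopeL t ζ m v y) := by
  refine le_antisymm (h.profile_le y _) ?_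
  exact h.dual_min (h.lower_lt y) (fun c hc => (Finset.mem_filter.1 hc).2.le)
    (fun c hc => by simpa using hc) _

lemma profile_le_line_left (h : ClusterProfile t ζ m v) (y y' : ℝ) :
    profile t ζ m v y' ≤ profile t ζ m v y + profileSlopeL t ζ m v y * (y' - y) := by
  refine (h.profile_le y' (profileSlopeL t ζ m v y)).trans (le_of_eq ?_)
  rw [h.profile_eq_left y]; ring

lemma concaveOn_profile (h : ClusterProfile t ζ m v) : ConcaveOn ℝ univ (profile t ζ m v) := by
  refine ⟨convex_univ, fun x _ y _ a b ha hb hab => ?_⟩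
  simp only [smul_eq_mul]
  have h1 := mul_le_mul_of_nonneg_left (h.profile_le_line (a * x + b * y) x) ha
  have h2 := mul_le_mul_of_nonneg_left (h.profile_le_line (a * x + b * y) y) hb
  set p := profileSlope t ζ m v (a * x + b * y)
  set P := profile t ζ m v (a * x + b * y)
  have hb' : b = 1 - a := by linarith
  subst hb'
  nlinarith

lemma eventually_lower_right (ζ : Fin n → ℝ) (y : ℝ) : ∀ᶠ y' in 𝓝[≥] y,
    (Finset.univ.filter fun c => ζ c ≤ y') = Finset.univ.filter fun c => ζ c ≤ y := by
  have h1 : ∀ᶠ y' in 𝓝 y, ∀ c, y < ζ c → y' < ζ c := by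
    rw [eventually_all]
    intro c
    by_cases hc : y < ζ c
    · filter_upwards [Iio_mem_nhds hc] with y' hy' _ using hy'
    · exact Eventually.of_forall fun _ h => absurd h hc
  filter_upwards [mem_nhdsWithin_of_mem_nhds h1, self_mem_nhdsWithin] with y' h2 h3
  ext c
  simp only [Finset.mem_filter, Finset.mem_univ, true_and]
  exact ⟨fun h => not_lt.1 fun h' => absurd (h2 c h') (not_lt.2 h), fun h => h.trans h3⟩

lemma eventually_lower_left (ζ : Fin n → ℝ) (y : ℝ) : ∀ᶠ y' in 𝓝[<] y,
    (Finset.univ.filter fun c => ζ c ≤ y') = Finset.univ.filter fun c => ζ c < y := by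
  have h1 : ∀ᶠ y' in 𝓝 y, ∀ c, ζ c < y → ζ c < y' := by
    rw [eventually_all]
    intro c
    by_cases hc : ζ c < y
    · filter_upwards [Ioi_mem_nhds hc] with y' hy' _ using hy'
    · exact Eventually.of_forall fun _ h => absurd h hc
  filter_upwards [mem_nhdsWithin_of_mem_nhds h1, self_mem_nhdsWithin] with y' h2 h3
  ext c
  simp only [Finset.mem_filter, Finset.mem_univ, true_and]
  exact ⟨fun h => h.trans_lt h3, fun h => (h2 c h).le⟩

lemma tendsto_profileSlope_right (ζ : Fin n → ℝ) (t : ℝ) (m v : Fin n → ℝ) (y : ℝ) :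
    Tendsto (profileSlope t ζ m v) (𝓝[≥] y) (𝓝 (profileSlope t ζ m v y)) := by
  have h1 : Tendsto (fun y' => clipVel m v (Finset.univ.filter fun c => ζ c ≤ y) (-y' / t)) (𝓝[≥] y)
      (𝓝 (profileSlope t ζ m v y)) := by
    have hc : Continuous fun y' => clipVel m v (Finset.univ.filter fun c => ζ c ≤ y) (-y' / t) :=
      (continuous_clipVel m v _).comp (by fun_prop)
    exact (hc.tendsto y).mono_left nhdsWithin_le_nhds
  refine h1.congr' ?_
  filter_upwards [eventually_lower_right ζ y] with y' hy'
  rw [profileSlope, hy']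

lemma tendsto_profileSlope_left (ζ : Fin n → ℝ) (t : ℝ) (m v : Fin n → ℝ) (y : ℝ) :
    Tendsto (profileSlope t ζ m v) (𝓝[<] y) (𝓝 (profileSlopeL t ζ m v y)) := by
  have h1 : Tendsto (fun y' => clipVel m v (Finset.univ.filter fun c => ζ c < y) (-y' / t)) (𝓝[<] y)
      (𝓝 (profileSlopeL t ζ m v y)) := by
    have hc : Continuous fun y' => clipVel m v (Finset.univ.filter fun c => ζ c < y) (-y' / t) :=
      (continuous_clipVel m v _).comp (by fun_prop)
    exact (hc.tendsto y).mono_left nhdsWithin_le_nhds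
  refine h1.congr' ?_
  filter_upwards [eventually_lower_left ζ y] with y' hy'
  rw [profileSlope, hy']

lemma hasDerivWithinAt_profile_right (h : ClusterProfile t ζ m v) (y : ℝ) :
    HasDerivWithinAt (profile t ζ m v) (profileSlope t ζ m v y) (Ici y) y := by
  rw [hasDerivWithinAt_iff_tendsto_slope, Ici_sdiff_left]
  refine tendsto_of_tendsto_of_tendsto_of_le_of_le'
    ((tendsto_profileSlope_right ζ t m v y).mono_left (nhdsWithin_mono y Ioi_subset_Ici_self))
    tendsto_const_nhds ?_ ?_
  · filter_upwards [self_mem_nhdsWithin] with y' hy'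
    have hy : 0 < y' - y := sub_pos.2 hy'
    rw [slope_def_field, le_div_iff₀ hy]
    have := h.profile_le_line y' y
    linarith
  · filter_upwards [self_mem_nhdsWithin] with y' hy'
    have hy : 0 < y' - y := sub_pos.2 hy'
    rw [slope_def_field, div_le_iff₀ hy]
    have := h.profile_le_line y y'
    linarith

lemma hasDerivWithinAt_profile_left (h : ClusterProfile t ζ m v) (y : ℝ) :
    HasDerivWithinAt (profile t ζ m v) (profileSlopeL t ζ m v y) (Iic y) y := by
  rw [hasDerivWithinAt_iff_tendsto_slope, Iic_sdiff_right]
  refine tendsto_of_tendsto_of_tendsto_of_le_of_le' tendsto_const_nhds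
    (tendsto_profileSlope_left ζ t m v y) ?_ ?_
  · filter_upwards [self_mem_nhdsWithin] with y' hy'
    have hy : 0 < y - y' := sub_pos.2 hy'
    rw [slope_comm, slope_def_field, le_div_iff₀ hy]
    have := h.profile_le_line_left y y'
    linarith
  · filter_upwards [self_mem_nhdsWithin] with y' hy'
    have hy : 0 < y - y' := sub_pos.2 hy'
    rw [slope_comm, slope_def_field, div_le_iff₀ hy]
    have := h.profile_le_line y' y
    linarith

lemma lower_eq_of_notMem {y : ℝ} (hy : y ∉ range ζ) :
    (Finset.univ.filter fun c => ζ c < y) = Finset.univ.filter fun c => ζ c ≤ y := by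
  ext c
  simp only [Finset.mem_filter, Finset.mem_univ, true_and]
  exact ⟨le_of_lt, fun h => lt_of_le_of_ne h fun e => hy ⟨c, e⟩⟩

lemma profileSlopeL_of_notMem {y : ℝ} (hy : y ∉ range ζ) :
    profileSlopeL t ζ m v y = profileSlope t ζ m v y := by
  rw [profileSlopeL, profileSlope, lower_eq_of_notMem hy]

lemma hasDerivAt_profile (h : ClusterProfile t ζ m v) {y : ℝ} (hy : y ∉ range ζ) :
    HasDerivAt (profile t ζ m v) (profileSlope t ζ m v y) y := by
  have h1 := h.hasDerivWithinAt_profile_left y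
  rw [profileSlopeL_of_notMem hy] at h1
  have := h1.union (h.hasDerivWithinAt_profile_right y)
  rwa [Iic_union_Ici, hasDerivWithinAt_univ] at this

lemma continuousAt_profileSlope {y : ℝ} (hy : y ∉ range ζ) :
    ContinuousAt (profileSlope t ζ m v) y := by
  rw [continuousAt_iff_continuous_left'_right']
  refine ⟨?_, ?_⟩
  · have := tendsto_profileSlope_left ζ t m v y
    rwa [profileSlopeL_of_notMem hy] at this
  · exact (tendsto_profileSlope_right ζ t m v y).mono_left
      (nhdsWithin_mono y Ioi_subset_Ici_self)

lemma continuous_profile (h : ClusterProfile t ζ m v) : Continuous (profile t ζ m v) :=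
  continuousOn_univ.1 (h.concaveOn_profile.continuousOn isOpen_univ)

/-- Above the parabola, the slope of the profile is an end of a velocity interval. -/
lemma profileSlope_mem (h : ClusterProfile t ζ m v) {y : ℝ}
    (hy : parab t y < profile t ζ m v y) :
    profileSlope t ζ m v y ∈ range (loEnd m v) ∪ range (hiEnd m v) := by
  by_contra hne
  simp only [mem_union, mem_range, not_or, not_exists] at hne
  set K := Finset.univ.filter fun c => ζ c ≤ y
  have hK := h.lower_le y
  have hp : profileSlope t ζ m v y = clipVel m v K (-y / t) := rfl
  have h1 : profileSlope t ζ m v y = -y / t := by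
    rcases lt_trichotomy (clipVel m v K (-y / t)) (-y / t) with h2 | h2 | h2
    · obtain ⟨c, -, hc⟩ := h.clip_lt hK h2
      exact absurd hc.symm (hne.1 c)
    · exact h2
    · obtain ⟨c, -, hc⟩ := lt_clip h2
      exact absurd hc.symm (hne.2 c)
  have h2 : ∑ c ∈ K, m c * (ζ c + t * v c) = 0 := by
    refine h.mom_zero K hK fun c hc c' hc' => ?_
    have i1 : hiEnd m v c' < profileSlope t ζ m v y :=
      lt_of_le_of_ne (le_clip _ hc') (hne.2 c')
    have i2 : profileSlope t ζ m v y < loEnd m v c :=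
      lt_of_le_of_ne (h.clip_le hK _ hc) fun e => hne.1 c e.symm
    exact i1.trans i2
  rw [h.profile_eq, h1, h2] at hy
  have : -y / t + y / t = 0 := by ring
  rw [this] at hy
  simp at hy

/-- The profile is the shape through its own values at the positions of the clusters. -/
lemma isShapeAt_profile (h : ClusterProfile t ζ m v) {k : ℕ} {x : Fin k → ℝ}
    {hv : EuclideanSpace ℝ (Fin k)} (hx : range x = range ζ)
    (hval : ∀ c, hv c = profile t ζ m v (x c)) : IsShapeAt t x hv (profile t ζ m v) where
  continuous := h.continuous_profile
  contDiffOn := by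
    have hopen : IsOpen (range x)ᶜ := (Set.finite_range x).isClosed.isOpen_compl
    rw [show (1 : WithTop ℕ∞) = 0 + 1 by rfl, contDiffOn_succ_iff_deriv_of_isOpen hopen]
    refine ⟨fun y hy => (h.hasDerivAt_profile (by rwa [← hx])).differentiableAt.differentiableWithinAt,
      by simp, ?_⟩
    rw [contDiffOn_zero]
    refine ContinuousOn.congr (f := profileSlope t ζ m v) (fun y hy => ?_) fun y hy => ?_
    · exact (continuousAt_profileSlope (by rwa [← hx])).continuousWithinAt
    · exact (h.hasDerivAt_profile (by rwa [← hx])).deriv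
  value := fun c => (hval c).symm
  ge_parab := h.parab_le_profile
  eq_parab := by
    have ht := h.t_pos
    set C : ℝ := (∑ c, |ζ c|) + t * ((∑ c, |loEnd m v c|) + ∑ c, |hiEnd m v c|) with hC
    have b1 : ∀ c, |ζ c| ≤ ∑ c, |ζ c| := fun c =>
      Finset.single_le_sum (f := fun c => |ζ c|) (fun c _ => abs_nonneg _) (Finset.mem_univ c)
    have b2 : ∀ c, |loEnd m v c| ≤ ∑ c, |loEnd m v c| := fun c =>
      Finset.single_le_sum (f := fun c => |loEnd m v c|) (fun c _ => abs_nonneg _)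
        (Finset.mem_univ c)
    have b3 : ∀ c, |hiEnd m v c| ≤ ∑ c, |hiEnd m v c| := fun c =>
      Finset.single_le_sum (f := fun c => |hiEnd m v c|) (fun c _ => abs_nonneg _)
        (Finset.mem_univ c)
    have s1 : 0 ≤ ∑ c, |ζ c| := Finset.sum_nonneg fun c _ => abs_nonneg _
    have s2 : 0 ≤ ∑ c, |loEnd m v c| := Finset.sum_nonneg fun c _ => abs_nonneg _
    have s3 : 0 ≤ ∑ c, |hiEnd m v c| := Finset.sum_nonneg fun c _ => abs_nonneg _
    have s2' := mul_nonneg ht.le s2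
    have s3' := mul_nonneg ht.le s3
    refine ⟨C + 1, fun y hy => ?_⟩
    have key : ∀ K : Finset (Fin n), (Finset.univ.filter fun c => ζ c ≤ y) = K →
        ∑ c ∈ K, m c * (ζ c + t * v c) = 0 → clipVel m v K (-y / t) = -y / t →
        profile t ζ m v y = parab t y := by
      intro K e h1 h2
      rw [h.profile_eq, profileSlope, e, h1, h2]
      have : -y / t + y / t = 0 := by ring
      rw [this]; simp
    rcases le_abs.1 hy with hy | hy
    · refine key Finset.univ (Finset.filter_true_of_mem fun c _ => ?_)
        (h.mom_zero _ (by simp) (by simp)) ?_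
      · have := b1 c; have := le_abs_self (ζ c); rw [mul_add] at hC; linarith
      · rcases (lt_trichotomy (clipVel m v Finset.univ (-y / t)) (-y / t)) with h2 | h2 | h2
        · obtain ⟨c, -, hc⟩ := h.clip_lt (by simp) h2
          exfalso
          rw [hc, lt_div_iff₀ ht] at h2
          have i1 := mul_le_mul_of_nonneg_left ((neg_abs_le (loEnd m v c)).trans' (neg_le_neg (b2 c))) ht.le
          rw [mul_add] at hC
          linarith
        · exact h2
        · obtain ⟨c, hc, -⟩ := lt_clip h2
          exact absurd (Finset.mem_univ c) hc
    · refine key ∅ (Finset.filter_false_of_mem fun c _ => ?_) (by simp) ?_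
      · have := b1 c; have := neg_abs_le (ζ c); rw [mul_add] at hC; linarith
      · rcases (lt_trichotomy (clipVel m v ∅ (-y / t)) (-y / t)) with h2 | h2 | h2
        · obtain ⟨c, hc, -⟩ := h.clip_lt (by simp) h2
          exact absurd hc (Finset.notMem_empty c)
        · exact h2
        · obtain ⟨c, -, hc⟩ := lt_clip h2
          exfalso
          rw [hc, div_lt_iff₀ ht] at h2
          have i1 := mul_le_mul_of_nonneg_left ((le_abs_self (hiEnd m v c)).trans (b3 c)) ht.le
          rw [mul_add] at hC
          linarith
  deriv_const := by
    intro a b hab hy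
    -- the slope is continuous and takes values in a finite set
    have hmaps : MapsTo (profileSlope t ζ m v) (Icc a b)
        (range (loEnd m v) ∪ range (hiEnd m v)) := fun y hyy => h.profileSlope_mem (hy y hyy).1
    have hcont : ContinuousOn (profileSlope t ζ m v) (Icc a b) := fun y hyy =>
      (continuousAt_profileSlope (by rw [← hx]; exact (hy y hyy).2)).continuousWithinAt
    have hfin : (range (loEnd m v) ∪ range (hiEnd m v)).Finite :=
      (Set.finite_range _).union (Set.finite_range _)
    rw [(h.hasDerivAt_profile (by rw [← hx]; exact (hy a ⟨le_rfl, hab⟩).2)).deriv,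
      (h.hasDerivAt_profile (by rw [← hx]; exact (hy b ⟨hab, le_rfl⟩).2)).deriv]
    exact hfin.countable.isTotallyDisconnected _ hmaps.image_subset
      (isPreconnected_Icc.image _ hcont) (mem_image_of_mem _ ⟨le_rfl, hab⟩)
      (mem_image_of_mem _ ⟨hab, le_rfl⟩)

/-- The velocity intervals of the clusters at `y` tile the interval of slopes at `y`, up to a null
set. -/
lemma profile_kink (h : ClusterProfile t ζ m v) {y : ℝ} :
    profileSlopeL t ζ m v y - profileSlope t ζ m v y = ∑ c with ζ c = y, m c := by
  set q := profileSlope t ζ m v y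
  set p := profileSlopeL t ζ m v y
  have hqp : q ≤ p :=
    h.concaveOn_profile.right_le_left (h.hasDerivWithinAt_profile_left y)
      (h.hasDerivWithinAt_profile_right y)
  set S := Finset.univ.filter fun c => ζ c = y
  have hlen : ∀ c, hiEnd m v c - loEnd m v c = m c := fun c => by rw [hiEnd, loEnd]; ring
  have hdisj : (S : Set (Fin n)).PairwiseDisjoint fun c => Ico (loEnd m v c) (hiEnd m v c) := by
    have key : ∀ c d : Fin n, c < d → Disjoint (Ico (loEnd m v c) (hiEnd m v c))
        (Ico (loEnd m v d) (hiEnd m v d)) := fun c d hcd =>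
      Set.disjoint_left.2 fun b hb hb' => by linarith [h.gap c d hcd, hb.1, hb'.2]
    intro c _ d _ hne
    rcases lt_or_gt_of_ne hne with hlt | hlt
    · exact key c d hlt
    · exact (key d c hlt).symm
  have hvol : volume (⋃ c ∈ S, Ico (loEnd m v c) (hiEnd m v c)) =
      ENNReal.ofReal (∑ c ∈ S, m c) := by
    rw [measure_biUnion_finset hdisj fun _ _ => measurableSet_Ico,
      ENNReal.ofReal_sum_of_nonneg fun c _ => (h.m_pos c).le]
    simp only [Real.volume_Ico, hlen]
  refine le_antisymm ?_ ?_
  · have hsub : Ioo q p ⊆ {-y / t} ∪ ⋃ c ∈ S, Ico (loEnd m v c) (hiEnd m v c) := by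
      intro b hb
      -- between the one-sided slopes at `y`, the function `b ↦ b y + profileDual b` is constant
      have h1 := h.dualSlope_nonneg (y := y) (b := b) (h.lower_le y)
        (fun c hc => (Finset.mem_filter.1 hc).2) hb.1.le
      have h2 := h.dualSlope_nonpos (y := y) (b := b) (h.lower_lt y)
        (fun c hc => by simpa using hc) hb.2
      have h3 := le_antisymm h2 h1
      by_cases hblk : ∃ c, b ∈ Ico (loEnd m v c) (hiEnd m v c)
      · obtain ⟨c, hc⟩ := hblk
        rw [h.dualSlope_of_mem hc] at h3
        have hcS : c ∈ S := Finset.mem_filter.2 ⟨Finset.mem_univ c, by linarith⟩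
        exact Or.inr (mem_iUnion₂.2 ⟨c, hcS, hc⟩)
      · push Not at hblk
        rw [dualSlope_of_notMem hblk] at h3
        left
        rw [mem_singleton_iff, eq_div_iff h.t_pos.ne']; linarith
    have := (measure_mono (μ := volume) hsub).trans (measure_union_le _ _)
    rw [hvol, Real.volume_Ioo, Real.volume_singleton, zero_add] at this
    exact (ENNReal.ofReal_le_ofReal_iff (Finset.sum_nonneg fun c _ => (h.m_pos c).le)).1 this
  · have hsub : (⋃ c ∈ S, Ico (loEnd m v c) (hiEnd m v c)) ⊆ Icc q p := by
      refine iUnion₂_subset fun c hc => ?_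
      have hcy : ζ c = y := (Finset.mem_filter.1 hc).2
      have h1 : q ≤ loEnd m v c := h.clip_le (h.lower_le y) _ (by simp [hcy])
      have h2 : hiEnd m v c ≤ p := le_clip _ (by simp [hcy])
      exact Ico_subset_Icc_self.trans (Icc_subset_Icc h1 h2)
    have := measure_mono (μ := volume) hsub
    rw [hvol, Real.volume_Icc] at this
    exact (ENNReal.ofReal_le_ofReal_iff (sub_nonneg.2 hqp)).1 this

lemma slope_le_lo (h : ClusterProfile t ζ m v) (c : Fin n) :
    profileSlope t ζ m v (ζ c) ≤ loEnd m v c :=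
  h.clip_le (h.lower_le _) _ (by simp)

lemma hi_le_slopeL (c : Fin n) : hiEnd m v c ≤ profileSlopeL t ζ m v (ζ c) :=
  le_clip _ (by simp)

section shape
variable {k : ℕ} {x : Fin (k + 1) → ℝ} {hv : EuclideanSpace ℝ (Fin (k + 1))}

lemma shapeFn_eq (h : ClusterProfile t ζ m v) (hxm : StrictMono x) (hx : range x = range ζ)
    (hval : ∀ c, hv c = profile t ζ m v (x c)) : shapeFn t x hv = profile t ζ m v :=
  (h.isShapeAt_profile hx hval).shapeFn_eq h.t_pos hxm

lemma mem_hvConc (h : ClusterProfile t ζ m v) (hxm : StrictMono x) (hx : range x = range ζ)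
    (hval : ∀ c, hv c = profile t ζ m v (x c)) : hv ∈ hvConc t x := by
  refine ⟨fun c => ?_, ?_⟩
  · rw [hval]; exact h.parab_le_profile _
  · rw [h.shapeFn_eq hxm hx hval]; exact h.concaveOn_profile

lemma slopesR_eq (h : ClusterProfile t ζ m v) (hxm : StrictMono x) (hx : range x = range ζ)
    (hval : ∀ c, hv c = profile t ζ m v (x c)) (c : Fin (k + 1)) :
    slopesR t x hv c = profileSlope t ζ m v (x c) :=
  (uniqueDiffOn_Ici _ _ self_mem_Ici).eq_deriv _
    ((h.isShapeAt_profile hx hval).hasDerivWithinAt_right h.t_pos hxm c)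
    (h.hasDerivWithinAt_profile_right _)

lemma slopesL_eq (h : ClusterProfile t ζ m v) (hxm : StrictMono x) (hx : range x = range ζ)
    (hval : ∀ c, hv c = profile t ζ m v (x c)) (c : Fin (k + 1)) :
    slopesL t x hv c = profileSlopeL t ζ m v (x c) :=
  (uniqueDiffOn_Iic _ _ self_mem_Iic).eq_deriv _
    ((h.isShapeAt_profile hx hval).hasDerivWithinAt_left h.t_pos hxm c)
    (h.hasDerivWithinAt_profile_left _)

lemma kinks_eq (h : ClusterProfile t ζ m v) (hxm : StrictMono x) (hx : range x = range ζ)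
    (hval : ∀ c, hv c = profile t ζ m v (x c)) (c : Fin (k + 1)) :
    kinks t x hv c = ∑ c' with ζ c' = x c, m c' := by
  rw [kinks_apply, h.slopesR_eq hxm hx hval, h.slopesL_eq hxm hx hval, h.profile_kink]

end shape
end ClusterProfile

/-- At every time before `T` the optimal clusters define a profile. -/
lemma IsInertiaClusters.clusterProfile {n : ℕ} {T : ℝ} {x m : Fin n → ℝ} {z : Fin n → ℝ → ℝ}
    (hz : IsInertiaClusters T x m z) (hT : 0 < T) (hx : Monotone x) (hm : ∀ c, 0 < m c) {s : ℝ}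
    (hs : s ∈ Ico 0 T) :
    ClusterProfile (T - s) (fun c => optimalCluster 0 T z c s) m (optVel T m z) where
  t_pos := sub_pos.2 hs.2
  m_pos := hm
  gap := fun _ _ h => hz.optVel_gap hT hx (fun c => (hm c).le) h
  mono := hz.optimal_mono hT hx hm ⟨hs.1, hs.2.le⟩
  mom_nonneg := fun _ hK => hz.momentum_nonneg hT hm ⟨hs.1, hs.2.le⟩ hK
  mom_zero := fun _ hK hgap => hz.momentum_eq_zero hT hx hm ⟨hs.1, hs.2.le⟩ hK hgap
end

noncomputable section
open Set Filter Topology MeasureTheory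

/-! ### Uniqueness of the entropy solution -/

lemma AbsolutelyContinuousOnInterval.le_of_ae_hasDerivAt_nonneg {f : ℝ → ℝ} {a b : ℝ}
    (hf : AbsolutelyContinuousOnInterval f a b) (hab : a ≤ b)
    (h : ∀ᵐ t : ℝ, t ∈ Ioo a b → ∃ d, 0 ≤ d ∧ HasDerivAt f d t) : f a ≤ f b := by
  rw [← sub_nonneg, ← hf.integral_deriv_eq_sub, intervalIntegral.integral_of_le hab,
    integral_Ioc_eq_integral_Ioo]
  refine integral_nonneg_of_ae ?_
  filter_upwards [ae_restrict_of_ae h, ae_restrict_mem measurableSet_Ioo] with t ht htm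
  obtain ⟨d, hd, hd'⟩ := ht htm
  rw [hd'.deriv]; exact hd

/-- A locally Lipschitz function is differentiable almost everywhere on an open set. -/
lemma LocallyLipschitzOn.ae_differentiableAt {f : ℝ × ℝ → ℝ} {s U : Set (ℝ × ℝ)}
    (hf : LocallyLipschitzOn s f) (hU : IsOpen U) (hUs : U ⊆ s) :
    ∀ᵐ p : ℝ × ℝ, p ∈ U → DifferentiableAt ℝ f p := by
  rw [ae_iff]
  refine measure_null_of_locally_null _ fun p hp => ?_
  push Not at hp
  obtain ⟨K, V, hV, hK⟩ := hf (hUs hp.1)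
  have hVn : V ∈ 𝓝 p := by
    have := nhdsWithin_mono p hUs hV
    rwa [hU.nhdsWithin_eq hp.1] at this
  refine ⟨{a | ¬(a ∈ U → DifferentiableAt ℝ f a)} ∩ interior V,
    inter_mem self_mem_nhdsWithin (mem_nhdsWithin_of_mem_nhds (interior_mem_nhds.2 hVn)), ?_⟩
  have h := (hK.mono interior_subset).ae_differentiableWithinAt_of_mem (μ := volume)
  rw [ae_iff] at h
  refine measure_mono_null (fun a ha => ?_) h
  intro hcon
  exact ha.1 fun _ => (hcon ha.2).differentiableAt (isOpen_interior.mem_nhds ha.2)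

/-- A function with bounded second differences lies below its tangent parabolas. -/
lemma le_tangent_parabola {u : ℝ → ℝ} {C p y : ℝ} (hu : HasDerivAt u p y)
    (h : ∀ x r, u (x + r) + u (x - r) - 2 * u x ≤ C * r ^ 2) (k : ℝ) :
    u (y + k) ≤ u y + p * k + C / 2 * k ^ 2 := by
  set w : ℝ → ℝ := fun k => u (y + k) - u y - p * k with hw
  -- the second difference with centre `y + k / 2` bounds `w k` in terms of `w (k / 2)`; iterate
  have hhalf : ∀ k, w k ≤ 2 * w (k / 2) + C * k ^ 2 / 4 := fun k => by
    have := h (y + k / 2) (k / 2)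
    have e1 : y + k / 2 + k / 2 = y + k := by ring
    have e2 : y + k / 2 - k / 2 = y := by ring
    rw [e1, e2] at this
    simp only [hw]; linarith
  have hit : ∀ j : ℕ, w k ≤ 2 ^ j * w (k / 2 ^ j) + C * k ^ 2 / 2 * (1 - (1 / 2) ^ j) := by
    intro j
    induction j with
    | zero => simp
    | succ j ih =>
      have h1 := mul_le_mul_of_nonneg_left (hhalf (k / 2 ^ j)) (by positivity : (0 : ℝ) ≤ 2 ^ j)
      have e : k / 2 ^ j / 2 = k / 2 ^ (j + 1) := by rw [div_div, pow_succ]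
      rw [e] at h1
      have e2 : (2 : ℝ) ^ j * (2 * w (k / 2 ^ (j + 1)) + C * (k / 2 ^ j) ^ 2 / 4) =
          2 ^ (j + 1) * w (k / 2 ^ (j + 1)) + C * k ^ 2 / 4 * (1 / 2) ^ j := by
        rw [pow_succ, one_div, inv_pow]; field_simp
      rw [e2] at h1
      rw [pow_succ (1 / 2 : ℝ)]
      linarith
  have hlim : Tendsto (fun j : ℕ => (2 : ℝ) ^ j * w (k / 2 ^ j)) atTop (𝓝 0) := by
    rcases eq_or_ne k 0 with rfl | hk
    · simp [hw]
    have h0 : Tendsto (fun j : ℕ => k / (2 : ℝ) ^ j) atTop (𝓝[≠] 0) := by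
      refine tendsto_nhdsWithin_iff.2 ⟨?_, Eventually.of_forall fun j => ?_⟩
      · have := (tendsto_pow_atTop_nhds_zero_of_lt_one (by norm_num : (0 : ℝ) ≤ 1 / 2)
          (by norm_num)).const_mul k
        simpa [div_eq_mul_inv] using this
      · simp [hk]
    have h1 : Tendsto (fun e : ℝ => k * (e⁻¹ * (u (y + e) - u y) - p)) (𝓝[≠] 0) (𝓝 0) := by
      have := hu.tendsto_slope_zero
      have h2 := (this.sub_const p).const_mul k
      simpa using h2
    refine (h1.comp h0).congr fun j => ?_
    simp only [Function.comp, hw]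
    field_simp
  have hpow : Tendsto (fun j : ℕ => (1 / 2 : ℝ) ^ j) atTop (𝓝 0) :=
    tendsto_pow_atTop_nhds_zero_of_lt_one (by norm_num) (by norm_num)
  have hR := hlim.add ((hpow.const_sub 1).const_mul (C * k ^ 2 / 2))
  have := ge_of_tendsto' hR hit
  simp only [hw] at this
  linarith

namespace IsBackwardEntropySolution
variable {T : ℝ} {f : ℝ → ℝ} {g : ℝ → ℝ → ℝ}

lemma continuousOn (hg : IsBackwardEntropySolution T f g) :
    ContinuousOn (fun p : ℝ × ℝ => g p.1 p.2) (Ioc 0 T ×ˢ univ) :=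
  hg.locallyLipschitz.continuousOn

lemma continuous_space (hg : IsBackwardEntropySolution T f g) {t : ℝ} (ht : t ∈ Ioc 0 T) :
    Continuous (g t) := by
  have : ContinuousOn (fun y : ℝ => g (t, y).1 (t, y).2) univ :=
    hg.continuousOn.comp (by fun_prop) fun y _ => ⟨ht, mem_univ _⟩
  exact continuousOn_univ.1 this

/-- Along almost every line of velocity `-q`, the equation gives the derivative at almost every
time. -/
lemma ae_line (hg : IsBackwardEntropySolution T f g) (q : ℝ) :
    ∀ᵐ e : ℝ, ∀ᵐ t : ℝ, t ∈ Ioo 0 T → ∃ p, HasDerivAt (g t) p (e - q * t) ∧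
      HasDerivAt (fun r => g r (e - q * r)) (p ^ 2 / 2 - q * p) t := by
  set U : Set (ℝ × ℝ) := Ioo 0 T ×ˢ univ
  have hU : IsOpen U := isOpen_Ioo.prod isOpen_univ
  have h1 := hg.locallyLipschitz.ae_differentiableAt hU
    (prod_mono Ioo_subset_Ioc_self (subset_univ _))
  have h2 := (ae_restrict_iff' (μ := volume) hU.measurableSet).1 hg.equation
  have h3 : ∀ᵐ p : ℝ × ℝ, p ∈ U → ∃ L : ℝ × ℝ →L[ℝ] ℝ,
      HasFDerivAt (fun p : ℝ × ℝ => g p.1 p.2) L p ∧ L (1, 0) = (1 / 2) * L (0, 1) ^ 2 ∧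
        HasDerivAt (g p.1) (L (0, 1)) p.2 := by
    filter_upwards [h1, h2] with p d1 d2 hp
    have hL := (d1 hp).hasFDerivAt
    set L := fderiv ℝ (fun p : ℝ × ℝ => g p.1 p.2) p
    have hL' : HasFDerivAt (fun p : ℝ × ℝ => g p.1 p.2) L (p.1, p.2) := hL
    have e1 : HasDerivAt (fun t => g t p.2) (L (1, 0)) p.1 := by
      have h : HasDerivAt (fun t : ℝ => (t, p.2)) ((1 : ℝ), (0 : ℝ)) p.1 :=
        (hasDerivAt_id p.1).prodMk (hasDerivAt_const p.1 p.2)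
      exact hL'.comp_hasDerivAt p.1 h
    have e2 : HasDerivAt (g p.1) (L (0, 1)) p.2 := by
      have h : HasDerivAt (fun y : ℝ => (p.1, y)) ((0 : ℝ), (1 : ℝ)) p.2 :=
        (hasDerivAt_const p.2 p.1).prodMk (hasDerivAt_id p.2)
      exact hL'.comp_hasDerivAt p.2 h
    refine ⟨L, hL, ?_, e2⟩
    have := d2 hp
    rwa [e1.deriv, e2.deriv] at this
  have hmp : MeasurePreserving (fun p : ℝ × ℝ => (p.1, p.2 - q * p.1)) volume volume := by
    rw [Measure.volume_eq_prod]
    exact (MeasurePreserving.id volume).skew_product (g := fun t e => e - q * t)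
      (by simp only [Function.uncurry_def]; fun_prop)
      (Eventually.of_forall fun t => (measurePreserving_sub_right volume (q * t)).map_eq)
  have h4 := hmp.quasiMeasurePreserving.ae h3
  rw [Measure.volume_eq_prod] at h4
  have h5 := Measure.measurePreserving_swap (μ := (volume : Measure ℝ)) (ν := (volume : Measure ℝ))
    |>.quasiMeasurePreserving.ae h4
  filter_upwards [Measure.ae_ae_of_ae_prod h5] with e he
  filter_upwards [he] with t ht htm
  obtain ⟨L, hL, hLe, hLs⟩ := ht ⟨htm, mem_univ _⟩
  simp only [Prod.swap_prod_mk] at hL hLs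
  refine ⟨L (0, 1), hLs, ?_⟩
  have h : HasDerivAt (fun r : ℝ => (r, e - q * r)) ((1 : ℝ), -q) t := by
    have h' := ((hasDerivAt_id t).const_mul q).const_sub e
    rw [mul_one] at h'
    exact (hasDerivAt_id t).prodMk h'
  refine (hL.comp_hasDerivAt t h).congr_deriv ?_
  have : ((1 : ℝ), -q) = ((1 : ℝ), (0 : ℝ)) + (-q) • ((0 : ℝ), (1 : ℝ)) := by simp
  rw [this, map_add, map_smul, hLe, smul_eq_mul]
  ring

/-- A solution is absolutely continuous along lines. -/
lemma line_ac (hg : IsBackwardEntropySolution T f g) (q e : ℝ) {a b : ℝ} (ha : 0 < a) (hab : a ≤ b)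
    (hb : b ≤ T) : AbsolutelyContinuousOnInterval (fun r => g r (e - q * r)) a b := by
  set ℓ : ℝ → ℝ × ℝ := fun r => (r, e - q * r)
  have hℓ : Continuous ℓ := by fun_prop
  have hK : IsCompact (ℓ '' Icc a b) := isCompact_Icc.image hℓ
  have hsub : ℓ '' Icc a b ⊆ Ioc 0 T ×ˢ univ := by
    rintro _ ⟨r, hr, rfl⟩
    exact ⟨⟨ha.trans_le hr.1, hr.2.trans hb⟩, mem_univ _⟩
  obtain ⟨K, hK'⟩ := (hg.locallyLipschitz.mono hsub).exists_lipschitzOnWith_of_compact hK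
  have hℓL : LipschitzWith (max 1 ‖q‖₊) ℓ := by
    refine LipschitzWith.id.prodMk ?_
    refine LipschitzWith.of_dist_le_mul fun r s => ?_
    rw [Real.dist_eq, Real.dist_eq, coe_nnnorm, Real.norm_eq_abs, ← abs_mul,
      ← abs_neg (q * (r - s))]
    exact le_of_eq (congrArg abs (by ring))
  refine LipschitzOnWith.absolutelyContinuousOnInterval (K := K * max 1 ‖q‖₊) ?_
  rw [uIcc_of_le hab]
  exact hK'.comp hℓL.lipschitzOnWith (mapsTo_image _ _)

/-- The Hopf–Lax inequality between two times: it holds along almost every line because the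
derivative along it is a square, and along all lines by continuity. -/
lemma line_mono (hg : IsBackwardEntropySolution T f g) (q e : ℝ) {a b : ℝ} (ha : 0 < a)
    (hab : a ≤ b) (hb : b ≤ T) :
    g a (e - q * a) + q ^ 2 / 2 * a ≤ g b (e - q * b) + q ^ 2 / 2 * b := by
  have hae : ∀ᵐ e : ℝ,
      g a (e - q * a) + q ^ 2 / 2 * a ≤ g b (e - q * b) + q ^ 2 / 2 * b := by
    filter_upwards [hg.ae_line q] with e he
    have hac : AbsolutelyContinuousOnInterval (fun r => g r (e - q * r) + q ^ 2 / 2 * r) a b := by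
      refine (hg.line_ac q e ha hab hb).fun_add ?_
      exact ContDiffOn.absolutelyContinuousOnInterval
        (by fun_prop : ContDiff ℝ 1 fun r : ℝ => q ^ 2 / 2 * r).contDiffOn
    refine hac.le_of_ae_hasDerivAt_nonneg hab ?_
    filter_upwards [he] with t ht htm
    obtain ⟨p, -, hp⟩ := ht ⟨ha.trans htm.1, htm.2.trans_le hb⟩
    refine ⟨(p - q) ^ 2 / 2, by positivity, ?_⟩
    refine (hp.add ((hasDerivAt_id t).const_mul (q ^ 2 / 2))).congr_deriv ?_
    ring
  have hcl : IsClosed {e : ℝ |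
      g a (e - q * a) + q ^ 2 / 2 * a ≤ g b (e - q * b) + q ^ 2 / 2 * b} := by
    have h1 := hg.continuous_space (t := a) ⟨ha, hab.trans hb⟩
    have h2 := hg.continuous_space (t := b) ⟨ha.trans_le hab, hb⟩
    exact isClosed_le (by fun_prop) (by fun_prop)
  have := (Measure.dense_of_ae hae).closure_eq
  rw [hcl.closure_eq] at this
  have he : e ∈ (univ : Set ℝ) := mem_univ e
  rw [← this] at he
  exact he

/-- Where a solution is touched from below by a parabola of slope `q`, it is given by the
characteristic of velocity `-q`. The defect `P` in the Hopf–Lax inequality, with a correction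
quadratic in the distance `e` of the line, is nonnegative, and its derivative is `(p - q) ^ 2 / 2`,
where `p` is the slope of the solution. By semiconcavity `P` controls this square, and Gronwall
applies. -/
lemma touch_le (hg : IsBackwardEntropySolution T f g) {t₀ y q A τ : ℝ} (ht₀ : 0 < t₀) (hA : 0 ≤ A)
    (hτ : t₀ ≤ τ) (hτT : τ < T)
    (htouch : ∀ y', g t₀ y + q * (y' - y) - A * (y' - y) ^ 2 ≤ g t₀ y') :
    g τ (y - (τ - t₀) * q) + q ^ 2 / 2 * (τ - t₀) ≤ g t₀ y := by
  obtain ⟨C, hC⟩ := hg.entropy t₀ ⟨ht₀, hτ.trans_lt hτT⟩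
  set C' := |C| / (T - τ)
  have hC'0 : 0 ≤ C' := div_nonneg (abs_nonneg _) (by linarith)
  have hsemi : ∀ t ∈ Icc t₀ τ, ∀ x r, g t (x + r) + g t (x - r) - 2 * g t x ≤ C' * r ^ 2 := by
    intro t ht x r
    refine (hC t ⟨ht.1, ht.2.trans_lt hτT⟩ x r).trans (mul_le_mul_of_nonneg_right ?_ (sq_nonneg r))
    have h1 : 0 < T - τ := by linarith
    have h2 : T - τ ≤ T - t := by linarith [ht.2]
    calc C / (T - t) ≤ |C| / (T - t) :=
          div_le_div_of_nonneg_right (le_abs_self C) (by linarith)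
      _ ≤ C' := div_le_div_of_nonneg_left (abs_nonneg C) h1 h2
  set B := 2 * A + C' / 2 + 1
  have hB : 0 < B := by positivity
  -- the constant of the Gronwall estimate
  set κ := 2 * B
  -- the defect along the line through `y + e`
  set P : ℝ → ℝ → ℝ := fun e t => g t (y + t₀ * q + e - q * t) + q ^ 2 / 2 * (t - t₀) - g t₀ y -
    q * e + 2 * A * e ^ 2 with hP
  have hstep : ∀ᵐ e : ℝ, P e τ ≤ P e t₀ * Real.exp (κ * (τ - t₀)) := by
    have h0 := hg.ae_line q
    have h1 := (measurePreserving_add_left volume (y + t₀ * q)).quasiMeasurePreserving.ae h0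
    filter_upwards [h1] with e he
    have hac : AbsolutelyContinuousOnInterval (P e) t₀ τ := by
      have h2 := hg.line_ac q (y + t₀ * q + e) ht₀ hτ hτT.le
      have h3 : AbsolutelyContinuousOnInterval
          (fun t : ℝ => q ^ 2 / 2 * (t - t₀) - g t₀ y - q * e + 2 * A * e ^ 2) t₀ τ :=
        ContDiffOn.absolutelyContinuousOnInterval (ContDiff.contDiffOn (by fun_prop))
      have h4 := h2.fun_add h3
      have e5 : P e = fun t => g t (y + t₀ * q + e - q * t) +
          (q ^ 2 / 2 * (t - t₀) - g t₀ y - q * e + 2 * A * e ^ 2) := by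
        funext t; simp only [hP]; ring
      rw [e5]; exact h4
    have hexp : AbsolutelyContinuousOnInterval (fun t : ℝ => -Real.exp (-κ * (t - t₀))) t₀ τ :=
      ContDiffOn.absolutelyContinuousOnInterval (ContDiff.contDiffOn (by fun_prop))
    have hmain := (hac.fun_mul hexp).le_of_ae_hasDerivAt_nonneg hτ ?_
    · simp only [sub_self, mul_zero, Real.exp_zero] at hmain
      have hpos := Real.exp_pos (κ * (τ - t₀))
      have hinv : Real.exp (-κ * (τ - t₀)) * Real.exp (κ * (τ - t₀)) = 1 := by
        rw [← Real.exp_add]; simp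
      have h6 : P e τ * Real.exp (-κ * (τ - t₀)) ≤ P e t₀ := by linarith
      have h7 := mul_le_mul_of_nonneg_right h6 hpos.le
      rwa [mul_assoc, hinv, mul_one] at h7
    · filter_upwards [he] with t ht htm
      obtain ⟨p, hp, hpl⟩ := ht ⟨ht₀.trans htm.1, htm.2.trans hτT⟩
      have hPd : HasDerivAt (P e) ((p - q) ^ 2 / 2) t := by
        have h2 : HasDerivAt (fun t : ℝ => q ^ 2 / 2 * (t - t₀)) (q ^ 2 / 2) t := by
          simpa using ((hasDerivAt_id t).sub_const t₀).const_mul (q ^ 2 / 2)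
        refine ((((hpl.add h2).sub_const (g t₀ y)).sub_const (q * e)).add_const
          (2 * A * e ^ 2)).congr_deriv ?_
        ring
      have hEd : HasDerivAt (fun t : ℝ => -Real.exp (-κ * (t - t₀)))
          (κ * Real.exp (-κ * (t - t₀))) t := by
        have h2 : HasDerivAt (fun t : ℝ => -κ * (t - t₀)) (-κ) t := by
          simpa using ((hasDerivAt_id t).sub_const t₀).const_mul (-κ)
        refine h2.exp.neg.congr_deriv ?_
        ring
      refine ⟨_, ?_, hPd.mul hEd⟩
      -- optimize over translations `k` of the line
      have hquad : ∀ k, 0 ≤ P e t + (p - q) * k + B * k ^ 2 := by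
        intro k
        have i1 := le_tangent_parabola hp (hsemi t ⟨htm.1.le, htm.2.le⟩) k
        have i2 := htouch (y + (e + k))
        have i3 := hg.line_mono q (y + t₀ * q + (e + k)) ht₀ htm.1.le (htm.2.le.trans hτT.le)
        have e1 : y + t₀ * q + (e + k) - q * t₀ = y + (e + k) := by ring
        have e2 : y + t₀ * q + (e + k) - q * t = y + t₀ * q + e - q * t + k := by ring
        have e3 : y + (e + k) - y = e + k := by ring
        rw [e1, e2] at i3
        rw [e3] at i2
        have i4 : A * (e + k) ^ 2 ≤ 2 * A * e ^ 2 + 2 * A * k ^ 2 := by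
          nlinarith [mul_nonneg hA (sq_nonneg (e - k))]
        simp only [hP, B]
        nlinarith [sq_nonneg k]
      have hsq : (p - q) ^ 2 ≤ 4 * B * P e t := by
        have := hquad (-(p - q) / (2 * B))
        have e1 : P e t + (p - q) * (-(p - q) / (2 * B)) + B * (-(p - q) / (2 * B)) ^ 2 =
            P e t - (p - q) ^ 2 / (4 * B) := by field_simp; ring
        rw [e1, sub_nonneg, div_le_iff₀ (by positivity)] at this
        linarith
      have hE := Real.exp_pos (-κ * (t - t₀))
      have : 0 ≤ (κ * P e t - (p - q) ^ 2 / 2) * Real.exp (-κ * (t - t₀)) :=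
        mul_nonneg (by simp only [κ]; linarith) hE.le
      linarith
  have hcl : IsClosed {e : ℝ | P e τ ≤ P e t₀ * Real.exp (κ * (τ - t₀))} := by
    have h1 := hg.continuous_space (t := τ) ⟨ht₀.trans_le hτ, hτT.le⟩
    have h2 := hg.continuous_space (t := t₀) ⟨ht₀, hτ.trans hτT.le⟩
    simp only [hP]
    exact isClosed_le (by fun_prop) (by fun_prop)
  have hall := (Measure.dense_of_ae hstep).closure_eq
  rw [hcl.closure_eq] at hall
  have h0 : (0 : ℝ) ∈ (univ : Set ℝ) := mem_univ 0
  rw [← hall] at h0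
  have h0' : P 0 τ ≤ P 0 t₀ * Real.exp (κ * (τ - t₀)) := h0
  have e1 : P 0 t₀ = 0 := by simp only [hP]; ring_nf
  rw [e1, zero_mul] at h0'
  have e2 : y + t₀ * q + 0 - q * τ = y - (τ - t₀) * q := by ring
  simp only [hP, e2] at h0'
  linarith

/-- The characteristic from a contact point with a parabola, up to the terminal time, which the
entropy condition does not reach. -/
lemma touch_le_terminal (hg : IsBackwardEntropySolution T f g) {t₀ y q A : ℝ} (ht₀ : 0 < t₀)
    (hA : 0 ≤ A) (htT : t₀ < T)
    (htouch : ∀ y', g t₀ y + q * (y' - y) - A * (y' - y) ^ 2 ≤ g t₀ y') :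
    f (y - (T - t₀) * q) + q ^ 2 / 2 * (T - t₀) ≤ g t₀ y := by
  have hc : ContinuousOn (fun τ : ℝ => g τ (y - (τ - t₀) * q) + q ^ 2 / 2 * (τ - t₀))
      (Icc t₀ T) := by
    have h1 : ContinuousOn (fun τ : ℝ => g (τ, y - (τ - t₀) * q).1 (τ, y - (τ - t₀) * q).2)
        (Icc t₀ T) :=
      hg.continuousOn.comp (by fun_prop) fun τ hτ => ⟨⟨ht₀.trans_le hτ.1, hτ.2⟩, mem_univ _⟩
    exact h1.add (by fun_prop)
  have h2 := (hc T ⟨htT.le, le_rfl⟩).mono_left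
    (nhdsWithin_mono T (Ico_subset_Icc_self : Ico t₀ T ⊆ Icc t₀ T))
  have : (𝓝[Ico t₀ T] T).NeBot := by
    rw [← mem_closure_iff_nhdsWithin_neBot, closure_Ico htT.ne]
    exact ⟨htT.le, le_rfl⟩
  rw [← hg.terminal]
  refine le_of_tendsto h2 ?_
  filter_upwards [self_mem_nhdsWithin] with τ hτ
  exact hg.touch_le ht₀ hA hτ.1 hτ.2 htouch

/-- Parabolas touch a solution from below at a dense set of points: minimize the solution plus a
steep parabola centred at `y₀`. -/
lemma exists_touch (hg : IsBackwardEntropySolution T f g) {t₀ : ℝ} (ht₀ : t₀ ∈ Ioo 0 T) (y₀ : ℝ)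
    {ε : ℝ} (hε : 0 < ε) : ∃ y q A, |y - y₀| ≤ ε ∧ 0 ≤ A ∧
      ∀ y', g t₀ y + q * (y' - y) - A * (y' - y) ^ 2 ≤ g t₀ y' := by
  obtain ⟨K, hK⟩ := hg.growth t₀ ht₀
  have hc := hg.continuous_space (t := t₀) ⟨ht₀.1, ht₀.2.le⟩
  set K' := |K| * (1 + 2 * |y₀|)
  have hK' : 0 ≤ K' := by positivity
  have hlow : ∀ y, g t₀ y₀ - K' * |y - y₀| - |K| * |y - y₀| ^ 2 ≤ g t₀ y := by
    intro y
    have h1 := hK t₀ ⟨le_rfl, ht₀.2.le⟩ y y₀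
    have h2 : |y| ≤ |y₀| + |y - y₀| := by
      have := abs_add_le y₀ (y - y₀); rwa [add_sub_cancel] at this
    have h3 : K * (1 + |y| + |y₀|) * |y - y₀| ≤
        |K| * (1 + 2 * |y₀| + |y - y₀|) * |y - y₀| := by
      refine mul_le_mul_of_nonneg_right ?_ (abs_nonneg _)
      exact mul_le_mul (le_abs_self K) (by linarith) (by positivity) (abs_nonneg K)
    have h4 := (abs_le.1 (h1.trans h3)).1
    simp only [K']
    nlinarith
  set N := K' / ε + 1
  have hN : 0 < N := by positivity
  set A := |K| + N
  set R := ε + 1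
  obtain ⟨y, hy, hmin⟩ := isCompact_Icc.exists_isMinOn (s := Icc (y₀ - R) (y₀ + R))
    ⟨y₀, by constructor <;> simp only [R] <;> linarith⟩
    (f := fun y => g t₀ y + A * (y - y₀) ^ 2) (by fun_prop)
  have hfar : ∀ y, ε < |y - y₀| → g t₀ y₀ < g t₀ y + A * (y - y₀) ^ 2 := by
    intro y hy
    have h1 := hlow y
    have h2 : K' < N * |y - y₀| := by
      have : N * ε ≤ N * |y - y₀| := mul_le_mul_of_nonneg_left hy.le hN.le
      have e : N * ε = K' + ε := by simp only [N]; field_simp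
      linarith
    have h3 : (y - y₀) ^ 2 = |y - y₀| ^ 2 := (sq_abs _).symm
    have h4 : 0 < |y - y₀| := hε.trans hy
    have h5 := mul_lt_mul_of_pos_right h2 h4
    rw [h3]; simp only [A]; nlinarith
  have hy0 : g t₀ y + A * (y - y₀) ^ 2 ≤ g t₀ y₀ := by
    have := hmin (a := y₀) ⟨by simp only [R]; linarith, by simp only [R]; linarith⟩
    simpa using this
  have hall : ∀ y', g t₀ y + A * (y - y₀) ^ 2 ≤ g t₀ y' + A * (y' - y₀) ^ 2 := by
    intro y'
    by_cases h : ε < |y' - y₀|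
    · exact hy0.trans (hfar y' h).le
    · have h2 := abs_le.1 (not_lt.1 h)
      exact hmin (a := y') ⟨by simp only [R]; linarith, by simp only [R]; linarith⟩
  refine ⟨y, -2 * A * (y - y₀), A, ?_, by positivity, fun y' => ?_⟩
  · by_contra h
    exact absurd (hfar y (not_le.1 h)) (not_lt.2 hy0)
  · have := hall y'
    nlinarith

/-- The entropy solution is unique: at a dense set of points it is given by a characteristic, and
there the Hopf–Lax inequality of any other solution compares the two. -/
lemma unique {g' : ℝ → ℝ → ℝ} (hg : IsBackwardEntropySolution T f g)
    (hg' : IsBackwardEntropySolution T f g') {t : ℝ} (ht : t ∈ Ioc 0 T) : g t = g' t := by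
  rcases ht.2.eq_or_lt with rfl | htT
  · rw [hg.terminal, hg'.terminal]
  have key : ∀ {g g' : ℝ → ℝ → ℝ}, IsBackwardEntropySolution T f g →
      IsBackwardEntropySolution T f g' → ∀ y₀, g' t y₀ ≤ g t y₀ := by
    intro g g' hg hg' y₀
    have hc := hg.continuous_space ht
    have hc' := hg'.continuous_space ht
    have htouch : ∀ j : ℕ, ∃ y, |y - y₀| ≤ 1 / ((j : ℝ) + 1) ∧ g' t y ≤ g t y := by
      intro j
      obtain ⟨y, q, A, h1, h2, h3⟩ := hg.exists_touch (t₀ := t) ⟨ht.1, htT⟩ y₀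
        (ε := 1 / ((j : ℝ) + 1)) (by positivity)
      refine ⟨y, h1, ?_⟩
      have h4 := hg.touch_le_terminal ht.1 h2 htT h3
      have h5 := hg'.line_mono q (y + t * q) ht.1 htT.le le_rfl
      have e1 : y + t * q - q * t = y := by ring
      have e2 : y + t * q - q * T = y - (T - t) * q := by ring
      rw [e1, e2, hg'.terminal] at h5
      linarith
    choose yj h1 h2 using htouch
    have hlim : Tendsto yj atTop (𝓝 y₀) := by
      rw [tendsto_iff_dist_tendsto_zero]
      exact squeeze_zero (fun _ => dist_nonneg) (fun j => by rw [Real.dist_eq]; exact h1 j)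
        tendsto_one_div_add_atTop_nhds_zero_nat
    exact le_of_tendsto_of_tendsto' ((hc'.tendsto y₀).comp hlim) ((hc.tendsto y₀).comp hlim) h2
  exact funext fun y => le_antisymm (key hg' hg y) (key hg hg' y)

end IsBackwardEntropySolution
end

noncomputable section
open Set Filter Topology MeasureTheory

/-! ### The limit shape -/

/-- Abel summation: nonnegative partial sums stay nonnegative after weighting with a nonincreasing
nonnegative weight. -/
lemma sum_mul_nonneg_of_antitone {ι : Type*} [LinearOrder ι] {w p : ι → ℝ} (hw : Antitone w)
    (S : Finset ι) (hp : ∀ K ⊆ S, (∀ c ∈ K, ∀ c' ∈ S, c' ∉ K → c < c') → 0 ≤ ∑ c ∈ K, p c)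
    (r : ℝ) (hr : ∀ c ∈ S, r ≤ w c) : r * ∑ c ∈ S, p c ≤ ∑ c ∈ S, w c * p c := by
  induction S using Finset.induction_on_max generalizing r with
  | empty => simp
  | insert a S ha ih =>
    have haS : a ∉ S := fun h => lt_irrefl _ (ha a h)
    have h1 := ih (fun K hK hlow => hp K (hK.trans (Finset.subset_insert _ _))
      fun c hc c' hc' hcK => by
        rcases Finset.mem_insert.1 hc' with rfl | hc'
        · exact ha c (hK hc)
        · exact hlow c hc c' hc' hcK) (w a) fun c hc => hw (ha c hc).le
    have h2 := hp _ le_rfl fun c _ c' hc' hcK => absurd hc' hcK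
    rw [Finset.sum_insert haS] at h2 ⊢
    rw [Finset.sum_insert haS]
    have := mul_le_mul_of_nonneg_right (hr a (Finset.mem_insert_self _ _)) h2
    nlinarith

lemma ClusterProfile.abs_profileSlope_le {n : ℕ} {t : ℝ} {ζ m v : Fin n → ℝ}
    (h : ClusterProfile t ζ m v) (y : ℝ) :
    |profileSlope t ζ m v y| ≤ |y| / t + ∑ c, (|loEnd m v c| + |hiEnd m v c|) := by
  have ht := h.t_pos
  have h0 : ∀ c, |loEnd m v c| + |hiEnd m v c| ≤ ∑ c, (|loEnd m v c| + |hiEnd m v c|) := fun c =>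
    Finset.single_le_sum (f := fun c => |loEnd m v c| + |hiEnd m v c|)
      (fun c _ => by positivity) (Finset.mem_univ c)
  have h2 : 0 ≤ |y| / t := by positivity
  rcases lt_trichotomy (profileSlope t ζ m v y) (-y / t) with hlt | heq | hgt
  · obtain ⟨c, -, hc⟩ := h.clip_lt (h.lower_le y) hlt
    rw [profileSlope, hc]
    have := h0 c
    have := abs_nonneg (hiEnd m v c)
    linarith
  · rw [heq, abs_div, abs_neg, abs_of_pos ht]
    have : 0 ≤ ∑ c, (|loEnd m v c| + |hiEnd m v c|) :=
      Finset.sum_nonneg fun c _ => by positivity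
    linarith
  · obtain ⟨c, -, hc⟩ := lt_clip hgt
    rw [profileSlope, hc]
    have := h0 c
    have := abs_nonneg (loEnd m v c)
    linarith

/-- A function with supporting lines of slopes `b` from above is differentiable wherever `b` is
continuous. -/
lemma hasDerivAt_of_support {f b : ℝ → ℝ} {t : ℝ} (hb : ContinuousAt b t)
    (h1 : ∀ᶠ r in 𝓝 t, f r ≤ f t + b t * (r - t)) (h2 : ∀ᶠ r in 𝓝 t, f t ≤ f r + b r * (t - r)) :
    HasDerivAt f (b t) t := by
  rw [hasDerivAt_iff_isLittleO, Asymptotics.isLittleO_iff]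
  intro ε hε
  filter_upwards [h1, h2, Metric.continuousAt_iff'.1 hb ε hε] with r hr1 hr2 hr3
  rw [Real.dist_eq] at hr3
  rw [Real.norm_eq_abs, Real.norm_eq_abs, smul_eq_mul]
  have e1 : |f r - f t - (r - t) * b t| ≤ |(b r - b t) * (r - t)| := by
    refine abs_le_abs_of_nonpos ?_ ?_
    · linarith
    · linarith
  rw [abs_mul] at e1
  exact e1.trans (mul_le_mul_of_nonneg_right hr3.le (abs_nonneg _))

section
variable {n : ℕ} {T : ℝ} {x m : Fin n → ℝ} {z : Fin n → ℝ → ℝ}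

/-- The limit shape at time `t`: the profile of the optimal clusters at the backward time `T - t`. -/
def limitShape (T : ℝ) (m : Fin n → ℝ) (z : Fin n → ℝ → ℝ) (t y : ℝ) : ℝ :=
  profile t (fun c => optimalCluster 0 T z c (T - t)) m (optVel T m z) y

/-- The spatial right derivative of the limit shape. -/
def limitSlope (T : ℝ) (m : Fin n → ℝ) (z : Fin n → ℝ → ℝ) (t y : ℝ) : ℝ :=
  profileSlope t (fun c => optimalCluster 0 T z c (T - t)) m (optVel T m z) y

namespace IsInertiaClusters

lemma clusterProfile' (hz : IsInertiaClusters T x m z) (hx : Monotone x) (hm : ∀ c, 0 < m c)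
    {t : ℝ} (ht : t ∈ Ioc 0 T) :
    ClusterProfile t (fun c => optimalCluster 0 T z c (T - t)) m (optVel T m z) := by
  have := hz.clusterProfile (ht.1.trans_le ht.2) hx hm (s := T - t)
    ⟨sub_nonneg.2 ht.2, by linarith [ht.1]⟩
  rwa [sub_sub_cancel] at this

lemma clusterProfile_zero (hz : IsInertiaClusters T x m z) (hT : 0 < T) (hx : Monotone x)
    (hm : ∀ c, 0 < m c) : ClusterProfile T x m (optVel T m z) := by
  have := hz.clusterProfile hT hx hm (s := 0) ⟨le_rfl, hT⟩
  simpa only [sub_zero, hz.optimalCluster_zero] using this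

lemma limitShape_terminal (hz : IsInertiaClusters T x m z) :
    limitShape T m z T = profile T x m (optVel T m z) := by
  funext y
  rw [limitShape]
  simp only [sub_self, hz.optimalCluster_zero]

lemma lag_eq (hz : IsInertiaClusters T x m z) (hT : 0 < T) (K : Finset (Fin n)) (t : ℝ) :
    ∑ c ∈ K, m c * (x c - optimalCluster 0 T z c (T - t) + (T - t) * optVel T m z c) =
      momentLag x m z K (T - t) := by
  have h1 := momentum_eq (x := x) (m := m) (z := z) hT K (T - t)
  have h2 := momentum_eq (x := x) (m := m) (z := z) hT K 0
  simp only [hz.momentLag_zero, hz.optimalCluster_zero] at h2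
  rw [sub_sub_cancel] at h1
  rw [sub_zero, sub_zero] at h2
  rw [← sub_eq_iff_eq_add'.2 (sub_eq_iff_eq_add.1 h1.symm)]
  rw [← h2, ← Finset.sum_sub_distrib]
  exact Finset.sum_congr rfl fun c _ => by ring

/-- The excess of the dual function does not increase as the clusters move: it is the effect of the
lag of momentum of the left clusters. -/
lemma excess_le (hz : IsInertiaClusters T x m z) (hx : Monotone x) (hm : ∀ c, 0 < m c)
    {t : ℝ} (ht : t ∈ Ioc 0 T) (b : ℝ) :
    ∑ c, excessTerm t (fun c => optimalCluster 0 T z c (T - t)) m (optVel T m z) b c ≤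
      ∑ c, excessTerm T x m (optVel T m z) b c := by
  have hT : 0 < T := ht.1.trans_le ht.2
  have h0 := hz.clusterProfile_zero hT hx hm
  set v := optVel T m z with hv
  set u : Fin n → ℝ := fun c => max (loEnd m v c) (min b (hiEnd m v c)) with hu
  have hu1 : ∀ c, loEnd m v c ≤ u c := fun c => le_max_left _ _
  have hu2 : ∀ c, u c ≤ hiEnd m v c := fun c => max_le (h0.lo_lt_hi c).le (min_le_right _ _)
  -- the portion of the velocity interval of `c` that is above `b`; it is `1` for the fastest
  -- clusters, on the left, and `0` for the slowest
  set w : Fin n → ℝ := fun c => (hiEnd m v c - u c) / m c with hw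
  have hw0 : ∀ c, 0 ≤ w c := fun c => div_nonneg (sub_nonneg.2 (hu2 c)) (hm c).le
  have hw1 : ∀ c, w c ≤ 1 := fun c => by
    rw [hw, div_le_one (hm c)]
    have := hu1 c
    simp only [hiEnd, loEnd] at *; linarith
  have hanti : Antitone w := by
    intro c c' hc
    rcases hc.eq_or_lt with rfl | hc
    · exact le_rfl
    have hg := h0.gap c c' hc
    rcases le_total b (loEnd m v c) with hb | hb
    · have e : u c = loEnd m v c := max_eq_left ((min_le_left _ _).trans hb)
      have : w c = 1 := by
        simp only [hw, e, hiEnd, loEnd]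
        rw [div_eq_one_iff_eq (hm c).ne']; ring
      rw [this]; exact hw1 c'
    · have e : u c' = hiEnd m v c' := by
        simp only [hu]
        rw [min_eq_right (hg.trans hb), max_eq_right (h0.lo_lt_hi c').le]
      have : w c' = 0 := by simp only [hw, e, sub_self, zero_div]
      rw [this]; exact hw0 c
  set p : Fin n → ℝ := fun c =>
    m c * (x c - optimalCluster 0 T z c (T - t) + (T - t) * v c) with hp
  have hs : 0 ≤ T - t := sub_nonneg.2 ht.2
  have key : 0 ≤ ∑ c, w c * p c := by
    have := sum_mul_nonneg_of_antitone (p := p) hanti Finset.univ (fun K _ hK => ?_) 0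
      fun c _ => hw0 c
    · simpa using this
    · rw [hz.lag_eq hT K t, ← hz.momentLag_zero K]
      exact hz.momentLag_mono hm (fun c hc c' hc' => (hK c hc c' (Finset.mem_univ _) hc').le)
        le_rfl hs (by linarith [ht.1])
  rw [← sub_nonneg, ← Finset.sum_sub_distrib]
  refine key.trans (Finset.sum_le_sum fun c _ => ?_)
  have h1 : w c * p c =
      (hiEnd m v c - u c) * (x c - optimalCluster 0 T z c (T - t) + (T - t) * v c) := by
    simp only [hw, hp]
    have := (hm c).ne'
    field_simp
  have h2 : 0 ≤ (T - t) / 2 * ((hiEnd m v c - u c) * (u c - loEnd m v c)) :=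
    mul_nonneg (by linarith) (mul_nonneg (sub_nonneg.2 (hu2 c)) (sub_nonneg.2 (hu1 c)))
  have h3 : excessTerm T x m v b c =
      x c * (hiEnd m v c - u c) + T / 2 * (hiEnd m v c ^ 2 - u c ^ 2) := rfl
  have h4 : excessTerm t (fun c => optimalCluster 0 T z c (T - t)) m v b c =
      optimalCluster 0 T z c (T - t) * (hiEnd m v c - u c) +
        t / 2 * (hiEnd m v c ^ 2 - u c ^ 2) := rfl
  have h5 : v c = (hiEnd m v c + loEnd m v c) / 2 := by simp only [hiEnd, loEnd]; ring
  rw [h1, h3, h4]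
  rw [h5]
  nlinarith

/-- The limit shape is below each of the planes that the dual function at the terminal time
defines. -/
lemma limitShape_le (hz : IsInertiaClusters T x m z) (hx : Monotone x) (hm : ∀ c, 0 < m c)
    {t : ℝ} (ht : t ∈ Ioc 0 T) (y b : ℝ) :
    limitShape T m z t y ≤
      b * y + (t * b ^ 2 / 2 + ∑ c, excessTerm T x m (optVel T m z) b c) := by
  have h1 := (hz.clusterProfile' hx hm ht).profile_le y b
  rw [profileDual] at h1
  have h2 := hz.excess_le hx hm ht b
  rw [limitShape]; linarith

/-- The limit shape touches the plane given by its slope: the clusters to the left of `y` have not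
met those to the right, so their lag is zero. -/
lemma limitShape_eq (hz : IsInertiaClusters T x m z) (hx : Monotone x) (hm : ∀ c, 0 < m c)
    {t : ℝ} (ht : t ∈ Ioc 0 T) (y : ℝ) :
    limitShape T m z t y = limitSlope T m z t y * y + (t * limitSlope T m z t y ^ 2 / 2 +
      ∑ c, excessTerm T x m (optVel T m z) (limitSlope T m z t y) c) := by
  have hT : 0 < T := ht.1.trans_le ht.2
  have h0 := hz.clusterProfile_zero hT hx hm
  have ht' := hz.clusterProfile' hx hm ht
  set b := limitSlope T m z t y with hb
  set K := Finset.univ.filter fun c => optimalCluster 0 T z c (T - t) ≤ y with hK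
  have hK1 : ∀ c ∈ K, b ≤ loEnd m (optVel T m z) c := fun c hc =>
    ht'.clip_le (ht'.lower_le y) _ hc
  have hK2 : ∀ c ∉ K, hiEnd m (optVel T m z) c ≤ b := fun c hc => ClusterProfile.le_clip _ hc
  have h1 := ht'.profileDual_of_between hK1 hK2
  have h2 := h0.profileDual_of_between hK1 hK2
  have hs : T - t ∈ Ico 0 T := ⟨sub_nonneg.2 ht.2, by linarith [ht.1]⟩
  have h3 := hz.momentLag_eq_zero hm (K := K) (s := T - t) ⟨hs.1, hs.2.le⟩
    fun c hc c' hc' e => hc' (by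
      rw [← hz.optimal_eq_iff hT hx hm hs] at e
      have := (Finset.mem_filter.1 hc).2
      rw [e] at this
      exact Finset.mem_filter.2 ⟨Finset.mem_univ _, this⟩)
  rw [← hz.lag_eq hT K t] at h3
  have h4 : ∑ c ∈ K, m c * (x c + T * optVel T m z c) =
      ∑ c ∈ K, m c * (optimalCluster 0 T z c (T - t) + t * optVel T m z c) := by
    rw [← sub_eq_zero, ← Finset.sum_sub_distrib]
    refine Eq.trans ?_ h3
    exact Finset.sum_congr rfl fun c _ => by ring
  have h5 : limitShape T m z t y = b * y +
      profileDual t (fun c => optimalCluster 0 T z c (T - t)) m (optVel T m z) b := rfl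
  rw [profileDual] at h2
  rw [h5, h1, ← h4]
  linarith

/-- The supporting plane of the limit shape. -/
lemma limitShape_le_plane (hz : IsInertiaClusters T x m z) (hx : Monotone x) (hm : ∀ c, 0 < m c)
    {t t' : ℝ} (ht : t ∈ Ioc 0 T) (ht' : t' ∈ Ioc 0 T) (y y' : ℝ) :
    limitShape T m z t' y' ≤ limitShape T m z t y + limitSlope T m z t y * (y' - y) +
      limitSlope T m z t y ^ 2 / 2 * (t' - t) := by
  have h1 := hz.limitShape_le hx hm ht' y' (limitSlope T m z t y)
  have h2 := hz.limitShape_eq hx hm ht y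
  linarith

lemma exists_slope_bound (hz : IsInertiaClusters T x m z) (hx : Monotone x) (hm : ∀ c, 0 < m c) :
    ∃ B, 0 ≤ B ∧ ∀ t ∈ Ioc 0 T, ∀ y, |limitSlope T m z t y| ≤ |y| / t + B :=
  ⟨_, Finset.sum_nonneg fun c _ => by positivity,
    fun _ ht y => (hz.clusterProfile' hx hm ht).abs_profileSlope_le y⟩

lemma locallyLipschitz_limitShape (hz : IsInertiaClusters T x m z) (hx : Monotone x)
    (hm : ∀ c, 0 < m c) :
    LocallyLipschitzOn (Ioc 0 T ×ˢ univ) fun p : ℝ × ℝ => limitShape T m z p.1 p.2 := by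
  obtain ⟨B, hB0, hB⟩ := hz.exists_slope_bound hx hm
  rintro ⟨t₀, y₀⟩ ⟨ht₀, -⟩
  have ht₀p : 0 < t₀ := ht₀.1
  set D := (|y₀| + 1) / (t₀ / 2) + B with hD
  have hD0 : 0 ≤ D := by positivity
  refine ⟨⟨D + D ^ 2 / 2, by positivity⟩, (Ioi (t₀ / 2) ×ˢ Metric.ball y₀ 1) ∩ (Ioc 0 T ×ˢ univ),
    ?_, ?_⟩
  · rw [inter_comm]
    exact inter_mem_nhdsWithin _
      (prod_mem_nhds (Ioi_mem_nhds (by linarith)) (Metric.ball_mem_nhds _ one_pos))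
  · have hbd : ∀ p ∈ (Ioi (t₀ / 2) ×ˢ Metric.ball y₀ 1) ∩ (Ioc 0 T ×ˢ univ),
        |limitSlope T m z p.1 p.2| ≤ D := by
      rintro ⟨t, y⟩ ⟨⟨h1, h2⟩, ⟨h3, -⟩⟩
      refine (hB t h3 y).trans ?_
      have h4 : |y| ≤ |y₀| + 1 := by
        rw [Metric.mem_ball, Real.dist_eq] at h2
        have := abs_sub_abs_le_abs_sub y y₀
        linarith
      simp only [hD]
      gcongr
      exact le_of_lt h1
    have hone : ∀ p ∈ (Ioi (t₀ / 2) ×ˢ Metric.ball y₀ 1) ∩ (Ioc 0 T ×ˢ univ),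
        ∀ q ∈ (Ioi (t₀ / 2) ×ˢ Metric.ball y₀ 1) ∩ (Ioc 0 T ×ˢ univ),
        limitShape T m z q.1 q.2 - limitShape T m z p.1 p.2 ≤ (D + D ^ 2 / 2) * dist p q := by
      intro p hp q hq
      have h1 := hz.limitShape_le_plane hx hm hp.2.1 hq.2.1 p.2 q.2
      have h2 := hbd p hp
      have h3 : |q.2 - p.2| ≤ dist p q := by
        rw [Prod.dist_eq, Real.dist_eq, Real.dist_eq, abs_sub_comm q.2]; exact le_max_right _ _
      have h4 : |q.1 - p.1| ≤ dist p q := by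
        rw [Prod.dist_eq, Real.dist_eq, Real.dist_eq, abs_sub_comm q.1]; exact le_max_left _ _
      set b := limitSlope T m z p.1 p.2
      have h5 : b * (q.2 - p.2) ≤ D * dist p q := by
        refine (le_abs_self _).trans ?_
        rw [abs_mul]
        exact mul_le_mul h2 h3 (abs_nonneg _) hD0
      have h6 : b ^ 2 / 2 * (q.1 - p.1) ≤ D ^ 2 / 2 * dist p q := by
        refine (le_abs_self _).trans ?_
        rw [abs_mul, abs_of_nonneg (by positivity : 0 ≤ b ^ 2 / 2)]
        refine mul_le_mul ?_ h4 (abs_nonneg _) (by positivity)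
        have := sq_le_sq' (abs_le.1 h2).1 (abs_le.1 h2).2
        linarith
      linarith
    refine LipschitzOnWith.of_dist_le_mul fun p hp q hq => ?_
    rw [Real.dist_eq, abs_le]
    have h1 := hone p hp q hq
    have h2 := hone q hq p hp
    rw [dist_comm q p] at h2
    constructor
    · change -((D + D ^ 2 / 2) * dist p q) ≤ _; linarith
    · change _ ≤ (D + D ^ 2 / 2) * dist p q; linarith

lemma growth_limitShape (hz : IsInertiaClusters T x m z) (hx : Monotone x)
    (hm : ∀ c, 0 < m c) {τ : ℝ} (hτ : τ ∈ Ioo 0 T) : ∃ K : ℝ, ∀ t ∈ Icc τ T, ∀ y y' : ℝ,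
      |limitShape T m z t y - limitShape T m z t y'| ≤ K * (1 + |y| + |y'|) * |y - y'| := by
  obtain ⟨B, hB0, hB⟩ := hz.exists_slope_bound hx hm
  refine ⟨1 / τ + B, fun t ht y y' => ?_⟩
  have htm : t ∈ Ioc 0 T := ⟨hτ.1.trans_le ht.1, ht.2⟩
  have hτ0 := hτ.1
  have hs : ∀ w, |w| ≤ |y| + |y'| → |limitSlope T m z t w| ≤ (1 / τ + B) * (1 + |y| + |y'|) := by
    intro w hw
    refine (hB t htm w).trans ?_
    have h1 : |w| / t ≤ (|y| + |y'|) / τ := by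
      gcongr
      exact ht.1
    have h2 : 0 ≤ 1 / τ := by positivity
    have h3 : (|y| + |y'|) / τ = 1 / τ * (|y| + |y'|) := by ring
    nlinarith [abs_nonneg y, abs_nonneg y', mul_nonneg hB0 (abs_nonneg y),
      mul_nonneg hB0 (abs_nonneg y')]
  have hone : ∀ a b, |a| ≤ |y| + |y'| → limitShape T m z t b - limitShape T m z t a ≤
      (1 / τ + B) * (1 + |y| + |y'|) * |b - a| := fun a b ha => by
    have h1 := hz.limitShape_le_plane hx hm htm htm a b
    rw [sub_self, mul_zero, add_zero] at h1
    have h2 : limitSlope T m z t a * (b - a) ≤ (1 / τ + B) * (1 + |y| + |y'|) * |b - a| := by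
      refine (le_abs_self _).trans ?_
      rw [abs_mul]
      exact mul_le_mul_of_nonneg_right (hs a ha) (abs_nonneg _)
    linarith
  have h1 := hone y y' (by linarith [abs_nonneg y'])
  have h2 := hone y' y (by linarith [abs_nonneg y])
  rw [abs_sub_comm] at h1
  rw [abs_le]
  constructor <;> linarith

lemma hasDerivAt_limitShape_space (hz : IsInertiaClusters T x m z) (hx : Monotone x)
    (hm : ∀ c, 0 < m c) {t y : ℝ} (ht : t ∈ Ioc 0 T)
    (hy : ∀ c, y ≠ optimalCluster 0 T z c (T - t)) :
    HasDerivAt (limitShape T m z t) (limitSlope T m z t y) y :=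
  (hz.clusterProfile' hx hm ht).hasDerivAt_profile (by rintro ⟨c, hc⟩; exact hy c hc.symm)

lemma hasDerivAt_limitShape_time (hz : IsInertiaClusters T x m z) (hx : Monotone x)
    (hm : ∀ c, 0 < m c) {t y : ℝ} (ht : t ∈ Ioo 0 T)
    (hy : ∀ c, y ≠ optimalCluster 0 T z c (T - t)) :
    HasDerivAt (fun t => limitShape T m z t y) (limitSlope T m z t y ^ 2 / 2) t := by
  have htm : t ∈ Ioc 0 T := ⟨ht.1, ht.2.le⟩
  refine hasDerivAt_of_support (b := fun t => limitSlope T m z t y ^ 2 / 2) ?_ ?_ ?_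
  · have hcont : ∀ c, ContinuousAt (fun r => optimalCluster 0 T z c (T - r)) t := fun c => by
      have h1 : ContinuousAt (optimalCluster 0 T z c) (T - t) :=
        (hz.continuousOn_optimal c).continuousAt
          (Icc_mem_nhds (by linarith [ht.2]) (by linarith [ht.1]))
      exact ContinuousAt.comp (f := fun r : ℝ => T - r) h1 (by fun_prop)
    have hev : ∀ᶠ r in 𝓝 t, ∀ c, (optimalCluster 0 T z c (T - r) ≤ y ↔
        optimalCluster 0 T z c (T - t) ≤ y) := by
      rw [eventually_all]
      intro c
      rcases lt_or_gt_of_ne (hy c) with h | h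
      · filter_upwards [(hcont c).eventually (lt_mem_nhds h)] with r hr
        exact iff_of_false (not_le.2 hr) (not_le.2 h)
      · filter_upwards [(hcont c).eventually (gt_mem_nhds h)] with r hr
        exact iff_of_true hr.le h.le
    have h2 : ContinuousAt (fun r => limitSlope T m z r y) t := by
      have h3 : ContinuousAt (fun r => clipVel m (optVel T m z)
          (Finset.univ.filter fun c => optimalCluster 0 T z c (T - t) ≤ y) (-y / r)) t :=
        ContinuousAt.comp (f := fun r : ℝ => -y / r) (continuous_clipVel m _ _).continuousAt
          (continuousAt_const.div continuousAt_id ht.1.ne')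
      refine h3.congr ?_
      filter_upwards [hev] with r hr
      simp only [limitSlope, profileSlope, hr]
    exact (h2.pow 2).div_const 2
  · filter_upwards [Ioo_mem_nhds ht.1 ht.2] with r hr
    have := hz.limitShape_le_plane hx hm htm ⟨hr.1, hr.2.le⟩ y y
    rwa [sub_self, mul_zero, add_zero] at this
  · filter_upwards [Ioo_mem_nhds ht.1 ht.2] with r hr
    have := hz.limitShape_le_plane hx hm ⟨hr.1, hr.2.le⟩ htm y y
    rwa [sub_self, mul_zero, add_zero] at this

/-- The trajectories of the clusters are a null set in space-time. -/
lemma ae_ne_optimal (hz : IsInertiaClusters T x m z) (hT : 0 < T) :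
    ∀ᵐ p : ℝ × ℝ, p ∈ Ioo 0 T ×ˢ (univ : Set ℝ) →
      ∀ c, p.2 ≠ optimalCluster 0 T z c (T - p.1) := by
  have h1 : ∀ c, ∀ᵐ p : ℝ × ℝ, p ∈ Ioo 0 T ×ˢ (univ : Set ℝ) →
      p.2 ≠ optimalCluster 0 T z c (T - p.1) := fun c => by
    set φ : ℝ → ℝ := IccExtend hT.le ((Icc 0 T).domRestrict (optimalCluster 0 T z c)) with hφ
    have hc : Continuous φ := (hz.continuousOn_optimal c).domRestrict.Icc_extend'
    have hnull : (volume : Measure (ℝ × ℝ)) {p : ℝ × ℝ | p.2 = φ (T - p.1)} = 0 := by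
      have hcp : Continuous fun p : ℝ × ℝ => φ (T - p.1) := by fun_prop
      rw [Measure.volume_eq_prod, Measure.measure_prod_null
        (measurableSet_eq_fun measurable_snd hcp.measurable)]
      filter_upwards with r
      have : Prod.mk r ⁻¹' {p : ℝ × ℝ | p.2 = φ (T - p.1)} = {φ (T - r)} := by
        ext y; simp
      rw [this]; simp
    filter_upwards [measure_eq_zero_iff_ae_notMem.1 hnull] with p hp hpm he
    refine hp ?_
    have hmem : T - p.1 ∈ Icc 0 T := ⟨by linarith [hpm.1.2], by linarith [hpm.1.1]⟩
    change p.2 = φ (T - p.1)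
    rw [hφ, IccExtend_of_mem _ _ hmem]
    exact he
  filter_upwards [ae_all_iff.2 h1] with p hp hpm c using hp c hpm

/-- The limit shape of the clusters is an entropy solution. It is concave at each time, so the
entropy condition holds with constant `0`. -/
lemma isBackwardEntropySolution (hz : IsInertiaClusters T x m z) (hT : 0 < T) (hx : Monotone x)
    (hm : ∀ c, 0 < m c) :
    IsBackwardEntropySolution T (profile T x m (optVel T m z)) (limitShape T m z) where
  terminal := hz.limitShape_terminal
  locallyLipschitz := hz.locallyLipschitz_limitShape hx hm
  growth := fun _ hτ => hz.growth_limitShape hx hm hτ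
  equation := by
    rw [ae_restrict_iff' (measurableSet_Ioo.prod MeasurableSet.univ)]
    filter_upwards [hz.ae_ne_optimal hT] with p hp hpm
    rw [(hz.hasDerivAt_limitShape_time hx hm hpm.1 (hp hpm)).deriv,
      (hz.hasDerivAt_limitShape_space hx hm ⟨hpm.1.1, hpm.1.2.le⟩ (hp hpm)).deriv]
    ring
  entropy := fun τ hτ => ⟨0, fun t ht y r => by
    have htm : t ∈ Ioc 0 T := ⟨hτ.1.trans_le ht.1, ht.2.le⟩
    have h1 := hz.limitShape_le_plane hx hm htm htm y (y + r)
    have h2 := hz.limitShape_le_plane hx hm htm htm y (y - r)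
    rw [zero_div, zero_mul]
    nlinarith⟩

/-- The shocks of the limit shape are the optimal clusters. -/
lemma shockSet_limitShape (hz : IsInertiaClusters T x m z) (hx : Monotone x) (hm : ∀ c, 0 < m c)
    {t : ℝ} (ht : t ∈ Ioc 0 T) :
    shockSet (limitShape T m z) t = range fun c => optimalCluster 0 T z c (T - t) := by
  have h := hz.clusterProfile' hx hm ht
  ext y
  constructor
  · intro hy
    by_contra hne
    exact hy (h.hasDerivAt_profile hne).differentiableAt
  · rintro ⟨c, rfl⟩ hd
    have h1 := (uniqueDiffOn_Iic _ _ self_mem_Iic).eq_deriv _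
      (h.hasDerivWithinAt_profile_left (optimalCluster 0 T z c (T - t)))
      hd.hasDerivAt.hasDerivWithinAt
    have h2 := (uniqueDiffOn_Ici _ _ self_mem_Ici).eq_deriv _
      (h.hasDerivWithinAt_profile_right (optimalCluster 0 T z c (T - t)))
      hd.hasDerivAt.hasDerivWithinAt
    have h3 := h.profile_kink (y := optimalCluster 0 T z c (T - t))
    have h4 := blockMass_pos (y := fun c => optimalCluster 0 T z c (T - t)) hm c
    linarith

end IsInertiaClusters
end
end

noncomputable section
open Set Filter Topology MeasureTheory

/-! ### Legendre duality -/

/-- The value of `LSHE` at an optimal flow of clusters. -/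
lemma IsInertiaClusters.LSHE_eq {n : ℕ} {T : ℝ} {x m : Fin n → ℝ} {z : Fin n → ℝ → ℝ}
    (hz : IsInertiaClusters T x m z) (hT : 0 < T) (hx : Monotone x) (hm : ∀ c, 0 < m c) :
    LSHE 0 T x m = (certificate 0 T x m (optVel T m z) : EReal) := by
  refine le_antisymm (LSHE_le_certificate (fun c => (hm c).le) hT.le hx
    fun c c' h => hz.optVel_gap hT hx (fun c => (hm c).le) h) ?_
  exact certificate_le_LSHE (ζ := optimalCluster 0 T z) hT.le hm hz.optimalCluster_zero
    (optimalCluster_end hT z) (fun s hs => hz.optimal_mono hT hx hm hs) hz.continuousOn_optimal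
    (fun c s hs => hz.hasDeriv_optimal' hT hx hm hs c) (fun s hs y => hz.optVel_block hT hx hm hs y)

section
variable {k : ℕ} {t : ℝ} {x : Fin (k + 1) → ℝ}

lemma IsShapeAt.kinks_eq_zero {h : EuclideanSpace ℝ (Fin (k + 1))} {f : ℝ → ℝ}
    (hf : IsShapeAt t x h f) (ht : 0 < t) (hx : StrictMono x) {c : Fin (k + 1)}
    (hd : DifferentiableAt ℝ f (x c)) : kinks t x h c = 0 := by
  have h1 := (uniqueDiffOn_Iic _ _ self_mem_Iic).eq_deriv _ (hf.hasDerivWithinAt_left ht hx c)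
    hd.hasDerivAt.hasDerivWithinAt
  have h2 := (uniqueDiffOn_Ici _ _ self_mem_Ici).eq_deriv _ (hf.hasDerivWithinAt_right ht hx c)
    hd.hasDerivAt.hasDerivWithinAt
  rw [kinks_apply, h1, h2, sub_self]

/-- The profile of the optimal clusters at the terminal time has the gradient `m`, and its Legendre
transform is the certificate, since both integrate the same function over the velocity intervals. -/
lemma exists_dual_pos (ht : 0 < t) (hx : StrictMono x) {m : Fin (k + 1) → ℝ}
    (hm : ∀ c, 0 < m c) : ∃ h ∈ hvConc t x, (∀ c, kinks t x h c = m c) ∧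
      LSHE 0 t x m = ((∑ c, m c * h c - rateKPZ t x h : ℝ) : EReal) := by
  obtain ⟨z, hz⟩ := exists_isInertiaClusters ht.le x m
  have hP := hz.clusterProfile_zero ht hx.monotone hm
  set v := optVel t m z with hv
  set h : EuclideanSpace ℝ (Fin (k + 1)) := WithLp.toLp 2 fun c => profile t x m v (x c)
  have hval : ∀ c, h c = profile t x m v (x c) := fun c => rfl
  have hk : ∀ c, kinks t x h c = m c := fun c => by
    rw [hP.kinks_eq hx rfl hval]
    have : (Finset.univ.filter fun c' => x c' = x c) = {c} := by
      ext c'; simp [hx.injective.eq_iff]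
    rw [this, Finset.sum_singleton]
  have hc := hP.mem_hvConc hx rfl hval
  refine ⟨h, hc, hk, ?_⟩
  rw [hz.LSHE_eq ht hx.monotone hm]
  have hd := kinks_dual ht hx hc.1
  simp only [hk] at hd
  rw [hd, certificate]
  congr 1
  refine Finset.sum_congr rfl fun c _ => ?_
  have h1 := hk c
  rw [kinks_apply] at h1
  have h2 := hP.slope_le_lo c
  have h3 := ClusterProfile.hi_le_slopeL (t := t) (ζ := x) (m := m) (v := v) c
  rw [← hP.slopesR_eq hx rfl hval] at h2
  rw [← hP.slopesL_eq hx rfl hval] at h3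
  rw [loEnd] at h2
  rw [hiEnd] at h3
  have h4 : slopesL t x h c = v c + m c / 2 := by linarith
  have h5 : slopesR t x h c = v c - m c / 2 := by linarith
  rw [h4, h5, slopePrim, slopePrim]
  ring

lemma isShapeAt_parab {n : ℕ} (x : Fin n → ℝ) :
    IsShapeAt t x (WithLp.toLp 2 fun c => parab t (x c)) (parab t) where
  continuous := continuous_iff_continuousAt.2 fun y => (hasDerivAt_parab t y).continuousAt
  contDiffOn := by
    have : ContDiff ℝ 1 (parab t) := by unfold parab; fun_prop
    exact this.contDiffOn
  value := fun c => rfl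
  ge_parab := fun y => le_rfl
  eq_parab := ⟨0, fun y _ => rfl⟩
  deriv_const := fun a b hab h => absurd (h a ⟨le_rfl, hab⟩).1 (lt_irrefl _)

lemma concaveOn_parab (ht : 0 < t) : ConcaveOn ℝ univ (parab t) := by
  refine ⟨convex_univ, fun y _ w _ a b ha hb hab => ?_⟩
  have hb' : b = 1 - a := by linarith
  simp only [parab, smul_eq_mul]
  rw [← sub_nonneg]
  have : -(a * y + b * w) ^ 2 / (2 * t) - (a * (-y ^ 2 / (2 * t)) + b * (-w ^ 2 / (2 * t))) =
      a * b * (y - w) ^ 2 / (2 * t) := by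
    rw [hb']; field_simp; ring
  rw [this]
  positivity

/-- Without mass only the zero measure remains, also when there are marked points. -/
lemma LSHE_of_zero (ht : 0 < t) {ι : Type*} [Fintype ι] (x : ι → ℝ) :
    LSHE 0 t x (fun _ => 0) = ((0 : ℝ) : EReal) := by
  rw [LSHE_congr (x' := fun _ : Fin 0 => (0 : ℝ)) (m' := fun _ => 0) (by simp) (by simp)]
  have hc : certificate 0 t (fun _ : Fin 0 => (0 : ℝ)) (fun _ => 0) (fun _ => 0) = 0 := by
    simp [certificate]
  rw [← hc]
  exact le_antisymm (LSHE_le_certificate (fun c => le_rfl) ht.le (fun c => c.elim0) fun c => c.elim0)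
    (certificate_le_LSHE (ζ := fun _ _ => 0) ht.le (fun c => c.elim0) (fun c => c.elim0)
      (fun c => c.elim0) (fun _ _ c => c.elim0) (fun c => c.elim0) (fun c => c.elim0)
      fun _ _ _ => ⟨0, fun c => c.elim0⟩)

/-- Every nonnegative `m` is the gradient of the rate function at a deviation with concave shape,
and `LSHE` is the value of the Legendre transform there. -/
theorem exists_dual (ht : 0 < t) (hx : StrictMono x) {m : EuclideanSpace ℝ (Fin (k + 1))}
    (hm : m ∈ orthant (k + 1)) : ∃ h ∈ hvConc t x, kinks t x h = m ∧
      LSHE 0 t x (fun c => m c) = ((∑ c, m c * h c - rateKPZ t x h : ℝ) : EReal) := by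
  set S := Finset.univ.filter fun c => 0 < m c with hS
  have hzero : ∀ c ∉ S, m c = 0 := fun c hc =>
    le_antisymm (not_lt.1 fun h => hc (by simpa [S] using h)) (hm c)
  rcases Nat.eq_zero_or_eq_succ_pred S.card with hcard | hcard
  · -- no mass: the shape is the parabola
    have hm0 : ∀ c, m c = 0 := fun c => hzero c (by simp [Finset.card_eq_zero.1 hcard])
    have hf := isShapeAt_parab (t := t) x
    have hsh := hf.shapeFn_eq ht hx
    refine ⟨_, ⟨hf.mem_hvSpace, by rw [hsh]; exact concaveOn_parab ht⟩, ?_, ?_⟩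
    · ext c
      rw [hm0 c]
      exact hf.kinks_eq_zero ht hx (hasDerivAt_parab t _).differentiableAt
    · have hr : rateKPZ t x (WithLp.toLp 2 fun c => parab t (x c)) = 0 := by
        rw [rateKPZ, hsh]; simp
      simp only [hm0, hr]
      rw [LSHE_of_zero ht]
      simp
  · set j := S.card.pred
    have hcard' : S.card = j + 1 := hcard
    -- only the points with positive mass carry kinks; the shape through them passes through the
    -- remaining marked points without a kink
    set e := S.orderEmbOfFin hcard'
    have hsum : ∀ {M : Type} [AddCommMonoid M] (g : Fin (k + 1) → M), (∀ c ∉ S, g c = 0) →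
        ∑ c, g c = ∑ i, g (e i) := by
      intro M _ g hg
      rw [← Finset.sum_subset (Finset.subset_univ S) fun c _ hc => hg c hc,
        ← Finset.sum_image (f := g) (s := Finset.univ) (g := e) (fun a _ b _ h => e.injective h),
        Finset.image_orderEmbOfFin_univ]
    have hmem : ∀ i, e i ∈ S := fun i => S.orderEmbOfFin_mem hcard' i
    have hex : ∀ c ∈ S, ∃ i, e i = c := fun c hc => by
      have := S.range_orderEmbOfFin hcard'
      have hc' : c ∈ range e := by rw [this]; exact hc
      exact hc'
    have hy : StrictMono fun i => x (e i) := hx.comp e.strictMono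
    obtain ⟨h', hh', hk', hL'⟩ := exists_dual_pos ht hy (m := fun i => m (e i))
      fun i => (Finset.mem_filter.1 (hmem i)).2
    have hf' := isShapeAt_shapeFn ht hy hh'.1
    set f := shapeFn t (fun i => x (e i)) h' with hfdef
    have hrange : (range x)ᶜ ⊆ (range fun i => x (e i))ᶜ := by
      refine compl_subset_compl.2 ?_
      rintro _ ⟨i, rfl⟩; exact ⟨_, rfl⟩
    have hf : IsShapeAt t x (WithLp.toLp 2 fun c => f (x c)) f :=
      { continuous := hf'.continuous
        contDiffOn := hf'.contDiffOn.mono hrange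
        value := fun c => rfl
        ge_parab := hf'.ge_parab
        eq_parab := hf'.eq_parab
        deriv_const := fun a b hab h =>
          hf'.deriv_const a b hab fun y hy => ⟨(h y hy).1, hrange (h y hy).2⟩ }
    have hsh := hf.shapeFn_eq ht hx
    refine ⟨_, ⟨hf.mem_hvSpace, by rw [hsh]; exact hh'.2⟩, ?_, ?_⟩
    · ext c
      by_cases hc : c ∈ S
      · obtain ⟨i, rfl⟩ := hex c hc
        rw [← hk' i, kinks_apply, kinks_apply]
        have h1 := (uniqueDiffOn_Iic _ _ self_mem_Iic).eq_deriv _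
          (hf.hasDerivWithinAt_left ht hx (e i)) (hf'.hasDerivWithinAt_left ht hy i)
        have h2 := (uniqueDiffOn_Ici _ _ self_mem_Ici).eq_deriv _
          (hf.hasDerivWithinAt_right ht hx (e i)) (hf'.hasDerivWithinAt_right ht hy i)
        rw [h1, h2]
      · rw [hzero c hc]
        refine hf.kinks_eq_zero ht hx ?_
        have hopen : IsOpen (range fun i => x (e i))ᶜ :=
          (Set.finite_range _).isClosed.isOpen_compl
        have hnm : x c ∈ (range fun i => x (e i))ᶜ := by
          rintro ⟨i, hi⟩
          exact hc (hx.injective hi ▸ hmem i)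
        exact (hf'.contDiffOn.differentiableOn one_ne_zero).differentiableAt (hopen.mem_nhds hnm)
    · rw [LSHE_congr (x' := fun i => x (e i)) (m' := fun i => m (e i)), hL']
      · congr 1
        congr 1
        · rw [hsum _ fun c hc => by rw [hzero c hc, zero_mul]]
          refine Finset.sum_congr rfl fun i _ => ?_
          rw [← hf'.value i]
        · rw [rateKPZ, rateKPZ, hsh]
      · exact hsum _ hzero
      · exact hsum _ fun c hc => by rw [hzero c hc]; simp

lemma kinks_injective (ht : 0 < t) (hx : StrictMono x) {h g : EuclideanSpace ℝ (Fin (k + 1))}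
    (hh : h ∈ hvSpace t x) (hg : g ∈ hvSpace t x) (he : kinks t x h = kinks t x g) : h = g := by
  by_contra hne
  have h1 := rateKPZ_strict ht hx hh hg (Ne.symm hne)
  have h2 := rateKPZ_strict ht hx hg hh hne
  rw [he] at h1
  have h3 : ∑ c, kinks t x g c * (g c - h c) + ∑ c, kinks t x g c * (h c - g c) = 0 := by
    rw [← Finset.sum_add_distrib]
    exact Finset.sum_eq_zero fun c _ => by ring
  linarith

/-- The shape is concave if and only if all its kinks are: a deviation with concave shape and the
same kinks exists by `exists_dual`, and is the same by strict convexity. -/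
theorem mem_hvConc_iff (ht : 0 < t) (hx : StrictMono x) {h : EuclideanSpace ℝ (Fin (k + 1))} :
    h ∈ hvConc t x ↔ h ∈ hvSpace t x ∧ kinks t x h ∈ orthant (k + 1) := by
  refine ⟨fun hh => ⟨hh.1, fun c => kinks_nonneg ht hx hh c⟩, fun hh => ?_⟩
  obtain ⟨g, hg, hk, -⟩ := exists_dual ht hx hh.2
  rwa [← kinks_injective ht hx hg.1 hh.1 hk]

lemma convex_hvConc (ht : 0 < t) (hx : StrictMono x) : Convex ℝ (hvConc t x) :=
  fun _ hh _ hg _ _ ha hb hab => (mem_hvConc_iff ht hx).2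
    (kinks_nonneg_of_convexComb ht hx hh hg ha hb hab)

lemma isClosed_orthant (n : ℕ) : IsClosed (orthant n) := by
  have : orthant n = ⋂ c, {m : EuclideanSpace ℝ (Fin n) | 0 ≤ m c} := by
    ext m; simp [orthant]
  rw [this]
  exact isClosed_iInter fun c => isClosed_le continuous_const (by fun_prop)

lemma convex_orthant (n : ℕ) : Convex ℝ (orthant n) := fun m hm m' hm' a b ha hb _ c => by
  simp only [PiLp.add_apply, PiLp.smul_apply, smul_eq_mul]
  exact add_nonneg (mul_nonneg ha (hm c)) (mul_nonneg hb (hm' c))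

lemma isClosed_hvConc (ht : 0 < t) (hx : StrictMono x) : IsClosed (hvConc t x) := by
  have : hvConc t x = hvSpace t x ∩ kinks t x ⁻¹' orthant (k + 1) := by
    ext h; exact mem_hvConc_iff ht hx
  rw [this]
  exact (continuousOn_kinks ht hx).preimage_isClosed_of_isClosed isClosed_hvSpace
    (isClosed_orthant _)

lemma strictConvexOn_rateKPZ (ht : 0 < t) (hx : StrictMono x) :
    StrictConvexOn ℝ (hvConc t x) (rateKPZ t x) := by
  refine ⟨convex_hvConc ht hx, fun h hh g hg hne a b ha hb hab => ?_⟩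
  have hc := (convex_hvConc ht hx hh hg ha.le hb.le hab).1
  set c := a • h + b • g with hcdef
  have hb' : b = 1 - a := by linarith
  have hch : h ≠ c := fun e => hne <| by
    have : b • (g - h) = 0 := by
      rw [smul_sub, sub_eq_zero, ← sub_eq_zero]
      have : a • h + b • g - h = 0 := by rw [← hcdef, ← e, sub_self]
      rw [← this, hb', sub_smul, sub_smul, one_smul, one_smul]
      abel
    rcases smul_eq_zero.1 this with h0 | h0
    · exact absurd h0 hb.ne'
    · exact (sub_eq_zero.1 h0).symm
  have hcg : g ≠ c := fun e => hne <| by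
    have : a • (h - g) = 0 := by
      have : a • h + b • g - g = 0 := by rw [← hcdef, ← e, sub_self]
      rw [← this, hb', sub_smul, one_smul, smul_sub]
      abel
    rcases smul_eq_zero.1 this with h0 | h0
    · exact absurd h0 ha.ne'
    · exact sub_eq_zero.1 h0
  have h1 := mul_lt_mul_of_pos_left (rateKPZ_strict ht hx hc hh.1 hch) ha
  have h2 := mul_lt_mul_of_pos_left (rateKPZ_strict ht hx hc hg.1 hcg) hb
  have h3 : a * ∑ i, kinks t x c i * (h i - c i) + b * ∑ i, kinks t x c i * (g i - c i) = 0 := by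
    rw [Finset.mul_sum, Finset.mul_sum, ← Finset.sum_add_distrib]
    refine Finset.sum_eq_zero fun i _ => ?_
    have : c i = a * h i + b * g i := by
      simp [hcdef, PiLp.add_apply, PiLp.smul_apply]
    rw [this, hb']; ring
  have h4 : a * rateKPZ t x c + b * rateKPZ t x c = rateKPZ t x c := by
    rw [← add_mul, hab, one_mul]
  rw [smul_eq_mul, smul_eq_mul]
  nlinarith

lemma continuousOn_rateKPZ (ht : 0 < t) (hx : StrictMono x) :
    ContinuousOn (rateKPZ t x) (hvConc t x) := fun _ hh =>
  ((hasGradientWithinAt_rateKPZ ht hx hh.1).hasFDerivWithinAt.continuousWithinAt).mono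
    fun _ h => h.1

/-- The gradient of the rate function, as a map between the dual domains. -/
def kinkMap (ht : 0 < t) (hx : StrictMono x) (h : hvConc t x) : orthant (k + 1) :=
  ⟨kinks t x h, ((mem_hvConc_iff ht hx).1 h.2).2⟩

lemma continuous_kinkMap (ht : 0 < t) (hx : StrictMono x) : Continuous (kinkMap ht hx) :=
  Continuous.subtype_mk
    (((continuousOn_kinks ht hx).mono fun _ h => h.1).domRestrict) _

lemma bijective_kinkMap (ht : 0 < t) (hx : StrictMono x) : Function.Bijective (kinkMap ht hx) := by
  refine ⟨fun h g e => Subtype.ext (kinks_injective ht hx h.2.1 g.2.1 (congrArg Subtype.val e)),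
    fun m => ?_⟩
  obtain ⟨h, hh, hk, -⟩ := exists_dual ht hx m.2
  exact ⟨⟨h, hh⟩, Subtype.ext hk⟩

/-- A bound on the gradient bounds the deviation: compare with the deviation of larger gradient. -/
lemma exists_bound_of_kinks_le (ht : 0 < t) (hx : StrictMono x) (M : ℝ) :
    ∃ R, ∀ h ∈ hvConc t x, (∀ c, kinks t x h c ≤ M) → ∀ c, |h c| ≤ R := by
  obtain ⟨g, hg, hk, -⟩ := exists_dual ht hx (m := WithLp.toLp 2 fun _ => |M| + 1)
    (fun c => by change 0 ≤ |M| + 1; positivity)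
  have hk' : ∀ c, kinks t x g c = |M| + 1 := fun c => by rw [hk]
  set B := ∑ c, (|M| + 1) * (g c - parab t (x c)) with hB
  refine ⟨B + ∑ c, |parab t (x c)|, fun h hh hM c => ?_⟩
  have h1 := rateKPZ_le ht hx hg.1 hh.1
  have h2 := rateKPZ_le ht hx hh.1 hg.1
  have hn := fun c => kinks_nonneg ht hx hh c
  have h3 : ∑ c, (|M| + 1 - kinks t x h c) * (h c - parab t (x c)) ≤
      ∑ c, (|M| + 1 - kinks t x h c) * (g c - parab t (x c)) := by
    have e : ∑ c, (|M| + 1 - kinks t x h c) * (h c - parab t (x c)) -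
      ∑ c, (|M| + 1 - kinks t x h c) * (g c - parab t (x c)) =
        ∑ c, kinks t x g c * (h c - g c) + ∑ c, kinks t x h c * (g c - h c) := by
      rw [← Finset.sum_sub_distrib, ← Finset.sum_add_distrib]
      exact Finset.sum_congr rfl fun c _ => by rw [hk']; ring
    linarith
  have h4 : ∑ c, (|M| + 1 - kinks t x h c) * (g c - parab t (x c)) ≤ B :=
    Finset.sum_le_sum fun c _ =>
      mul_le_mul_of_nonneg_right (by linarith [hn c]) (sub_nonneg.2 (hg.1 c))
  have h5 : h c - parab t (x c) ≤ ∑ c, (|M| + 1 - kinks t x h c) * (h c - parab t (x c)) := by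
    have h6 : ∀ c, h c - parab t (x c) ≤ (|M| + 1 - kinks t x h c) * (h c - parab t (x c)) :=
      fun c => le_mul_of_one_le_left (sub_nonneg.2 (hh.1 c))
        (by linarith [hM c, le_abs_self M])
    exact (h6 c).trans (Finset.single_le_sum
      (f := fun c => (|M| + 1 - kinks t x h c) * (h c - parab t (x c)))
      (fun c _ => (sub_nonneg.2 (hh.1 c)).trans (h6 c)) (Finset.mem_univ c))
  have h7 : |parab t (x c)| ≤ ∑ c, |parab t (x c)| :=
    Finset.single_le_sum (f := fun c => |parab t (x c)|) (fun c _ => abs_nonneg _)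
      (Finset.mem_univ c)
  have h8 := hh.1 c
  have h9 := abs_le.1 h7
  rw [abs_le]
  constructor <;> linarith

lemma isClosedMap_kinkMap (ht : 0 < t) (hx : StrictMono x) : IsClosedMap (kinkMap ht hx) := by
  have : LocallyCompactSpace (orthant (k + 1)) := (isClosed_orthant _).isClosedEmbedding_subtypeVal.locallyCompactSpace
  refine IsProperMap.isClosedMap (isProperMap_iff_isCompact_preimage.2
    ⟨continuous_kinkMap ht hx, fun K hK => ?_⟩)
  rw [Subtype.isCompact_iff]
  refine Metric.isCompact_of_isClosed_isBounded ?_ ?_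
  · exact (isClosed_hvConc ht hx).isClosedEmbedding_subtypeVal.isClosedMap _
      (hK.isClosed.preimage (continuous_kinkMap ht hx))
  · obtain ⟨M, hM⟩ := (hK.image continuous_subtype_val).isBounded.exists_norm_le
    obtain ⟨R, hR⟩ := exists_bound_of_kinks_le ht hx M
    rw [isBounded_iff_forall_norm_le]
    refine ⟨√(∑ _c : Fin (k + 1), R ^ 2), ?_⟩
    rintro _ ⟨h, hh, rfl⟩
    have h1 := hR h h.2 fun c => by
      have h2 := hM _ ⟨_, hh, rfl⟩
      have h3 := PiLp.norm_apply_le (kinks t x h) c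
      exact (le_abs_self _).trans (h3.trans h2)
    rw [EuclideanSpace.norm_eq]
    refine Real.sqrt_le_sqrt (Finset.sum_le_sum fun c _ => ?_)
    rw [Real.norm_eq_abs]
    exact pow_le_pow_left₀ (abs_nonneg _) (h1 c) 2

/-- The gradient of the rate function as a homeomorphism. -/
def kinkHomeo (ht : 0 < t) (hx : StrictMono x) : hvConc t x ≃ₜ orthant (k + 1) :=
  (Equiv.ofBijective _ (bijective_kinkMap ht hx)).toHomeomorphOfContinuousClosed
    (continuous_kinkMap ht hx) (isClosedMap_kinkMap ht hx)

lemma kinkHomeo_apply (ht : 0 < t) (hx : StrictMono x) (h : hvConc t x) :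
    (kinkHomeo ht hx h : EuclideanSpace ℝ (Fin (k + 1))) = kinks t x h := rfl

/-- `LSHE` at the gradient of the rate function is the value of the Legendre transform. -/
lemma LSHE_kinks (ht : 0 < t) (hx : StrictMono x) {h : EuclideanSpace ℝ (Fin (k + 1))}
    (hh : h ∈ hvConc t x) : LSHE 0 t x (fun c => kinks t x h c) =
      ((∑ c, kinks t x h c * h c - rateKPZ t x h : ℝ) : EReal) := by
  obtain ⟨g, hg, hk, hL⟩ := exists_dual ht hx ((mem_hvConc_iff ht hx).1 hh).2
  rwa [kinks_injective ht hx hg.1 hh.1 hk] at hL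

/-- `LSHE` is finite, continuous and strictly convex, and the Legendre dual of the rate function. -/
theorem exists_legendre (ht : 0 < t) (hx : StrictMono x) :
    ∃ L : EuclideanSpace ℝ (Fin (k + 1)) → ℝ,
      (∀ m ∈ orthant (k + 1), LSHE 0 t x (fun c => m c) = (L m : EReal)) ∧
      ContinuousOn L (orthant (k + 1)) ∧
      StrictConvexOn ℝ (orthant (k + 1)) L ∧
      (∀ m ∈ orthant (k + 1),
        IsLUB ((fun h => (∑ c, m c * h c) - rateKPZ t x h) '' hvConc t x) (L m)) ∧
      (∀ h ∈ hvConc t x,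
        IsLUB ((fun m => (∑ c, m c * h c) - L m) '' orthant (k + 1)) (rateKPZ t x h)) := by
  set L : EuclideanSpace ℝ (Fin (k + 1)) → ℝ := fun m => (LSHE 0 t x fun c => m c).toReal with hLdef
  have hLk : ∀ h ∈ hvConc t x, L (kinks t x h) = ∑ c, kinks t x h c * h c - rateKPZ t x h :=
    fun h hh => by simp only [hLdef, LSHE_kinks ht hx hh, EReal.toReal_coe]
  have hsurj : ∀ m ∈ orthant (k + 1), ∃ h ∈ hvConc t x, kinks t x h = m := fun m hm => by
    obtain ⟨h, hh, hk, -⟩ := exists_dual ht hx hm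
    exact ⟨h, hh, hk⟩
  have hlt : ∀ h ∈ hvConc t x, ∀ g ∈ hvConc t x, g ≠ h →
      ∑ c, kinks t x h c * g c - rateKPZ t x g < L (kinks t x h) := fun h hh g hg hne => by
    have h1 := rateKPZ_strict ht hx hh.1 hg.1 hne
    rw [hLk h hh]
    simp only [mul_sub, Finset.sum_sub_distrib] at h1
    linarith
  have hle : ∀ m ∈ orthant (k + 1), ∀ g ∈ hvConc t x,
      ∑ c, m c * g c - rateKPZ t x g ≤ L m := fun m hm g hg => by
    obtain ⟨h, hh, rfl⟩ := hsurj m hm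
    by_cases hne : g = h
    · rw [hne, hLk h hh]
    · exact (hlt h hh g hg hne).le
  refine ⟨L, fun m hm => ?_, ?_, ⟨convex_orthant _, ?_⟩, fun m hm => ?_, fun h hh => ?_⟩
  · obtain ⟨h, hh, hk, hL⟩ := exists_dual ht hx hm
    simp only [hLdef, hL, EReal.toReal_coe]
  · rw [continuousOn_iff_continuous_domRestrict]
    have h1 : Continuous fun m : orthant (k + 1) =>
        ∑ c, (m : EuclideanSpace ℝ (Fin (k + 1))) c *
          ((kinkHomeo ht hx).symm m : EuclideanSpace ℝ (Fin (k + 1))) c -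
        rateKPZ t x ((kinkHomeo ht hx).symm m) := by
      refine Continuous.sub ?_ ?_
      · have := (kinkHomeo ht hx).symm.continuous
        fun_prop
      · exact (continuousOn_rateKPZ ht hx).domRestrict.comp (kinkHomeo ht hx).symm.continuous
    convert h1 using 1
    ext m
    have h2 : kinks t x ((kinkHomeo ht hx).symm m) = m := by
      rw [← kinkHomeo_apply ht hx, Homeomorph.apply_symm_apply]
    have h3 := hLk _ ((kinkHomeo ht hx).symm m).2
    rw [h2] at h3
    exact h3
  · intro m hm m' hm' hne a b ha hb hab
    have hmm := convex_orthant _ hm hm' ha.le hb.le hab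
    obtain ⟨h, hh, hk⟩ := hsurj _ hmm
    obtain ⟨g, hg, rfl⟩ := hsurj m hm
    have hgh : h ≠ g := fun e => hne <| by
      rw [e] at hk
      have : b • (m' - kinks t x g) = 0 := by
        rw [smul_sub, sub_eq_zero]
        have h1 : a • kinks t x g + b • kinks t x g = kinks t x g := by
          rw [← add_smul, hab, one_smul]
        have h2 := h1.trans hk
        exact (add_left_cancel h2).symm
      rcases smul_eq_zero.1 this with h0 | h0
      · exact absurd h0 hb.ne'
      · exact (sub_eq_zero.1 h0).symm
    have h1 := mul_lt_mul_of_pos_left (hlt g hg h hh hgh) ha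
    have h2 := mul_le_mul_of_nonneg_left (hle m' hm' h hh) hb.le
    have h3 : L (a • kinks t x g + b • m') = a * (∑ c, kinks t x g c * h c - rateKPZ t x h) +
        b * (∑ c, m' c * h c - rateKPZ t x h) := by
      have hb' : b = 1 - a := by linarith
      rw [← hk, hLk h hh, hk, mul_sub, mul_sub, Finset.mul_sum, Finset.mul_sum]
      have : ∑ c, (a • kinks t x g + b • m') c * h c =
          ∑ c, a * (kinks t x g c * h c) + ∑ c, b * (m' c * h c) := by
        rw [← Finset.sum_add_distrib]
        refine Finset.sum_congr rfl fun c _ => ?_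
        simp only [PiLp.add_apply, PiLp.smul_apply, smul_eq_mul]; ring
      rw [this, hb']; ring
    rw [h3, smul_eq_mul, smul_eq_mul]
    linarith
  · obtain ⟨h, hh, rfl⟩ := hsurj m hm
    refine IsGreatest.isLUB ⟨⟨h, hh, (hLk h hh).symm⟩, ?_⟩
    rintro _ ⟨g, hg, rfl⟩
    exact hle _ hm g hg
  · refine IsGreatest.isLUB ⟨⟨kinks t x h, ((mem_hvConc_iff ht hx).1 hh).2, ?_⟩, ?_⟩
    · simp only [hLk h hh]; ring
    · rintro _ ⟨m, hm, rfl⟩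
      have := hle m hm h hh
      simp only; linarith

end
end

noncomputable section
open Set Filter Topology MeasureTheory

/-! ### Shock trajectories and the splitting of the optimal flow -/

section
variable {k : ℕ} {T : ℝ} {x : Fin (k + 1) → ℝ}

/-- In the interior of the domain the gradient within `hvSpace` is unique. -/
lemma eq_kinks_of_interior (hT : 0 < T) (hx : StrictMono x) {h m : EuclideanSpace ℝ (Fin (k + 1))}
    (hh : h ∈ interior (hvConc T x)) (hm : HasGradientWithinAt (rateKPZ T x) m (hvSpace T x) h) :
    kinks T x h = m := by
  have hn : hvSpace T x ∈ 𝓝 h :=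
    mem_of_superset (mem_interior_iff_mem_nhds.1 hh) fun _ h => h.1
  have h1 := hm.hasFDerivWithinAt.hasFDerivAt hn
  have h2 := (hasGradientWithinAt_rateKPZ hT hx
    (interior_subset hh).1).hasFDerivWithinAt.hasFDerivAt hn
  exact (InnerProductSpace.toDual ℝ _).injective (h2.unique h1)

/-- The shape with given positive kinks is the profile of the corresponding optimal clusters. -/
lemma IsInertiaClusters.shapeFn_eq {m : Fin (k + 1) → ℝ} {z : Fin (k + 1) → ℝ → ℝ}
    (hz : IsInertiaClusters T x m z) (hT : 0 < T) (hx : StrictMono x) (hm : ∀ c, 0 < m c)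
    {h : EuclideanSpace ℝ (Fin (k + 1))} (hh : h ∈ hvSpace T x) (hk : ∀ c, kinks T x h c = m c) :
    shapeFn T x h = profile T x m (optVel T m z) := by
  have hP := hz.clusterProfile_zero hT hx.monotone hm
  set g : EuclideanSpace ℝ (Fin (k + 1)) :=
    WithLp.toLp 2 fun c => profile T x m (optVel T m z) (x c) with hg
  have hval : ∀ c, g c = profile T x m (optVel T m z) (x c) := fun c => rfl
  have he : g = h := by
    refine kinks_injective hT hx (hP.mem_hvConc hx rfl hval).1 hh ?_
    ext c
    rw [hk, hP.kinks_eq hx rfl hval]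
    have : (Finset.univ.filter fun c' => x c' = x c) = {c} := by
      ext c'; simp [hx.injective.eq_iff]
    rw [this, Finset.sum_singleton]
  rw [← he, hP.shapeFn_eq hx rfl hval]

end

section
variable {n : ℕ} {T : ℝ} {x m : Fin n → ℝ} {z : Fin n → ℝ → ℝ}

lemma IsInertiaClusters.optimal_merged (hz : IsInertiaClusters T x m z) (hT : 0 < T)
    (hx : Monotone x) (hm : ∀ c, 0 < m c) {c c' : Fin n} {s r : ℝ} (h0 : 0 ≤ s) (hsr : s ≤ r)
    (hr : r < T) (h : optimalCluster 0 T z c s = optimalCluster 0 T z c' s) :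
    optimalCluster 0 T z c r = optimalCluster 0 T z c' r := by
  rw [hz.optimal_eq_iff hT hx hm ⟨h0.trans hsr, hr⟩]
  rw [hz.optimal_eq_iff hT hx hm ⟨h0, hsr.trans_lt hr⟩] at h
  exact hz.merged c c' s r h0 hsr hr.le h

/-- A continuous path in the union of the cluster trajectories cannot leave a cluster: the clusters
at the same place have merged, and the others are away. -/
lemma IsInertiaClusters.isShockTrajectory_iff (hz : IsInertiaClusters T x m z) (hT : 0 < T)
    (hx : Monotone x) (hm : ∀ c, 0 < m c) {g : ℝ → ℝ → ℝ}
    (hg : ∀ t ∈ Ioc 0 T, shockSet g t = range fun c => optimalCluster 0 T z c (T - t))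
    (c : Fin n) (γ : ℝ → ℝ) :
    IsShockTrajectory T g (x c) γ ↔ EqOn γ (optimalCluster 0 T z c) (Ico 0 T) := by
  have hshock : ∀ s ∈ Ico 0 T, shockSet g (T - s) = range fun c => optimalCluster 0 T z c s := by
    intro s hs
    rw [hg (T - s) ⟨by linarith [hs.2], by linarith [hs.1]⟩]
    simp only [sub_sub_cancel]
  constructor
  · intro hγ s₁ hs₁
    have hsub : Icc 0 s₁ ⊆ Ico 0 T := fun r hr => ⟨hr.1, hr.2.trans_lt hs₁.2⟩
    have hcz : ∀ c, ContinuousOn (optimalCluster 0 T z c) (Ico 0 T) := fun c =>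
      (hz.continuousOn_optimal c).mono Ico_subset_Icc_self
    set A : Set ℝ := {s | γ s = optimalCluster 0 T z c s}
    have hcl : IsClosed (A ∩ Icc 0 s₁) := by
      have := ((hγ.continuousOn.sub (hcz c)).mono hsub).preimage_isClosed_of_isClosed isClosed_Icc
        (isClosed_singleton (x := (0 : ℝ)))
      convert this using 1
      ext s
      simp [A, sub_eq_zero, and_comm]
    have h0 : (0 : ℝ) ∈ A := by
      change γ 0 = optimalCluster 0 T z c 0
      rw [hγ.start, hz.optimalCluster_zero]
    refine hcl.Icc_subset_of_forall_mem_nhdsWithin h0 ?_ (right_mem_Icc.2 hs₁.1)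
    rintro s ⟨hs, hs0, hs1⟩
    have hsT : s ∈ Ico 0 T := ⟨hs0, hs1.trans hs₁.2⟩
    have hnhds : Ico 0 T ∈ 𝓝[>] s := mem_of_superset (Ioo_mem_nhdsGT hsT.2)
      fun r hr => ⟨hsT.1.trans hr.1.le, hr.2⟩
    have hle : 𝓝[>] s ≤ 𝓝[Ico 0 T] s := nhdsWithin_le_of_mem hnhds
    have hev : ∀ᶠ r in 𝓝[>] s, ∀ d, optimalCluster 0 T z d s ≠ optimalCluster 0 T z c s →
        γ r ≠ optimalCluster 0 T z d r := by
      rw [eventually_all]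
      intro d
      by_cases hd : optimalCluster 0 T z d s = optimalCluster 0 T z c s
      · exact Eventually.of_forall fun r h => absurd hd h
      · have h1 : Tendsto (fun r => γ r - optimalCluster 0 T z d r) (𝓝[>] s)
            (𝓝 (γ s - optimalCluster 0 T z d s)) :=
          ((hγ.continuousOn.sub (hcz d)) s hsT).mono_left hle
        have h2 : γ s - optimalCluster 0 T z d s ≠ 0 := by
          rw [show γ s = optimalCluster 0 T z c s from hs, sub_ne_zero]
          exact Ne.symm hd
        filter_upwards [h1.eventually_ne h2] with r hr _
        exact sub_ne_zero.1 hr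
    filter_upwards [hev, hnhds, self_mem_nhdsWithin] with r hr hrT hsr
    have hmem := hγ.mem_shockSet r hrT
    rw [hshock r hrT] at hmem
    obtain ⟨d, hd⟩ := hmem
    have hdc : optimalCluster 0 T z d s = optimalCluster 0 T z c s := by
      by_contra hne
      exact hr d hne hd.symm
    change γ r = _
    rw [← hd]
    exact hz.optimal_merged hT hx hm hs0 (le_of_lt hsr) hrT.2 hdc
  · intro hγ
    refine ⟨((hz.continuousOn_optimal c).mono Ico_subset_Icc_self).congr hγ, ?_, fun s hs => ?_⟩
    · rw [hγ ⟨le_rfl, hT⟩, hz.optimalCluster_zero]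
    · rw [hshock s hs, hγ hs]; exact ⟨c, rfl⟩

/-- A sum over part of a subtype, as a sum over part of the type. -/
lemma sum_subtype_filter {ι : Type*} [Fintype ι] (p q : ι → Prop) [DecidablePred p]
    [DecidablePred q] (hq : ∀ c, q c → p c) (f : ι → ℝ) :
    ∑ c : {c // p c} with q c.1, f c.1 = ∑ c with q c, f c := by
  rw [Finset.sum_filter, Finset.sum_filter,
    ← Finset.sum_subtype (Finset.univ.filter p) (by simp) fun c => if q c then f c else 0,
    Finset.sum_filter]
  refine Finset.sum_congr rfl fun c _ => ?_
  by_cases h : q c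
  · rw [if_pos (hq c h)]
  · simp [h]

/-- The value of `LSHE` for the flow of one branch of optimal clusters up to time `s`. -/
lemma IsInertiaClusters.LSHE_fiber (hz : IsInertiaClusters T x m z) (hT : 0 < T) (hx : Monotone x)
    (hm : ∀ c, 0 < m c) {s : ℝ} (hs : s ∈ Ico 0 T) (y : ℝ) :
    LSHE y s (fun c : {c : Fin n // optimalCluster 0 T z c s = y} => x c)
      (fun c : {c : Fin n // optimalCluster 0 T z c s = y} => m c) =
    (certificate y s (fun c : {c : Fin n // optimalCluster 0 T z c s = y} => x c)
      (fun c : {c : Fin n // optimalCluster 0 T z c s = y} => m c)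
      (fun c : {c : Fin n // optimalCluster 0 T z c s = y} => optVel T m z c) : EReal) := by
  refine le_antisymm (LSHE_le_certificate (ι := {c : Fin n // optimalCluster 0 T z c s = y})
    (fun c => (hm c).le) hs.1 (fun _ _ h => hx h) fun c c' h => hz.optVel_gap hT hx (fun c => (hm c).le) h) ?_
  refine certificate_le_LSHE
    (ζ := fun (c : {c : Fin n // optimalCluster 0 T z c s = y}) => optimalCluster 0 T z c)
    hs.1 (fun c => hm c) (fun c => hz.optimalCluster_zero c) (fun c => c.2)
    (fun r hr _ _ h => hz.optimal_mono hT hx hm ⟨hr.1, hr.2.trans hs.2.le⟩ h)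
    (fun c => (hz.continuousOn_optimal c).mono (Icc_subset_Icc_right hs.2.le)) ?_ ?_
  · intro c r hr
    have hd := hz.hasDeriv_optimal' hT hx hm (s := r) ⟨hr.1, hr.2.trans hs.2⟩ c
    have hq : ∀ c', optimalCluster 0 T z c' r = optimalCluster 0 T z c r →
        optimalCluster 0 T z c' s = y := fun c' h =>
      (hz.optimal_merged hT hx hm hr.1 hr.2.le hs.2 h).trans c.2
    rw [blockAvg] at hd
    have e1 := sum_subtype_filter (fun c => optimalCluster 0 T z c s = y) _ hq
      fun c' => m c' * optVel T m z c'
    have e2 := sum_subtype_filter (fun c => optimalCluster 0 T z c s = y) _ hq m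
    rw [e1, e2]
    exact hd
  · intro r hr w
    obtain ⟨K, hK⟩ := hz.optVel_block hT hx hm (s := r) ⟨hr.1, hr.2.trans hs.2⟩ w
    refine ⟨K, fun c hc => ?_⟩
    have e1 := sum_subtype_filter (fun c => optimalCluster 0 T z c s = y)
      (fun c' => optimalCluster 0 T z c' r = w ∧ c' < c) (fun c' h =>
        (hz.optimal_merged hT hx hm hr.1 hr.2.le hs.2 (h.1.trans hc.symm)).trans c.2) m
    rw [hK c hc, ← e1]
    rfl

/-- The one-sided slopes of the profile at a position where the velocity intervals are adjacent. -/
lemma ClusterProfile.slopes_of_block {t : ℝ} {ζ v : Fin n → ℝ} (h : ClusterProfile t ζ m v)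
    {y K : ℝ} (hne : ∃ c, ζ c = y)
    (hK : ∀ c, ζ c = y → v c = K - (∑ c' with ζ c' = y ∧ c' < c, m c') - m c / 2) :
    profileSlopeL t ζ m v y = K ∧
      profileSlope t ζ m v y = K - ∑ c with ζ c = y, m c := by
  set S := Finset.univ.filter fun c => ζ c = y
  have hS : S.Nonempty := by
    obtain ⟨c, hc⟩ := hne
    exact ⟨c, by simpa [S] using hc⟩
  have hmem : ∀ c ∈ S, ζ c = y := fun c hc => (Finset.mem_filter.1 hc).2
  have hkink := h.profile_kink (y := y)
  have h1 : K ≤ profileSlopeL t ζ m v y := by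
    -- the first cluster of the block has the uppermost velocity interval
    have hc := S.min'_mem hS
    have h2 := hi_le_slopeL (t := t) (ζ := ζ) (m := m) (v := v) (S.min' hS)
    rw [hmem _ hc, hiEnd, hK _ (hmem _ hc), Finset.filter_false_of_mem, Finset.sum_empty] at h2
    · linarith
    · rintro c - ⟨h3, h4⟩
      exact absurd (S.min'_le c (by simpa [S] using h3)) (not_le.2 h4)
  have h2 : profileSlope t ζ m v y ≤ K - ∑ c ∈ S, m c := by
    -- the last cluster of the block has the lowest velocity interval
    have hc := S.max'_mem hS
    have h3 := h.slope_le_lo (S.max' hS)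
    have h4 : (Finset.univ.filter fun c => ζ c = y ∧ c < S.max' hS) = S.erase (S.max' hS) := by
      ext c
      simp only [Finset.mem_filter, Finset.mem_univ, true_and, Finset.mem_erase, S]
      constructor
      · rintro ⟨e, hlt⟩; exact ⟨hlt.ne, e⟩
      · rintro ⟨hne, e⟩
        exact ⟨e, lt_of_le_of_ne (S.le_max' c (by simpa [S] using e)) hne⟩
    rw [hmem _ hc, loEnd, hK _ (hmem _ hc), h4] at h3
    have h5 := Finset.add_sum_erase S m hc
    linarith
  constructor <;> linarith

end

section
variable {k j : ℕ} {T t : ℝ} {x m : Fin (k + 1) → ℝ} {z : Fin (k + 1) → ℝ → ℝ}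
  {ξ : Fin (j + 1) → ℝ} {h' m' : EuclideanSpace ℝ (Fin (j + 1))}

lemma EReal.coe_sum_univ {ι : Type*} [Fintype ι] (f : ι → ℝ) :
    ((∑ a, f a : ℝ) : EReal) = ∑ a, (f a : EReal) :=
  map_sum ({ toFun := Real.toEReal, map_zero' := EReal.coe_zero, map_add' := EReal.coe_add } :
    ℝ →+ EReal) f Finset.univ

/-- The sum over the clusters, grouped by their position. -/
lemma sum_fibers {f : Fin (k + 1) → ℝ} {ζ : Fin (k + 1) → ℝ} (hξ : Function.Injective ξ)
    (hr : range ξ = range ζ) : ∑ a, ∑ c with ζ c = ξ a, f c = ∑ c, f c := by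
  simp only [Finset.sum_filter]
  rw [Finset.sum_comm]
  refine Finset.sum_congr rfl fun c _ => ?_
  obtain ⟨a, ha⟩ : ζ c ∈ range ξ := by rw [hr]; exact ⟨c, rfl⟩
  rw [Finset.sum_eq_single a]
  · rw [if_pos ha.symm]
  · intro b _ hb
    exact if_neg fun e => hb (hξ (e.symm.trans ha.symm))
  · simp

/-- The optimal flow splits at every time into the flow of the clusters merged so far, and the flows
of the branches that led to them. -/
theorem IsInertiaClusters.LSHE_split (hz : IsInertiaClusters T x m z) (hx : Monotone x)
    (hm : ∀ c, 0 < m c) (ht : t ∈ Ioc 0 T) (hξ : StrictMono ξ)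
    (hr : range ξ = range fun c => optimalCluster 0 T z c (T - t))
    (hh : ∀ a, h' a = limitShape T m z t (ξ a))
    (hm' : ∀ a, m' a = ∑ c with optimalCluster 0 T z c (T - t) = ξ a, m c) :
    h' ∈ hvConc t ξ ∧ HasGradientWithinAt (rateKPZ t ξ) m' (hvSpace t ξ) h' ∧
      LSHE 0 T x m = LSHE 0 t ξ (fun a => m' a) +
        ∑ a, LSHE (ξ a) (T - t)
          (fun c : {c : Fin (k + 1) // optimalCluster 0 T z c (T - t) = ξ a} => x c)
          (fun c : {c : Fin (k + 1) // optimalCluster 0 T z c (T - t) = ξ a} => m c) := by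
  have hT : 0 < T := ht.1.trans_le ht.2
  have hs : T - t ∈ Ico 0 T := ⟨sub_nonneg.2 ht.2, by linarith [ht.1]⟩
  have hP := hz.clusterProfile' hx hm ht
  have hc := hP.mem_hvConc hξ hr hh
  have hk : kinks t ξ h' = m' := by
    ext a
    rw [hP.kinks_eq hξ hr hh, hm']
  refine ⟨hc, by rw [← hk]; exact hasGradientWithinAt_rateKPZ ht.1 hξ hc.1, ?_⟩
  have h1 := LSHE_kinks ht.1 hξ hc
  rw [kinks_dual ht.1 hξ hc.1, hk] at h1
  rw [h1, hz.LSHE_eq hT hx hm]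
  simp only [hz.LSHE_fiber hT hx hm hs]
  rw [← EReal.coe_sum_univ, ← EReal.coe_add, ← Finset.sum_add_distrib, certificate,
    ← sum_fibers hξ.injective hr]
  congr 1
  refine Finset.sum_congr rfl fun a _ => ?_
  obtain ⟨K, hK⟩ := hz.optVel_block hT hx hm hs (ξ a)
  have hex : ∃ c, optimalCluster 0 T z c (T - t) = ξ a := by
    have : ξ a ∈ range fun c => optimalCluster 0 T z c (T - t) := by rw [← hr]; exact ⟨a, rfl⟩
    exact this
  obtain ⟨e1, e2⟩ := hP.slopes_of_block hex hK
  rw [hP.slopesL_eq hξ hr hh, hP.slopesR_eq hξ hr hh, e1, e2]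
  set S := Finset.univ.filter fun c => optimalCluster 0 T z c (T - t) = ξ a with hS
  obtain ⟨b1, b2⟩ := block_moments (m := m) (v := optVel T m z) (K := K) S fun c hc => by
    rw [hS, Finset.filter_filter]; exact hK c (Finset.mem_filter.1 hc).2
  -- by `block_moments`, the clusters that are together at `ξ a` contribute to the certificate from
  -- then on as one cluster does
  rw [certificate, ← Finset.sum_subtype S (by simp [hS]) fun c =>
    (T - t) / 2 * (m c * optVel T m z c ^ 2 + m c ^ 3 / 12) + (x c - ξ a) * (m c * optVel T m z c)]
  have e3 : ∑ c ∈ S, (T / 2 * (m c * optVel T m z c ^ 2 + m c ^ 3 / 12) +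
      (x c - 0) * (m c * optVel T m z c)) =
      ∑ c ∈ S, ((T - t) / 2 * (m c * optVel T m z c ^ 2 + m c ^ 3 / 12) +
        (x c - ξ a) * (m c * optVel T m z c)) +
      (t / 2 * ∑ c ∈ S, (m c * optVel T m z c ^ 2 + m c ^ 3 / 12) +
        ξ a * ∑ c ∈ S, m c * optVel T m z c) := by
    rw [Finset.mul_sum, Finset.mul_sum, ← Finset.sum_add_distrib, ← Finset.sum_add_distrib]
    exact Finset.sum_congr rfl fun c _ => by ring
  rw [e3, b1, b2, slopePrim, slopePrim]
  ring

end

theorem theorem2p4 (n : ℕ) (hn : 1 ≤ n) (x : Fin n → ℝ) (hx : StrictMono x) :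
    (∀ t : ℝ, 0 < t →
      (∀ h ∈ hvSpace t x, ∃! f : ℝ → ℝ, IsShapeAt t x h f) ∧
      ContinuousOn (rateKPZ t x) (hvConc t x) ∧
      StrictConvexOn ℝ (hvConc t x) (rateKPZ t x) ∧
      (∃ L : EuclideanSpace ℝ (Fin n) → ℝ,
        (∀ m ∈ orthant n, LSHE 0 t x (fun c => m c) = (L m : EReal)) ∧
        ContinuousOn L (orthant n) ∧
        StrictConvexOn ℝ (orthant n) L ∧
        (∀ m ∈ orthant n,
          IsLUB ((fun h => (∑ c, m c * h c) - rateKPZ t x h) '' hvConc t x) (L m)) ∧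
        (∀ h ∈ hvConc t x,
          IsLUB ((fun m => (∑ c, m c * h c) - L m) '' orthant n) (rateKPZ t x h))) ∧
      (∃ Φ : hvConc t x ≃ₜ orthant n, ∀ h : hvConc t x,
        HasGradientWithinAt (rateKPZ t x) (Φ h : EuclideanSpace ℝ (Fin n)) (hvSpace t x)
          (h : EuclideanSpace ℝ (Fin n)))) ∧
    (∀ T : ℝ, 0 < T → ∀ h m : EuclideanSpace ℝ (Fin n),
      h ∈ interior (hvConc T x) → (∀ c, 0 < m c) →
      HasGradientWithinAt (rateKPZ T x) m (hvSpace T x) h →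
      (∃ g, IsBackwardEntropySolution T (shapeFn T x h) g) ∧
      (∃ z, IsInertiaClusters T x (fun c => m c) z) ∧
      ∀ (g : ℝ → ℝ → ℝ) (z : Fin n → ℝ → ℝ),
        IsBackwardEntropySolution T (shapeFn T x h) g →
        IsInertiaClusters T x (fun c => m c) z →
        ((∀ t ∈ Set.Ioc 0 T,
            shockSet g t = Set.range (fun c => optimalCluster 0 T z c (T - t))) ∧
          (∀ (c : Fin n) (γ : ℝ → ℝ),
            IsShockTrajectory T g (x c) γ ↔
              Set.EqOn γ (optimalCluster 0 T z c) (Set.Ico 0 T))) ∧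
        (∀ t' ∈ Set.Ioc 0 T, ∀ (n' : ℕ) (ξ : Fin n' → ℝ), StrictMono ξ →
          Set.range ξ = Set.range (fun c => optimalCluster 0 T z c (T - t')) →
          ∀ h' m' : EuclideanSpace ℝ (Fin n'),
          (∀ a, h' a = g t' (ξ a)) →
          (∀ a, m' a = ∑ c with optimalCluster 0 T z c (T - t') = ξ a, m c) →
          h' ∈ hvConc t' ξ ∧
          HasGradientWithinAt (rateKPZ t' ξ) m' (hvSpace t' ξ) h' ∧
          LSHE 0 T x (fun c => m c) =
            LSHE 0 t' ξ (fun a => m' a) +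
              ∑ a, LSHE (ξ a) (T - t')
                (fun c : {c : Fin n // optimalCluster 0 T z c (T - t') = ξ a} => x c)
                (fun c : {c : Fin n // optimalCluster 0 T z c (T - t') = ξ a} => m c))) := by
  obtain ⟨k, rfl⟩ := Nat.exists_eq_add_of_le' hn
  refine ⟨fun t ht => ⟨fun h hh => ?_, continuousOn_rateKPZ ht hx, strictConvexOn_rateKPZ ht hx,
    exists_legendre ht hx, kinkHomeo ht hx, fun h => ?_⟩, fun T hT h m hh hm hgrad => ?_⟩
  · obtain ⟨f, hf⟩ := exists_isShapeAt ht hx hh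
    exact ⟨f, hf, fun g hg => hg.unique hf ht hx⟩
  · rw [kinkHomeo_apply]
    exact hasGradientWithinAt_rateKPZ ht hx h.2.1
  · have hk := eq_kinks_of_interior hT hx hh hgrad
    have hshape : ∀ z, IsInertiaClusters T x (fun c => m c) z →
        IsBackwardEntropySolution T (shapeFn T x h) (limitShape T (fun c => m c) z) :=
      fun z hz => by
        rw [hz.shapeFn_eq hT hx hm (interior_subset hh).1 fun c => by rw [hk]]
        exact hz.isBackwardEntropySolution hT hx.monotone hm
    obtain ⟨z₀, hz₀⟩ := exists_isInertiaClusters hT.le x (fun c => m c)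
    refine ⟨⟨_, hshape z₀ hz₀⟩, ⟨z₀, hz₀⟩, fun g z hg hz => ?_⟩
    have hgz : ∀ t ∈ Ioc 0 T, g t = limitShape T (fun c => m c) z t :=
      fun t ht => hg.unique (hshape z hz) ht
    have hshock : ∀ t ∈ Ioc 0 T,
        shockSet g t = range fun c => optimalCluster 0 T z c (T - t) := fun t ht => by
      rw [← hz.shockSet_limitShape hx.monotone hm ht, shockSet, shockSet, hgz t ht]
    refine ⟨⟨hshock, hz.isShockTrajectory_iff hT hx.monotone hm hshock⟩, ?_⟩
    intro t' ht' n' ξ hξ hr h' m' hh' hm'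
    obtain ⟨j, rfl⟩ : ∃ j, n' = j + 1 := by
      refine Nat.exists_eq_succ_of_ne_zero fun e => ?_
      subst e
      have : optimalCluster 0 T z 0 (T - t') ∈ range ξ := by rw [hr]; exact ⟨0, rfl⟩
      obtain ⟨a, -⟩ := this
      exact a.elim0
    exact hz.LSHE_split hx.monotone hm ht' hξ hr (fun a => by rw [hh', hgz t' ht']) hm'
end
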